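/- Setting. Let $(M,g)$ be a smooth (Hausdorff) four-dimensional Lorentzian manifold of signature $(-,+,+,+)$, foliated by the connected timelike level sets (slices) of a smooth function $\Omega$ with spacelike gradient. Let $\varphi=(g^{\alpha\beta}\partial_\alpha\Omega\,\partial_\beta\Omega)^{-1/2}$ be the lapse, $n_\alpha=\varphi\,\partial_\alpha\Omega$ the unit normal, $f'=\varphi\, n^\alpha\partial_\alpha f$ the derivative with respect to the foliation parameter, and write $\mathcal D_\gamma f=0$ if all derivatives of $f$ tangent to the slices vanish. Let $\kappa_0,\kappa_1$ be Killing vector fields tangent to the slices whose Gram matrix $\mathcal G_{ab}=\kappa_a{}^\alpha\kappa_{b\alpha}$, with inverse $\mathcal G^{ab}$, has signature $(-,+)$. A slice-reducible conformal Killing tensor of $g$ is a conformal Killing tensor of the form $$K_{\alpha\beta}=\alpha g_{\alpha\beta}+\gamma^{ab}\kappa_{a\alpha}\kappa_{b\beta}+e^{\Psi}n_\alpha n_\beta$$ with $\alpha,\gamma^{ab}=\gamma^{ba},\Psi$ smooth and $\mathcal D_\gamma\gamma^{ab}=0$; a slice-reducible exact Killing tensor is an exact Killing tensor of this form with, in addition,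 $\mathcal D_\gamma\alpha=0$. The foliation and the $\kappa_a$ are fixed throughout. Let $m$ be a smooth function (the variable mass) and $\tilde m$ a constant with $m/\tilde m>0$ everywhere, and let $\tilde g=(m/\tilde m)^2g$. 1. (Reduction to geodesics.) Let $J$ be an open interval, $d\tau/ds=(m(\gamma(s))/\tilde m)^2$ and $\tilde\gamma(\tau(s))=\gamma(s)$ on $J$. Then $\gamma$ solves $\dot\gamma^\alpha\nabla_\alpha\dot\gamma^\beta=-m\,g^{\beta\lambda}\partial_\lambda m$, $\dot\gamma^\alpha\dot\gamma_\alpha=-m^2$ on $J$ if and only if $\tilde\gamma$ is an affinely parametrized geodesic of $\tilde g$ with $\tilde g(\dot{\tilde\gamma},\dot{\tilde\gamma})=-\tilde m^2$ on $\tau(J)$, and $\tilde g(\kappa_a,\dot{\tilde\gamma})=g(\kappa_a,\dot\gamma)$. Every continuous curve $\gamma$ on an open interval has such a reparametrization $\tilde\gamma$, and every continuous $\tilde\gamma$ on an open interval arises in this way. 2. (Killing vectors.) For each $a$, $\kappa_a$ is a Killing vector of $\tilde g$ if and only if $\kappa_a{}^\alpha\partial_\alpha m=0$. 3. (Killing tensor.)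 If $\tilde g$ has a slice-reducible exact Killing tensor, then $g$ has a slice-reducible conformal Killing tensor. Conversely, suppose that $g$ has a slice-reducible conformal Killing tensor, with functions $\alpha,\gamma^{ab},\Psi$. Then $\kappa_0,\kappa_1$ are Killing vectors of $\tilde g$ and $\tilde g$ has a slice-reducible exact Killing tensor if and only if $$\kappa_a{}^\alpha\partial_\alpha m=0\ (a=0,1)\qquad\text{and}\qquad \mathcal D_\gamma\left[(e^{\Psi}m^2)'\right]=0 .$$ The second condition is equivalent to $\mathcal D_\gamma\left[m^2\varphi^3\chi_\tau+\tfrac12\varphi^2(m^2)'\right]=0$, where $\chi_\tau$ is the function with $\chi(\sigma,\sigma)=\chi_\tau\, g(\sigma,\sigma)$ for all $\sigma$ tangent to the slices and orthogonal to $\kappa_0,\kappa_1$, and $\chi$ is the second fundamental form of the slices. 4. (Shadow formula.) Assume that $g$ has a slice-reducible conformal Killing tensor with functions $\alpha,\gamma^{ab},\Psi$ and that both conditions of part 3 hold, and let $\tilde K$ be any slice-reducible exact Killing tensor of $\tilde g$. Then $q_a=g(\kappa_a,\dot\gamma)$ and $\mathcal C=\tilde K(u,u)$, $u=(\tilde m/m)^2\dot\gamma$,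 are constant along every solution $\gamma$ of the equations of motion in part 1. Consider an observer at a point $O$ with timelike four-velocity $\bar v^a\kappa_a$ and particles of observed energy $\bar E>0$. Bars denote values at $O$; let $$\bar v=\sqrt{-\bar{\mathcal G}_{ab}\bar v^a\bar v^b},\quad \bar\tau^a=\bar{\mathcal G}^{ab}\sqrt{-\det\bar{\mathcal G}}\,\epsilon_{bc}\bar v^c\ (\epsilon_{01}=-\epsilon_{10}=1),\quad m_E^2=\bar v^2m^2/\bar E^2,\quad \mathcal S^{ab}=e^\Psi\left(\mathcal G^{ab}+m_E^2\,\bar v^a\bar v^b/\bar v^2\right),$$ where $m_E^2$ and $\mathcal S^{ab}$ are functions on $M$ ($\bar v^a,\bar v,\bar E$ being constants), and suppose $\bar m_E^2<1$. Let $\bar e_2$ be a unit vector at $O$ orthogonal to $n,\kappa_0,\kappa_1$, and let $\bar e_0=\bar v^a\kappa_a/\bar v$, $\bar e_1=\bar\tau^a\kappa_a/\bar v$, $\bar e_3=-n$. For $\Phi\in[0,2\pi]$, $\Theta\in[0,\pi)$ consider the velocity $$u_{\Phi,\Theta}=\tfrac{\bar E}{\bar v}\bar e_0+\sqrt{\tfrac{\bar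 E^2}{\bar v^2}-\bar m^2}\,\left(\sin\Phi\sin\Theta\,\bar e_1+\cos\Phi\sin\Theta\,\bar e_2+\cos\Theta\,\bar e_3\right)$$ and the stereographic coordinates $X=-2\tan(\Theta/2)\sin\Phi$, $Y=-2\tan(\Theta/2)\cos\Phi$. Call $(\Phi,\Theta)$ a shadow boundary direction for a slice $S$ if, with $q_a=g(\kappa_a,u_{\Phi,\Theta})$, $S$ is a massive particle surface for $q_a$ (every solution of the equations of motion with constants $q_a$ that touches $S$ lies in $S$ entirely) and at some point of $S$ there is a vector $w$ tangent to $S$ with $g(w,w)=-m^2$ and with the same $q_a$ and the same $\mathcal C$ as $u_{\Phi,\Theta}$. Then: (a) $\mathcal D_\gamma[(\mathcal S^{ab})']=0$. (b) $\mathcal S^{ab}$ equals the shadow matrix computed from $\tilde g$, the function $\tilde\Psi=\Psi+2\ln(m/\tilde m)$ and the constant mass $\tilde m$, with the same $O$, $\bar v^a$, $\bar E$; and the set of points $(X,Y)$ given by the formula in (c) is the same for both sets of data. (c) Let $p$ be a point on the integral curve of $n$ through $O$. The set of points $(X,Y)$ of the shadow boundary directions for the slice through $p$ equals the set of points $$X=\frac{2\bar\tau^a\rho_a}{\sqrt{1-\bar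 m_E^2}\,\bar v^a\rho_a-\varepsilon\,\bar v e^{-\bar\Psi/2}\sqrt{(\mathcal S^{ab}-\overline{\mathcal S}{}^{ab})\rho_a\rho_b}},\qquad Y=\varepsilon'\,\frac{2\bar v e^{-\bar\Psi/2}\sqrt{-\mathcal S^{ab}\rho_a\rho_b}}{\sqrt{1-\bar m_E^2}\,\bar v^a\rho_a-\varepsilon\,\bar v e^{-\bar\Psi/2}\sqrt{(\mathcal S^{ab}-\overline{\mathcal S}{}^{ab})\rho_a\rho_b}},$$ with $\mathcal S^{ab}$ evaluated at $p$ and $\overline{\mathcal S}{}^{ab}$ at $O$, where $\varepsilon,\varepsilon'\in\{1,-1\}$ and $\rho\neq0$ runs through the solutions of $(\mathcal S^{ab})'\rho_a\rho_b=0$ at $p$ with $(\bar\tau^a\rho_a)^2\le(1-\bar m_E^2)(\bar v^a\rho_a)^2$, $\mathcal S^{ab}\rho_a\rho_b\le0$ and $(\mathcal S^{ab}-\overline{\mathcal S}{}^{ab})\rho_a\rho_b\ge0$, for which the denominator is nonzero. -/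

import Mathlib

open scoped Manifold ContDiff Matrix
open Bundle

noncomputable section

namespace Spacetime

/-- The model space of a four-dimensional manifold. -/
abbrev E4 : Type := EuclideanSpace ℝ (Fin 4)

variable {M : Type*} [TopologicalSpace M] [ChartedSpace E4 M]

/-- (Not necessarily smooth) vector fields on `M`. -/
abbrev VField (M : Type*) [TopologicalSpace M] [ChartedSpace E4 M] : Type _ :=
  ∀ x : M, TangentSpace (𝓡 4) x

/-- (Not necessarily smooth) covector fields on `M`. -/
abbrev CoField (M : Type*) [TopologicalSpace M] [ChartedSpace E4 M] : Type _ :=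
  ∀ x : M, TangentSpace (𝓡 4) x →L[ℝ] ℝ

/-- (Not necessarily smooth) covariant rank-two tensor fields on `M`. -/
abbrev Tensor2 (M : Type*) [TopologicalSpace M] [ChartedSpace E4 M] : Type _ :=
  ∀ x : M, TangentSpace (𝓡 4) x →L[ℝ] TangentSpace (𝓡 4) x →L[ℝ] ℝ

/-- Smooth real functions. -/
def SmoothFun (f : M → ℝ) : Prop := ContMDiff (𝓡 4) 𝓘(ℝ, ℝ) ∞ f

/-- Smooth vector fields. -/
def SmoothVField (X : VField M) [IsManifold (𝓡 4) ∞ M] : Prop :=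
  ContMDiff (𝓡 4) (𝓡 4).tangent ∞ (fun x => (⟨x, X x⟩ : TangentBundle (𝓡 4) M))

/-- The derivative `v^α ∂_α f` of a function along a tangent vector `v` at `x`. -/
def dirDeriv (f : M → ℝ) (x : M) (v : TangentSpace (𝓡 4) x) : ℝ := mvfderiv (𝓡 4) f x v

/-! ### Metric, Levi-Civita connection, Killing vectors and Killing tensors

Covariant derivatives at a point `x` are computed in the preferred chart `extChartAt (𝓡 4) x`.
Mathlib identifies `TangentSpace (𝓡 4) x` with `E4` through that chart, so the standard basis
vectors of `E4` are the coordinate vectors of the chart at `x` itself. -/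

/-- The coordinate vector `∂_i` at the point `x`, for the preferred chart at `x`. -/
def frame (x : M) (i : Fin 4) : TangentSpace (𝓡 4) x := (EuclideanSpace.single i (1 : ℝ) : E4)

/-- The `i`-th component, in the preferred chart at `x`, of a tangent vector at `x`. -/
def component {x : M} (v : TangentSpace (𝓡 4) x) (i : Fin 4) : ℝ := (show E4 from v) i

/-- The coordinate vector `∂_i` of the preferred chart at `x`, at the point with coordinates `y`. -/
def coordVec (x : M) (i : Fin 4) (y : E4) :
    TangentSpace (𝓡 4) ((extChartAt (𝓡 4) x).symm y) :=
  mfderiv 𝓘(ℝ, E4) (𝓡 4) (extChartAt (𝓡 4) x).symm y (EuclideanSpace.single i (1 : ℝ) : E4)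

/-- Components `θ_i`, as functions of the coordinates, of a covector field in the chart at `x`. -/
def comp₁ (θ : CoField M) (x : M) (i : Fin 4) (y : E4) : ℝ :=
  θ ((extChartAt (𝓡 4) x).symm y) (coordVec x i y)

/-- Components `B_{ij}`, as functions of the coordinates, of a tensor field in the chart at `x`. -/
def comp₂ (B : Tensor2 M) (x : M) (i j : Fin 4) (y : E4) : ℝ :=
  B ((extChartAt (𝓡 4) x).symm y) (coordVec x i y) (coordVec x j y)

/-- The partial derivative `∂_k F` at `x` of a function of the coordinates of the chart at `x`. -/
def partialAt (x : M) (k : Fin 4) (F : E4 → ℝ) : ℝ :=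
  fderiv ℝ F (extChartAt (𝓡 4) x x) (EuclideanSpace.single k (1 : ℝ))

/-- A smooth Lorentzian metric of signature `(-,+,+,+)`. -/
structure IsLorentzMetric [IsManifold (𝓡 4) ∞ M] (g : Tensor2 M) : Prop where
  symm : ∀ (x : M) (v w : TangentSpace (𝓡 4) x), g x v w = g x w v
  signature : ∀ x : M, ∃ b : Module.Basis (Fin 4) ℝ (TangentSpace (𝓡 4) x), ∀ i j,
    g x (b i) (b j) = if i = j then (if i = 0 then -1 else 1) else 0
  smooth : ContMDiff (𝓡 4) ((𝓡 4).prod 𝓘(ℝ, E4 →L[ℝ] E4 →L[ℝ] ℝ)) ∞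
    (fun x => TotalSpace.mk' (E4 →L[ℝ] E4 →L[ℝ] ℝ) x (g x))

/-- The matrix `g_{ij}` at `x`; its inverse is `g^{ij}`. -/
def metricMatrix (g : Tensor2 M) (x : M) : Matrix (Fin 4) (Fin 4) ℝ :=
  Matrix.of fun i j => g x (frame x i) (frame x j)

/-- The Christoffel symbol `Γ^k_{ij}` of `g` at `x`, in the preferred chart at `x`. -/
def christoffel (g : Tensor2 M) (x : M) (k i j : Fin 4) : ℝ :=
  1 / 2 * ∑ l, (metricMatrix g x)⁻¹ k l *
    (partialAt x i (comp₂ g x j l) + partialAt x j (comp₂ g x i l) - partialAt x l (comp₂ g x i j))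

/-- The Levi-Civita covariant derivative `∇_i θ_j` at `x`. -/
def nabla₁ (g : Tensor2 M) (θ : CoField M) (x : M) (i j : Fin 4) : ℝ :=
  partialAt x i (comp₁ θ x j) - ∑ l, christoffel g x l i j * θ x (frame x l)

/-- The Levi-Civita covariant derivative `∇_k B_{ij}` at `x`. -/
def nabla₂ (g : Tensor2 M) (B : Tensor2 M) (x : M) (k i j : Fin 4) : ℝ :=
  partialAt x k (comp₂ B x i j)
    - ∑ l, christoffel g x l k i * B x (frame x l) (frame x j)
    - ∑ l, christoffel g x l k j * B x (frame x i) (frame x l)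

/-- The covector field `X_α = g_{αβ} X^β`. -/
def flat (g : Tensor2 M) (X : VField M) : CoField M := fun x => g x (X x)

/-- `X` is a smooth Killing vector field: `∇_i X_j + ∇_j X_i = 0`. -/
def IsKillingVector [IsManifold (𝓡 4) ∞ M] (g : Tensor2 M) (X : VField M) : Prop :=
  SmoothVField X ∧ ∀ x i j, nabla₁ g (flat g X) x i j + nabla₁ g (flat g X) x j i = 0

/-- The Killing tensor equation `∇_(k K_{ij)} = 0`. -/
def IsKillingTensor (g K : Tensor2 M) : Prop :=
  ∀ x i j k, nabla₂ g K x i j k + nabla₂ g K x j k i + nabla₂ g K x k i j = 0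

/-- The conformal Killing tensor equation `∇_(k K_{ij)} = θ_(k g_{ij)}` for some covector `θ`. -/
def IsConformalKillingTensor (g K : Tensor2 M) : Prop :=
  ∃ θ : CoField M, ∀ x i j k,
    nabla₂ g K x i j k + nabla₂ g K x j k i + nabla₂ g K x k i j =
      θ x (frame x i) * g x (frame x j) (frame x k)
        + θ x (frame x j) * g x (frame x k) (frame x i)
        + θ x (frame x k) * g x (frame x i) (frame x j)

/-- The Weyl rescaled metric `r² g`. -/
def weyl (r : M → ℝ) (g : Tensor2 M) : Tensor2 M := fun x => (r x) ^ 2 • g x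

/-! ### Foliation by the level sets of a function `Ω` -/

/-- The gradient `g^{αβ} ∂_β Ω`. -/
def grad (g : Tensor2 M) (Ω : M → ℝ) : VField M := fun x =>
  ∑ i, (∑ j, (metricMatrix g x)⁻¹ i j * dirDeriv Ω x (frame x j)) • frame x i

/-- The lapse function `φ = (g^{αβ} ∂_α Ω ∂_β Ω)^{-1/2}`. -/
def lapse (g : Tensor2 M) (Ω : M → ℝ) (x : M) : ℝ :=
  1 / Real.sqrt (dirDeriv Ω x (grad g Ω x))

/-- The unit normal of the slices, `n_α = φ ∂_α Ω`. -/
def normal (g : Tensor2 M) (Ω : M → ℝ) : VField M := fun x => lapse g Ω x • grad g Ω x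

/-- The derivative `f' = φ n^α ∂_α f` with respect to the foliation parameter. -/
def prime (g : Tensor2 M) (Ω : M → ℝ) (f : M → ℝ) (x : M) : ℝ :=
  lapse g Ω x * dirDeriv f x (normal g Ω x)

/-- The slice `Ω = c`. -/
def slice (Ω : M → ℝ) (c : ℝ) : Set M := {x | Ω x = c}

/-- `v` is tangent to the slice through `x`. -/
def TangentToSlice (Ω : M → ℝ) (x : M) (v : TangentSpace (𝓡 4) x) : Prop := dirDeriv Ω x v = 0

/-- `D_γ f = 0`: all derivatives of `f` tangent to the slices vanish. -/
def SliceConstant (Ω f : M → ℝ) : Prop :=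
  ∀ (x : M) (v : TangentSpace (𝓡 4) x), TangentToSlice Ω x v → dirDeriv f x v = 0

/-- The level sets of the smooth function `Ω` are connected and timelike (they have a spacelike
normal), hence form a foliation of `M` with foliation parameter `Ω`. -/
structure IsTimelikeFoliation (g : Tensor2 M) (Ω : M → ℝ) : Prop where
  smooth : SmoothFun Ω
  spacelike_grad : ∀ x, 0 < g x (grad g Ω x) (grad g Ω x)
  connected : ∀ c, IsPreconnected (slice Ω c)

/-- For vectors `v, w` tangent to a slice, the second fundamental form
`χ(v, w) = v^α w^β ∇_α n_β`. -/
def secondForm (g : Tensor2 M) (Ω : M → ℝ) (x : M) (v w : TangentSpace (𝓡 4) x) : ℝ :=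
  ∑ i, ∑ j, component v i * component w j * nabla₁ g (flat g (normal g Ω)) x i j

/-- The Gram matrix `𝒢_{ab}` of two vector fields. -/
def gram (g : Tensor2 M) (κ : Fin 2 → VField M) (x : M) : Matrix (Fin 2) (Fin 2) ℝ :=
  Matrix.of fun a b => g x (κ a x) (κ b x)

/-- Two Killing vector fields tangent to the slices, whose Gram matrix has signature `(-,+)`
(for a symmetric real `2 × 2` matrix: negative determinant). -/
structure IsAxistationary [IsManifold (𝓡 4) ∞ M] (g : Tensor2 M) (Ω : M → ℝ)
    (κ : Fin 2 → VField M) : Prop where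
  killing : ∀ a, IsKillingVector g (κ a)
  tangent : ∀ a x, TangentToSlice Ω x (κ a x)
  signature : ∀ x, (gram g κ x).det < 0

/-- `χ_τ`: the factor in `χ(σ, σ) = χ_τ h(σ, σ)` for vectors `σ` tangent to the slice and
orthogonal to the Killing vectors. -/
def IsChiTau (g : Tensor2 M) (Ω : M → ℝ) (κ : Fin 2 → VField M) (χτ : M → ℝ) : Prop :=
  ∀ (x : M) (σ : TangentSpace (𝓡 4) x), TangentToSlice Ω x σ → (∀ a, g x (κ a x) σ = 0) →
    secondForm g Ω x σ σ = χτ x * g x σ σ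

/-! ### Slice-reducible Killing tensors -/

/-- `K_{αβ} = α g_{αβ} + γ^{ab} κ_{aα} κ_{bβ} + e^Ψ n_α n_β`. -/
def sliceTensor (g : Tensor2 M) (Ω : M → ℝ) (κ : Fin 2 → VField M)
    (α : M → ℝ) (γ : M → Matrix (Fin 2) (Fin 2) ℝ) (Ψ : M → ℝ) : Tensor2 M := fun x =>
  α x • g x
    + ∑ a, ∑ b, γ x a b • (flat g (κ a) x).smulRight (flat g (κ b) x)
    + Real.exp (Ψ x) • (flat g (normal g Ω) x).smulRight (flat g (normal g Ω) x)

/-- The tensor `sliceTensor g Ω κ α γ Ψ`, with smooth coefficients and with `γ^{ab}` symmetric and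
constant on each slice, is a conformal Killing tensor. -/
structure IsSliceReducibleConformalKT (g : Tensor2 M) (Ω : M → ℝ) (κ : Fin 2 → VField M)
    (α : M → ℝ) (γ : M → Matrix (Fin 2) (Fin 2) ℝ) (Ψ : M → ℝ) : Prop where
  smooth_α : SmoothFun α
  smooth_γ : ∀ a b, SmoothFun fun x => γ x a b
  smooth_Ψ : SmoothFun Ψ
  symm_γ : ∀ x, (γ x).IsSymm
  const_γ : ∀ a b, SliceConstant Ω fun x => γ x a b
  killing : IsConformalKillingTensor g (sliceTensor g Ω κ α γ Ψ)

/-- The tensor `sliceTensor g Ω κ α γ Ψ`, with smooth coefficients and with `α` and the symmetric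
`γ^{ab}` constant on each slice (so that its projection `α h_{αβ} + γ^{ab} κ_{aα} κ_{bβ}` to
each slice is reducible), is an exact Killing tensor. -/
structure IsSliceReducibleKT (g : Tensor2 M) (Ω : M → ℝ) (κ : Fin 2 → VField M)
    (α : M → ℝ) (γ : M → Matrix (Fin 2) (Fin 2) ℝ) (Ψ : M → ℝ) : Prop where
  smooth_α : SmoothFun α
  smooth_γ : ∀ a b, SmoothFun fun x => γ x a b
  smooth_Ψ : SmoothFun Ψ
  symm_γ : ∀ x, (γ x).IsSymm
  const_α : SliceConstant Ω α
  const_γ : ∀ a b, SliceConstant Ω fun x => γ x a b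
  killing : IsKillingTensor g (sliceTensor g Ω κ α γ Ψ)

/-! ### Particle motion -/

/-- The velocity `γ̇(s)`. -/
def velocity (γ : ℝ → M) (s : ℝ) : TangentSpace (𝓡 4) (γ s) :=
  mfderiv 𝓘(ℝ, ℝ) (𝓡 4) γ s (1 : ℝ)

/-- The curve `γ` in the coordinates of the preferred chart at `γ s`. -/
def inChartAt (γ : ℝ → M) (s t : ℝ) : E4 := extChartAt (𝓡 4) (γ s) (γ t)

/-- The covariant acceleration `γ̇^α ∇_α γ̇^β = γ̈^β + Γ^β_{ij} γ̇^i γ̇^j` at the parameter `s`. -/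
def acceleration (g : Tensor2 M) (γ : ℝ → M) (s : ℝ) : TangentSpace (𝓡 4) (γ s) :=
  ∑ k, (deriv (deriv (inChartAt γ s)) s k + ∑ i, ∑ j, christoffel g (γ s) k i j
    * deriv (inChartAt γ s) s i * deriv (inChartAt γ s) s j) • frame (γ s) k

/-- An open interval, possibly empty or unbounded. -/
def IsOpenInterval (J : Set ℝ) : Prop := IsOpen J ∧ J.OrdConnected

/-- Twice continuously differentiable curves on `J`. -/
def IsC2On (γ : ℝ → M) (J : Set ℝ) : Prop := ContMDiffOn 𝓘(ℝ, ℝ) (𝓡 4) 2 γ J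

/-- Worldlines of a particle of variable mass `m`:
`γ̇^α ∇_α γ̇^β = - m g^{βλ} ∂_λ m` (here with the index `β` lowered) and `γ̇^α γ̇_α = - m²`. -/
structure IsWorldline (g : Tensor2 M) (m : M → ℝ) (J : Set ℝ) (γ : ℝ → M) : Prop where
  c2 : IsC2On γ J
  norm : ∀ s ∈ J, g (γ s) (velocity γ s) (velocity γ s) = -(m (γ s)) ^ 2
  motion : ∀ s ∈ J, ∀ v : TangentSpace (𝓡 4) (γ s),
    g (γ s) (acceleration g γ s) v = -(m (γ s) * dirDeriv m (γ s) v)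

/-- Affinely parametrized geodesics with `γ̇^α γ̇_α = - m₀²`, `m₀` constant. -/
structure IsMassiveGeodesic (g : Tensor2 M) (m₀ : ℝ) (J : Set ℝ) (γ : ℝ → M) : Prop where
  c2 : IsC2On γ J
  norm : ∀ s ∈ J, g (γ s) (velocity γ s) (velocity γ s) = -m₀ ^ 2
  geodesic : ∀ s ∈ J, acceleration g γ s = 0

/-- `γ̃` is the reparametrization `γ̃(τ(s)) = γ(s)` of `γ` on `J`, with `dτ/ds = (m / m̃)²`. -/
def IsReparam (m : M → ℝ) (mt : ℝ) (J : Set ℝ) (γ : ℝ → M) (τ : ℝ → ℝ) (γt : ℝ → M) : Prop :=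
  (∀ s ∈ J, HasDerivAt τ ((m (γ s) / mt) ^ 2) s) ∧ ∀ s ∈ J, γt (τ s) = γ s

/-- The constants of motion `q_a = κ_{aα} u^α` of a tangent vector. -/
def charge (g : Tensor2 M) (κ : Fin 2 → VField M) (x : M) (u : TangentSpace (𝓡 4) x)
    (a : Fin 2) : ℝ := g x (κ a x) u

/-- The Carter constant `K_{αβ} ũ^α ũ^β` of the rescaled velocity `ũ = (m̃ / m)² u`. -/
def carter (K : Tensor2 M) (m : M → ℝ) (mt : ℝ) (x : M) (u : TangentSpace (𝓡 4) x) : ℝ :=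
  K x ((mt / m x) ^ 2 • u) ((mt / m x) ^ 2 • u)

/-- The slice `Ω = c` is a massive particle surface for the constants of motion `q_a`: every
worldline with these constants that touches the slice lies in it entirely. -/
def IsMassiveParticleSurface (g : Tensor2 M) (Ω : M → ℝ) (κ : Fin 2 → VField M) (m : M → ℝ)
    (c : ℝ) (q : Fin 2 → ℝ) : Prop :=
  ∀ (J : Set ℝ) (γ : ℝ → M), IsOpenInterval J → IsWorldline g m J γ →
    (∀ s ∈ J, ∀ a, charge g κ (γ s) (velocity γ s) a = q a) →
    (∃ s ∈ J, γ s ∈ slice Ω c ∧ TangentToSlice Ω (γ s) (velocity γ s)) →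
    ∀ s ∈ J, γ s ∈ slice Ω c

/-! ### Observer, shadow matrix and shadow boundary

The observer is at the point `O` and has four-velocity `v^a κ_a`; `E` is the observed energy. -/

/-- `v̄ = (- 𝒢_{ab} v^a v^b)^{1/2}` at `O`. -/
def obsNorm (g : Tensor2 M) (κ : Fin 2 → VField M) (O : M) (v : Fin 2 → ℝ) : ℝ :=
  Real.sqrt (-(v ⬝ᵥ gram g κ O *ᵥ v))

/-- `τ^a = 𝒢^{ab} (- det 𝒢)^{1/2} ε_{bc} v^c` at `O`, with `ε_{01} = 1`. -/
def obsTau (g : Tensor2 M) (κ : Fin 2 → VField M) (O : M) (v : Fin 2 → ℝ) : Fin 2 → ℝ :=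
  (gram g κ O)⁻¹ *ᵥ (Real.sqrt (-(gram g κ O).det) • (!![0, 1; -1, 0] *ᵥ v))

/-- The effective mass squared `m_E² = v̄² m² / E²`, as a function of the point `x`. -/
def effMassSq (g : Tensor2 M) (κ : Fin 2 → VField M) (m : M → ℝ) (O : M) (v : Fin 2 → ℝ) (E : ℝ)
    (x : M) : ℝ := (obsNorm g κ O v) ^ 2 * (m x) ^ 2 / E ^ 2

/-- The shadow matrix `𝒮^{ab} = e^Ψ (𝒢^{ab} + m_E² v^a v^b / v̄²)`, as a function of `x`. -/
def shadowMatrix (g : Tensor2 M) (κ : Fin 2 → VField M) (Ψ m : M → ℝ) (O : M) (v : Fin 2 → ℝ)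
    (E : ℝ) (x : M) : Matrix (Fin 2) (Fin 2) ℝ :=
  Real.exp (Ψ x) • ((gram g κ x)⁻¹
    + (effMassSq g κ m O v E x / (obsNorm g κ O v) ^ 2) • Matrix.vecMulVec v v)

/-- The entrywise derivative `(𝒮^{ab})'`. -/
def shadowMatrix' (g : Tensor2 M) (Ω : M → ℝ) (κ : Fin 2 → VField M) (Ψ m : M → ℝ) (O : M)
    (v : Fin 2 → ℝ) (E : ℝ) (x : M) : Matrix (Fin 2) (Fin 2) ℝ :=
  Matrix.of fun a b => prime g Ω (fun y => shadowMatrix g κ Ψ m O v E y a b) x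

/-- `A^{ab} ρ_a ρ_b`. -/
def quad (A : Matrix (Fin 2) (Fin 2) ℝ) (ρ : Fin 2 → ℝ) : ℝ := ρ ⬝ᵥ A *ᵥ ρ

/-- The common denominator of the shadow formula, with sign `ε`:
`(1 - m̄_E²)^{1/2} v^a ρ_a - ε v̄ e^{-Ψ̄/2} ((𝒮^{ab} - 𝒮̄^{ab}) ρ_a ρ_b)^{1/2}`. -/
def shadowDenom (g : Tensor2 M) (κ : Fin 2 → VField M) (Ψ m : M → ℝ) (O : M) (v : Fin 2 → ℝ)
    (E : ℝ) (p : M) (ρ : Fin 2 → ℝ) (ε : ℝ) : ℝ :=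
  Real.sqrt (1 - effMassSq g κ m O v E O) * (v ⬝ᵥ ρ)
    - ε * (obsNorm g κ O v * Real.exp (-(Ψ O) / 2) * Real.sqrt
        (quad (shadowMatrix g κ Ψ m O v E p - shadowMatrix g κ Ψ m O v E O) ρ))

/-- The points `(X, Y)` given by the shadow formula evaluated at `p`. The impact parameter `ρ` runs
through the nonzero solutions of `(𝒮^{ab})' ρ_a ρ_b = 0` at `p` which satisfy
`(τ^a ρ_a)² ≤ (1 - m̄_E²) (v^a ρ_a)²`, `𝒮^{ab} ρ_a ρ_b ≤ 0`, and for which the remaining square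
root is real; `ε` and `ε'` are the two independent signs. -/
def shadowFormula (g : Tensor2 M) (Ω : M → ℝ) (κ : Fin 2 → VField M) (Ψ m : M → ℝ) (O : M)
    (v : Fin 2 → ℝ) (E : ℝ) (p : M) : Set (ℝ × ℝ) :=
  {P | ∃ (ρ : Fin 2 → ℝ) (ε ε' : ℝ), ρ ≠ 0 ∧ (ε = 1 ∨ ε = -1) ∧ (ε' = 1 ∨ ε' = -1) ∧
    quad (shadowMatrix' g Ω κ Ψ m O v E p) ρ = 0 ∧
    (obsTau g κ O v ⬝ᵥ ρ) ^ 2 ≤ (1 - effMassSq g κ m O v E O) * (v ⬝ᵥ ρ) ^ 2 ∧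
    quad (shadowMatrix g κ Ψ m O v E p) ρ ≤ 0 ∧
    0 ≤ quad (shadowMatrix g κ Ψ m O v E p - shadowMatrix g κ Ψ m O v E O) ρ ∧
    shadowDenom g κ Ψ m O v E p ρ ε ≠ 0 ∧
    P.1 = 2 * (obsTau g κ O v ⬝ᵥ ρ) / shadowDenom g κ Ψ m O v E p ρ ε ∧
    P.2 = ε' * (2 * (obsNorm g κ O v * Real.exp (-(Ψ O) / 2) *
      Real.sqrt (-quad (shadowMatrix g κ Ψ m O v E p) ρ)) / shadowDenom g κ Ψ m O v E p ρ ε)}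

/-- The velocity of the particle of energy `E` received from the direction `(Φ, Θ)`, for the
tetrad `e₀ = v^a κ_a / v̄`, `e₁ = τ^a κ_a / v̄`, `e₂`, `e₃ = - n`. -/
def particleVelocity (g : Tensor2 M) (Ω : M → ℝ) (κ : Fin 2 → VField M) (m : M → ℝ) (O : M)
    (v : Fin 2 → ℝ) (E : ℝ) (e₂ : TangentSpace (𝓡 4) O) (Φ Θ : ℝ) : TangentSpace (𝓡 4) O :=
  (E / obsNorm g κ O v) • ((1 / obsNorm g κ O v) • ∑ a, v a • κ a O)
    + Real.sqrt ((E / obsNorm g κ O v) ^ 2 - (m O) ^ 2) •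
      ((Real.sin Φ * Real.sin Θ) • ((1 / obsNorm g κ O v) • ∑ a, obsTau g κ O v a • κ a O)
        + (Real.cos Φ * Real.sin Θ) • e₂ + Real.cos Θ • (-normal g Ω O))

/-- The particle with velocity `u` at `O` is matched with the slice through `p`: this slice is a
massive particle surface for the constants of motion `q_a` of `u`, and some velocity `w` tangent
to the slice with `w^α w_α = - m²` has the same `q_a` and the same Carter constant. -/
def IsShadowVelocity (g : Tensor2 M) (Ω : M → ℝ) (κ : Fin 2 → VField M) (K : Tensor2 M)
    (m : M → ℝ) (mt : ℝ) (O : M) (u : TangentSpace (𝓡 4) O) (p : M) : Prop :=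
  IsMassiveParticleSurface g Ω κ m (Ω p) (charge g κ O u) ∧
    ∃ x ∈ slice Ω (Ω p), ∃ w : TangentSpace (𝓡 4) x, TangentToSlice Ω x w ∧
      g x w w = -(m x) ^ 2 ∧ charge g κ x w = charge g κ O u ∧
      carter K m mt x w = carter K m mt O u

/-- The shadow boundary points due to the slice through `p`, in the stereographic coordinates
`X = - 2 tan(Θ/2) sin Φ`, `Y = - 2 tan(Θ/2) cos Φ`. -/
def shadowBoundary (g : Tensor2 M) (Ω : M → ℝ) (κ : Fin 2 → VField M) (K : Tensor2 M)
    (m : M → ℝ) (mt : ℝ) (O : M) (v : Fin 2 → ℝ) (E : ℝ) (e₂ : TangentSpace (𝓡 4) O) (p : M) :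
    Set (ℝ × ℝ) :=
  {P | ∃ Φ ∈ Set.Icc 0 (2 * Real.pi), ∃ Θ ∈ Set.Ico 0 Real.pi,
    IsShadowVelocity g Ω κ K m mt O (particleVelocity g Ω κ m O v E e₂ Φ Θ) p ∧
    P.1 = -2 * Real.tan (Θ / 2) * Real.sin Φ ∧ P.2 = -2 * Real.tan (Θ / 2) * Real.cos Φ}

/-- An observer at `O` with four-velocity `v^a κ_a` timelike, receiving particles of energy
`E > 0` larger than their rest energy `m v̄`, with unit tetrad vector `e₂` orthogonal to the Killing
vectors and to the normal. -/
structure IsObserver (g : Tensor2 M) (Ω : M → ℝ) (κ : Fin 2 → VField M) (m : M → ℝ) (O : M)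
    (v : Fin 2 → ℝ) (E : ℝ) (e₂ : TangentSpace (𝓡 4) O) : Prop where
  timelike : v ⬝ᵥ gram g κ O *ᵥ v < 0
  energy_pos : 0 < E
  energy : effMassSq g κ m O v E O < 1
  unit : g O e₂ e₂ = 1
  orth_killing : ∀ a, g O (κ a O) e₂ = 0
  orth_normal : g O (normal g Ω O) e₂ = 0

/-- `O` and `p` lie on a common integral curve of the unit normal field. -/
def OnNormalCurve (g : Tensor2 M) (Ω : M → ℝ) (O p : M) : Prop :=
  ∃ (c : ℝ → M) (J : Set ℝ), J.OrdConnected ∧ IsMIntegralCurveOn c (normal g Ω) J ∧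
    (∃ s ∈ J, c s = O) ∧ ∃ s ∈ J, c s = p

end Spacetime

end

noncomputable section

open scoped Topology

set_option synthInstance.maxHeartbeats 200000
set_option linter.unusedSectionVars false

namespace Spacetime

/-! The proof rests on one tensor identity. Write `n` for the unit conormal and let the `κ_a` be
Killing, or merely conformal Killing. For `K` of the slice form, `∇_v K(v,v) = μ(v) g(v,v) + n(v)
B(v)` with `μ` linear and `B` quadratic (`IsSliceFrame.nablaT_eq`). If this equals `θ(v) g(v,v)`,
then `n` divides `(θ - μ) g`. Since `g` does not vanish on the kernel of `n`, the linear form `θ -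
μ` is a multiple of `n`, and `B` is a multiple of `g`. The last statement is `SliceEq`: it gives
`∇n` on the diagonal in terms of `dΨ` and the normal derivative of `γ`, and `α` has dropped out
(`IsSliceFrame.sliceEq_of_nablaT`, converse `IsSliceFrame.nablaT_of_sliceEq`).

`SliceEq` is covariant under `g ↦ r² g`, `Ψ ↦ Ψ + 2 log r` (`IsSliceFrame.sliceEq_weyl`), so
conformal tensors pass between `g` and the rescaled metric. What separates an exact tensor from a
conformal one is `θ = 0`, that is `(e^Ψ)' = -α'` with `α` constant on the slices. Such an `α` exists
exactly when `(e^Ψ)'` is constant on the slices, because slice constants are functions of `Ω` and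
can be integrated (`SliceConstant.exists_prime_eq`, `exists_weyl_iff`). For the rescaled metric,
`e^Ψ` becomes `e^Ψ m²` up to a constant.

The components of `SliceEq` supply the geometry. Mixed components give `dΨ = 2 d log φ` along the
slices, directions orthogonal to the `κ_a` give `χ_τ = dΨ(n)/2`, and the Killing directions give
`(e^Ψ 𝒢^{ab})' = (γ^{ab})'` (`IsSliceFrame.dd_exp_gram_inv`). In particular `dΨ` is the same for all
solutions (`IsSliceFrame.dd_unique`), and `(𝒮^{ab})'` is constant on the slices.

For a worldline with charges `q`, the normal velocity `ν` solves a linear equation whose source is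
proportional to `F = (γ^{ab})' q_a q_b + (e^Ψ m²)'` (`surfaceFun`). As `F` is slice constant,
`dF/ds` is proportional to `ν`, so `(ν, F)` solves a homogeneous linear system. Uniqueness shows
that a slice with `F = 0` is a massive particle surface; local existence of worldlines gives the
converse whenever a suitable tangent velocity exists. With `v^a q_a = -E` one has `F = (𝒮^{ab})' q_a
q_b`.

On velocities of norm `-m²` the Carter constant is a slice constant plus a multiple of `ν²`.
Transporting the slice constant along the normal curve from `O` to `p` turns equality of Carter
constants into `(𝒮^{ab} - 𝒮̄^{ab}) q_a q_b = e^Ψ̄ ν²` at `O` (`IsSliceReducibleKT.carterBase_sub`,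
`isShadowVelocity_iff`). The rest is algebra: directions are points of the unit sphere, and
normalizing `ρ` by `v^a ρ_a = -E` matches them with the formula (`shadow_algebra`).

The reduction to geodesics is the Weyl transformation of the Christoffel symbols combined with the
reparametrization (`IsReparam.acc_eq`). -/

variable {M : Type*} [TopologicalSpace M] [ChartedSpace E4 M]

/-! ### Fields and functions in the preferred chart -/

section

/-- The differential of the inverse of the preferred chart at `x`. -/
def coordMap (x : M) (y : E4) : E4 →L[ℝ] E4 :=
  mfderiv 𝓘(ℝ, E4) (𝓡 4) (extChartAt (𝓡 4) x).symm y

/-- The differential of the preferred chart at `x`, at the point with coordinates `y`. -/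
def chartMap (x : M) (y : E4) : E4 →L[ℝ] E4 :=
  mfderiv (𝓡 4) 𝓘(ℝ, E4) (extChartAt (𝓡 4) x) ((extChartAt (𝓡 4) x).symm y)

/-- The value of a tensor field, as a bilinear form on `E4`. -/
def at₂ (B : Tensor2 M) (z : M) : E4 →L[ℝ] E4 →L[ℝ] ℝ := B z

/-- The value of a covector field, as a linear form on `E4`. -/
def at₁ (θ : CoField M) (z : M) : E4 →L[ℝ] ℝ := θ z

/-- The value of a vector field, as an element of `E4`. -/
def atV (X : VField M) (z : M) : E4 := X z

/-- A covariant rank-two tensor field in the preferred chart at `x`. -/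
def loc₂ (B : Tensor2 M) (x : M) (y : E4) : E4 →L[ℝ] E4 →L[ℝ] ℝ :=
  (at₂ B ((extChartAt (𝓡 4) x).symm y)).bilinearComp (coordMap x y) (coordMap x y)

/-- A covector field in the preferred chart at `x`. -/
def loc₁ (θ : CoField M) (x : M) (y : E4) : E4 →L[ℝ] ℝ :=
  (at₁ θ ((extChartAt (𝓡 4) x).symm y)).comp (coordMap x y)

/-- A vector field in the preferred chart at `x`. -/
def locV (X : VField M) (x : M) (y : E4) : E4 :=
  chartMap x y (atV X ((extChartAt (𝓡 4) x).symm y))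

/-- A function in the preferred chart at `x`. -/
def locF (f : M → ℝ) (x : M) (y : E4) : ℝ := f ((extChartAt (𝓡 4) x).symm y)

/-- The differential of a function, as a covector field. -/
def dF (f : M → ℝ) : CoField M := fun x => mvfderiv (𝓡 4) f x

lemma loc₂_apply (B : Tensor2 M) (x : M) (y u w : E4) :
    loc₂ B x y u w = B ((extChartAt (𝓡 4) x).symm y) (coordMap x y u) (coordMap x y w) := rfl

lemma loc₁_apply (θ : CoField M) (x : M) (y u : E4) :
    loc₁ θ x y u = θ ((extChartAt (𝓡 4) x).symm y) (coordMap x y u) := rfl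

lemma target_mem_nhds (x : M) {y : E4} (hy : y ∈ (extChartAt (𝓡 4) x).target) :
    (extChartAt (𝓡 4) x).target ∈ 𝓝 y :=
  (isOpen_extChartAt_target x).mem_nhds hy

lemma locF_self (f : M → ℝ) (x : M) : locF f x (extChartAt (𝓡 4) x x) = f x := by
  rw [locF, extChartAt_to_inv]

/-- Near `x` the function is its local expression composed with the chart at `x`. Hence smoothness
need only be tested at the centre of each preferred chart. -/
lemma contMDiffAt_of_locF {f : M → ℝ} {x : M}
    (h : ContDiffAt ℝ ∞ (locF f x) (extChartAt (𝓡 4) x x)) :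
    ContMDiffAt (𝓡 4) 𝓘(ℝ, ℝ) ∞ f x := by
  have h1 : ContMDiffAt (𝓡 4) 𝓘(ℝ, ℝ) ∞ (locF f x ∘ extChartAt (𝓡 4) x) x :=
    (contMDiffAt_iff_contDiffAt.2 h).comp x contMDiffAt_extChartAt
  refine h1.congr_of_eventuallyEq ?_
  filter_upwards [extChartAt_source_mem_nhds (I := 𝓡 4) x] with z hz
  rw [Function.comp_apply, locF, (extChartAt (𝓡 4) x).left_inv hz]

section
variable [IsManifold (𝓡 4) ∞ M]

lemma mdifferentiableAt_symm (x : M) {y : E4} (hy : y ∈ (extChartAt (𝓡 4) x).target) :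
    MDifferentiableAt 𝓘(ℝ, E4) (𝓡 4) (extChartAt (𝓡 4) x).symm y := by
  have := mdifferentiableWithinAt_extChartAt_symm (I := 𝓡 4) hy
  rwa [ModelWithCorners.range_eq_univ, mdifferentiableWithinAt_univ] at this

lemma coordMap_chartMap (x : M) {y : E4} (hy : y ∈ (extChartAt (𝓡 4) x).target) (u : E4) :
    coordMap x y (chartMap x y u) = u := by
  have := mfderivWithin_extChartAt_symm_comp_mfderiv_extChartAt (I := 𝓡 4) hy
  rw [ModelWithCorners.range_eq_univ, mfderivWithin_univ] at this
  exact congrArg (fun L => L u) this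

lemma chartMap_coordMap (x : M) {y : E4} (hy : y ∈ (extChartAt (𝓡 4) x).target) (u : E4) :
    chartMap x y (coordMap x y u) = u := by
  have := mfderiv_extChartAt_comp_mfderivWithin_extChartAt_symm (I := 𝓡 4) hy
  rw [ModelWithCorners.range_eq_univ, mfderivWithin_univ] at this
  exact congrArg (fun L => L u) this

lemma coordMap_self (x : M) (u : E4) : coordMap x (extChartAt (𝓡 4) x x) u = u := by
  have := mfderivWithin_range_extChartAt_symm (I := 𝓡 4) (x := x)
  rw [ModelWithCorners.range_eq_univ, mfderivWithin_univ] at this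
  exact congrArg (fun L => L u) this

lemma coordMap_locV (X : VField M) (x : M) {y : E4} (hy : y ∈ (extChartAt (𝓡 4) x).target) :
    coordMap x y (locV X x y) = atV X ((extChartAt (𝓡 4) x).symm y) := coordMap_chartMap x hy _

lemma locV_eq_of_coordMap (X : VField M) (x : M) {y : E4} (hy : y ∈ (extChartAt (𝓡 4) x).target)
    {u : E4} (hu : coordMap x y u = atV X ((extChartAt (𝓡 4) x).symm y)) : locV X x y = u := by
  rw [locV, ← hu, chartMap_coordMap x hy]

lemma loc₂_self (B : Tensor2 M) (x : M) : loc₂ B x (extChartAt (𝓡 4) x x) = B x := by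
  have h1 : at₂ B ((extChartAt (𝓡 4) x).symm (extChartAt (𝓡 4) x x)) = at₂ B x := by
    rw [extChartAt_to_inv]
  ext u w
  rw [loc₂, h1]
  change at₂ B x (coordMap x _ u) (coordMap x _ w) = _
  rw [coordMap_self, coordMap_self]; rfl

lemma loc₁_self (θ : CoField M) (x : M) : loc₁ θ x (extChartAt (𝓡 4) x x) = θ x := by
  have h1 : at₁ θ ((extChartAt (𝓡 4) x).symm (extChartAt (𝓡 4) x x)) = at₁ θ x := by
    rw [extChartAt_to_inv]
  ext u
  rw [loc₁, h1]
  change at₁ θ x (coordMap x _ u) = _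
  rw [coordMap_self]; rfl

lemma locV_self (X : VField M) (x : M) : locV X x (extChartAt (𝓡 4) x x) = X x := by
  apply locV_eq_of_coordMap X x (mem_extChartAt_target x)
  have h : ∀ z, z = x → (X z : E4) = X x := by rintro z rfl; rfl
  exact (coordMap_self x _).trans (h _ (extChartAt_to_inv (I := 𝓡 4) x)).symm

lemma contDiffOn_locF {f : M → ℝ} (hf : SmoothFun f) (x : M) :
    ContDiffOn ℝ ∞ (locF f x) (extChartAt (𝓡 4) x).target := by
  rw [← contMDiffOn_iff_contDiffOn]
  exact hf.comp_contMDiffOn (contMDiffOn_extChartAt_symm x)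

lemma contDiffAt_locF {f : M → ℝ} (hf : SmoothFun f) (x : M) {y : E4}
    (hy : y ∈ (extChartAt (𝓡 4) x).target) : ContDiffAt ℝ ∞ (locF f x) y :=
  (contDiffOn_locF hf x).contDiffAt (target_mem_nhds x hy)

lemma loc₁_dF {f : M → ℝ} (hf : SmoothFun f) (x : M) {y : E4}
    (hy : y ∈ (extChartAt (𝓡 4) x).target) : loc₁ (dF f) x y = fderiv ℝ (locF f x) y := by
  have h1 : MDifferentiableAt (𝓡 4) 𝓘(ℝ, ℝ) f ((extChartAt (𝓡 4) x).symm y) :=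
    (hf _).mdifferentiableAt (by simp)
  have h2 := mfderiv_comp y h1 (mdifferentiableAt_symm x hy)
  rw [← mfderiv_eq_fderiv]
  exact h2.symm

lemma dirDeriv_coordMap {f : M → ℝ} (hf : SmoothFun f) (x : M) {y : E4}
    (hy : y ∈ (extChartAt (𝓡 4) x).target) (u : E4) :
    dirDeriv f ((extChartAt (𝓡 4) x).symm y) (coordMap x y u) = fderiv ℝ (locF f x) y u := by
  rw [← loc₁_dF hf x hy]; rfl

lemma coordMap_eq_symmL (x : M) {z : M} (hz : z ∈ (chartAt E4 x).source) :
    coordMap x (extChartAt (𝓡 4) x z) =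
      (trivializationAt E4 (TangentSpace (𝓡 4)) x).symmL ℝ z := by
  have := TangentBundle.symmL_trivializationAt (I := 𝓡 4) hz
  rw [ModelWithCorners.range_eq_univ, mfderivWithin_univ] at this
  exact this.symm

lemma chartMap_eq_continuousLinearMapAt (x : M) {z : M} (hz : z ∈ (chartAt E4 x).source) :
    chartMap x (extChartAt (𝓡 4) x z) =
      (trivializationAt E4 (TangentSpace (𝓡 4)) x).continuousLinearMapAt ℝ z := by
  rw [TangentBundle.continuousLinearMapAt_trivializationAt (I := 𝓡 4) hz, chartMap,
    (extChartAt (𝓡 4) x).left_inv (by rwa [extChartAt_source])]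

/-- The differential of the inverse chart is the fibrewise inverse of the tangent bundle
trivialization at `x`, so a fixed coordinate vector is a smooth local section. These sections are
fed into the metric in `contDiffOn_loc₂`. -/
lemma contMDiffOn_coordMap (x : M) (u : E4) :
    ContMDiffOn (𝓡 4) ((𝓡 4).prod 𝓘(ℝ, E4)) ∞
      (fun z => TotalSpace.mk' E4 (E := TangentSpace (𝓡 4)) z
        (coordMap x (extChartAt (𝓡 4) x z) u)) (chartAt E4 x).source := by
  have h := (trivializationAt E4 (TangentSpace (𝓡 4) (M := M)) x).contMDiffOn_symmL
    (IB := 𝓡 4) (n := ∞)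
  have h2 := h.clm_bundle_apply (v := fun _ => u) (F₁ := E4) (F₂ := E4) (b := fun z : M => z)
    (E₁ := Bundle.Trivial M E4) (E₂ := TangentSpace (𝓡 4)) ?_
  · refine h2.congr fun z hz => ?_
    rw [coordMap_eq_symmL x hz]
    rfl
  · intro z hz
    rw [contMDiffWithinAt_section]
    exact contMDiffWithinAt_const

lemma contDiffOn_locV {X : VField M} (hX : SmoothVField X) (x : M) :
    ContDiffOn ℝ ∞ (locV X x) (extChartAt (𝓡 4) x).target := by
  have h1 : ContMDiffOn (𝓡 4) 𝓘(ℝ, E4) ∞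
      (fun z => (trivializationAt E4 (TangentSpace (𝓡 4)) x ⟨z, X z⟩).2) (chartAt E4 x).source :=
    ((trivializationAt E4 (TangentSpace (𝓡 4)) x).contMDiffOn_section_baseSet_iff).1
      hX.contMDiffOn
  rw [← contMDiffOn_iff_contDiffOn]
  refine (h1.comp (contMDiffOn_extChartAt_symm x) ?_).congr ?_
  · intro y hy
    rw [← extChartAt_source (𝓡 4)]
    exact (extChartAt (𝓡 4) x).map_target hy
  · intro y hy
    have hz : (extChartAt (𝓡 4) x).symm y ∈ (chartAt E4 x).source := by
      rw [← extChartAt_source (𝓡 4)]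
      exact (extChartAt (𝓡 4) x).map_target hy
    have h2 := chartMap_eq_continuousLinearMapAt x hz
    rw [(extChartAt (𝓡 4) x).right_inv hy] at h2
    rw [locV, h2]
    exact Trivialization.continuousLinearMapAt_apply_of_mem ℝ _ hz _

/-- In finite dimension, smoothness of a form-valued map can be tested on fixed vectors, which here
means evaluating the smooth bundle section `g` on two coordinate sections. -/
lemma contDiffOn_loc₂ {g : Tensor2 M} (hg : IsLorentzMetric g) (x : M) :
    ContDiffOn ℝ ∞ (loc₂ g x) (extChartAt (𝓡 4) x).target := by
  rw [contDiffOn_clm_apply]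
  intro u
  rw [contDiffOn_clm_apply]
  intro w
  rw [← contMDiffOn_iff_contDiffOn]
  have h1 := hg.smooth.contMDiffOn (s := (chartAt E4 x).source)
  have h2 := h1.clm_bundle_apply₂ (b := fun z : M => z) (E₁ := TangentSpace (𝓡 4))
    (E₂ := TangentSpace (𝓡 4)) (E₃ := Bundle.Trivial M ℝ) (F₃ := ℝ)
    (contMDiffOn_coordMap x u) (contMDiffOn_coordMap x w)
  have h3 : ContMDiffOn (𝓡 4) 𝓘(ℝ, ℝ) ∞ (fun z => g z (coordMap x (extChartAt (𝓡 4) x z) u)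
      (coordMap x (extChartAt (𝓡 4) x z) w)) (chartAt E4 x).source := by
    intro z hz
    have := h2 z hz
    rw [contMDiffWithinAt_section] at this
    exact this
  refine (h3.comp (contMDiffOn_extChartAt_symm x) ?_).congr ?_
  · intro y hy
    rw [← extChartAt_source (𝓡 4)]
    exact (extChartAt (𝓡 4) x).map_target hy
  · intro y hy
    rw [Function.comp_apply, (extChartAt (𝓡 4) x).right_inv hy]
    rfl

end

end

section

/-! ### Linear algebra of a Lorentzian form -/

section
variable {E : Type*} [NormedAddCommGroup E] [NormedSpace ℝ E]

/-- A bilinear form of signature `(-,+,+,+)`. -/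
structure IsLorentzForm (G : E →L[ℝ] E →L[ℝ] ℝ) : Prop where
  symm : ∀ v w, G v w = G w v
  signature : ∃ b : Module.Basis (Fin 4) ℝ E, ∀ i j,
    G (b i) (b j) = if i = j then (if i = 0 then -1 else 1) else 0

lemma IsLorentzForm.apply_basis {G : E →L[ℝ] E →L[ℝ] ℝ} {b : Module.Basis (Fin 4) ℝ E}
    (hb : ∀ i j, G (b i) (b j) = if i = j then (if i = 0 then -1 else 1) else 0) (v w : E) :
    G v w = -(b.repr v 0 * b.repr w 0) + b.repr v 1 * b.repr w 1 + b.repr v 2 * b.repr w 2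
      + b.repr v 3 * b.repr w 3 := by
  conv_lhs => rw [← b.sum_repr v, ← b.sum_repr w]
  simp only [Fin.sum_univ_four, map_add, map_smul, add_apply, smul_apply, hb, smul_eq_mul]
  simp only [Fin.isValue, ↓reduceIte, Fin.reduceEq]
  ring

lemma IsLorentzForm.nondegenerate {G : E →L[ℝ] E →L[ℝ] ℝ} (hG : IsLorentzForm G) {v : E}
    (hv : ∀ w, G v w = 0) : v = 0 := by
  obtain ⟨b, hb⟩ := hG.signature
  apply b.repr.injective
  ext i
  have h := hv (b i)
  rw [IsLorentzForm.apply_basis hb] at h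
  fin_cases i <;> simpa using h

lemma IsLorentzForm.ext {G : E →L[ℝ] E →L[ℝ] ℝ} (hG : IsLorentzForm G) {v v' : E}
    (hv : ∀ w, G v w = G v' w) : v = v' := by
  rw [← sub_eq_zero]
  exact hG.nondegenerate fun w => by simp [hv w]

/-- A nonzero vector orthogonal to a timelike vector is spacelike. -/
lemma IsLorentzForm.pos_of_orthogonal {G : E →L[ℝ] E →L[ℝ] ℝ} (hG : IsLorentzForm G) {u σ : E}
    (hu : G u u < 0) (huσ : G u σ = 0) (hσ : σ ≠ 0) : 0 < G σ σ := by
  obtain ⟨b, hb⟩ := hG.signature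
  by_contra! hneg
  -- On vectors without time component the form is positive definite.
  have hz : ∀ w : E, b.repr w 0 = 0 → G w w ≤ 0 → w = 0 := by
    intro w h0 hw
    rw [IsLorentzForm.apply_basis hb, h0] at hw
    have h1 : b.repr w 1 = 0 := by nlinarith [sq_nonneg (b.repr w 1), sq_nonneg (b.repr w 2), sq_nonneg (b.repr w 3)]
    have h2 : b.repr w 2 = 0 := by nlinarith [sq_nonneg (b.repr w 1), sq_nonneg (b.repr w 2), sq_nonneg (b.repr w 3)]
    have h3 : b.repr w 3 = 0 := by nlinarith [sq_nonneg (b.repr w 1), sq_nonneg (b.repr w 2), sq_nonneg (b.repr w 3)]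
    apply b.repr.injective
    ext i
    fin_cases i <;> simp [h0, h1, h2, h3]
  set s := b.repr σ 0
  set t := b.repr u 0
  -- This combination has no time component, and by orthogonality its norm is `s² G(u,u) + t² G(σ,σ)
  -- ≤ 0`; hence it vanishes. Pairing with `u` then gives `s = 0`, so `σ` itself has no time
  -- component.
  have hw := hz (s • u - t • σ) (by simp [s, t, mul_comm]) (by
    have h2 : G σ u = 0 := by rw [hG.symm, huσ]
    simp only [map_sub, map_smul, sub_apply, smul_apply,
      smul_eq_mul, huσ, h2]
    nlinarith [mul_nonneg (sq_nonneg s) (neg_nonneg.2 hu.le),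
      mul_nonneg (sq_nonneg t) (neg_nonneg.2 hneg)])
  have h3 : G u (s • u - t • σ) = 0 := by rw [hw, map_zero]
  simp only [map_sub, map_smul, smul_eq_mul, huσ, mul_zero, sub_zero] at h3
  have hs : s = 0 := by
    rcases mul_eq_zero.1 h3 with h | h
    · exact h
    · exact absurd h hu.ne
  exact hσ (hz σ hs hneg)

end

lemma IsLorentzMetric.form [IsManifold (𝓡 4) ∞ M] {g : Tensor2 M} (hg : IsLorentzMetric g)
    (x : M) : IsLorentzForm (at₂ g x) := ⟨hg.symm x, hg.signature x⟩

/-- The vector dual to a covector. -/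
def sharp (A : Matrix (Fin 4) (Fin 4) ℝ) (θ : E4 →L[ℝ] ℝ) : E4 :=
  ∑ i, (∑ j, A⁻¹ i j * θ (EuclideanSpace.single j 1)) • EuclideanSpace.single i 1

lemma sum_smul_single (v : E4) : ∑ i, v i • EuclideanSpace.single i (1 : ℝ) = v := by
  ext j
  simp [Finset.sum_apply, Pi.single_apply]

lemma clm_ext_single {θ η : E4 →L[ℝ] ℝ}
    (h : ∀ j, θ (EuclideanSpace.single j 1) = η (EuclideanSpace.single j 1)) : θ = η := by
  ext v
  rw [← sum_smul_single v]
  simp [h]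

/-- The Gram matrix of the standard basis. -/
def formMatrix (G : E4 →L[ℝ] E4 →L[ℝ] ℝ) : Matrix (Fin 4) (Fin 4) ℝ :=
  Matrix.of fun i j => G (EuclideanSpace.single i 1) (EuclideanSpace.single j 1)

/-- A vector in the left kernel of the Gram matrix is the coordinate vector of something orthogonal
to everything. -/
lemma IsLorentzForm.isUnit_det {G : E4 →L[ℝ] E4 →L[ℝ] ℝ} (hG : IsLorentzForm G) :
    IsUnit (formMatrix G).det := by
  rw [isUnit_iff_ne_zero]
  intro h
  obtain ⟨c, hc, h0⟩ := Matrix.exists_vecMul_eq_zero_iff.2 h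
  apply hc
  have : ∑ i, c i • EuclideanSpace.single i (1 : ℝ) = 0 := by
    apply hG.nondegenerate
    intro w
    have : G (∑ i, c i • EuclideanSpace.single i (1 : ℝ)) = 0 := by
      apply clm_ext_single
      intro j
      have := congrFun h0 j
      simpa [Matrix.vecMul, dotProduct, formMatrix] using this
    rw [this]; rfl
  ext j
  have := congrArg (fun v : E4 => v j) this
  simpa [Finset.sum_apply, Pi.single_apply] using this

lemma IsLorentzForm.apply_sharp {G : E4 →L[ℝ] E4 →L[ℝ] ℝ} (hG : IsLorentzForm G)
    (θ : E4 →L[ℝ] ℝ) : G (sharp (formMatrix G) θ) = θ := by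
  apply clm_ext_single
  intro k
  have hsym : (formMatrix G)ᵀ = formMatrix G := by
    ext i j
    exact hG.symm _ _
  have h1 : formMatrix G * (formMatrix G)⁻¹ = 1 := Matrix.mul_nonsing_inv _ hG.isUnit_det
  have h2 : ∀ j, ∑ i, (formMatrix G) k i * (formMatrix G)⁻¹ i j = if k = j then 1 else 0 := by
    intro j
    have := congrFun (congrFun h1 k) j
    simpa [Matrix.mul_apply, Matrix.one_apply] using this
  have h3 : ∀ i, G (EuclideanSpace.single i 1) (EuclideanSpace.single k 1) = formMatrix G k i :=
    fun i => hG.symm _ _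
  simp only [sharp, map_sum, map_smul, sum_apply,
    smul_apply, smul_eq_mul, h3, Finset.sum_mul]
  rw [Finset.sum_comm]
  calc _ = ∑ j, (∑ i, (formMatrix G) k i * (formMatrix G)⁻¹ i j) *
        θ (EuclideanSpace.single j 1) := by
        refine Finset.sum_congr rfl fun j _ => ?_
        rw [Finset.sum_mul]
        exact Finset.sum_congr rfl fun i _ => by ring
    _ = _ := by simp [h2]

lemma metricMatrix_eq (g : Tensor2 M) (x : M) : metricMatrix g x = formMatrix (at₂ g x) := rfl

/-! ### Covariant derivatives contracted with vectors -/

/-- The derivative of the metric in the preferred chart at `x`. -/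
def dG (g : Tensor2 M) (x : M) (v : E4) : E4 →L[ℝ] E4 →L[ℝ] ℝ :=
  fderiv ℝ (loc₂ g x) (extChartAt (𝓡 4) x x) v

/-- The Christoffel symbols contracted with two vectors. -/
def Gam (g : Tensor2 M) (x : M) (v w : E4) : E4 :=
  ∑ k, (∑ i, ∑ j, christoffel g x k i j * v i * w j) • EuclideanSpace.single k 1

lemma partialAt_comp₂ {B : Tensor2 M} {x : M}
    (hB : DifferentiableAt ℝ (loc₂ B x) (extChartAt (𝓡 4) x x)) (k i j : Fin 4) :
    partialAt x k (comp₂ B x i j) = fderiv ℝ (loc₂ B x) (extChartAt (𝓡 4) x x)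
      (EuclideanSpace.single k 1) (EuclideanSpace.single i 1) (EuclideanSpace.single j 1) := by
  have h : HasFDerivAt (comp₂ B x i j) _ (extChartAt (𝓡 4) x x) :=
    (hB.hasFDerivAt.clm_apply (hasFDerivAt_const (EuclideanSpace.single i (1 : ℝ) : E4) _)).clm_apply
      (hasFDerivAt_const (EuclideanSpace.single j (1 : ℝ) : E4) _)
  rw [partialAt, h.fderiv]
  simp

lemma partialAt_comp₁ {θ : CoField M} {x : M}
    (hθ : DifferentiableAt ℝ (loc₁ θ x) (extChartAt (𝓡 4) x x)) (k i : Fin 4) :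
    partialAt x k (comp₁ θ x i) = fderiv ℝ (loc₁ θ x) (extChartAt (𝓡 4) x x)
      (EuclideanSpace.single k 1) (EuclideanSpace.single i 1) := by
  have h : HasFDerivAt (comp₁ θ x i) _ (extChartAt (𝓡 4) x x) :=
    hθ.hasFDerivAt.clm_apply (hasFDerivAt_const (EuclideanSpace.single i (1 : ℝ) : E4) _)
  rw [partialAt, h.fderiv]
  simp

lemma clm₂_sum_sum (L : E4 →L[ℝ] E4 →L[ℝ] ℝ) (v w : E4) :
    ∑ i, ∑ j, L (EuclideanSpace.single i 1) (EuclideanSpace.single j 1) * v i * w j = L v w := by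
  conv_rhs => rw [← sum_smul_single v, ← sum_smul_single w]
  simp only [map_sum, map_smul, sum_apply, smul_apply,
    smul_eq_mul, Finset.mul_sum]
  rw [Finset.sum_comm]
  exact Finset.sum_congr rfl fun i _ => Finset.sum_congr rfl fun j _ => by ring

/-- The Christoffel symbols of the first kind. -/
def Gam₁ (g : Tensor2 M) (x : M) (v w u : E4) : ℝ :=
  1 / 2 * (dG g x v w u + dG g x w v u - dG g x u v w)

lemma dG_sum (g : Tensor2 M) (x : M) (v : E4) :
    dG g x v = ∑ i, v i • dG g x (EuclideanSpace.single i 1) := by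
  conv_lhs => rw [← sum_smul_single v]
  simp only [dG, map_sum, map_smul]

lemma sum_dG_left (g : Tensor2 M) (x : M) (v w u : E4) :
    ∑ i, ∑ j, dG g x (EuclideanSpace.single i 1) (EuclideanSpace.single j 1) u * v i * w j
      = dG g x v w u := by
  rw [dG_sum g x v]
  conv_rhs => rw [← sum_smul_single w]
  simp only [map_sum, map_smul, sum_apply, smul_apply, smul_eq_mul, Finset.mul_sum]
  rw [Finset.sum_comm]
  exact Finset.sum_congr rfl fun i _ => Finset.sum_congr rfl fun j _ => by ring

lemma sum_Gam₁ (g : Tensor2 M) (x : M) (v w u : E4) :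
    ∑ i, ∑ j, Gam₁ g x (EuclideanSpace.single i 1) (EuclideanSpace.single j 1) u * v i * w j
      = Gam₁ g x v w u := by
  have h1 := sum_dG_left g x v w u
  have h2 := sum_dG_left g x w v u
  have h3 := clm₂_sum_sum (dG g x u) v w
  rw [Finset.sum_comm] at h2
  simp only [Gam₁, ← h1, ← h2, ← h3, mul_add, mul_sub, Finset.mul_sum, ← Finset.sum_add_distrib,
    ← Finset.sum_sub_distrib]
  exact Finset.sum_congr rfl fun i _ => Finset.sum_congr rfl fun j _ => by ring

lemma exists_Gam₁_clm (g : Tensor2 M) (x : M) (v w : E4) :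
    ∃ θ : E4 →L[ℝ] ℝ, ∀ u, θ u = Gam₁ g x v w u := by
  have hlin : IsLinearMap ℝ (Gam₁ g x v w) := by
    constructor
    · intro u u'
      simp only [Gam₁, dG, map_add, add_apply]
      ring
    · intro c u
      simp only [Gam₁, dG, map_smul, smul_apply, smul_eq_mul]
      ring
  exact ⟨(hlin.mk' _).toContinuousLinearMap, fun u => rfl⟩

section
variable [IsManifold (𝓡 4) ∞ M]

lemma IsLorentzMetric.differentiableAt {g : Tensor2 M} (hg : IsLorentzMetric g) (x : M) :
    DifferentiableAt ℝ (loc₂ g x) (extChartAt (𝓡 4) x x) :=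
  ((contDiffOn_loc₂ hg x).contDiffAt (target_mem_nhds x (mem_extChartAt_target x))).differentiableAt
    (by simp)

lemma christoffel_eq {g : Tensor2 M} (hg : IsLorentzMetric g) (x : M) (k i j : Fin 4) :
    christoffel g x k i j = ∑ l, (metricMatrix g x)⁻¹ k l * Gam₁ g x (EuclideanSpace.single i 1)
      (EuclideanSpace.single j 1) (EuclideanSpace.single l 1) := by
  simp only [christoffel, partialAt_comp₂ (hg.differentiableAt x), Finset.mul_sum, Gam₁, dG]
  exact Finset.sum_congr rfl fun l _ => by ring

/-- Lowering the index cancels the inverse matrix in the Christoffel symbols. Later computations use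
only this lowered form, so the inverse metric never has to be differentiated in them. -/
lemma apply_Gam {g : Tensor2 M} (hg : IsLorentzMetric g) (x : M) (v w u : E4) :
    at₂ g x (Gam g x v w) u = Gam₁ g x v w u := by
  obtain ⟨θ, hθ⟩ := exists_Gam₁_clm g x v w
  have h : Gam g x v w = sharp (metricMatrix g x) θ := by
    unfold Gam sharp
    refine Finset.sum_congr rfl fun k _ => ?_
    congr 1
    simp only [christoffel_eq hg, Finset.sum_mul]
    rw [Finset.sum_congr rfl fun i _ => Finset.sum_comm, Finset.sum_comm]
    refine Finset.sum_congr rfl fun l _ => ?_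
    rw [hθ, ← sum_Gam₁, Finset.mul_sum]
    refine Finset.sum_congr rfl fun i _ => ?_
    rw [Finset.mul_sum]
    exact Finset.sum_congr rfl fun j _ => by ring
  rw [h, metricMatrix_eq, (hg.form x).apply_sharp, hθ]

end

/-- The covariant derivative `∇_v θ (v)`. -/
def nablaC (g : Tensor2 M) (θ : CoField M) (x : M) (v : E4) : ℝ :=
  ∑ i, ∑ j, v i * v j * nabla₁ g θ x i j

/-- The covariant derivative `∇_v B (v, v)`. -/
def nablaT (g : Tensor2 M) (B : Tensor2 M) (x : M) (v : E4) : ℝ :=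
  ∑ k, ∑ i, ∑ j, v k * v i * v j * nabla₂ g B x k i j

lemma Gam_single (g : Tensor2 M) (x : M) (i j : Fin 4) :
    Gam g x (EuclideanSpace.single i 1) (EuclideanSpace.single j 1)
      = ∑ k, christoffel g x k i j • EuclideanSpace.single k 1 := by
  unfold Gam
  refine Finset.sum_congr rfl fun k _ => ?_
  congr 1
  simp

/-- The covariant derivative `∇_v θ (w)`. -/
def nablaC₂ (g : Tensor2 M) (θ : CoField M) (x : M) (v w : E4) : ℝ :=
  fderiv ℝ (loc₁ θ x) (extChartAt (𝓡 4) x x) v w - at₁ θ x (Gam g x v w)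

/-- The covariant derivative `∇_u B (v, w)`. -/
def nablaT₂ (g : Tensor2 M) (B : Tensor2 M) (x : M) (u v w : E4) : ℝ :=
  fderiv ℝ (loc₂ B x) (extChartAt (𝓡 4) x x) u v w - at₂ B x (Gam g x u v) w
    - at₂ B x v (Gam g x u w)

lemma nabla₁_eq {g : Tensor2 M} {θ : CoField M} {x : M}
    (hθ : DifferentiableAt ℝ (loc₁ θ x) (extChartAt (𝓡 4) x x)) (i j : Fin 4) :
    nabla₁ g θ x i j
      = nablaC₂ g θ x (EuclideanSpace.single i 1) (EuclideanSpace.single j 1) := by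
  rw [nabla₁, nablaC₂, partialAt_comp₁ hθ, Gam_single]
  simp only [map_sum, map_smul, smul_eq_mul]
  rfl

lemma nabla₂_eq {g : Tensor2 M} {B : Tensor2 M} {x : M}
    (hB : DifferentiableAt ℝ (loc₂ B x) (extChartAt (𝓡 4) x x)) (k i j : Fin 4) :
    nabla₂ g B x k i j = nablaT₂ g B x (EuclideanSpace.single k 1) (EuclideanSpace.single i 1)
      (EuclideanSpace.single j 1) := by
  rw [nabla₂, nablaT₂, partialAt_comp₂ hB, Gam_single, Gam_single]
  simp only [map_sum, map_smul, sum_apply, smul_apply, smul_eq_mul]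
  rfl

lemma Gam_add_left (g : Tensor2 M) (x : M) (v v' w : E4) :
    Gam g x (v + v') w = Gam g x v w + Gam g x v' w := by
  simp only [Gam, PiLp.add_apply, mul_add, add_mul, Finset.sum_add_distrib, add_smul]

lemma Gam_add_right (g : Tensor2 M) (x : M) (v w w' : E4) :
    Gam g x v (w + w') = Gam g x v w + Gam g x v w' := by
  simp only [Gam, PiLp.add_apply, mul_add, Finset.sum_add_distrib, add_smul]

lemma Gam_smul_left (g : Tensor2 M) (x : M) (c : ℝ) (v w : E4) :
    Gam g x (c • v) w = c • Gam g x v w := by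
  simp only [Gam, PiLp.smul_apply, smul_eq_mul, Finset.smul_sum, smul_smul, Finset.mul_sum]
  refine Finset.sum_congr rfl fun k _ => ?_
  congr 1
  exact Finset.sum_congr rfl fun i _ => Finset.sum_congr rfl fun j _ => by ring

lemma Gam_smul_right (g : Tensor2 M) (x : M) (c : ℝ) (v w : E4) :
    Gam g x v (c • w) = c • Gam g x v w := by
  simp only [Gam, PiLp.smul_apply, smul_eq_mul, Finset.smul_sum, smul_smul, Finset.mul_sum]
  refine Finset.sum_congr rfl fun k _ => ?_
  congr 1
  exact Finset.sum_congr rfl fun i _ => Finset.sum_congr rfl fun j _ => by ring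

/-- A biadditive and bihomogeneous function is determined by its values on the standard basis. -/
lemma bilin_sum {f : E4 → E4 → ℝ} (h1 : ∀ v v' w, f (v + v') w = f v w + f v' w)
    (h2 : ∀ (c : ℝ) v w, f (c • v) w = c * f v w) (h3 : ∀ v w w', f v (w + w') = f v w + f v w')
    (h4 : ∀ (c : ℝ) v w, f v (c • w) = c * f v w) (v w : E4) :
    f v w = ∑ i, ∑ j, v i * w j * f (EuclideanSpace.single i 1) (EuclideanSpace.single j 1) := by
  let L : E4 →ₗ[ℝ] E4 →ₗ[ℝ] ℝ := LinearMap.mk₂ ℝ f h1 (fun c v w => by simp [h2]) h3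
    (fun c v w => by simp [h4])
  have : f v w = L v w := rfl
  rw [this]
  conv_lhs => rw [← sum_smul_single v, ← sum_smul_single w]
  simp only [map_sum, map_smul, LinearMap.sum_apply, LinearMap.smul_apply, smul_eq_mul,
    Finset.mul_sum]
  rw [Finset.sum_comm]
  refine Finset.sum_congr rfl fun i _ => Finset.sum_congr rfl fun j _ => ?_
  simp only [L, LinearMap.mk₂_apply]
  ring

lemma nablaC_eq {g : Tensor2 M} {θ : CoField M} {x : M}
    (hθ : DifferentiableAt ℝ (loc₁ θ x) (extChartAt (𝓡 4) x x)) (v : E4) :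
    nablaC g θ x v = nablaC₂ g θ x v v := by
  rw [bilin_sum (f := nablaC₂ g θ x)]
  · simp only [nablaC, nabla₁_eq hθ]
  · intro v v' w; simp only [nablaC₂, map_add, add_apply, Gam_add_left]; ring
  · intro v v' w; simp only [nablaC₂, map_smul, smul_apply, Gam_smul_left, smul_eq_mul]; ring
  · intro v v' w; simp only [nablaC₂, map_add, Gam_add_right]; ring
  · intro v v' w; simp only [nablaC₂, map_smul, Gam_smul_right, smul_eq_mul]; ring

lemma nablaT₂_add₁ (g B : Tensor2 M) (x : M) (u u' v w : E4) :
    nablaT₂ g B x (u + u') v w = nablaT₂ g B x u v w + nablaT₂ g B x u' v w := by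
  simp only [nablaT₂, map_add, add_apply, Gam_add_left]; ring

lemma nablaT₂_add₂ (g B : Tensor2 M) (x : M) (u v v' w : E4) :
    nablaT₂ g B x u (v + v') w = nablaT₂ g B x u v w + nablaT₂ g B x u v' w := by
  simp only [nablaT₂, map_add, add_apply, Gam_add_right]; ring

lemma nablaT₂_add₃ (g B : Tensor2 M) (x : M) (u v w w' : E4) :
    nablaT₂ g B x u v (w + w') = nablaT₂ g B x u v w + nablaT₂ g B x u v w' := by
  simp only [nablaT₂, map_add, Gam_add_right]; ring

lemma nablaT_eq {g : Tensor2 M} {B : Tensor2 M} {x : M}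
    (hB : DifferentiableAt ℝ (loc₂ B x) (extChartAt (𝓡 4) x x)) (v : E4) :
    nablaT g B x v = nablaT₂ g B x v v v := by
  have h1 : ∀ u, nablaT₂ g B x u v v = ∑ i, ∑ j, v i * v j *
      nablaT₂ g B x u (EuclideanSpace.single i 1) (EuclideanSpace.single j 1) := fun u =>
    bilin_sum (f := nablaT₂ g B x u) (nablaT₂_add₂ g B x u)
      (fun c v w => by simp only [nablaT₂, map_smul, smul_apply, Gam_smul_right, smul_eq_mul]; ring)
      (nablaT₂_add₃ g B x u)
      (fun c v w => by simp only [nablaT₂, map_smul, Gam_smul_right, smul_eq_mul]; ring) v v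
  have h2 : nablaT₂ g B x v v v = ∑ k, v k * nablaT₂ g B x (EuclideanSpace.single k 1) v v := by
    let L : E4 →ₗ[ℝ] ℝ := (IsLinearMap.mk (f := fun u => nablaT₂ g B x u v v)
      (fun u u' => nablaT₂_add₁ g B x u u' v v) (fun c u => by
        simp only [nablaT₂, map_smul, smul_apply, Gam_smul_left, smul_eq_mul]; ring)).mk' _
    change L v = ∑ k, v k * L (EuclideanSpace.single k 1)
    conv_lhs => rw [← sum_smul_single v]
    simp only [map_sum, map_smul, smul_eq_mul]
  rw [h2]
  simp only [h1, nablaT, nabla₂_eq hB, Finset.mul_sum]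
  exact Finset.sum_congr rfl fun k _ => Finset.sum_congr rfl fun i _ =>
    Finset.sum_congr rfl fun j _ => by ring

end

/-! ### Killing equations as polarised forms -/

section

/-- Polarisation of a cubic form. -/
lemma cyclic_eq_zero_of_cubic {E : Type*} [AddCommGroup E] {f : E → E → E → ℝ}
    (h1 : ∀ u u' v w, f (u + u') v w = f u v w + f u' v w)
    (h2 : ∀ u v v' w, f u (v + v') w = f u v w + f u v' w)
    (h3 : ∀ u v w w', f u v (w + w') = f u v w + f u v w')
    (hs : ∀ u v w, f u v w = f u w v) (h0 : ∀ v, f v v v = 0) (u v w : E) :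
    f u v w + f v w u + f w u v = 0 := by
  -- Inclusion-exclusion over these sums isolates the full symmetrisation of `f`; symmetry in the
  -- last two slots makes it twice the cyclic sum.
  have a1 := h0 (u + v + w)
  have a2 := h0 (u + v)
  have a3 := h0 (u + w)
  have a4 := h0 (v + w)
  simp only [h1, h2, h3, h0] at a1 a2 a3 a4
  have b1 := hs u v w
  have b2 := hs v u w
  have b3 := hs w u v
  linarith

/-- A tensor field is symmetric. -/
def IsSymmT (B : Tensor2 M) : Prop := ∀ x (v w : E4), at₂ B x v w = at₂ B x w v

/-- A covector field has differentiable components. -/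
def DiffC (θ : CoField M) : Prop :=
  ∀ x, DifferentiableAt ℝ (loc₁ θ x) (extChartAt (𝓡 4) x x)

/-- A tensor field has differentiable components. -/
def DiffT (B : Tensor2 M) : Prop :=
  ∀ x, DifferentiableAt ℝ (loc₂ B x) (extChartAt (𝓡 4) x x)

lemma loc₂_symm {B : Tensor2 M} (hs : IsSymmT B) (x : M) (y v w : E4) :
    loc₂ B x y v w = loc₂ B x y w v := hs _ _ _

lemma fderiv_loc₂_apply {B : Tensor2 M} (hB : DiffT B) (x : M) (u v w : E4) :
    fderiv ℝ (loc₂ B x) (extChartAt (𝓡 4) x x) u v w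
      = fderiv ℝ (fun y => loc₂ B x y v w) (extChartAt (𝓡 4) x x) u := by
  have h := ((hB x).hasFDerivAt.clm_apply
    (hasFDerivAt_const v (extChartAt (𝓡 4) x x))).clm_apply
      (hasFDerivAt_const w (extChartAt (𝓡 4) x x))
  rw [h.fderiv]
  simp

lemma fderiv_loc₂_symm {B : Tensor2 M} (hB : DiffT B) (hs : IsSymmT B) (x : M) (u v w : E4) :
    fderiv ℝ (loc₂ B x) (extChartAt (𝓡 4) x x) u v w
      = fderiv ℝ (loc₂ B x) (extChartAt (𝓡 4) x x) u w v := by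
  rw [fderiv_loc₂_apply hB, fderiv_loc₂_apply hB]
  simp only [loc₂_symm hs x _ v w]

lemma nablaT₂_symm {g B : Tensor2 M} (hB : DiffT B) (hs : IsSymmT B) (x : M) (u v w : E4) :
    nablaT₂ g B x u v w = nablaT₂ g B x u w v := by
  simp only [nablaT₂, fderiv_loc₂_symm hB hs x u v w, hs x _ w, hs x v _]
  ring

/-- The cyclic index equation is the polarisation of the cubic form `∇_v K(v,v) - θ(v) g(v,v)`.
Every Killing tensor equation can therefore be tested on a single vector. -/
lemma cyclic_iff_cubic {g K : Tensor2 M} (hK : DiffT K) (hs : IsSymmT K) (hg : IsSymmT g)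
    (x : M) (θ : E4 →L[ℝ] ℝ) :
    (∀ i j k, nabla₂ g K x i j k + nabla₂ g K x j k i + nabla₂ g K x k i j =
      θ (EuclideanSpace.single i 1) * g x (frame x j) (frame x k)
        + θ (EuclideanSpace.single j 1) * g x (frame x k) (frame x i)
        + θ (EuclideanSpace.single k 1) * g x (frame x i) (frame x j)) ↔
    ∀ v, nablaT g K x v = θ v * at₂ g x v v := by
  constructor
  · intro h v
    -- The weight `v i * v j * v k` is invariant under cyclic relabelling, so the three cyclic sums
    -- agree and each is a third of zero.
    have rot : ∀ a : Fin 4 → Fin 4 → Fin 4 → ℝ,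
        ∑ i, ∑ j, ∑ k, a j k i = ∑ i, ∑ j, ∑ k, a i j k := by
      intro a
      rw [Finset.sum_comm]
      exact Finset.sum_congr rfl fun j _ => Finset.sum_comm
    have h1 : θ v * at₂ g x v v = ∑ i, ∑ j, ∑ k, v i * v j * v k *
        (θ (EuclideanSpace.single i 1) * g x (frame x j) (frame x k)) := by
      have hθ : θ v = ∑ i, v i * θ (EuclideanSpace.single i 1) := by
        conv_lhs => rw [← sum_smul_single v]
        simp only [map_sum, map_smul, smul_eq_mul]
      rw [← clm₂_sum_sum (at₂ g x) v v, hθ, Finset.sum_mul]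
      refine Finset.sum_congr rfl fun i _ => ?_
      simp only [Finset.mul_sum]
      refine Finset.sum_congr rfl fun j _ => Finset.sum_congr rfl fun k _ => ?_
      change _ = v i * v j * v k * (θ (EuclideanSpace.single i 1) *
        at₂ g x (EuclideanSpace.single j 1) (EuclideanSpace.single k 1))
      ring
    let c : Fin 4 → Fin 4 → Fin 4 → ℝ := fun i j k => v i * v j * v k * (nabla₂ g K x i j k -
      θ (EuclideanSpace.single i 1) * g x (frame x j) (frame x k))
    have h2 : nablaT g K x v - θ v * at₂ g x v v = ∑ i, ∑ j, ∑ k, c i j k := by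
      simp only [h1, nablaT, c, mul_sub, Finset.sum_sub_distrib]
    have h3 : ∑ i, ∑ j, ∑ k, (c i j k + c j k i + c k i j) = 0 := by
      refine Finset.sum_eq_zero fun i _ => Finset.sum_eq_zero fun j _ =>
        Finset.sum_eq_zero fun k _ => ?_
      linear_combination v i * v j * v k * h i j k
    simp only [Finset.sum_add_distrib] at h3
    rw [rot c, rot fun i j k => c k i j, rot fun i j k => c j k i, rot c] at h3
    linarith
  · intro h i j k
    have := cyclic_eq_zero_of_cubic (E := E4)
      (f := fun u v w => nablaT₂ g K x u v w - θ u * at₂ g x v w)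
      (fun u u' v w => by simp only [nablaT₂_add₁, map_add]; ring)
      (fun u v v' w => by simp only [nablaT₂_add₂, map_add, add_apply]; ring)
      (fun u v w w' => by simp only [nablaT₂_add₃, map_add]; ring)
      (fun u v w => by simp only [nablaT₂_symm hK hs x u v w, hg x v w])
      (fun v => by rw [← nablaT_eq (hK x), h v, sub_self])
      (EuclideanSpace.single i 1) (EuclideanSpace.single j 1) (EuclideanSpace.single k 1)
    simp only [nabla₂_eq (hK x)]
    change _ = θ (EuclideanSpace.single i 1) * at₂ g x (EuclideanSpace.single j 1) (EuclideanSpace.single k 1)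
        + θ (EuclideanSpace.single j 1) * at₂ g x (EuclideanSpace.single k 1) (EuclideanSpace.single i 1)
        + θ (EuclideanSpace.single k 1) * at₂ g x (EuclideanSpace.single i 1) (EuclideanSpace.single j 1)
    linarith

lemma isConformalKillingTensor_iff {g K : Tensor2 M} (hK : DiffT K) (hs : IsSymmT K)
    (hg : IsSymmT g) :
    IsConformalKillingTensor g K ↔
      ∃ θ : M → E4 →L[ℝ] ℝ, ∀ x v, nablaT g K x v = θ x v * at₂ g x v v := by
  constructor
  · rintro ⟨θ, h⟩
    exact ⟨at₁ θ, fun x => (cyclic_iff_cubic hK hs hg x (at₁ θ x)).1 (h x)⟩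
  · rintro ⟨θ, h⟩
    exact ⟨θ, fun x => (cyclic_iff_cubic hK hs hg x (θ x)).2 (h x)⟩

lemma isKillingTensor_iff {g K : Tensor2 M} (hK : DiffT K) (hs : IsSymmT K)
    (hg : IsSymmT g) :
    IsKillingTensor g K ↔ ∀ x v, nablaT g K x v = 0 := by
  have := fun x => cyclic_iff_cubic hK hs hg x 0
  simp only [zero_apply, zero_mul, add_zero] at this
  exact forall_congr' this

/-- The symmetric part of `∇X` is determined by its quadratic form. -/
lemma isKillingVector_iff [IsManifold (𝓡 4) ∞ M] {g : Tensor2 M} {X : VField M}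
    (hX : SmoothVField X) (hd : DiffC (flat g X)) :
    IsKillingVector g X ↔ ∀ x v, nablaC g (flat g X) x v = 0 := by
  constructor
  · rintro ⟨-, h⟩ x v
    have h1 : nablaC g (flat g X) x v = ∑ i, ∑ j, v i * v j * nabla₁ g (flat g X) x j i := by
      unfold nablaC
      rw [Finset.sum_comm]
      exact Finset.sum_congr rfl fun i _ => Finset.sum_congr rfl fun j _ => by ring
    have h2 : nablaC g (flat g X) x v + nablaC g (flat g X) x v = 0 := by
      conv_lhs => rw [h1]
      rw [← h1]
      nth_rewrite 2 [h1]
      simp only [nablaC, ← Finset.sum_add_distrib, ← mul_add, h, mul_zero, Finset.sum_const_zero]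
    linarith
  · intro h
    refine ⟨hX, fun x i j => ?_⟩
    rw [nabla₁_eq (hd x), nabla₁_eq (hd x)]
    have h1 := h x (EuclideanSpace.single i 1 + EuclideanSpace.single j 1)
    have h2 := h x (EuclideanSpace.single i 1)
    have h3 := h x (EuclideanSpace.single j 1)
    rw [nablaC_eq (hd x)] at h1 h2 h3
    simp only [nablaC₂, map_add, add_apply, Gam_add_left, Gam_add_right] at h1 h2 h3 ⊢
    linarith

end

/-! ### Smoothness of the gradient, the lapse and the unit normal -/

section

/-- A covector field has smooth components. -/
def SmoothC (θ : CoField M) : Prop :=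
  ∀ x, ContDiffOn ℝ ∞ (loc₁ θ x) (extChartAt (𝓡 4) x).target

/-- A tensor field has smooth components. -/
def SmoothT (B : Tensor2 M) : Prop :=
  ∀ x, ContDiffOn ℝ ∞ (loc₂ B x) (extChartAt (𝓡 4) x).target

lemma SmoothC.diffC {θ : CoField M} (h : SmoothC θ) : DiffC θ := fun x =>
  ((h x).contDiffAt (target_mem_nhds x (mem_extChartAt_target x))).differentiableAt (by simp)

lemma SmoothT.diffT {B : Tensor2 M} (h : SmoothT B) : DiffT B := fun x =>
  ((h x).contDiffAt (target_mem_nhds x (mem_extChartAt_target x))).differentiableAt (by simp)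

lemma clm_apply_contDiffOn {E : Type*} [NormedAddCommGroup E] [NormedSpace ℝ E] {n : WithTop ℕ∞}
    {s : Set E} {G : E → E →L[ℝ] E →L[ℝ] ℝ} {P : E → E} (hG : ContDiffOn ℝ n G s)
    (hP : ContDiffOn ℝ n P s) : ContDiffOn ℝ n (fun y => G y (P y)) s := hG.clm_apply hP

lemma IsLorentzForm.exists_equiv {G : E4 →L[ℝ] E4 →L[ℝ] ℝ} (hG : IsLorentzForm G) :
    ∃ e : E4 ≃L[ℝ] (E4 →L[ℝ] ℝ), (e : E4 →L[ℝ] E4 →L[ℝ] ℝ) = G := by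
  refine ⟨ContinuousLinearEquiv.ofBijective G ?_ ?_, by ext; rfl⟩
  · rw [LinearMap.ker_eq_bot']
    intro v hv
    exact hG.nondegenerate fun w => by
      change (G v) w = 0
      rw [show G v = 0 from hv]; rfl
  · rw [LinearMap.range_eq_top]
    intro θ
    exact ⟨_, hG.apply_sharp θ⟩

/-- Inversion of operators is smooth near an invertible one, so the solution of a linear equation
with smooth data is smooth. The gradient is obtained in this way from `g(grad Ω, ·) = dΩ`. -/
lemma contDiffAt_of_apply_eq {E F : Type*} [NormedAddCommGroup E] [NormedSpace ℝ E]
    [CompleteSpace E]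
    [NormedAddCommGroup F] [NormedSpace ℝ F] {n : WithTop ℕ∞} {G : E → E →L[ℝ] F}
    {θ : E → F} {P : E → E} {y₀ : E} (hG : ContDiffAt ℝ n G y₀) (hθ : ContDiffAt ℝ n θ y₀)
    (e : E ≃L[ℝ] F) (he : (e : E →L[ℝ] F) = G y₀) (hP : ∀ᶠ y in 𝓝 y₀, G y (P y) = θ y) :
    ContDiffAt ℝ n P y₀ := by
  have h1 : ContDiffAt ℝ n (fun y => (G y).inverse) y₀ := by
    have h2 : ContDiffAt ℝ n (ContinuousLinearMap.inverse : (E →L[ℝ] F) → F →L[ℝ] E) (G y₀) := by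
      rw [← he]
      exact contDiffAt_map_inverse e
    exact h2.comp y₀ hG
  refine (h1.clm_apply hθ).congr_of_eventuallyEq ?_
  have h2 := hG.continuousAt.eventually (he ▸ ContinuousLinearEquiv.nhds e)
  filter_upwards [hP, h2] with y hy ⟨e', he'⟩
  rw [← hy, ← he', ContinuousLinearMap.inverse_equiv]
  simp

lemma smoothC_dF [IsManifold (𝓡 4) ∞ M] {f : M → ℝ} (hf : SmoothFun f) : SmoothC (dF f) := by
  intro x
  have h : ContDiffOn ℝ ∞ (fderiv ℝ (locF f x)) (extChartAt (𝓡 4) x).target :=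
    ContDiffOn.fderiv_of_isOpen (m := ∞) (contDiffOn_locF hf x) (isOpen_extChartAt_target x)
      (by simp)
  exact h.congr fun y hy => loc₁_dF hf x hy

section
variable [IsManifold (𝓡 4) ∞ M] {g : Tensor2 M} {Ω : M → ℝ}

lemma IsLorentzMetric.smoothT (hg : IsLorentzMetric g) : SmoothT g := contDiffOn_loc₂ hg

lemma IsLorentzMetric.isSymmT (hg : IsLorentzMetric g) : IsSymmT g := hg.symm

lemma apply_grad (hg : IsLorentzMetric g) (Ω : M → ℝ) (x : M) :
    at₂ g x (atV (grad g Ω) x) = at₁ (dF Ω) x :=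
  (hg.form x).apply_sharp (at₁ (dF Ω) x)

lemma loc₁_flat (g : Tensor2 M) (X : VField M) (x : M) {y : E4}
    (hy : y ∈ (extChartAt (𝓡 4) x).target) :
    loc₁ (flat g X) x y = loc₂ g x y (locV X x y) := by
  ext u
  rw [loc₁_apply, loc₂_apply, coordMap_locV X x hy]
  rfl

lemma loc₂_grad (hg : IsLorentzMetric g) (hΩ : SmoothFun Ω) (x : M) {y : E4}
    (hy : y ∈ (extChartAt (𝓡 4) x).target) :
    loc₂ g x y (locV (grad g Ω) x y) = fderiv ℝ (locF Ω x) y := by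
  rw [← loc₁_flat g _ x hy, ← loc₁_dF hΩ x hy]
  ext u
  exact congrArg (fun L => L (coordMap x y u))
    (apply_grad hg Ω ((extChartAt (𝓡 4) x).symm y))

lemma contDiffAt_grad (hg : IsLorentzMetric g) (hΩ : SmoothFun Ω) (x : M) :
    ContDiffAt ℝ ∞ (locV (grad g Ω) x) (extChartAt (𝓡 4) x x) := by
  obtain ⟨e, he⟩ := (hg.form x).exists_equiv
  have hT := target_mem_nhds x (mem_extChartAt_target x)
  refine contDiffAt_of_apply_eq (G := loc₂ g x) (θ := loc₁ (dF Ω) x)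
    ((hg.smoothT x).contDiffAt hT) ((smoothC_dF hΩ x).contDiffAt hT) e ?_ ?_
  · rw [loc₂_self]; exact he
  · filter_upwards [hT] with y hy
    rw [loc₂_grad hg hΩ x hy, loc₁_dF hΩ x hy]

lemma smoothC_flat (hg : IsLorentzMetric g) {X : VField M} (hX : SmoothVField X) :
    SmoothC (flat g X) := fun x =>
  (clm_apply_contDiffOn (hg.smoothT x) (contDiffOn_locV hX x)).congr
    fun _ hy => loc₁_flat g X x hy

lemma SmoothFun.of_contDiffAt {f : M → ℝ}
    (h : ∀ x, ContDiffAt ℝ ∞ (locF f x) (extChartAt (𝓡 4) x x)) : SmoothFun f :=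
  fun x => contMDiffAt_of_locF (h x)

lemma SmoothFun.contDiffAt {f : M → ℝ} (hf : SmoothFun f) (x : M) :
    ContDiffAt ℝ ∞ (locF f x) (extChartAt (𝓡 4) x x) :=
  contDiffAt_locF hf x (mem_extChartAt_target x)

lemma locF_dirDeriv {f : M → ℝ} (hf : SmoothFun f) (X : VField M) (x : M) {y : E4}
    (hy : y ∈ (extChartAt (𝓡 4) x).target) :
    locF (fun z => dirDeriv f z (X z)) x y = fderiv ℝ (locF f x) y (locV X x y) := by
  rw [← dirDeriv_coordMap hf x hy, coordMap_locV X x hy]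
  rfl

lemma SmoothFun.dirDeriv_grad {f : M → ℝ} (hg : IsLorentzMetric g) (hΩ : SmoothFun Ω)
    (hf : SmoothFun f) : SmoothFun fun z => dirDeriv f z (grad g Ω z) := by
  refine SmoothFun.of_contDiffAt fun x => ?_
  have h1 : ContDiffAt ℝ ∞ (fderiv ℝ (locF f x)) (extChartAt (𝓡 4) x x) :=
    (hf.contDiffAt x).fderiv_right (by simp)
  refine (h1.clm_apply (contDiffAt_grad hg hΩ x)).congr_of_eventuallyEq ?_
  filter_upwards [target_mem_nhds x (mem_extChartAt_target x)] with y hy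
  exact locF_dirDeriv hf _ x hy

/-- The squared norm of the gradient. -/
lemma IsTimelikeFoliation.pos (hg : IsLorentzMetric g) (hΩ : IsTimelikeFoliation g Ω) (x : M) :
    0 < dirDeriv Ω x (grad g Ω x) := by
  have h := hΩ.spacelike_grad x
  have h2 : g x (grad g Ω x) (grad g Ω x) = dirDeriv Ω x (grad g Ω x) :=
    congrArg (fun L => L (grad g Ω x)) (apply_grad hg Ω x)
  rwa [h2] at h

lemma lapse_pos (hg : IsLorentzMetric g) (hΩ : IsTimelikeFoliation g Ω) (x : M) :
    0 < lapse g Ω x := one_div_pos.2 (Real.sqrt_pos.2 (hΩ.pos hg x))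

lemma lapse_sq (hg : IsLorentzMetric g) (hΩ : IsTimelikeFoliation g Ω) (x : M) :
    (lapse g Ω x) ^ 2 * dirDeriv Ω x (grad g Ω x) = 1 := by
  have h := hΩ.pos hg x
  rw [lapse, div_pow, Real.sq_sqrt h.le]
  field_simp

lemma smooth_lapse (hg : IsLorentzMetric g) (hΩ : IsTimelikeFoliation g Ω) :
    SmoothFun (lapse g Ω) := by
  refine SmoothFun.of_contDiffAt fun x => ?_
  have h1 := (SmoothFun.dirDeriv_grad hg hΩ.smooth hΩ.smooth).contDiffAt x
  have h2 : 0 < locF (fun z => dirDeriv Ω z (grad g Ω z)) x (extChartAt (𝓡 4) x x) := by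
    rw [locF_self]
    exact hΩ.pos hg x
  exact contDiffAt_const.div (h1.sqrt h2.ne') (Real.sqrt_pos.2 h2).ne'

lemma SmoothFun.mul {f h : M → ℝ} (hf : SmoothFun f) (hh : SmoothFun h) :
    SmoothFun fun x => f x * h x := ContMDiff.mul hf hh

lemma SmoothFun.add {f h : M → ℝ} (hf : SmoothFun f) (hh : SmoothFun h) :
    SmoothFun fun x => f x + h x := ContMDiff.add hf hh

lemma SmoothFun.comp {f : M → ℝ} (hf : SmoothFun f) {F : ℝ → ℝ} (hF : ∀ x, ContDiffAt ℝ ∞ F (f x)) :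
    SmoothFun fun x => F (f x) :=
  fun x => (contMDiffAt_iff_contDiffAt.2 (hF x)).comp x (hf x)

lemma SmoothFun.const (c : ℝ) : SmoothFun fun _ : M => c := contMDiff_const

lemma SmoothFun.pow {f : M → ℝ} (hf : SmoothFun f) (n : ℕ) : SmoothFun fun x => f x ^ n :=
  hf.comp fun _ => (contDiff_id.pow n).contDiffAt

lemma SmoothFun.exp {f : M → ℝ} (hf : SmoothFun f) : SmoothFun fun x => Real.exp (f x) :=
  hf.comp fun _ => Real.contDiff_exp.contDiffAt

lemma dirDeriv_smul (f : M → ℝ) (x : M) (c : ℝ) (v : TangentSpace (𝓡 4) x) :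
    dirDeriv f x (c • v) = c * dirDeriv f x v := by
  simp [dirDeriv]

lemma prime_eq (g : Tensor2 M) (Ω f : M → ℝ) (x : M) :
    prime g Ω f x = (lapse g Ω x) ^ 2 * dirDeriv f x (grad g Ω x) := by
  rw [prime, normal, dirDeriv_smul]
  ring

lemma SmoothFun.prime {f : M → ℝ} (hg : IsLorentzMetric g) (hΩ : IsTimelikeFoliation g Ω)
    (hf : SmoothFun f) : SmoothFun (prime g Ω f) := by
  have : Spacetime.prime g Ω f = fun x => (lapse g Ω x) ^ 2 * dirDeriv f x (grad g Ω x) :=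
    funext fun x => prime_eq g Ω f x
  rw [this]
  exact ((smooth_lapse hg hΩ).pow 2).mul (SmoothFun.dirDeriv_grad hg hΩ.smooth hf)

/-- The index-free unit conormal `φ dΩ`. -/
lemma apply_normal (hg : IsLorentzMetric g) (Ω : M → ℝ) (x : M) (v : E4) :
    at₂ g x (atV (normal g Ω) x) v = lapse g Ω x * at₁ (dF Ω) x v := by
  have h : atV (normal g Ω) x = lapse g Ω x • atV (grad g Ω) x := rfl
  rw [h, map_smul, smul_apply, apply_grad hg, smul_eq_mul]

lemma loc₁_normal (hg : IsLorentzMetric g) (hΩ : SmoothFun Ω) (x : M) {y : E4}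
    (hy : y ∈ (extChartAt (𝓡 4) x).target) :
    loc₁ (flat g (normal g Ω)) x y = locF (lapse g Ω) x y • fderiv ℝ (locF Ω x) y := by
  rw [← loc₁_dF hΩ x hy]
  ext u
  exact apply_normal hg Ω _ _

lemma smoothC_normal (hg : IsLorentzMetric g) (hΩ : IsTimelikeFoliation g Ω) :
    SmoothC (flat g (normal g Ω)) := fun x =>
  ((contDiffOn_locF (smooth_lapse hg hΩ) x).smul (smoothC_dF hΩ.smooth x)).congr fun y hy => by
    rw [loc₁_normal hg hΩ.smooth x hy, Pi.smul_apply', loc₁_dF hΩ.smooth x hy]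

lemma normal_normal (hg : IsLorentzMetric g) (hΩ : IsTimelikeFoliation g Ω) (x : M) :
    at₂ g x (atV (normal g Ω) x) (atV (normal g Ω) x) = 1 := by
  have h := lapse_sq hg hΩ x
  rw [apply_normal hg]
  have : at₁ (dF Ω) x (atV (normal g Ω) x) = lapse g Ω x * dirDeriv Ω x (grad g Ω x) :=
    dirDeriv_smul Ω x _ _
  rw [this, ← h]
  ring

end

end

/-! ### The covariant derivative of a slice tensor -/

section

variable [IsManifold (𝓡 4) ∞ M] {g : Tensor2 M} {Ω : M → ℝ}

/-- The differential of a function at `x`, as a linear form on `E4`. -/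
def dd (f : M → ℝ) (x : M) : E4 →L[ℝ] ℝ := at₁ (dF f) x

lemma dd_eq {f : M → ℝ} (hf : SmoothFun f) (x : M) :
    dd f x = fderiv ℝ (locF f x) (extChartAt (𝓡 4) x x) := by
  rw [← loc₁_dF hf x (mem_extChartAt_target x), loc₁_self]
  rfl

lemma hasFDerivAt_locF {f : M → ℝ} (hf : SmoothFun f) (x : M) :
    HasFDerivAt (locF f x) (dd f x) (extChartAt (𝓡 4) x x) := by
  rw [dd_eq hf]
  exact ((hf.contDiffAt x).differentiableAt (by simp)).hasFDerivAt

lemma dd_eq_of_hasFDerivAt {f : M → ℝ} (hf : SmoothFun f) {x : M} {L : E4 →L[ℝ] ℝ}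
    (h : HasFDerivAt (locF f x) L (extChartAt (𝓡 4) x x)) : dd f x = L := by
  rw [dd_eq hf, h.fderiv]

/-- The unit normal at `x`, as an element of `E4`. -/
def nv (g : Tensor2 M) (Ω : M → ℝ) (x : M) : E4 := atV (normal g Ω) x

/-- The unit conormal at `x`, as a linear form on `E4`. -/
def nf (g : Tensor2 M) (Ω : M → ℝ) (x : M) : E4 →L[ℝ] ℝ := at₂ g x (nv g Ω x)

/-- The quadratic form `∇_v n (v)`. -/
def Qn (g : Tensor2 M) (Ω : M → ℝ) (x : M) (v : E4) : ℝ := nablaC g (flat g (normal g Ω)) x v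

lemma nf_eq (hg : IsLorentzMetric g) (Ω : M → ℝ) (x : M) (v : E4) :
    nf g Ω x v = lapse g Ω x * dd Ω x v := apply_normal hg Ω x v

lemma nf_nv (hg : IsLorentzMetric g) (hΩ : IsTimelikeFoliation g Ω) (x : M) :
    nf g Ω x (nv g Ω x) = 1 := normal_normal hg hΩ x

lemma hasFDerivAt_loc₂ {B : Tensor2 M} (hB : DiffT B) (x : M) (v w : E4) :
    HasFDerivAt (fun y => loc₂ B x y v w)
      (fderiv ℝ (fun y => loc₂ B x y v w) (extChartAt (𝓡 4) x x)) (extChartAt (𝓡 4) x x) :=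
  (((hB x).clm_apply (differentiableAt_const v)).clm_apply
    (differentiableAt_const w)).hasFDerivAt

lemma fderiv_loc₁_apply {θ : CoField M} (hθ : DiffC θ) (x : M) (u v : E4) :
    fderiv ℝ (loc₁ θ x) (extChartAt (𝓡 4) x x) u v
      = fderiv ℝ (fun y => loc₁ θ x y v) (extChartAt (𝓡 4) x x) u := by
  rw [((hθ x).hasFDerivAt.clm_apply (hasFDerivAt_const v (extChartAt (𝓡 4) x x))).fderiv]
  simp

lemma hasFDerivAt_loc₁ {θ : CoField M} (hθ : DiffC θ) (x : M) (v : E4) :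
    HasFDerivAt (fun y => loc₁ θ x y v)
      (fderiv ℝ (fun y => loc₁ θ x y v) (extChartAt (𝓡 4) x x)) (extChartAt (𝓡 4) x x) :=
  ((hθ x).clm_apply (differentiableAt_const v)).hasFDerivAt

lemma dG_apply (hg : IsLorentzMetric g) (x : M) (u v w : E4) :
    dG g x u v w = fderiv ℝ (fun y => loc₂ g x y v w) (extChartAt (𝓡 4) x x) u :=
  fderiv_loc₂_apply hg.smoothT.diffT x u v w

lemma dG_symm (hg : IsLorentzMetric g) (x : M) (u v w : E4) : dG g x u v w = dG g x u w v :=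
  fderiv_loc₂_symm hg.smoothT.diffT hg.isSymmT x u v w

lemma apply_Gam_self (hg : IsLorentzMetric g) (x : M) (v w : E4) :
    at₂ g x (Gam g x v v) w = dG g x v v w - 1 / 2 * dG g x w v v := by
  rw [apply_Gam hg, Gam₁]
  ring

lemma loc₁_self' (θ : CoField M) (x : M) : loc₁ θ x (extChartAt (𝓡 4) x x) = at₁ θ x :=
  loc₁_self θ x

lemma loc₂_self' (B : Tensor2 M) (x : M) : loc₂ B x (extChartAt (𝓡 4) x x) = at₂ B x :=
  loc₂_self B x

lemma locV_self' (X : VField M) (x : M) : locV X x (extChartAt (𝓡 4) x x) = atV X x :=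
  locV_self X x

section slice
variable (κ : Fin 2 → VField M) (α : M → ℝ) (γ : M → Matrix (Fin 2) (Fin 2) ℝ) (Ψ : M → ℝ)

lemma sliceTensor_apply (x : M) (v w : TangentSpace (𝓡 4) x) :
    sliceTensor g Ω κ α γ Ψ x v w = α x * g x v w
      + (∑ a, ∑ b, γ x a b * (flat g (κ a) x v * flat g (κ b) x w))
      + Real.exp (Ψ x) * (flat g (normal g Ω) x v * flat g (normal g Ω) x w) := by
  simp only [sliceTensor, add_apply, smul_apply, sum_apply,
    ContinuousLinearMap.smulRight_apply, smul_eq_mul]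

lemma at₂_sliceTensor (x : M) (v w : E4) :
    at₂ (sliceTensor g Ω κ α γ Ψ) x v w = α x * at₂ g x v w
      + (∑ a, ∑ b, γ x a b * (at₁ (flat g (κ a)) x v * at₁ (flat g (κ b)) x w))
      + Real.exp (Ψ x) * (nf g Ω x v * nf g Ω x w) := sliceTensor_apply κ α γ Ψ x v w

lemma loc₂_sliceTensor (x : M) (y v w : E4) :
    loc₂ (sliceTensor g Ω κ α γ Ψ) x y v w = locF α x y * loc₂ g x y v w
      + (∑ a, ∑ b, locF (fun z => γ z a b) x y *
        (loc₁ (flat g (κ a)) x y v * loc₁ (flat g (κ b)) x y w))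
      + Real.exp (locF Ψ x y) * (loc₁ (flat g (normal g Ω)) x y v *
        loc₁ (flat g (normal g Ω)) x y w) := by
  have h := at₂_sliceTensor (g := g) (Ω := Ω) κ α γ Ψ ((extChartAt (𝓡 4) x).symm y)
    (coordMap x y v) (coordMap x y w)
  have h1 : ∀ (B : Tensor2 M) (v w : E4), loc₂ B x y v w
    = at₂ B ((extChartAt (𝓡 4) x).symm y) (coordMap x y v) (coordMap x y w) := fun _ _ _ => rfl
  have h2 : ∀ (θ : CoField M) (v : E4), loc₁ θ x y v
    = at₁ θ ((extChartAt (𝓡 4) x).symm y) (coordMap x y v) := fun _ _ => rfl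
  have h3 : ∀ f : M → ℝ, locF f x y = f ((extChartAt (𝓡 4) x).symm y) := fun _ => rfl
  have h4 : ∀ z, at₁ (flat g (normal g Ω)) z = nf g Ω z := fun _ => rfl
  simp only [h1, h2, h3, h4]
  exact h

variable {κ α γ Ψ}

lemma smoothT_sliceTensor (hg : IsLorentzMetric g) (hΩ : IsTimelikeFoliation g Ω)
    (hκ : ∀ a, SmoothVField (κ a)) (hα : SmoothFun α) (hγ : ∀ a b, SmoothFun fun x => γ x a b)
    (hΨ : SmoothFun Ψ) : SmoothT (sliceTensor g Ω κ α γ Ψ) := by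
  intro x
  rw [contDiffOn_clm_apply]
  intro v
  rw [contDiffOn_clm_apply]
  intro w
  simp only [loc₂_sliceTensor]
  have hn := smoothC_normal hg hΩ x
  have hk := fun a => smoothC_flat hg (hκ a) x
  refine ((((contDiffOn_locF hα x)).mul (((hg.smoothT x).clm_apply contDiffOn_const).clm_apply
    contDiffOn_const)).add (ContDiffOn.sum fun a _ => ContDiffOn.sum fun b _ =>
      (contDiffOn_locF (hγ a b) x).mul (((hk a).clm_apply contDiffOn_const).mul
        ((hk b).clm_apply contDiffOn_const)))).add
    ((contDiffOn_locF hΨ x).exp.mul ((hn.clm_apply contDiffOn_const).mul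
      (hn.clm_apply contDiffOn_const)))

lemma isSymmT_sliceTensor (hg : IsLorentzMetric g) (hγ : ∀ x, (γ x).IsSymm) :
    IsSymmT (sliceTensor g Ω κ α γ Ψ) := by
  intro x v w
  rw [at₂_sliceTensor, at₂_sliceTensor, hg.isSymmT x v w]
  have h := (hγ x).apply 0 1
  simp only [Fin.sum_univ_two, h]
  ring

lemma nablaC_eq' {θ : CoField M} (hθ : DiffC θ) (x : M) (v : E4) :
    nablaC g θ x v = fderiv ℝ (fun y => loc₁ θ x y v) (extChartAt (𝓡 4) x x) v
      - at₁ θ x (Gam g x v v) := by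
  rw [nablaC_eq (hθ x), nablaC₂, fderiv_loc₁_apply hθ]

/-- This is the Leibniz rule. The term `α g` leaves only `dα`: by `apply_Gam_self`, the two
Christoffel terms cancel the derivative of `g(v,v)`, which is `∇g = 0` on the diagonal. -/
lemma nablaT_sliceTensor (hg : IsLorentzMetric g) (hΩ : IsTimelikeFoliation g Ω)
    (hκ : ∀ a, SmoothVField (κ a)) (hα : SmoothFun α) (hγ : ∀ a b, SmoothFun fun x => γ x a b)
    (hΨ : SmoothFun Ψ) (x : M) (v : E4) :
    nablaT g (sliceTensor g Ω κ α γ Ψ) x v = dd α x v * at₂ g x v v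
      + (∑ a, ∑ b, (dd (fun z => γ z a b) x v * (at₁ (flat g (κ a)) x v * at₁ (flat g (κ b)) x v)
        + γ x a b * (nablaC g (flat g (κ a)) x v * at₁ (flat g (κ b)) x v
          + at₁ (flat g (κ a)) x v * nablaC g (flat g (κ b)) x v)))
      + Real.exp (Ψ x) * (dd Ψ x v * nf g Ω x v ^ 2 + 2 * Qn g Ω x v * nf g Ω x v) := by
  have hK := (smoothT_sliceTensor (g := g) (Ω := Ω) hg hΩ hκ hα hγ hΨ).diffT
  have hk : ∀ a, DiffC (flat g (κ a)) := fun a => (smoothC_flat hg (hκ a)).diffC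
  have hn := (smoothC_normal hg hΩ).diffC
  rw [nablaT_eq (hK x), nablaT₂, fderiv_loc₂_apply hK]
  have h0 := hasFDerivAt_loc₂ hg.smoothT.diffT x v v
  have h1 := fun a => hasFDerivAt_loc₁ (hk a) x v
  have h2 := hasFDerivAt_loc₁ hn x v
  have H := (((hasFDerivAt_locF hα x).mul h0).add (HasFDerivAt.fun_sum (u := Finset.univ)
    fun a _ => HasFDerivAt.fun_sum (u := Finset.univ) fun b _ =>
      (hasFDerivAt_locF (hγ a b) x).mul ((h1 a).mul (h1 b)))).add
        ((hasFDerivAt_locF hΨ x).exp.mul (h2.mul h2))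
  have H2 := H.fderiv
  have e : (fun y => loc₂ (sliceTensor g Ω κ α γ Ψ) x y v v) = _ :=
    funext fun y => loc₂_sliceTensor κ α γ Ψ x y v v
  rw [e]
  refine (congrArg (fun t => t - _ - _) (congrArg (fun L => L v) H2)).trans ?_
  rw [at₂_sliceTensor, at₂_sliceTensor, hg.isSymmT x v (Gam g x v v), apply_Gam_self hg, dG_apply hg]
  simp only [Qn, nablaC_eq' (hk _), nablaC_eq' hn, loc₁_self', loc₂_self', locF_self,
    add_apply, smul_apply, smul_eq_mul, Fin.sum_univ_two, Pi.mul_apply]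
  have hN : at₁ (flat g (normal g Ω)) x = nf g Ω x := rfl
  rw [hN]
  ring

end slice

end

/-! ### Differentials, the Hessian of the foliation function and the derivative of the normal -/

section

variable [IsManifold (𝓡 4) ∞ M] {g : Tensor2 M} {Ω : M → ℝ}

lemma dd_mul {f h : M → ℝ} (hf : SmoothFun f) (hh : SmoothFun h) (x : M) (v : E4) :
    dd (fun z => f z * h z) x v = f x * dd h x v + h x * dd f x v := by
  have := dd_eq_of_hasFDerivAt (hf.mul hh) ((hasFDerivAt_locF hf x).mul (hasFDerivAt_locF hh x))
  rw [this]
  simp only [locF_self, extChartAt_to_inv, add_apply, smul_apply, smul_eq_mul]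

lemma dd_add {f h : M → ℝ} (hf : SmoothFun f) (hh : SmoothFun h) (x : M) (v : E4) :
    dd (fun z => f z + h z) x v = dd f x v + dd h x v := by
  have := dd_eq_of_hasFDerivAt (hf.add hh) ((hasFDerivAt_locF hf x).add (hasFDerivAt_locF hh x))
  rw [this]
  simp only [add_apply]

lemma dd_eq_of_mdifferentiableAt {f : M → ℝ} {x : M}
    (h : MDifferentiableAt (𝓡 4) 𝓘(ℝ, ℝ) f x) :
    dd f x = fderiv ℝ (locF f x) (extChartAt (𝓡 4) x x) := by
  have h1 := h.mfderiv
  rw [ModelWithCorners.range_eq_univ, fderivWithin_univ] at h1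
  exact h1

/-- `F` is differentiable only at the one value `f x`, so the composite need not be smooth and
`dd_eq` is not available. This generality is needed for functions of `Ω` that are controlled only on
the range of `Ω`. -/
lemma dd_comp {f : M → ℝ} (hf : SmoothFun f) {F : ℝ → ℝ} {F' : ℝ} {x : M}
    (hF : HasDerivAt F F' (f x)) (v : E4) :
    dd (fun z => F (f z)) x v = F' * dd f x v := by
  have h1 : HasDerivAt F F' (locF f x (extChartAt (𝓡 4) x x)) := by rwa [locF_self]
  have h2 := h1.comp_hasFDerivAt _ (hasFDerivAt_locF hf x)
  have h3 : MDifferentiableAt (𝓡 4) 𝓘(ℝ, ℝ) (fun z => F (f z)) x :=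
    (hF.differentiableAt.mdifferentiableAt).comp x ((hf x).mdifferentiableAt (by simp))
  have h4 := dd_eq_of_mdifferentiableAt h3
  rw [h4]
  have h7 : fderiv ℝ (locF (fun z => F (f z)) x) (extChartAt (𝓡 4) x x) = F' • dd f x := h2.fderiv
  rw [h7]
  rfl

lemma dd_const (c : ℝ) (x : M) (v : E4) : dd (fun _ : M => c) x v = 0 := by
  rw [dd_eq_of_hasFDerivAt (SmoothFun.const c) (hasFDerivAt_const c _)]
  rfl

lemma dd_pow_two {f : M → ℝ} (hf : SmoothFun f) (x : M) (v : E4) :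
    dd (fun z => f z ^ 2) x v = 2 * f x * dd f x v := by
  rw [dd_comp hf (hasDerivAt_pow 2 (f x))]
  simp

lemma dd_exp {f : M → ℝ} (hf : SmoothFun f) (x : M) (v : E4) :
    dd (fun z => Real.exp (f z)) x v = Real.exp (f x) * dd f x v :=
  dd_comp hf (Real.hasDerivAt_exp (f x)) v

/-- The derivative of a vector field in the preferred chart at `x`. -/
def dV (X : VField M) (x : M) : E4 →L[ℝ] E4 := fderiv ℝ (locV X x) (extChartAt (𝓡 4) x x)

lemma hasFDerivAt_locV {X : VField M} (hX : SmoothVField X) (x : M) :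
    HasFDerivAt (locV X x) (dV X x) (extChartAt (𝓡 4) x x) :=
  (((contDiffOn_locV hX x).contDiffAt (target_mem_nhds x (mem_extChartAt_target x))
    ).differentiableAt (by simp)).hasFDerivAt

lemma target_eventually (x : M) :
    ∀ᶠ y in 𝓝 (extChartAt (𝓡 4) x x), y ∈ (extChartAt (𝓡 4) x).target :=
  target_mem_nhds x (mem_extChartAt_target x)

lemma hasFDerivAt_loc₂_dG (hg : IsLorentzMetric g) (x : M) :
    HasFDerivAt (loc₂ g x) (fderiv ℝ (loc₂ g x) (extChartAt (𝓡 4) x x)) (extChartAt (𝓡 4) x x) :=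
  (hg.differentiableAt x).hasFDerivAt

/-- The right side is half the Lie derivative of the metric along `X`; the Christoffel symbols
combine with the derivative of `g` in the direction `v`. -/
lemma nablaC_flat (hg : IsLorentzMetric g) {X : VField M} (hX : SmoothVField X) (x : M) (v : E4) :
    nablaC g (flat g X) x v
      = at₂ g x (dV X x v) v + 1 / 2 * dG g x (atV X x) v v := by
  have hd := (smoothC_flat hg hX).diffC
  have h1 : HasFDerivAt (loc₁ (flat g X) x) _ (extChartAt (𝓡 4) x x) :=
    ((hasFDerivAt_loc₂_dG hg x).clm_apply (hasFDerivAt_locV hX x)).congr_of_eventuallyEq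
      ((target_eventually x).mono fun y hy => loc₁_flat g X x hy)
  rw [nablaC_eq (hd x), nablaC₂, h1.fderiv]
  have h2 : at₁ (flat g X) x (Gam g x v v) = at₂ g x (Gam g x v v) (atV X x) :=
    hg.isSymmT x (atV X x) (Gam g x v v)
  rw [h2, apply_Gam_self hg, dG_symm hg x v v]
  simp only [add_apply, ContinuousLinearMap.comp_apply, ContinuousLinearMap.flip_apply,
    loc₂_self', locV_self']
  change _ + dG g x v (atV X x) v - _ = _
  ring

/-- The Hessian of a function. -/
def hess (g : Tensor2 M) (Ω : M → ℝ) (x : M) (v w : E4) : ℝ :=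
  fderiv ℝ (fderiv ℝ (locF Ω x)) (extChartAt (𝓡 4) x x) v w - dd Ω x (Gam g x v w)

lemma Gam_symm (hg : IsLorentzMetric g) (x : M) (v w : E4) : Gam g x v w = Gam g x w v := by
  refine (hg.form x).ext fun u => ?_
  rw [apply_Gam hg, apply_Gam hg, Gam₁, Gam₁, dG_symm hg x u v w]
  ring

lemma hess_symm (hg : IsLorentzMetric g) (hΩ : SmoothFun Ω) (x : M) (v w : E4) :
    hess g Ω x v w = hess g Ω x w v := by
  have h := (hΩ.contDiffAt x).isSymmSndFDerivAt (by simp only [minSmoothness_of_isRCLikeNormedField]; exact ENat.LEInfty.out)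
  rw [hess, hess, Gam_symm hg, h.eq v w]

lemma hasFDerivAt_fderiv_locF (hΩ : SmoothFun Ω) (x : M) :
    HasFDerivAt (fderiv ℝ (locF Ω x)) (fderiv ℝ (fderiv ℝ (locF Ω x)) (extChartAt (𝓡 4) x x))
      (extChartAt (𝓡 4) x x) := by
  have h1 : ContDiffAt ℝ ∞ (fderiv ℝ (locF Ω x)) (extChartAt (𝓡 4) x x) :=
    (hΩ.contDiffAt x).fderiv_right (by simp)
  exact (h1.differentiableAt (by simp)).hasFDerivAt

/-- The conormal is `φ dΩ`, hence `∇n = dφ ⊗ dΩ + φ Hess Ω`. -/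
lemma Qn_eq (hg : IsLorentzMetric g) (hΩ : IsTimelikeFoliation g Ω) (x : M) (v : E4) :
    Qn g Ω x v = dd (lapse g Ω) x v * dd Ω x v + lapse g Ω x * hess g Ω x v v := by
  have hd := (smoothC_normal hg hΩ).diffC
  have h1 : HasFDerivAt (loc₁ (flat g (normal g Ω)) x) _ (extChartAt (𝓡 4) x x) :=
    ((hasFDerivAt_locF (smooth_lapse hg hΩ) x).smul
      (hasFDerivAt_fderiv_locF hΩ.smooth x)).congr_of_eventuallyEq
      ((target_eventually x).mono fun y hy => loc₁_normal hg hΩ.smooth x hy)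
  rw [Qn, nablaC_eq (hd x), nablaC₂, h1.fderiv, hess]
  have h2 : at₁ (flat g (normal g Ω)) x (Gam g x v v) = lapse g Ω x * dd Ω x (Gam g x v v) :=
    nf_eq hg Ω x _
  rw [h2, ← dd_eq hΩ.smooth]
  simp only [add_apply, smul_apply, ContinuousLinearMap.smulRight_apply, locF_self, smul_eq_mul]
  ring

/-- The gradient at `x`, as an element of `E4`. -/
def gv (g : Tensor2 M) (Ω : M → ℝ) (x : M) : E4 := atV (grad g Ω) x

lemma at₂_gv (hg : IsLorentzMetric g) (Ω : M → ℝ) (x : M) (v : E4) :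
    at₂ g x (gv g Ω x) v = dd Ω x v := by
  rw [gv, apply_grad hg]; rfl

/-- This is `Hess Ω(v, grad Ω) = ½ d|grad Ω|²(v)`. It follows by differentiating both `g(grad Ω, ·)
= dΩ` and the function `dΩ(grad Ω)`, and eliminating the derivative of the gradient. -/
lemma hess_grad (hg : IsLorentzMetric g) (hΩ : SmoothFun Ω) (x : M) (v : E4) :
    hess g Ω x v (gv g Ω x) = 1 / 2 * dd (fun z => dirDeriv Ω z (grad g Ω z)) x v := by
  have hP : HasFDerivAt (locV (grad g Ω) x) (dV (grad g Ω) x) (extChartAt (𝓡 4) x x) :=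
    ((contDiffAt_grad hg hΩ x).differentiableAt (by simp)).hasFDerivAt
  have h1 : HasFDerivAt (locF (fun z => dirDeriv Ω z (grad g Ω z)) x) _
      (extChartAt (𝓡 4) x x) :=
    ((hasFDerivAt_fderiv_locF hΩ x).clm_apply hP).congr_of_eventuallyEq
      ((target_eventually x).mono fun y hy => locF_dirDeriv hΩ _ x hy)
  have h2 : HasFDerivAt (fderiv ℝ (locF Ω x)) _ (extChartAt (𝓡 4) x x) :=
    ((hasFDerivAt_loc₂_dG hg x).clm_apply hP).congr_of_eventuallyEq
      ((target_eventually x).mono fun y hy => (loc₂_grad hg hΩ x hy).symm)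
  have h3 : ∀ w, fderiv ℝ (fderiv ℝ (locF Ω x)) (extChartAt (𝓡 4) x x) v w
      = at₂ g x (dV (grad g Ω) x v) w + dG g x v (gv g Ω x) w := by
    intro w
    rw [h2.fderiv]
    simp only [add_apply, ContinuousLinearMap.comp_apply, ContinuousLinearMap.flip_apply,
      loc₂_self', locV_self']
    rfl
  have h4 : dd (fun z => dirDeriv Ω z (grad g Ω z)) x v = dd Ω x (dV (grad g Ω) x v)
      + fderiv ℝ (fderiv ℝ (locF Ω x)) (extChartAt (𝓡 4) x x) v (gv g Ω x) := by
    rw [dd_eq_of_hasFDerivAt (SmoothFun.dirDeriv_grad hg hΩ hΩ) h1, dd_eq hΩ]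
    simp only [add_apply, ContinuousLinearMap.comp_apply, ContinuousLinearMap.flip_apply,
      locV_self']
    rfl
  have h5 := h3 (gv g Ω x)
  rw [hg.isSymmT, at₂_gv hg] at h5
  have h6 : dd Ω x (Gam g x v (gv g Ω x)) = 1 / 2 * dG g x v (gv g Ω x) (gv g Ω x) := by
    rw [← at₂_gv hg, hg.isSymmT, apply_Gam hg, Gam₁, dG_symm hg x (gv g Ω x) v]
    ring
  rw [hess, h6, h4, h5]
  ring

lemma nv_eq (g : Tensor2 M) (Ω : M → ℝ) (x : M) : nv g Ω x = lapse g Ω x • gv g Ω x := rfl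

/-- Differentiating `φ² |grad Ω|² = 1` expresses the Hessian against the normal through `dφ`. -/
lemma hess_nv (hg : IsLorentzMetric g) (hΩ : IsTimelikeFoliation g Ω) (x : M) (v : E4) :
    (lapse g Ω x) ^ 2 * hess g Ω x v (nv g Ω x) = -dd (lapse g Ω) x v := by
  have h1 : hess g Ω x v (nv g Ω x) = lapse g Ω x * hess g Ω x v (gv g Ω x) := by
    rw [nv_eq, hess, hess]
    simp only [Gam_smul_right, map_smul, smul_eq_mul]
    ring
  have hF := SmoothFun.dirDeriv_grad hg hΩ.smooth hΩ.smooth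
  have h2 : dd (fun z => (lapse g Ω z) ^ 2 * dirDeriv Ω z (grad g Ω z)) x v = 0 := by
    have : (fun z => (lapse g Ω z) ^ 2 * dirDeriv Ω z (grad g Ω z)) = fun _ => (1 : ℝ) :=
      funext fun z => lapse_sq hg hΩ z
    rw [this, dd_const]
  have hl := smooth_lapse hg hΩ
  rw [dd_mul (hl.pow 2) hF, dd_pow_two hl] at h2
  have h3 := lapse_sq hg hΩ x
  rw [h1, hess_grad hg hΩ.smooth]
  linear_combination (1 / 2 * lapse g Ω x) * h2 - dd (lapse g Ω) x v * h3

lemma dd_nv (hg : IsLorentzMetric g) (hΩ : IsTimelikeFoliation g Ω) (x : M) :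
    lapse g Ω x * dd Ω x (nv g Ω x) = 1 := by
  rw [← nf_eq hg, nf_nv hg hΩ]

/-- The normal components of `∇n`. -/
lemma Qn_add_smul (hg : IsLorentzMetric g) (hΩ : IsTimelikeFoliation g Ω) (x : M) {w : E4}
    (hw : dd Ω x w = 0) (ν : ℝ) :
    Qn g Ω x (w + ν • nv g Ω x) = Qn g Ω x w - ν * (dd (lapse g Ω) x w / lapse g Ω x) := by
  have hφ := (lapse_pos hg hΩ x).ne'
  have h1 := hess_nv hg hΩ x w
  have h2 := hess_nv hg hΩ x (nv g Ω x)
  have h3 := dd_nv hg hΩ x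
  have h4 := hess_symm hg hΩ.smooth x (nv g Ω x) w
  rw [Qn_eq hg hΩ, Qn_eq hg hΩ]
  -- In the `ν²` terms, `dφ(n) dΩ(n)` cancels `φ Hess Ω(n,n)`. In the `ν` terms, one `dφ(w)/φ` from
  -- the product stands against two from the Hessian.
  have h5 : hess g Ω x (w + ν • nv g Ω x) (w + ν • nv g Ω x) = hess g Ω x w w
      + ν * hess g Ω x w (nv g Ω x) + ν * hess g Ω x (nv g Ω x) w
      + ν ^ 2 * hess g Ω x (nv g Ω x) (nv g Ω x) := by
    simp only [hess, Gam_add_left, Gam_add_right, Gam_smul_left, Gam_smul_right, map_add, map_smul,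
      add_apply, smul_apply, smul_eq_mul]
    ring
  have h6 : dd Ω x (nv g Ω x) = 1 / lapse g Ω x := by field_simp; linarith
  have h7 : hess g Ω x w (nv g Ω x) = -dd (lapse g Ω) x w / lapse g Ω x ^ 2 := by
    field_simp; linarith
  have h8 : hess g Ω x (nv g Ω x) (nv g Ω x)
      = -dd (lapse g Ω) x (nv g Ω x) / lapse g Ω x ^ 2 := by
    field_simp; linarith
  rw [h5, h4, h7, h8]
  simp only [map_add, map_smul, smul_eq_mul, hw, h6]
  field_simp
  ring

lemma Qn_nv (hg : IsLorentzMetric g) (hΩ : IsTimelikeFoliation g Ω) (x : M) :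
    Qn g Ω x (nv g Ω x) = 0 := by
  have h := Qn_add_smul hg hΩ x (w := 0) (map_zero _) 1
  have h0 : Qn g Ω x 0 = 0 := by
    rw [Qn_eq hg hΩ]
    have h1 : Gam g x 0 0 = 0 := by simpa using Gam_smul_left g x 0 0 0
    rw [hess, h1]
    simp
  simpa [h0] using h

end

section

variable [IsManifold (𝓡 4) ∞ M] {g : Tensor2 M} {Ω : M → ℝ}

/-! ### Killing fields tangent to the slices -/

lemma killing_polar (hg : IsLorentzMetric g) {X : VField M} (hX : SmoothVField X) {x : M}
    (hk : ∀ v, nablaC g (flat g X) x v = 0) (v w : E4) :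
    at₂ g x (dV X x v) w + at₂ g x (dV X x w) v + dG g x (atV X x) v w = 0 := by
  have h1 := hk (v + w)
  have h2 := hk v
  have h3 := hk w
  rw [nablaC_flat hg hX] at h1 h2 h3
  have h4 := dG_symm hg x (atV X x) v w
  simp only [map_add, add_apply] at h1
  linarith

lemma locF_inner (X Y : VField M) (x : M) {y : E4} (hy : y ∈ (extChartAt (𝓡 4) x).target) :
    locF (fun z => at₂ g z (atV X z) (atV Y z)) x y
      = loc₂ g x y (locV X x y) (locV Y x y) := by
  rw [loc₂_apply, coordMap_locV X x hy, coordMap_locV Y x hy]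
  rfl

lemma hasFDerivAt_inner (hg : IsLorentzMetric g) {X Y : VField M} (hX : SmoothVField X)
    (hY : SmoothVField Y) (x : M) :
    ∃ L : E4 →L[ℝ] ℝ, HasFDerivAt (locF (fun z => at₂ g z (atV X z) (atV Y z)) x) L
      (extChartAt (𝓡 4) x x) ∧ ∀ v, L v = dG g x v (atV X x) (atV Y x)
        + at₂ g x (dV X x v) (atV Y x) + at₂ g x (atV X x) (dV Y x v) := by
  refine ⟨_, (((hasFDerivAt_loc₂_dG hg x).clm_apply (hasFDerivAt_locV hX x)).clm_apply
    (hasFDerivAt_locV hY x)).congr_of_eventuallyEq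
      ((target_eventually x).mono fun y hy => locF_inner X Y x hy), fun v => ?_⟩
  simp only [add_apply, ContinuousLinearMap.comp_apply, ContinuousLinearMap.flip_apply,
    loc₂_self', locV_self', dG]
  ring

lemma SmoothFun.inner (hg : IsLorentzMetric g) {X Y : VField M} (hX : SmoothVField X)
    (hY : SmoothVField Y) : SmoothFun fun z => at₂ g z (atV X z) (atV Y z) := by
  refine SmoothFun.of_contDiffAt fun x => ?_
  have hT := target_mem_nhds x (mem_extChartAt_target x)
  exact ((((hg.smoothT x).contDiffAt hT).clm_apply ((contDiffOn_locV hX x).contDiffAt hT)).clm_apply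
    ((contDiffOn_locV hY x).contDiffAt hT)).congr_of_eventuallyEq
      ((target_eventually x).mono fun y hy => locF_inner X Y x hy)

/-- Differentiating `n(X) = 0` along `Y` expresses `(∇_Y n)(X)` through the derivative of `X` along
`Y` paired with `n`. Killing's equation then trades it for the derivative of `X` along `n` paired
with `Y`. -/
lemma nablaC₂_normal_killing (hg : IsLorentzMetric g) (hΩ : IsTimelikeFoliation g Ω)
    {X Y : VField M} (hX : SmoothVField X)
    (hXt : ∀ z, TangentToSlice Ω z (X z)) {x : M}
    (hXk : ∀ v, nablaC g (flat g X) x v = 0) :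
    nablaC₂ g (flat g (normal g Ω)) x (atV Y x) (atV X x)
      = at₂ g x (dV X x (nv g Ω x)) (atV Y x) + dG g x (atV X x) (atV Y x) (nv g Ω x)
        - Gam₁ g x (atV Y x) (atV X x) (nv g Ω x) := by
  have hd := (smoothC_normal hg hΩ).diffC x
  have h1 := hd.hasFDerivAt.clm_apply (hasFDerivAt_locV hX x)
  have h2 : HasFDerivAt (fun y => loc₁ (flat g (normal g Ω)) x y (locV X x y)) (0 : E4 →L[ℝ] ℝ)
      (extChartAt (𝓡 4) x x) := by
    refine (hasFDerivAt_const (0 : ℝ) _).congr_of_eventuallyEq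
      ((target_eventually x).mono fun y hy => ?_)
    have h3 := apply_normal hg Ω ((extChartAt (𝓡 4) x).symm y)
      (atV X ((extChartAt (𝓡 4) x).symm y))
    have h4 : at₁ (dF Ω) ((extChartAt (𝓡 4) x).symm y) (atV X ((extChartAt (𝓡 4) x).symm y)) = 0 :=
      hXt _
    rw [h4, mul_zero] at h3
    change loc₁ (flat g (normal g Ω)) x y (locV X x y) = 0
    rw [loc₁_apply, coordMap_locV X x hy]
    exact h3
  have h5 := congrArg (fun L : E4 →L[ℝ] ℝ => L (atV Y x)) (h1.unique h2)
  simp only [add_apply, ContinuousLinearMap.comp_apply, ContinuousLinearMap.flip_apply,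
    loc₁_self', locV_self', zero_apply] at h5
  have h6 : at₁ (flat g (normal g Ω)) x (dV X x (atV Y x))
      = at₂ g x (dV X x (atV Y x)) (nv g Ω x) := hg.isSymmT x _ _
  have h7 := killing_polar hg hX hXk (atV Y x) (nv g Ω x)
  have h8 : at₁ (flat g (normal g Ω)) x (Gam g x (atV Y x) (atV X x))
      = Gam₁ g x (atV Y x) (atV X x) (nv g Ω x) := by
    rw [← apply_Gam hg, hg.isSymmT]; rfl
  rw [nablaC₂, h8]
  rw [h6] at h5
  linarith

/-- The second fundamental form on Killing fields tangent to the slices. -/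
lemma Qn_polar_killing (hg : IsLorentzMetric g) (hΩ : IsTimelikeFoliation g Ω)
    {X Y : VField M} (hX : SmoothVField X) (hY : SmoothVField Y)
    (hXt : ∀ z, TangentToSlice Ω z (X z)) (hYt : ∀ z, TangentToSlice Ω z (Y z)) {x : M}
    (hXk : ∀ v, nablaC g (flat g X) x v = 0) (hYk : ∀ v, nablaC g (flat g Y) x v = 0) :
    Qn g Ω x (atV X x + atV Y x) - Qn g Ω x (atV X x) - Qn g Ω x (atV Y x)
      = dd (fun z => at₂ g z (atV X z) (atV Y z)) x (nv g Ω x) := by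
  have hd := (smoothC_normal hg hΩ).diffC
  have h1 := nablaC₂_normal_killing (Y := Y) hg hΩ hX hXt hXk
  have h2 := nablaC₂_normal_killing (Y := X) hg hΩ hY hYt hYk
  obtain ⟨L, hL, hL2⟩ := hasFDerivAt_inner hg hX hY x
  rw [dd_eq_of_hasFDerivAt (SmoothFun.inner hg hX hY) hL, hL2]
  -- The polarised form is `2χ(X,Y)`, so the claim is the familiar `χ(X,Y) = ½ n(g(X,Y))`.
  have h3 : Qn g Ω x (atV X x + atV Y x) - Qn g Ω x (atV X x) - Qn g Ω x (atV Y x)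
      = nablaC₂ g (flat g (normal g Ω)) x (atV Y x) (atV X x)
        + nablaC₂ g (flat g (normal g Ω)) x (atV X x) (atV Y x) := by
    simp only [Qn, nablaC_eq (hd x), nablaC₂, map_add, add_apply, Gam_add_left, Gam_add_right]
    ring
  have h4 := hg.isSymmT x (atV X x) (dV Y x (nv g Ω x))
  have h5 := dG_symm hg x (atV X x) (atV Y x) (nv g Ω x)
  have h6 := dG_symm hg x (atV Y x) (atV X x) (nv g Ω x)
  have h7 := dG_symm hg x (nv g Ω x) (atV X x) (atV Y x)
  rw [h3, h1, h2, h4, Gam₁, Gam₁]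
  linarith

/-! ### Weyl rescaling -/

section weyl
variable {r : M → ℝ}

lemma at₂_weyl (r : M → ℝ) (g : Tensor2 M) (x : M) : at₂ (weyl r g) x = (r x) ^ 2 • at₂ g x := rfl

lemma IsLorentzMetric.weyl (hg : IsLorentzMetric g) (hr : SmoothFun r) (hr0 : ∀ x, 0 < r x) :
    IsLorentzMetric (weyl r g) where
  symm x v w := by
    change (r x) ^ 2 * g x v w = (r x) ^ 2 * g x w v
    rw [hg.symm]
  signature x := by
    obtain ⟨b, hb⟩ := hg.signature x
    have h0 := (hr0 x).ne'
    refine ⟨b.isUnitSMul (w := fun _ => (r x)⁻¹) fun _ => (inv_ne_zero h0).isUnit, fun i j => ?_⟩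
    rw [Module.Basis.isUnitSMul_apply, Module.Basis.isUnitSMul_apply]
    change (r x) ^ 2 * g x ((r x)⁻¹ • b i) ((r x)⁻¹ • b j) = _
    rw [← hb i j]
    simp only [map_smul, smul_apply, smul_eq_mul]
    field_simp
  smooth := by
    have h := ContMDiff.smul_section (V := fun z : M => TangentSpace (𝓡 4) z →L[ℝ]
      TangentSpace (𝓡 4) z →L[ℝ] ℝ) (hr.pow 2) hg.smooth
    exact h

lemma dG_weyl (hg : IsLorentzMetric g) (hr : SmoothFun r) (hr0 : ∀ x, 0 < r x) (x : M)
    (u v w : E4) :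
    dG (weyl r g) x u v w = 2 * r x * dd r x u * at₂ g x v w + (r x) ^ 2 * dG g x u v w := by
  have h0 : (fun y => loc₂ (weyl r g) x y v w)
      = fun y => locF (fun z => r z ^ 2) x y * loc₂ g x y v w := rfl
  have h1 := (hasFDerivAt_locF (hr.pow 2) x).mul (hasFDerivAt_loc₂ hg.smoothT.diffT x v w)
  rw [dG_apply (hg.weyl hr hr0), h0]
  refine (congrArg (fun L => L u) h1.fderiv).trans ?_
  simp only [add_apply, smul_apply, loc₂_self', smul_eq_mul, dd_pow_two hr, ← dG_apply hg]
  rw [locF_self]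
  ring

/-- The classical change of the Christoffel symbols on the diagonal, with the index lowered and
multiplied by `r` so that neither an inverse metric nor a quotient appears. -/
lemma Gam_weyl (hg : IsLorentzMetric g) (hr : SmoothFun r) (hr0 : ∀ x, 0 < r x) (x : M)
    (v w : E4) :
    r x * at₂ g x (Gam (weyl r g) x v v) w = 2 * dd r x v * at₂ g x v w
      - dd r x w * at₂ g x v v + r x * at₂ g x (Gam g x v v) w := by
  have h1 := apply_Gam_self (hg.weyl hr hr0) x v w
  have h2 := apply_Gam_self hg x v w
  have h0 := (hr0 x).ne'
  rw [at₂_weyl, smul_apply, smul_apply, smul_eq_mul, dG_weyl hg hr hr0, dG_weyl hg hr hr0] at h1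
  rw [h2]
  have h3 : r x * (r x * at₂ g x (Gam (weyl r g) x v v) w) = r x * (2 * dd r x v * at₂ g x v w
      - dd r x w * at₂ g x v v + r x * (dG g x v v w - 1 / 2 * dG g x w v v)) := by
    linear_combination h1
  exact mul_left_cancel₀ h0 h3

/-- The weight `ρ` is left open because lowered vector fields scale by `r²` and the unit conormal by
`r`. -/
lemma nablaC_weyl (hg : IsLorentzMetric g) (hr : SmoothFun r) (hr0 : ∀ x, 0 < r x)
    {ρ : M → ℝ} (hρ : SmoothFun ρ) {θ θ' : CoField M} (hθ : DiffC θ) (hθ' : DiffC θ')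
    (he : ∀ z, at₁ θ' z = ρ z • at₁ θ z) (x : M) {Z : E4} (hZ : at₁ θ x = at₂ g x Z) (v : E4) :
    r x * nablaC (weyl r g) θ' x v = r x * (dd ρ x v * at₁ θ x v) + ρ x * (r x * nablaC g θ x v
      - 2 * dd r x v * at₁ θ x v + dd r x Z * at₂ g x v v) := by
  have h1 : loc₁ θ' x = locF ρ x • loc₁ θ x := by
    funext y
    rw [loc₁, he]
    rfl
  have h2 := (hasFDerivAt_locF hρ x).smul (hθ x).hasFDerivAt
  rw [nablaC_eq (hθ' x), nablaC_eq (hθ x), nablaC₂, nablaC₂, h1, h2.fderiv, he, hZ]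
  have h3 := Gam_weyl hg hr hr0 x v Z
  rw [hg.isSymmT x _ Z, hg.isSymmT x _ Z, hg.isSymmT x _ Z] at h3
  simp only [add_apply, smul_apply, ContinuousLinearMap.smulRight_apply, loc₁_self', smul_eq_mul,
    hZ, locF_self]
  linear_combination (-ρ x) * h3

/-- The rescaled Killing operator. -/
lemma nablaC_flat_weyl (hg : IsLorentzMetric g) (hr : SmoothFun r) (hr0 : ∀ x, 0 < r x)
    {X : VField M} (hX : SmoothVField X) (x : M) (v : E4) :
    nablaC (weyl r g) (flat (weyl r g) X) x v = (r x) ^ 2 * nablaC g (flat g X) x v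
      + r x * dd r x (atV X x) * at₂ g x v v := by
  have h := nablaC_weyl hg hr hr0 (hr.pow 2) (smoothC_flat hg hX).diffC
    (smoothC_flat (hg.weyl hr hr0) hX).diffC (fun z => rfl) x (Z := atV X x) rfl v
  rw [dd_pow_two hr] at h
  refine mul_left_cancel₀ (hr0 x).ne' ?_
  linear_combination h

lemma grad_weyl (hg : IsLorentzMetric g) (hr : SmoothFun r) (hr0 : ∀ x, 0 < r x) (Ω : M → ℝ)
    (x : M) : gv (weyl r g) Ω x = (r x ^ 2)⁻¹ • gv g Ω x := by
  refine ((hg.weyl hr hr0).form x).ext fun w => ?_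
  have h0 := (hr0 x).ne'
  rw [at₂_gv (hg.weyl hr hr0), map_smul, smul_apply, at₂_weyl, smul_apply, smul_apply, at₂_gv hg,
    smul_eq_mul, smul_eq_mul]
  field_simp

lemma lapse_weyl (hg : IsLorentzMetric g) (hr : SmoothFun r) (hr0 : ∀ x, 0 < r x) (Ω : M → ℝ)
    (x : M) : lapse (weyl r g) Ω x = r x * lapse g Ω x := by
  have h1 : dirDeriv Ω x (grad (weyl r g) Ω x) = (r x ^ 2)⁻¹ * dirDeriv Ω x (grad g Ω x) := by
    have := congrArg (dd Ω x) (grad_weyl hg hr hr0 Ω x)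
    rw [map_smul] at this
    exact this
  have h0 := (hr0 x).ne'
  rw [lapse, lapse, h1, Real.sqrt_mul (by positivity), Real.sqrt_inv, Real.sqrt_sq (hr0 x).le]
  field_simp

lemma nv_weyl (hg : IsLorentzMetric g) (hr : SmoothFun r) (hr0 : ∀ x, 0 < r x) (Ω : M → ℝ)
    (x : M) : nv (weyl r g) Ω x = (r x)⁻¹ • nv g Ω x := by
  have h0 := (hr0 x).ne'
  rw [nv_eq, nv_eq, grad_weyl hg hr hr0, lapse_weyl hg hr hr0, smul_smul, smul_smul]
  congr 1
  field_simp

lemma nf_weyl (hg : IsLorentzMetric g) (hr : SmoothFun r) (hr0 : ∀ x, 0 < r x) (Ω : M → ℝ)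
    (x : M) : nf (weyl r g) Ω x = r x • nf g Ω x := by
  have h0 := (hr0 x).ne'
  rw [nf, nv_weyl hg hr hr0, map_smul, at₂_weyl, smul_apply, smul_smul, nf]
  congr 1
  field_simp

/-- The lapse scales by `r` and the unit normal by `1/r`, so the derivative with respect to the
foliation parameter is conformally invariant. -/
lemma prime_weyl (hg : IsLorentzMetric g) (hr : SmoothFun r) (hr0 : ∀ x, 0 < r x) (Ω f : M → ℝ)
    (x : M) : prime (weyl r g) Ω f x = prime g Ω f x := by
  have h0 := (hr0 x).ne'
  have h1 : ∀ h : Tensor2 M, prime h Ω f x = lapse h Ω x * dd f x (nv h Ω x) := fun _ => rfl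
  rw [h1, h1, nv_weyl hg hr hr0, lapse_weyl hg hr hr0, map_smul, smul_eq_mul]
  field_simp

lemma IsTimelikeFoliation.weyl (hg : IsLorentzMetric g) (hr : SmoothFun r) (hr0 : ∀ x, 0 < r x)
    (hΩ : IsTimelikeFoliation g Ω) : IsTimelikeFoliation (weyl r g) Ω where
  smooth := hΩ.smooth
  spacelike_grad x := by
    have h1 : at₂ (Spacetime.weyl r g) x (gv (Spacetime.weyl r g) Ω x)
        (gv (Spacetime.weyl r g) Ω x) = (r x ^ 2)⁻¹ * at₂ g x (gv g Ω x) (gv g Ω x) := by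
      have h0 := (hr0 x).ne'
      rw [grad_weyl hg hr hr0, at₂_weyl]
      simp only [map_smul, smul_apply, smul_eq_mul]
      field_simp
    have h2 : 0 < at₂ g x (gv g Ω x) (gv g Ω x) := hΩ.spacelike_grad x
    have h3 : 0 < at₂ (Spacetime.weyl r g) x (gv (Spacetime.weyl r g) Ω x)
        (gv (Spacetime.weyl r g) Ω x) := by
      rw [h1]
      have := hr0 x
      positivity
    exact h3
  connected := hΩ.connected

lemma Qn_weyl (hg : IsLorentzMetric g) (hr : SmoothFun r) (hr0 : ∀ x, 0 < r x)
    (hΩ : IsTimelikeFoliation g Ω) (x : M) (v : E4) :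
    Qn (weyl r g) Ω x v = r x * Qn g Ω x v - dd r x v * nf g Ω x v
      + dd r x (nv g Ω x) * at₂ g x v v := by
  have h := nablaC_weyl hg hr hr0 hr (smoothC_normal hg hΩ).diffC
    (smoothC_normal (hg.weyl hr hr0) (hΩ.weyl hg hr hr0)).diffC
    (fun z => nf_weyl hg hr hr0 Ω z) x (Z := nv g Ω x) rfl v
  have h2 : at₁ (flat g (normal g Ω)) x v = nf g Ω x v := rfl
  rw [h2] at h
  refine mul_left_cancel₀ (hr0 x).ne' ?_
  change r x * nablaC _ _ _ _ = _
  rw [h, Qn]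
  ring

end weyl

end

section

variable [IsManifold (𝓡 4) ∞ M] {g : Tensor2 M} {Ω : M → ℝ} {κ : Fin 2 → VField M}
  {γ : M → Matrix (Fin 2) (Fin 2) ℝ} {α Ψ : M → ℝ}

/-! ### The slice equation -/

/-- Smooth vector fields tangent to the slices, with Gram matrix of signature `(-,+)`. -/
structure IsSliceFrame (g : Tensor2 M) (Ω : M → ℝ) (κ : Fin 2 → VField M) : Prop where
  metric : IsLorentzMetric g
  foliation : IsTimelikeFoliation g Ω
  smooth : ∀ a, SmoothVField (κ a)
  tangent : ∀ a x, TangentToSlice Ω x (κ a x)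
  signature : ∀ x, (gram g κ x).det < 0

lemma IsAxistationary.isSliceFrame (hg : IsLorentzMetric g) (hΩ : IsTimelikeFoliation g Ω)
    (hκ : IsAxistationary g Ω κ) : IsSliceFrame g Ω κ :=
  ⟨hg, hΩ, fun a => (hκ.killing a).1, hκ.tangent, hκ.signature⟩

/-- The structure omits the Killing equation precisely so that it survives every rescaling; after
one, Killing fields are in general only conformal Killing. -/
lemma IsSliceFrame.weyl (h : IsSliceFrame g Ω κ) {r : M → ℝ} (hr : SmoothFun r)
    (hr0 : ∀ x, 0 < r x) : IsSliceFrame (weyl r g) Ω κ where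
  metric := h.metric.weyl hr hr0
  foliation := h.foliation.weyl h.metric hr hr0
  smooth := h.smooth
  tangent := h.tangent
  signature x := by
    have h1 : gram (Spacetime.weyl r g) κ x = (r x) ^ 2 • gram g κ x := by
      ext a b
      rfl
    rw [h1, Matrix.det_smul]
    have := hr0 x
    exact mul_neg_of_pos_of_neg (by positivity) (h.signature x)

/-- The vector fields `κ_a` at `x`, as elements of `E4`. -/
def kv (κ : Fin 2 → VField M) (a : Fin 2) (x : M) : E4 := atV (κ a) x

/-- The covectors `κ_{aα}` at `x`. -/
def kf (g : Tensor2 M) (κ : Fin 2 → VField M) (a : Fin 2) (x : M) : E4 →L[ℝ] ℝ :=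
  at₂ g x (kv κ a x)

/-- The quadratic form `n(γ^{ab}) κ_{aα} κ_{bβ}`. -/
def gq (g : Tensor2 M) (Ω : M → ℝ) (κ : Fin 2 → VField M) (γ : M → Matrix (Fin 2) (Fin 2) ℝ)
    (x : M) (v : E4) : ℝ :=
  ∑ a, ∑ b, dd (fun z => γ z a b) x (nv g Ω x) * (kf g κ a x v * kf g κ b x v)

/-- The slice-reduced (conformal) Killing tensor equation. -/
def SliceEq (g : Tensor2 M) (Ω : M → ℝ) (κ : Fin 2 → VField M)
    (γ : M → Matrix (Fin 2) (Fin 2) ℝ) (Ψ : M → ℝ) (x : M) : Prop :=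
  ∀ v, Qn g Ω x v = 1 / 2 * dd Ψ x (nv g Ω x) * at₂ g x v v
    - 1 / 2 * Real.exp (-Ψ x) * gq g Ω κ γ x v - 1 / 2 * nf g Ω x v * dd Ψ x v

lemma IsSliceFrame.dd_kv (h : IsSliceFrame g Ω κ) (a : Fin 2) (x : M) :
    dd Ω x (kv κ a x) = 0 := h.tangent a x

lemma IsSliceFrame.kf_nv (h : IsSliceFrame g Ω κ) (a : Fin 2) (x : M) :
    kf g κ a x (nv g Ω x) = 0 := by
  have h1 := nf_eq h.metric Ω x (kv κ a x)
  rw [h.dd_kv, mul_zero] at h1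
  rw [← h1, kf, nf, h.metric.isSymmT]

lemma IsSliceFrame.gq_nv (h : IsSliceFrame g Ω κ) (x : M) : gq g Ω κ γ x (nv g Ω x) = 0 := by
  simp [gq, h.kf_nv]

lemma exists_quadratic_neg {a b c : ℝ} (h : a * c - b * b < 0) :
    ∃ s t : ℝ, s * s * a + 2 * (s * t * b) + t * t * c < 0 := by
  rcases lt_trichotomy a 0 with ha | ha | ha
  · exact ⟨1, 0, by linarith⟩
  · have hb : b ≠ 0 := by rintro rfl; simp [ha] at h
    -- With `a = 0` and `t = 1` the form is `2 s b + c`; this `s` makes it `-1`.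
    refine ⟨-(c + 1) / (2 * b), 1, ?_⟩
    have h1 : -(c + 1) / (2 * b) * b = -(c + 1) / 2 := by field_simp
    rw [ha, mul_one, h1]
    linarith
  -- Up to scale this is the minimizing direction found by completing the square.
  · refine ⟨-b, a, ?_⟩
    have : -b * -b * a + 2 * (-b * a * b) + a * a * c = a * (a * c - b * b) := by ring
    rw [this]
    exact mul_neg_of_pos_of_neg ha h

lemma IsSliceFrame.exists_timelike (h : IsSliceFrame g Ω κ) (x : M) :
    ∃ s t : ℝ, at₂ g x (s • kv κ 0 x + t • kv κ 1 x) (s • kv κ 0 x + t • kv κ 1 x) < 0 := by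
  have h1 := h.signature x
  rw [Matrix.det_fin_two] at h1
  have h2 : at₂ g x (kv κ 0 x) (kv κ 0 x) * at₂ g x (kv κ 1 x) (kv κ 1 x)
      - at₂ g x (kv κ 0 x) (kv κ 1 x) * at₂ g x (kv κ 1 x) (kv κ 0 x) < 0 := h1
  rw [h.metric.isSymmT x (kv κ 1 x) (kv κ 0 x)] at h2
  obtain ⟨s, t, hst⟩ := exists_quadratic_neg h2
  refine ⟨s, t, ?_⟩
  have h3 := h.metric.isSymmT x (kv κ 1 x) (kv κ 0 x)
  simp only [map_add, map_smul, add_apply, smul_apply, smul_eq_mul, h3]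
  linarith

lemma exists_ne_zero_of_three (f₁ f₂ f₃ : E4 →L[ℝ] ℝ) :
    ∃ σ : E4, σ ≠ 0 ∧ f₁ σ = 0 ∧ f₂ σ = 0 ∧ f₃ σ = 0 := by
  let L : E4 →ₗ[ℝ] (Fin 3 → ℝ) := LinearMap.pi ![f₁.toLinearMap, f₂.toLinearMap, f₃.toLinearMap]
  have h1 : LinearMap.ker L ≠ ⊥ := LinearMap.ker_ne_bot_of_finrank_lt (by simp)
  obtain ⟨σ, hσ, h0⟩ := (Submodule.ne_bot_iff _).1 h1
  have h2 : L σ = 0 := hσ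
  exact ⟨σ, h0, congrFun h2 0, congrFun h2 1, congrFun h2 2⟩

lemma IsSliceFrame.pos_of_orthogonal (h : IsSliceFrame g Ω κ) {x : M} {σ : E4} (hσ : σ ≠ 0)
    (h0 : ∀ a, kf g κ a x σ = 0) : 0 < at₂ g x σ σ := by
  obtain ⟨s, t, hst⟩ := h.exists_timelike x
  refine (h.metric.form x).pos_of_orthogonal hst ?_ hσ
  have h1 : at₂ g x (kv κ 0 x) σ = 0 := h0 0
  have h2 : at₂ g x (kv κ 1 x) σ = 0 := h0 1
  simp only [map_add, map_smul, add_apply, smul_apply, smul_eq_mul, h1, h2]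
  ring

/-- Three linear conditions on a four-dimensional space leave a nonzero vector, which is spacelike
because it is orthogonal to a timelike combination of the `κ_a`. It supplies a slice-tangent vector
of nonzero norm. -/
lemma IsSliceFrame.exists_orthogonal (h : IsSliceFrame g Ω κ) (x : M) :
    ∃ σ : E4, dd Ω x σ = 0 ∧ (∀ a, kf g κ a x σ = 0) ∧ 0 < at₂ g x σ σ := by
  obtain ⟨σ, h0, h1, h2, h3⟩ := exists_ne_zero_of_three (dd Ω x) (kf g κ 0 x) (kf g κ 1 x)
  have h4 : ∀ a, kf g κ a x σ = 0 := by
    intro a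
    fin_cases a
    · exact h2
    · exact h3
  exact ⟨σ, h1, h4, h.pos_of_orthogonal h0 h4⟩

lemma nf_of_tangent (hg : IsLorentzMetric g) {x : M} {w : E4} (hw : dd Ω x w = 0) :
    nf g Ω x w = 0 := by rw [nf_eq hg, hw, mul_zero]

lemma dd_of_nf (hg : IsLorentzMetric g) (hΩ : IsTimelikeFoliation g Ω) {x : M} {w : E4}
    (hw : nf g Ω x w = 0) : dd Ω x w = 0 := by
  rw [nf_eq hg] at hw
  exact (mul_eq_zero.1 hw).resolve_left (lapse_pos hg hΩ x).ne'

lemma SliceConstant.dd_eq (hg : IsLorentzMetric g) (hΩ : IsTimelikeFoliation g Ω) {f : M → ℝ}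
    (hf : SliceConstant Ω f) (x : M) (v : E4) :
    dd f x v = nf g Ω x v * dd f x (nv g Ω x) := by
  have h1 : dd Ω x (v + (-nf g Ω x v) • nv g Ω x) = 0 := by
    refine dd_of_nf hg hΩ ?_
    rw [map_add, map_smul, nf_nv hg hΩ, smul_eq_mul]
    ring
  have h2 : dd f x (v + (-nf g Ω x v) • nv g Ω x) = 0 := hf x _ h1
  rw [map_add, map_smul, smul_eq_mul] at h2
  linarith

/-- Serves to extend an identity between quadratic forms from `n(v) ≠ 0` to the hyperplane `n(v) =
0`. -/
lemma Qn_parallelogram (hg : IsLorentzMetric g) (hΩ : IsTimelikeFoliation g Ω) (x : M)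
    (v w : E4) : Qn g Ω x (v + w) + Qn g Ω x (v + (-1 : ℝ) • w)
      = 2 * Qn g Ω x v + 2 * Qn g Ω x w := by
  have hd := (smoothC_normal hg hΩ).diffC
  simp only [Qn, nablaC_eq (hd x), nablaC₂, map_add, map_smul, add_apply, smul_apply, Gam_add_left,
    Gam_add_right, Gam_smul_left, Gam_smul_right, smul_eq_mul]
  ring

/-- The divergence covector of the reducible part of the tensor. -/
def mu (g : Tensor2 M) (κ : Fin 2 → VField M) (α : M → ℝ) (γ : M → Matrix (Fin 2) (Fin 2) ℝ)
    (c : Fin 2 → ℝ) (x : M) (v : E4) : ℝ :=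
  dd α x v + 2 * ∑ a, ∑ b, γ x a b * c a * kf g κ b x v

/-- Because `γ` is constant on the slices, its differential carries a factor `n(v)`, as does the
derivative of the normal term; everything else is a multiple of `g(v,v)`. The `κ_a` are allowed to
be conformal Killing with factors `c a`, which enter only `mu`, so the formula also applies to the
rescaled metric before its Killing vectors are known. -/
lemma IsSliceFrame.nablaT_eq (h : IsSliceFrame g Ω κ) (hα : SmoothFun α)
    (hγ : ∀ a b, SmoothFun fun x => γ x a b) (hΨ : SmoothFun Ψ) (hs : ∀ x, (γ x).IsSymm)
    (hc : ∀ a b, SliceConstant Ω fun x => γ x a b) {x : M} {c : Fin 2 → ℝ}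
    (hk : ∀ a v, nablaC g (flat g (κ a)) x v = c a * at₂ g x v v) (v : E4) :
    nablaT g (sliceTensor g Ω κ α γ Ψ) x v = mu g κ α γ c x v * at₂ g x v v
      + nf g Ω x v * (gq g Ω κ γ x v
        + Real.exp (Ψ x) * (dd Ψ x v * nf g Ω x v + 2 * Qn g Ω x v)) := by
  rw [nablaT_sliceTensor h.metric h.foliation h.smooth hα hγ hΨ]
  have h1 := fun a b => (hc a b).dd_eq h.metric h.foliation x v
  have h2 : ∀ a, at₁ (flat g (κ a)) x v = kf g κ a x v := fun a => rfl
  have h3 := (hs x).apply 0 1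
  simp only [mu, gq, h1, h2, hk, Fin.sum_univ_two, h3]
  ring

/-- A product of a linear and a nonzero quadratic form vanishes only if the linear form does. It
vanishes at the anisotropic vector `w₀`; for an isotropic `w`, adding the relations at `w + w₀` and
`w - w₀` removes the cross term. -/
lemma eq_zero_on_of_mul {G : E4 →L[ℝ] E4 →L[ℝ] ℝ} (hG : ∀ v w, G v w = G w v) {P : E4 → Prop}
    (hP : ∀ v w, P v → P w → ∀ s : ℝ, P (v + s • w)) {w₀ : E4} (hw₀ : P w₀) (h0 : G w₀ w₀ ≠ 0)
    {l : E4 → ℝ} (hadd : ∀ v w (s : ℝ), l (v + s • w) = l v + s * l w)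
    (hl : ∀ w, P w → l w * G w w = 0) {w : E4}
    (hw : P w) : l w = 0 := by
  have h1 := (mul_eq_zero.1 (hl w₀ hw₀)).resolve_right h0
  by_cases h2 : G w w = 0
  · have h3 : ∀ s : ℝ, l w * (2 * s * G w w₀ + s ^ 2 * G w₀ w₀) = 0 := by
      intro s
      have h4 := hl _ (hP w w₀ hw hw₀ s)
      rw [hadd, h1] at h4
      simp only [map_add, map_smul, add_apply, smul_apply, smul_eq_mul, h2, hG w₀ w] at h4
      linear_combination h4
    have h5 := h3 1
    have h6 := h3 (-1)
    have h7 : l w * G w₀ w₀ = 0 := by linear_combination (h5 + h6) / 2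
    exact (mul_eq_zero.1 h7).resolve_right h0
  · exact (mul_eq_zero.1 (hl w hw)).resolve_right h2

lemma mu_add (c : Fin 2 → ℝ) (x : M) (v w : E4) (s : ℝ) :
    mu g κ α γ c x (v + s • w) = mu g κ α γ c x v + s * mu g κ α γ c x w := by
  simp only [mu, map_add, map_smul, smul_eq_mul, Fin.sum_univ_two]
  ring

/-- The conformal Killing tensor equation implies the slice equation. -/
lemma IsSliceFrame.sliceEq_of_nablaT (h : IsSliceFrame g Ω κ) (hα : SmoothFun α)
    (hγ : ∀ a b, SmoothFun fun x => γ x a b) (hΨ : SmoothFun Ψ) (hs : ∀ x, (γ x).IsSymm)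
    (hc : ∀ a b, SliceConstant Ω fun x => γ x a b) {x : M} {c : Fin 2 → ℝ}
    (hk : ∀ a v, nablaC g (flat g (κ a)) x v = c a * at₂ g x v v) {θ : E4 →L[ℝ] ℝ}
    (hT : ∀ v, nablaT g (sliceTensor g Ω κ α γ Ψ) x v = θ v * at₂ g x v v) :
    SliceEq g Ω κ γ Ψ x ∧ ∀ v, θ v = mu g κ α γ c x v
      + Real.exp (Ψ x) * dd Ψ x (nv g Ω x) * nf g Ω x v := by
  set B : E4 → ℝ := fun v => gq g Ω κ γ x v
    + Real.exp (Ψ x) * (dd Ψ x v * nf g Ω x v + 2 * Qn g Ω x v) with hB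
  set l : E4 → ℝ := fun v => θ v - mu g κ α γ c x v with hl
  -- The factorization on which the argument turns: linear times metric equals conormal times
  -- quadratic.
  have h1 : ∀ v, l v * at₂ g x v v = nf g Ω x v * B v := by
    intro v
    have := hT v
    rw [h.nablaT_eq hα hγ hΨ hs hc hk] at this
    rw [hl, hB]
    linear_combination -this
  have hadd : ∀ v w (s : ℝ), l (v + s • w) = l v + s * l w := by
    intro v w s
    simp only [hl, mu_add, map_add, map_smul, smul_eq_mul]
    ring
  obtain ⟨σ, hσ, -, hσ2⟩ := h.exists_orthogonal x
  have h2 : ∀ w, nf g Ω x w = 0 → l w = 0 := fun w hw =>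
    eq_zero_on_of_mul (G := at₂ g x) (h.metric.isSymmT x) (P := fun w => nf g Ω x w = 0)
      (fun v w hv hw s => by rw [map_add, map_smul, hv, hw, smul_zero, add_zero])
      (nf_of_tangent h.metric hσ) hσ2.ne' hadd (fun w hw => by rw [h1, hw, zero_mul]) hw
  set N := nv g Ω x with hN
  have hN1 : nf g Ω x N = 1 := nf_nv h.metric h.foliation x
  have h3 : ∀ v, l v = nf g Ω x v * l N := by
    intro v
    have := h2 (v + (-nf g Ω x v) • N) (by rw [map_add, map_smul, hN1, smul_eq_mul]; ring)
    rw [hadd] at this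
    linarith
  have hNN : at₂ g x N N = 1 := normal_normal h.metric h.foliation x
  have hkN := fun a => h.kf_nv a x
  -- At the normal itself both `∇n` and the `γ` term vanish, so only the derivative of `Ψ` is left.
  have hlN : l N = Real.exp (Ψ x) * dd Ψ x N := by
    have h4 := h1 N
    rw [hNN, hN1, hB] at h4
    simp only [hN, h.gq_nv, Qn_nv h.metric h.foliation, nf_nv h.metric h.foliation] at h4
    linarith
  have h5 : ∀ v, nf g Ω x v ≠ 0 → B v = l N * at₂ g x v v := by
    intro v hv
    refine mul_left_cancel₀ hv ?_
    rw [← h1, h3 v]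
    ring
  have hpar : ∀ v w, B (v + w) + B (v + (-1 : ℝ) • w) = 2 * B v + 2 * B w := by
    intro v w
    have := Qn_parallelogram h.metric h.foliation x v w
    simp only [hB, gq, Fin.sum_univ_two, map_add, map_smul, smul_eq_mul]
    linear_combination (2 * Real.exp (Ψ x)) * this
  -- Division by `n(v)` gives the identity off the hyperplane. The parallelogram law with `v ± N`
  -- carries it onto the hyperplane.
  have h6 : ∀ v, B v = l N * at₂ g x v v := by
    intro v
    by_cases hv : nf g Ω x v = 0
    · have a1 := h5 (v + N) (by rw [map_add, hv, hN1]; norm_num)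
      have a2 := h5 (v + (-1 : ℝ) • N) (by rw [map_add, map_smul, hv, hN1]; norm_num)
      have a3 := h5 N (by rw [hN1]; norm_num)
      have a4 := hpar v N
      simp only [map_add, map_smul, add_apply, smul_apply, smul_eq_mul] at a1 a2
      linear_combination (a1 + a2 - a4) / 2 - a3
    · exact h5 v hv
  refine ⟨fun v => ?_, fun v => ?_⟩
  · have h7 := h6 v
    rw [hlN] at h7
    have h8 : Real.exp (-Ψ x) * Real.exp (Ψ x) = 1 := by rw [← Real.exp_add]; simp
    simp only [hB] at h7
    linear_combination (1 / 2 * Real.exp (-Ψ x)) * h7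
      - (Qn g Ω x v + 1 / 2 * dd Ψ x v * nf g Ω x v - 1 / 2 * dd Ψ x N * at₂ g x v v) * h8
  · have := h3 v
    rw [hlN] at this
    simp only [hl] at this
    linarith

/-- The slice equation implies the conformal Killing tensor equation. -/
lemma IsSliceFrame.nablaT_of_sliceEq (h : IsSliceFrame g Ω κ) (hα : SmoothFun α)
    (hγ : ∀ a b, SmoothFun fun x => γ x a b) (hΨ : SmoothFun Ψ) (hs : ∀ x, (γ x).IsSymm)
    (hc : ∀ a b, SliceConstant Ω fun x => γ x a b) {x : M} {c : Fin 2 → ℝ}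
    (hk : ∀ a v, nablaC g (flat g (κ a)) x v = c a * at₂ g x v v) (hS : SliceEq g Ω κ γ Ψ x)
    (v : E4) : nablaT g (sliceTensor g Ω κ α γ Ψ) x v = (mu g κ α γ c x v
      + Real.exp (Ψ x) * dd Ψ x (nv g Ω x) * nf g Ω x v) * at₂ g x v v := by
  rw [h.nablaT_eq hα hγ hΨ hs hc hk, hS v]
  have h8 : Real.exp (-Ψ x) * Real.exp (Ψ x) = 1 := by rw [← Real.exp_add]; simp
  linear_combination (-nf g Ω x v * gq g Ω κ γ x v) * h8

/-! ### Consequences of the slice equation -/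

lemma IsSliceFrame.gq_add_smul (h : IsSliceFrame g Ω κ) (x : M) (w : E4) (ν : ℝ) :
    gq g Ω κ γ x (w + ν • nv g Ω x) = gq g Ω κ γ x w := by
  simp only [gq, map_add, map_smul, h.kf_nv, smul_zero, add_zero]

lemma IsSliceFrame.metric_add_smul (h : IsSliceFrame g Ω κ) {x : M} {w : E4}
    (hw : dd Ω x w = 0) (ν : ℝ) :
    at₂ g x (w + ν • nv g Ω x) (w + ν • nv g Ω x) = at₂ g x w w + ν ^ 2 := by
  have h1 : at₂ g x (nv g Ω x) w = 0 := nf_of_tangent h.metric hw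
  have h2 : at₂ g x w (nv g Ω x) = 0 := by rw [h.metric.isSymmT, h1]
  have h3 : at₂ g x (nv g Ω x) (nv g Ω x) = 1 := normal_normal h.metric h.foliation x
  simp only [map_add, map_smul, add_apply, smul_apply, smul_eq_mul, h1, h2, h3]
  ring

/-- Compare the slice equation at `w` and at `w + n`: the left side changes by `-dφ(w)/φ`, the right
side by `-dΨ(w)/2`. Consequently `Ψ - 2 log φ` is constant on the slices. -/
lemma IsSliceFrame.dd_of_sliceEq (h : IsSliceFrame g Ω κ) {x : M} (hS : SliceEq g Ω κ γ Ψ x)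
    {w : E4} (hw : dd Ω x w = 0) : dd Ψ x w = 2 * (dd (lapse g Ω) x w / lapse g Ω x) := by
  have h1 := hS (w + (1 : ℝ) • nv g Ω x)
  have h2 := hS w
  rw [Qn_add_smul h.metric h.foliation x hw, h.gq_add_smul, h.metric_add_smul hw, h2] at h1
  simp only [map_add, map_smul, smul_eq_mul, nf_nv h.metric h.foliation,
    nf_of_tangent h.metric hw] at h1
  linarith

lemma IsSliceFrame.Qn_orthogonal (_h : IsSliceFrame g Ω κ) {x : M} (hS : SliceEq g Ω κ γ Ψ x)
    {σ : E4} (hn : nf g Ω x σ = 0) (hσ : ∀ a, kf g κ a x σ = 0) :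
    Qn g Ω x σ = 1 / 2 * dd Ψ x (nv g Ω x) * at₂ g x σ σ := by
  rw [hS σ, hn, gq]
  simp only [hσ]
  simp

/-- The normal derivative of `Ψ` is fixed by the umbilicity factor orthogonal to the `κ_a`, the
tangential ones by the lapse; neither involves `γ`. So any two slice-reducible tensors have
functions `Ψ` with the same differential. -/
lemma IsSliceFrame.dd_unique (h : IsSliceFrame g Ω κ) {x : M} {γ₁ : M → Matrix (Fin 2) (Fin 2) ℝ}
    {Ψ₁ : M → ℝ} (hS : SliceEq g Ω κ γ Ψ x) (hS₁ : SliceEq g Ω κ γ₁ Ψ₁ x) : dd Ψ x = dd Ψ₁ x := by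
  have h1 : dd Ψ x (nv g Ω x) = dd Ψ₁ x (nv g Ω x) := by
    obtain ⟨σ, h1, h2, h3⟩ := h.exists_orthogonal x
    have h4 := h.Qn_orthogonal hS (nf_of_tangent h.metric h1) h2
    rw [h.Qn_orthogonal hS₁ (nf_of_tangent h.metric h1) h2] at h4
    have := mul_right_cancel₀ h3.ne' h4
    linarith
  ext v
  have h2 : dd Ω x (v + (-nf g Ω x v) • nv g Ω x) = 0 := by
    refine dd_of_nf h.metric h.foliation ?_
    rw [map_add, map_smul, nf_nv h.metric h.foliation, smul_eq_mul]
    ring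
  have h3 := h.dd_of_sliceEq hS h2
  rw [← h.dd_of_sliceEq hS₁ h2, map_add, map_add, map_smul, map_smul, h1] at h3
  exact add_right_cancel h3

end

section

variable [IsManifold (𝓡 4) ∞ M] {g : Tensor2 M} {Ω : M → ℝ} {κ : Fin 2 → VField M}
  {γ : M → Matrix (Fin 2) (Fin 2) ℝ} {α Ψ : M → ℝ}

lemma SmoothFun.inv {f : M → ℝ} (hf : SmoothFun f) (h0 : ∀ x, f x ≠ 0) :
    SmoothFun fun x => (f x)⁻¹ := hf.comp fun x => contDiffAt_inv ℝ (h0 x)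

lemma SmoothFun.log {f : M → ℝ} (hf : SmoothFun f) (h0 : ∀ x, f x ≠ 0) :
    SmoothFun fun x => Real.log (f x) := hf.comp fun x => Real.contDiffAt_log.2 (h0 x)

lemma SmoothFun.smul_const {f : M → ℝ} (hf : SmoothFun f) (c : ℝ) : SmoothFun fun x => c * f x :=
  (SmoothFun.const c).mul hf

lemma dd_const_mul {f : M → ℝ} (hf : SmoothFun f) (c : ℝ) (x : M) (v : E4) :
    dd (fun z => c * f z) x v = c * dd f x v := by
  rw [dd_mul (SmoothFun.const c) hf, dd_const]
  ring

lemma dd_log {f : M → ℝ} (hf : SmoothFun f) {x : M} (h0 : f x ≠ 0) (v : E4) :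
    dd (fun z => Real.log (f z)) x v = (f x)⁻¹ * dd f x v :=
  dd_comp hf (Real.hasDerivAt_log h0) v

lemma prime_eq_dd (g : Tensor2 M) (Ω f : M → ℝ) (x : M) :
    prime g Ω f x = lapse g Ω x * dd f x (nv g Ω x) := rfl

/-! ### The slice equation under Weyl rescaling -/

lemma gq_weyl (hg : IsLorentzMetric g) {r : M → ℝ} (hr : SmoothFun r) (hr0 : ∀ x, 0 < r x)
    (x : M) (v : E4) : gq (weyl r g) Ω κ γ x v = r x ^ 3 * gq g Ω κ γ x v := by
  have h1 : ∀ a, kf (weyl r g) κ a x v = r x ^ 2 * kf g κ a x v := fun a => rfl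
  have h0 := (hr0 x).ne'
  simp only [gq, nv_weyl hg hr hr0, h1, map_smul, smul_eq_mul, Fin.sum_univ_two]
  field_simp

/-- The inhomogeneous terms of `Qn_weyl` are exactly those produced by the shift of `Ψ`, while all
other terms scale by the same factor `r`. The matrix `γ` is unchanged. -/
lemma IsSliceFrame.sliceEq_weyl (h : IsSliceFrame g Ω κ) {r : M → ℝ} (hr : SmoothFun r)
    (hr0 : ∀ x, 0 < r x) (hΨ : SmoothFun Ψ) (x : M) :
    SliceEq (Spacetime.weyl r g) Ω κ γ (fun z => Ψ z + 2 * Real.log (r z)) x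
      ↔ SliceEq g Ω κ γ Ψ x := by
  have h0 := hr0 x
  have hl := hr.log fun z => (hr0 z).ne'
  have h1 : ∀ v, dd (fun z => Ψ z + 2 * Real.log (r z)) x v
      = dd Ψ x v + 2 * ((r x)⁻¹ * dd r x v) := by
    intro v
    rw [dd_add hΨ (hl.smul_const 2), dd_const_mul hl, dd_log hr h0.ne']
  have h2 : Real.exp (-(Ψ x + 2 * Real.log (r x))) = Real.exp (-Ψ x) * (r x ^ 2)⁻¹ := by
    rw [neg_add, Real.exp_add, Real.exp_neg (2 * _), two_mul, Real.exp_add, Real.exp_log h0, sq]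
  refine forall_congr' fun v => ?_
  rw [Qn_weyl h.metric hr hr0 h.foliation, gq_weyl h.metric hr hr0, h1, h1, h2,
    nv_weyl h.metric hr hr0, nf_weyl h.metric hr hr0, at₂_weyl, map_smul, map_smul]
  simp only [smul_apply, smul_eq_mul]
  have e : 1 / 2 * ((r x)⁻¹ * dd Ψ x (nv g Ω x) + 2 * ((r x)⁻¹ * ((r x)⁻¹ * dd r x (nv g Ω x))))
        * (r x ^ 2 * at₂ g x v v)
      - 1 / 2 * (Real.exp (-Ψ x) * (r x ^ 2)⁻¹) * (r x ^ 3 * gq g Ω κ γ x v)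
      - 1 / 2 * (r x * nf g Ω x v) * (dd Ψ x v + 2 * ((r x)⁻¹ * dd r x v))
      = r x * (1 / 2 * dd Ψ x (nv g Ω x) * at₂ g x v v
        - 1 / 2 * Real.exp (-Ψ x) * gq g Ω κ γ x v - 1 / 2 * nf g Ω x v * dd Ψ x v)
        + dd r x (nv g Ω x) * at₂ g x v v - dd r x v * nf g Ω x v := by
    field_simp
    ring
  rw [e]
  constructor
  · intro h3
    refine mul_left_cancel₀ h0.ne' ?_
    linarith
  · intro h3
    rw [h3]
    ring

/-! ### The Gram matrix -/

lemma smooth_gram (hg : IsLorentzMetric g) (hκ : ∀ a, SmoothVField (κ a)) (a b : Fin 2) :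
    SmoothFun fun x => gram g κ x a b := SmoothFun.inner hg (hκ a) (hκ b)

lemma gram_symm (hg : IsLorentzMetric g) (κ : Fin 2 → VField M) (x : M) :
    gram g κ x 1 0 = gram g κ x 0 1 := hg.symm _ _ _

lemma smooth_gram_det (hg : IsLorentzMetric g) (hκ : ∀ a, SmoothVField (κ a)) :
    SmoothFun fun x => (gram g κ x).det := by
  have h := smooth_gram hg hκ
  have h1 := ((h 0 0).mul (h 1 1)).add (((h 0 1).mul (h 1 0)).smul_const (-1))
  refine (congrArg SmoothFun (funext fun x => ?_)).mp h1
  rw [Matrix.det_fin_two]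
  ring

lemma gram_inv (x : M) : (gram g κ x)⁻¹ = (gram g κ x).det⁻¹ •
    !![gram g κ x 1 1, -gram g κ x 0 1; -gram g κ x 1 0, gram g κ x 0 0] := by
  rw [Matrix.inv_def, Matrix.adjugate_fin_two, Ring.inverse_eq_inv']

lemma IsSliceFrame.smooth_gram_inv (h : IsSliceFrame g Ω κ) (a b : Fin 2) :
    SmoothFun fun x => (gram g κ x)⁻¹ a b := by
  have hG := smooth_gram h.metric h.smooth
  have hd := (smooth_gram_det h.metric h.smooth).inv fun x => (h.signature x).ne
  have e : (fun x => (gram g κ x)⁻¹ a b) = fun x => (gram g κ x).det⁻¹ *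
    !![gram g κ x 1 1, -gram g κ x 0 1; -gram g κ x 1 0, gram g κ x 0 0] a b := by
    funext x
    rw [gram_inv]
    rfl
  rw [e]
  fin_cases a <;> fin_cases b
  · exact hd.mul (hG 1 1)
  · refine (congrArg SmoothFun (funext fun x => ?_)).mp (hd.mul ((hG 0 1).smul_const (-1)))
    simp
  · refine (congrArg SmoothFun (funext fun x => ?_)).mp (hd.mul ((hG 1 0).smul_const (-1)))
    simp
  · exact hd.mul (hG 0 0)

/-- The normal derivative of the Gram matrix of Killing fields. -/
lemma IsSliceFrame.dd_gram (h : IsSliceFrame g Ω κ) (hs : ∀ x, (γ x).IsSymm) {x : M}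
    (hk : ∀ a v, nablaC g (flat g (κ a)) x v = 0) (hS : SliceEq g Ω κ γ Ψ x) (a b : Fin 2) :
    dd (fun z => gram g κ z a b) x (nv g Ω x) = dd Ψ x (nv g Ω x) * gram g κ x a b
      - Real.exp (-Ψ x) * ∑ c, ∑ d, dd (fun z => γ z c d) x (nv g Ω x)
        * (gram g κ x c a * gram g κ x d b) := by
  have h1 := Qn_polar_killing h.metric h.foliation (h.smooth a) (h.smooth b) (h.tangent a)
    (h.tangent b) (hk a) (hk b)
  have h2 : dd (fun z => gram g κ z a b) x (nv g Ω x)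
    = dd (fun z => at₂ g z (atV (κ a) z) (atV (κ b) z)) x (nv g Ω x) := rfl
  have hn : ∀ a, nf g Ω x (atV (κ a) x) = 0 := fun a => nf_of_tangent h.metric (h.dd_kv a x)
  have hk1 : ∀ a c, kf g κ c x (atV (κ a) x) = gram g κ x c a := fun a c => rfl
  have hk2 : ∀ a b, at₂ g x (atV (κ a) x) (atV (κ b) x) = gram g κ x a b := fun a c => rfl
  have hγ : (fun z => γ z 1 0) = fun z => γ z 0 1 := funext fun z => (hs z).apply 0 1
  have hsym := gram_symm h.metric κ x
  have hba : gram g κ x b a = gram g κ x a b := h.metric.symm _ _ _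
  rw [h2, ← h1, hS, hS, hS]
  simp only [map_add, add_apply, hn, gq, hk1, hk2, hγ, Fin.sum_univ_two, hba]
  ring

/-- Inserting `dd_gram` into the derivative of `𝒢⁻¹ 𝒢 = 1` gives `-Ψ_n 𝒢⁻¹ + e^{-Ψ} γ_n` for the
normal derivative of `𝒢⁻¹`, and the factor `e^Ψ` absorbs the first term. Thus the normal derivative
of `e^Ψ 𝒢^{ab}` is slice data up to the lapse, although `e^Ψ 𝒢^{ab}` itself need not be. -/
lemma IsSliceFrame.dd_exp_gram_inv (h : IsSliceFrame g Ω κ) (hs : ∀ x, (γ x).IsSymm) (hΨ : SmoothFun Ψ)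
    {x : M} (hk : ∀ a v, nablaC g (flat g (κ a)) x v = 0) (hS : SliceEq g Ω κ γ Ψ x)
    (a b : Fin 2) :
    dd (fun z => Real.exp (Ψ z) * (gram g κ z)⁻¹ a b) x (nv g Ω x)
      = dd (fun z => γ z a b) x (nv g Ω x) := by
  set N := nv g Ω x
  have hD := h.dd_gram hs hk hS
  have hG := smooth_gram h.metric h.smooth
  have hI := h.smooth_gram_inv
  have h0 := (h.signature x).ne
  have hγ : (fun z => γ z 1 0) = fun z => γ z 0 1 := funext fun z => (hs z).apply 0 1
  have hsym := gram_symm h.metric κ x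
  -- differentiate `𝒢⁻¹ 𝒢 = 1`
  have hmul : ∀ c d, ∑ e, (dd (fun z => (gram g κ z)⁻¹ c e) x N * gram g κ x e d
      + (gram g κ x)⁻¹ c e * dd (fun z => gram g κ z e d) x N) = 0 := by
    intro c d
    have h1 : (fun z => (gram g κ z)⁻¹ c 0 * gram g κ z 0 d + (gram g κ z)⁻¹ c 1 * gram g κ z 1 d)
        = fun _ => (1 : Matrix (Fin 2) (Fin 2) ℝ) c d := by
      funext z
      have h2 := congrFun (congrFun (Matrix.nonsing_inv_mul (gram g κ z)
        (Ne.isUnit (h.signature z).ne)) c) d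
      rw [Matrix.mul_apply, Fin.sum_univ_two] at h2
      exact h2
    have h3 := dd_const (M := M) ((1 : Matrix (Fin 2) (Fin 2) ℝ) c d) x N
    rw [← h1, dd_add ((hI c 0).mul (hG 0 d)) ((hI c 1).mul (hG 1 d)), dd_mul (hI c 0) (hG 0 d),
      dd_mul (hI c 1) (hG 1 d)] at h3
    rw [Fin.sum_univ_two]
    linarith
  rw [dd_mul hΨ.exp (hI a b), dd_exp hΨ]
  set I : Matrix (Fin 2) (Fin 2) ℝ := (gram g κ x)⁻¹
  set G : Matrix (Fin 2) (Fin 2) ℝ := gram g κ x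
  set D : Matrix (Fin 2) (Fin 2) ℝ := Matrix.of fun c d => dd (fun z => (gram g κ z)⁻¹ c d) x N
  set D' : Matrix (Fin 2) (Fin 2) ℝ := Matrix.of fun c d => dd (fun z => gram g κ z c d) x N
  set P : Matrix (Fin 2) (Fin 2) ℝ := Matrix.of fun c d => dd (fun z => γ z c d) x N
  have m1 : D * G + I * D' = 0 := by
    ext c d
    rw [Matrix.add_apply, Matrix.mul_apply, Matrix.mul_apply, ← Finset.sum_add_distrib]
    exact hmul c d
  have m2 : I * G = 1 := Matrix.nonsing_inv_mul _ (Ne.isUnit h0)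
  have m3 : G * I = 1 := Matrix.mul_nonsing_inv _ (Ne.isUnit h0)
  have m4 : D' = dd Ψ x N • G - Real.exp (-Ψ x) • (G * P * G) := by
    ext c d
    have h1 := hD c d
    have hG2 : ∀ i j, G i j = G j i := fun i j => h.metric.symm _ _ _
    have hP : ∀ i j, dd (fun z => γ z i j) x (nv g Ω x) = P i j := fun i j => rfl
    refine h1.trans ?_
    rw [Matrix.sub_apply, Matrix.smul_apply, Matrix.smul_apply, Matrix.mul_apply, smul_eq_mul,
      smul_eq_mul]
    simp only [Matrix.mul_apply, Fin.sum_univ_two, hP]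
    rw [hG2 0 c, hG2 1 c]
    ring
  have m5 : D = -(dd Ψ x N) • I + Real.exp (-Ψ x) • P := by
    have e1 : D = (D * G + I * D') * I - I * D' * I := by
      rw [Matrix.add_mul, Matrix.mul_assoc D, m3, Matrix.mul_one, add_sub_cancel_right]
    have e2 : I * (G * P * G) * I = P := by
      rw [← Matrix.mul_assoc, ← Matrix.mul_assoc, m2, Matrix.one_mul, Matrix.mul_assoc, m3,
        Matrix.mul_one]
    rw [e1, m1, m4, Matrix.mul_sub, Matrix.sub_mul, Matrix.mul_smul, Matrix.mul_smul, m2,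
      Matrix.smul_mul, Matrix.smul_mul, Matrix.one_mul, e2, Matrix.zero_mul, neg_smul]
    abel
  have m6 : dd (fun z => (gram g κ z)⁻¹ a b) x N = -(dd Ψ x N) * I a b + Real.exp (-Ψ x) * P a b :=
    congrFun (congrFun m5 a) b
  have h8 : Real.exp (Ψ x) * Real.exp (-Ψ x) = 1 := by rw [← Real.exp_add]; simp
  rw [m6]
  change _ = P a b
  linear_combination P a b * h8

end

section

variable [IsManifold (𝓡 4) ∞ M] {g : Tensor2 M} {Ω : M → ℝ}

/-! ### Functions constant on the slices -/

lemma eq_of_fderiv_segment {E : Type*} [NormedAddCommGroup E] [NormedSpace ℝ E] {h : E → ℝ}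
    {U : Set E} (hU : Convex ℝ U) {h' : E → E →L[ℝ] ℝ} (hd : ∀ z ∈ U, HasFDerivAt h (h' z) z)
    {a b : E} (ha : a ∈ U) (hb : b ∈ U) (h0 : ∀ z ∈ U, h' z (b - a) = 0) : h b = h a := by
  have hmem : ∀ t ∈ Set.Icc (0 : ℝ) 1, a + t • (b - a) ∈ U := fun t ht =>
    hU.add_smul_sub_mem ha hb ht
  have h1 : ∀ t ∈ Set.Icc (0 : ℝ) 1, HasDerivAt (fun t : ℝ => h (a + t • (b - a))) 0 t := by
    intro t ht
    have h2 : HasDerivAt (fun t : ℝ => a + t • (b - a)) (b - a) t := by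
      simpa using ((hasDerivAt_id t).smul_const (b - a)).const_add a
    have h3 := (hd _ (hmem t ht)).comp_hasDerivAt t h2
    rwa [h0 _ (hmem t ht)] at h3
  have h4 := constant_of_has_deriv_right_zero (f := fun t : ℝ => h (a + t • (b - a)))
    (a := 0) (b := 1) (fun t ht => (h1 t ht).continuousAt.continuousWithinAt)
    (fun t ht => (h1 t (Set.Ico_subset_Icc_self ht)).hasDerivWithinAt) 1 (by simp)
  simpa using h4

/-- A function whose differential is proportional to that of a submersion factors through it
locally. -/
lemma exists_local_factor {E : Type*} [NormedAddCommGroup E] [NormedSpace ℝ E] [CompleteSpace E]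
    {f w : E → ℝ} {y₀ : E} (hf : ContDiffAt ℝ ∞ f y₀) (hw : ContDiffAt ℝ ∞ w y₀)
    (hw0 : fderiv ℝ w y₀ ≠ 0)
    (hfw : ∀ᶠ y in 𝓝 y₀, ∀ v, fderiv ℝ w y v = 0 → fderiv ℝ f y v = 0) :
    ∃ F : ℝ → ℝ, ContDiffAt ℝ ∞ F (w y₀) ∧ ∀ᶠ y in 𝓝 y₀, f y = F (w y) := by
  obtain ⟨e, he⟩ : ∃ e, fderiv ℝ w y₀ e = 1 := by
    obtain ⟨e, he⟩ := DFunLike.ne_iff.1 hw0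
    refine ⟨(fderiv ℝ w y₀ e)⁻¹ • e, ?_⟩
    rw [map_smul, smul_eq_mul]
    exact inv_mul_cancel₀ he
  set l := fderiv ℝ w y₀ with hl
  -- A straightening of `w`: its derivative at `y₀` is the identity, and `l (Φ y - y₀) = w y - w
  -- y₀`. In the new coordinates `w` is affine.
  set Φ : E → E := fun y => y + (w y - w y₀ - l (y - y₀)) • e with hΦ
  have hΦ0 : Φ y₀ = y₀ := by simp [hΦ]
  have hΦc : ContDiffAt ℝ ∞ Φ y₀ := by
    have h1 : ContDiffAt ℝ ∞ (fun y => l (y - y₀)) y₀ :=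
      l.contDiff.contDiffAt.comp y₀ (contDiffAt_id.sub contDiffAt_const)
    exact contDiffAt_id.add (((hw.sub contDiffAt_const).sub h1).smul contDiffAt_const)
  have hΦd : ∀ y, DifferentiableAt ℝ w y →
      HasFDerivAt Φ (ContinuousLinearMap.id ℝ E + (fderiv ℝ w y - l).smulRight e) y := by
    intro y hy
    have h1 : HasFDerivAt (fun y => l (y - y₀)) l y :=
      l.hasFDerivAt.comp y ((hasFDerivAt_id y).sub_const y₀)
    exact (hasFDerivAt_id y).add (((hy.hasFDerivAt.sub_const _).sub h1).smul_const e)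
  have hΦd0 : HasFDerivAt Φ ((ContinuousLinearEquiv.refl ℝ E : E ≃L[ℝ] E) : E →L[ℝ] E) y₀ := by
    have h1 := hΦd y₀ (hw.differentiableAt (by simp))
    rw [← hl, sub_self] at h1
    convert h1 using 1
    ext v
    simp
  set P := hΦc.toOpenPartialHomeomorph Φ hΦd0 (by simp) with hP
  have hPs : ContDiffAt ℝ ∞ P.symm y₀ := by
    have := hΦc.to_localInverse hΦd0 (by simp)
    rw [hΦ0] at this
    exact this
  have hy₀ : y₀ ∈ P.source := hΦc.mem_toOpenPartialHomeomorph_source hΦd0 (by simp)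
  have hPy : ∀ y, P y = Φ y := fun y => rfl
  have hPt : y₀ ∈ P.target := by
    have := P.map_source hy₀
    rwa [hPy, hΦ0] at this
  have hP0 : P.symm y₀ = y₀ := by
    have := P.left_inv hy₀
    rwa [hPy, hΦ0] at this
  have hlΦ : ∀ y, l (Φ y - y₀) = w y - w y₀ := by
    intro y
    simp only [hΦ, map_sub, map_add, map_smul, he, smul_eq_mul]
    ring
  set h : E → ℝ := fun z => f (P.symm z) with hh
  have hhc : ContDiffAt ℝ ∞ h y₀ := ContDiffAt.comp y₀ (by rwa [hP0]) hPs
  -- near `y₀` the differential of `h` is proportional to `l`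
  have htend : Filter.Tendsto P.symm (𝓝 y₀) (𝓝 y₀) := by
    have := hPs.continuousAt
    rwa [ContinuousAt, hP0] at this
  have ev1 : ∀ᶠ z in 𝓝 y₀, DifferentiableAt ℝ h z :=
    ((hhc.of_le (m := 1) (by exact_mod_cast le_top)).eventually (by simp)).mono
      fun z hz => hz.differentiableAt (by simp)
  have ev2 : ∀ᶠ z in 𝓝 y₀, DifferentiableAt ℝ P.symm z :=
    ((hPs.of_le (m := 1) (by exact_mod_cast le_top)).eventually (by simp)).mono
      fun z hz => hz.differentiableAt (by simp)
  have ev3 : ∀ᶠ z in 𝓝 y₀, DifferentiableAt ℝ w (P.symm z) :=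
    htend.eventually (((hw.of_le (m := 1) (by exact_mod_cast le_top)).eventually (by simp)).mono
      fun z hz => hz.differentiableAt (by simp))
  have ev4 : ∀ᶠ z in 𝓝 y₀, DifferentiableAt ℝ f (P.symm z) :=
    htend.eventually (((hf.of_le (m := 1) (by exact_mod_cast le_top)).eventually (by simp)).mono
      fun z hz => hz.differentiableAt (by simp))
  have ev5 := htend.eventually hfw
  have ev6 : ∀ᶠ z in 𝓝 y₀, z ∈ P.target := P.open_target.mem_nhds hPt
  have ev7 : ∀ᶠ z in 𝓝 y₀, DifferentiableAt ℝ h z ∧ ∀ v, l v = 0 → fderiv ℝ h z v = 0 := by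
    filter_upwards [ev1, ev2, ev3, ev4, ev5, ev6.eventually_nhds] with z h1 h2 h3 h4 h5 h6
    refine ⟨h1, fun v hv => ?_⟩
    have h7 : fderiv ℝ h z = (fderiv ℝ f (P.symm z)).comp (fderiv ℝ P.symm z) :=
      (h4.hasFDerivAt.comp z h2.hasFDerivAt).fderiv
    rw [h7, ContinuousLinearMap.comp_apply]
    refine h5 _ ?_
    have h8 : HasFDerivAt (fun z => w (P.symm z)) l z := by
      have h9 : HasFDerivAt (fun z => l (z - y₀) + w y₀) l z :=
        (l.hasFDerivAt.comp z ((hasFDerivAt_id z).sub_const y₀)).add_const _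
      refine h9.congr_of_eventuallyEq (h6.mono fun z' hz' => ?_)
      have h10 := hlΦ (P.symm z')
      rw [← hPy, P.right_inv hz'] at h10
      change w (P.symm z') = l (z' - y₀) + w y₀
      linarith
    have h11 := congrArg (fun L => L v) (h8.unique (h3.hasFDerivAt.comp z h2.hasFDerivAt))
    simp only [ContinuousLinearMap.comp_apply] at h11
    rw [← h11, hv]
  obtain ⟨ε, hε, hball⟩ := Metric.eventually_nhds_iff_ball.1 ev7
  refine ⟨fun c => h (y₀ + (c - w y₀) • e), ?_, ?_⟩
  · have h1 : ContDiffAt ℝ ∞ (fun c : ℝ => y₀ + (c - w y₀) • e) (w y₀) :=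
      contDiffAt_const.add ((contDiffAt_id.sub contDiffAt_const).smul contDiffAt_const)
    exact ContDiffAt.comp (w y₀) (g := h) (by simpa only [sub_self, zero_smul, add_zero] using hhc) h1
  · have c1 : Filter.Tendsto Φ (𝓝 y₀) (𝓝 y₀) := by
      have := hΦc.continuousAt
      rwa [ContinuousAt, hΦ0] at this
    have c2 : Filter.Tendsto (fun y => y₀ + (w y - w y₀) • e) (𝓝 y₀) (𝓝 y₀) := by
      have : ContinuousAt (fun y => y₀ + (w y - w y₀) • e) y₀ :=
        continuousAt_const.add ((hw.continuousAt.sub continuousAt_const).smul continuousAt_const)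
      simpa [ContinuousAt] using this
    filter_upwards [c1.eventually (Metric.ball_mem_nhds y₀ hε),
      c2.eventually (Metric.ball_mem_nhds y₀ hε), P.open_source.mem_nhds hy₀] with y h1 h2 h3
    have h4 : f y = h (Φ y) := by
      rw [hh, ← hPy]
      simp only [P.left_inv h3]
    rw [h4]
    -- Both endpoints have the same value of `l`, so the segment between them runs in a direction
    -- where the derivative of `h` vanishes.
    refine eq_of_fderiv_segment (convex_ball y₀ ε) (h' := fderiv ℝ h)
      (fun z hz => (hball z hz).1.hasFDerivAt) h2 h1 fun z hz => (hball z hz).2 _ ?_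
    have h5 := hlΦ y
    have h6 : Φ y - (y₀ + (w y - w y₀) • e) = (Φ y - y₀) - (w y - w y₀) • e := by abel
    rw [h6, map_sub, h5, map_smul, he, smul_eq_mul, mul_one, sub_self]

lemma dd_ne_zero (hg : IsLorentzMetric g) (hΩ : IsTimelikeFoliation g Ω) (x : M) :
    dd Ω x ≠ 0 := by
  intro h
  have := dd_nv hg hΩ x
  rw [h] at this
  simp at this

lemma SliceConstant.exists_local (hg : IsLorentzMetric g) (hΩ : IsTimelikeFoliation g Ω)
    {f : M → ℝ} (hf : SmoothFun f) (hc : SliceConstant Ω f) (x : M) :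
    ∃ F : ℝ → ℝ, ContDiffAt ℝ ∞ F (Ω x) ∧ ∀ᶠ z in 𝓝 x, f z = F (Ω z) := by
  have h1 := dd_ne_zero hg hΩ x
  rw [Spacetime.dd_eq hΩ.smooth] at h1
  obtain ⟨F, hF, hev⟩ := exists_local_factor (hf.contDiffAt x) (hΩ.smooth.contDiffAt x) h1
    ((target_eventually x).mono fun y hy v hv => by
      rw [← dirDeriv_coordMap hΩ.smooth x hy] at hv
      rw [← dirDeriv_coordMap hf x hy]
      exact hc _ _ hv)
  rw [locF_self] at hF
  refine ⟨F, hF, ?_⟩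
  have h2 := (continuousAt_extChartAt (I := 𝓡 4) x).eventually hev
  filter_upwards [h2, extChartAt_source_mem_nhds (I := 𝓡 4) x] with z hz hzs
  rwa [locF, locF, (extChartAt (𝓡 4) x).left_inv hzs] at hz

/-- Locally the function factors through `Ω`, so it is locally constant on each slice; connectedness
of the slices makes it globally constant there. -/
lemma SliceConstant.eq_of_eq (hg : IsLorentzMetric g) (hΩ : IsTimelikeFoliation g Ω)
    {f : M → ℝ} (hf : SmoothFun f) (hc : SliceConstant Ω f) {x y : M} (hxy : Ω x = Ω y) :
    f x = f y := by
  refine (hΩ.connected (Ω y)).induction₂ (fun a b => f a = f b) (fun a ha => ?_)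
    (fun a b c _ _ _ h1 h2 => h1.trans h2) (fun a b _ _ h => h.symm) hxy rfl
  obtain ⟨F, -, hev⟩ := hc.exists_local hg hΩ hf a
  have h1 := hev.self_of_nhds
  filter_upwards [nhdsWithin_le_nhds hev, self_mem_nhdsWithin] with b hb hb'
  have h2 : Ω a = Ω b := Eq.trans ha (Eq.symm hb')
  rw [h1, hb, h2]

/-- `Ω` is a submersion and hence open, so the germ at `Ω x` of a function of the parameter is
determined by what happens near `x`. -/
lemma nhds_le_map (hg : IsLorentzMetric g) (hΩ : IsTimelikeFoliation g Ω) (x : M) :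
    𝓝 (Ω x) ≤ Filter.map Ω (𝓝 x) := by
  have h1 : HasStrictFDerivAt (locF Ω x) (dd Ω x) (extChartAt (𝓡 4) x x) := by
    rw [dd_eq hΩ.smooth]
    exact (hΩ.smooth.contDiffAt x).hasStrictFDerivAt (by simp)
  have h2 := h1.map_nhds_eq_of_surj (by
    refine LinearMap.range_eq_top.2 fun c => ?_
    have := dd_nv hg hΩ x
    refine ⟨(c * lapse g Ω x) • nv g Ω x, ?_⟩
    change dd Ω x ((c * lapse g Ω x) • nv g Ω x) = c
    rw [map_smul, smul_eq_mul, mul_assoc, this, mul_one])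
  rw [locF_self] at h2
  rw [← h2]
  have h3 : Filter.Tendsto (extChartAt (𝓡 4) x).symm (𝓝 (extChartAt (𝓡 4) x x)) (𝓝 x) := by
    have := continuousAt_extChartAt_symm (I := 𝓡 4) x
    rwa [ContinuousAt, extChartAt_to_inv] at this
  exact Filter.map_mono (m := Ω) h3

/-- A smooth function constant on the slices is a smooth function of the foliation parameter. -/
lemma SliceConstant.exists_factor (hg : IsLorentzMetric g) (hΩ : IsTimelikeFoliation g Ω)
    {f : M → ℝ} (hf : SmoothFun f) (hc : SliceConstant Ω f) :
    ∃ F : ℝ → ℝ, (∀ x, f x = F (Ω x)) ∧ ∀ x, ContDiffAt ℝ ∞ F (Ω x) := by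
  classical
  let F : ℝ → ℝ := fun c => if h : ∃ x, Ω x = c then f h.choose else 0
  have hF : ∀ x, f x = F (Ω x) := by
    intro x
    have h : ∃ y, Ω y = Ω x := ⟨x, rfl⟩
    simp only [F, dif_pos h]
    exact hc.eq_of_eq hg hΩ hf h.choose_spec.symm
  refine ⟨F, hF, fun x => ?_⟩
  obtain ⟨F₀, h1, h2⟩ := hc.exists_local hg hΩ hf x
  refine h1.congr_of_eventuallyEq (nhds_le_map hg hΩ x ?_)
  change ∀ᶠ z in 𝓝 x, F (Ω z) = F₀ (Ω z)
  filter_upwards [h2] with z hz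
  rw [← hF, hz]

/-- Derivatives normal to the slices preserve constancy on the slices. -/
lemma SliceConstant.prime (hg : IsLorentzMetric g) (hΩ : IsTimelikeFoliation g Ω)
    {f : M → ℝ} (hf : SmoothFun f) (hc : SliceConstant Ω f) :
    SliceConstant Ω (prime g Ω f) := by
  obtain ⟨F, h1, h2⟩ := hc.exists_factor hg hΩ hf
  have h3 : Spacetime.prime g Ω f = fun x => deriv F (Ω x) := by
    funext x
    have h4 : dd f x (nv g Ω x) = deriv F (Ω x) * dd Ω x (nv g Ω x) := by
      rw [funext h1]
      exact dd_comp hΩ.smooth ((h2 x).differentiableAt (by simp)).hasDerivAt _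
    change lapse g Ω x * dd f x (nv g Ω x) = _
    have := dd_nv hg hΩ x
    rw [h4]
    linear_combination deriv F (Ω x) * this
  intro x v hv
  rw [h3]
  have h5 : DifferentiableAt ℝ (deriv F) (Ω x) := by
    have h6 : ContDiffAt ℝ 1 (fderiv ℝ F) (Ω x) := (h2 x).fderiv_right (by norm_num; exact ENat.LEInfty.out)
    have h7 := (h6.differentiableAt (by simp)).clm_apply (differentiableAt_const (1 : ℝ))
    exact h7
  have h8 := dd_comp hΩ.smooth h5.hasDerivAt v
  have h9 : dd Ω x v = 0 := hv
  rw [h9, mul_zero] at h8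
  exact h8

/-- `M` is not assumed connected, so the range of `Ω` may have several components; one integrates
from a separate base point in each. -/
lemma exists_antideriv {R : Set ℝ} (hR : IsOpen R) {F : ℝ → ℝ} (hF : ContDiffOn ℝ ∞ F R) :
    ∃ A : ℝ → ℝ, ContDiffOn ℝ ∞ A R ∧ ∀ c ∈ R, HasDerivAt A (F c) c := by
  classical
  -- The base point is chosen from the component as a set, so it is the same for all points of one
  -- component.
  let b : ℝ → ℝ := fun c => if h : (connectedComponentIn R c).Nonempty then h.some else 0
  have hb : ∀ c ∈ R, b c ∈ connectedComponentIn R c := by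
    intro c hc
    have h : (connectedComponentIn R c).Nonempty := ⟨c, mem_connectedComponentIn hc⟩
    simp only [b, dif_pos h]
    exact h.some_mem
  let A : ℝ → ℝ := fun c => ∫ t in (b c)..c, F t
  have hA : ∀ c ∈ R, HasDerivAt A (F c) c := by
    intro c hc
    have h1 : connectedComponentIn R c ∈ 𝓝 c := (hR.connectedComponentIn).mem_nhds
      (mem_connectedComponentIn hc)
    have h2 : ∀ᶠ c' in 𝓝 c, A c' = ∫ t in (b c)..c', F t := by
      filter_upwards [h1] with c' hc'
      have : b c' = b c := by
        simp only [b, connectedComponentIn_eq hc']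
      simp only [A, this]
    have h3 : Set.uIcc (b c) c ⊆ R := by
      have := isPreconnected_connectedComponentIn (F := R) (x := c)
      exact (this.ordConnected.uIcc_subset (hb c hc) (mem_connectedComponentIn hc)).trans
        (connectedComponentIn_subset R c)
    have h4 : HasDerivAt (fun c' => ∫ t in (b c)..c', F t) (F c) c :=
      intervalIntegral.integral_hasDerivAt_right
        ((hF.continuousOn.mono h3).intervalIntegrable)
        (hF.continuousOn.stronglyMeasurableAtFilter hR c hc) (hF.continuousOn.continuousAt
          (hR.mem_nhds hc))
    exact h4.congr_of_eventuallyEq h2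
  refine ⟨A, ?_, hA⟩
  rw [contDiffOn_infty_iff_deriv_of_isOpen hR]
  exact ⟨fun c hc => (hA c hc).differentiableAt.differentiableWithinAt,
    hF.congr fun c hc => (hA c hc).deriv⟩

/-- Antiderivatives with respect to the foliation parameter. -/
lemma SliceConstant.exists_prime_eq (hg : IsLorentzMetric g) (hΩ : IsTimelikeFoliation g Ω)
    {f : M → ℝ} (hf : SmoothFun f) (hc : SliceConstant Ω f) :
    ∃ α : M → ℝ, SmoothFun α ∧ SliceConstant Ω α ∧ ∀ x, Spacetime.prime g Ω α x = f x := by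
  obtain ⟨F, h1, h2⟩ := hc.exists_factor hg hΩ hf
  have hR : IsOpen (Set.range Ω) := by
    rw [isOpen_iff_mem_nhds]
    rintro _ ⟨x, rfl⟩
    exact nhds_le_map hg hΩ x (Filter.mem_map.2 (Filter.univ_mem' fun z => ⟨z, rfl⟩))
  obtain ⟨A, hA1, hA2⟩ := exists_antideriv hR (F := F) (by
    rintro _ ⟨x, rfl⟩
    exact (h2 x).contDiffWithinAt)
  have hd : ∀ x v, dd (fun z => A (Ω z)) x v = F (Ω x) * dd Ω x v := fun x v =>
    dd_comp hΩ.smooth (hA2 _ ⟨x, rfl⟩) v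
  refine ⟨fun x => A (Ω x), hΩ.smooth.comp fun x => hA1.contDiffAt (hR.mem_nhds ⟨x, rfl⟩),
    fun x v hv => ?_, fun x => ?_⟩
  · have h3 : dd Ω x v = 0 := hv
    exact (hd x v).trans (by rw [h3, mul_zero])
  · have := dd_nv hg hΩ x
    change lapse g Ω x * dd (fun z => A (Ω z)) x (nv g Ω x) = _
    rw [hd, h1]
    linear_combination F (Ω x) * this

end

/-! ### Algebra of functions constant on the slices -/

section

variable [IsManifold (𝓡 4) ∞ M] {g : Tensor2 M} {Ω : M → ℝ} {κ : Fin 2 → VField M}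
  {γ : M → Matrix (Fin 2) (Fin 2) ℝ} {α Ψ : M → ℝ}

lemma SliceConstant.mul {f h : M → ℝ} (hf : SmoothFun f) (hh : SmoothFun h)
    (h1 : SliceConstant Ω f) (h2 : SliceConstant Ω h) : SliceConstant Ω fun x => f x * h x := by
  intro x (v : E4) (hv : dd Ω x v = 0)
  refine (dd_mul hf hh x v).trans ?_
  have e1 : dd f x v = 0 := h1 x v hv
  have e2 : dd h x v = 0 := h2 x v hv
  rw [e1, e2]
  ring

lemma SliceConstant.add {f h : M → ℝ} (hf : SmoothFun f) (hh : SmoothFun h)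
    (h1 : SliceConstant Ω f) (h2 : SliceConstant Ω h) : SliceConstant Ω fun x => f x + h x := by
  intro x (v : E4) (hv : dd Ω x v = 0)
  refine (dd_add hf hh x v).trans ?_
  have e1 : dd f x v = 0 := h1 x v hv
  have e2 : dd h x v = 0 := h2 x v hv
  rw [e1, e2, add_zero]

lemma SliceConstant.const_mul {f : M → ℝ} (hf : SmoothFun f) (h1 : SliceConstant Ω f) (c : ℝ) :
    SliceConstant Ω fun x => c * f x := by
  intro x (v : E4) (hv : dd Ω x v = 0)
  refine (dd_const_mul hf c x v).trans ?_
  have e1 : dd f x v = 0 := h1 x v hv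
  rw [e1, mul_zero]

lemma dd_smooth_eq {f h : M → ℝ} (e : f = h) (x : M) : dd f x = dd h x := by rw [e]

/-! ### Killing vectors of the rescaled metric -/

lemma IsSliceFrame.diffC (h : IsSliceFrame g Ω κ) (a : Fin 2) : DiffC (flat g (κ a)) :=
  (smoothC_flat h.metric (h.smooth a)).diffC

lemma IsSliceFrame.isKillingVector_iff (h : IsSliceFrame g Ω κ) (a : Fin 2) :
    IsKillingVector g (κ a) ↔ ∀ x v, nablaC g (flat g (κ a)) x v = 0 :=
  Spacetime.isKillingVector_iff (h.smooth a) (h.diffC a)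

lemma nablaC_weyl_killing (h : IsSliceFrame g Ω κ) {r : M → ℝ} (hr : SmoothFun r)
    (hr0 : ∀ x, 0 < r x) (a : Fin 2) (hk : ∀ x v, nablaC g (flat g (κ a)) x v = 0) (x : M)
    (v : E4) : nablaC (weyl r g) (flat (weyl r g) (κ a)) x v
      = (r x)⁻¹ * dd r x (kv κ a x) * at₂ (weyl r g) x v v := by
  have h0 := (hr0 x).ne'
  rw [nablaC_flat_weyl h.metric hr hr0 (h.smooth a), hk, at₂_weyl, smul_apply, smul_apply,
    smul_eq_mul, kv]
  field_simp
  ring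

lemma isKillingVector_weyl_iff (h : IsSliceFrame g Ω κ) {r : M → ℝ} (hr : SmoothFun r)
    (hr0 : ∀ x, 0 < r x) (a : Fin 2) (hk : ∀ x v, nablaC g (flat g (κ a)) x v = 0) :
    IsKillingVector (weyl r g) (κ a) ↔ ∀ x, dd r x (kv κ a x) = 0 := by
  rw [(h.weyl hr hr0).isKillingVector_iff]
  have h1 := nablaC_weyl_killing h hr hr0 a hk
  constructor
  · intro h2 x
    have h3 := h1 x (nv (weyl r g) Ω x)
    have h4 : at₂ (weyl r g) x (nv (weyl r g) Ω x) (nv (weyl r g) Ω x) = 1 :=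
      nf_nv (h.metric.weyl hr hr0) (h.foliation.weyl h.metric hr hr0) x
    rw [h2, h4, mul_one] at h3
    exact (mul_eq_zero.1 h3.symm).resolve_left (inv_ne_zero (hr0 x).ne')
  · intro h2 x v
    rw [h1, h2]
    ring

/-! ### Slice-reducible Killing tensors and the slice equation -/

lemma IsSliceReducibleConformalKT.sliceEq (h : IsSliceFrame g Ω κ) {c : Fin 2 → M → ℝ}
    (hk : ∀ a x v, nablaC g (flat g (κ a)) x v = c a x * at₂ g x v v)
    (hK : IsSliceReducibleConformalKT g Ω κ α γ Ψ) (x : M) : SliceEq g Ω κ γ Ψ x := by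
  obtain ⟨θ, hθ⟩ := (isConformalKillingTensor_iff (smoothT_sliceTensor h.metric h.foliation
    h.smooth hK.smooth_α hK.smooth_γ hK.smooth_Ψ).diffT
    (isSymmT_sliceTensor h.metric hK.symm_γ) h.metric.isSymmT).1 hK.killing
  exact (h.sliceEq_of_nablaT hK.smooth_α hK.smooth_γ hK.smooth_Ψ hK.symm_γ hK.const_γ
    (c := fun a => c a x) (fun a v => hk a x v) (hθ x)).1

lemma IsSliceReducibleKT.sliceEq_and (h : IsSliceFrame g Ω κ) {c : Fin 2 → M → ℝ}
    (hk : ∀ a x v, nablaC g (flat g (κ a)) x v = c a x * at₂ g x v v)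
    (hK : IsSliceReducibleKT g Ω κ α γ Ψ) (x : M) : SliceEq g Ω κ γ Ψ x ∧
      ∀ v, 0 = mu g κ α γ (fun a => c a x) x v
        + Real.exp (Ψ x) * dd Ψ x (nv g Ω x) * nf g Ω x v := by
  have hθ := (isKillingTensor_iff (smoothT_sliceTensor h.metric h.foliation
    h.smooth hK.smooth_α hK.smooth_γ hK.smooth_Ψ).diffT
    (isSymmT_sliceTensor h.metric hK.symm_γ) h.metric.isSymmT).1 hK.killing
  exact (h.sliceEq_of_nablaT hK.smooth_α hK.smooth_γ hK.smooth_Ψ hK.symm_γ hK.const_γ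
    (c := fun a => c a x) (fun a v => hk a x v) (θ := 0) fun v => by
      rw [hθ, zero_apply, zero_mul])

lemma mu_zero (x : M) (v : E4) : mu g κ α γ (fun _ => 0) x v = dd α x v := by simp [mu]

/-- Exactness means `θ = 0`; its normal component, multiplied by the lapse, is `α' + (e^Ψ)' = 0`. -/
lemma IsSliceReducibleKT.prime_eq (h : IsSliceFrame g Ω κ)
    (hk : ∀ a x v, nablaC g (flat g (κ a)) x v = 0)
    (hK : IsSliceReducibleKT g Ω κ α γ Ψ) (x : M) :
    prime g Ω (fun z => Real.exp (Ψ z)) x = -prime g Ω α x := by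
  have h1 := (hK.sliceEq_and (c := fun _ _ => 0) h (fun a x v => by rw [hk, zero_mul]) x).2
    (nv g Ω x)
  rw [mu_zero, nf_nv h.metric h.foliation] at h1
  rw [prime_eq_dd, prime_eq_dd, dd_exp hK.smooth_Ψ]
  linear_combination (-lapse g Ω x) * h1

/-- The coefficient `α` is arbitrary: adding a multiple of the metric only changes `θ` by `dα`. -/
lemma isSliceReducibleConformalKT_of_sliceEq (h : IsSliceFrame g Ω κ)
    (hk : ∀ a x v, nablaC g (flat g (κ a)) x v = 0) (hα : SmoothFun α)
    (hγ : ∀ a b, SmoothFun fun x => γ x a b) (hΨ : SmoothFun Ψ) (hs : ∀ x, (γ x).IsSymm)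
    (hc : ∀ a b, SliceConstant Ω fun x => γ x a b) (hS : ∀ x, SliceEq g Ω κ γ Ψ x) :
    IsSliceReducibleConformalKT g Ω κ α γ Ψ where
  smooth_α := hα
  smooth_γ := hγ
  smooth_Ψ := hΨ
  symm_γ := hs
  const_γ := hc
  killing := by
    refine (isConformalKillingTensor_iff (smoothT_sliceTensor h.metric h.foliation
      h.smooth hα hγ hΨ).diffT (isSymmT_sliceTensor h.metric hs) h.metric.isSymmT).2
      ⟨fun x => dd α x + (Real.exp (Ψ x) * dd Ψ x (nv g Ω x)) • nf g Ω x, fun x v => ?_⟩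
    rw [h.nablaT_of_sliceEq hα hγ hΨ hs hc (c := fun _ => 0) (fun a v => by rw [hk, zero_mul])
      (hS x), mu_zero]
    simp only [add_apply, smul_apply, smul_eq_mul]

lemma isSliceReducibleKT_of_sliceEq (h : IsSliceFrame g Ω κ)
    (hk : ∀ a x v, nablaC g (flat g (κ a)) x v = 0) (hα : SmoothFun α)
    (hγ : ∀ a b, SmoothFun fun x => γ x a b) (hΨ : SmoothFun Ψ) (hs : ∀ x, (γ x).IsSymm)
    (hcα : SliceConstant Ω α)
    (hc : ∀ a b, SliceConstant Ω fun x => γ x a b) (hS : ∀ x, SliceEq g Ω κ γ Ψ x)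
    (hp : ∀ x, prime g Ω (fun z => Real.exp (Ψ z)) x = -prime g Ω α x) :
    IsSliceReducibleKT g Ω κ α γ Ψ where
  smooth_α := hα
  smooth_γ := hγ
  smooth_Ψ := hΨ
  symm_γ := hs
  const_α := hcα
  const_γ := hc
  killing := by
    refine (isKillingTensor_iff (smoothT_sliceTensor h.metric h.foliation
      h.smooth hα hγ hΨ).diffT (isSymmT_sliceTensor h.metric hs) h.metric.isSymmT).2
      fun x v => ?_
    rw [h.nablaT_of_sliceEq hα hγ hΨ hs hc (c := fun _ => 0) (fun a v => by rw [hk, zero_mul])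
      (hS x), mu_zero, hcα.dd_eq h.metric h.foliation x v]
    have h1 := hp x
    rw [prime_eq_dd, prime_eq_dd, dd_exp hΨ, ← mul_neg] at h1
    have h2 := mul_left_cancel₀ (lapse_pos h.metric h.foliation x).ne' h1
    rw [h2]
    ring

/-! ### Slice-reducible tensors of the rescaled metric -/

section weyl
variable {r : M → ℝ}

lemma SmoothFun.add_log (hΨ : SmoothFun Ψ) (hr : SmoothFun r) (hr0 : ∀ x, 0 < r x) (c : ℝ) :
    SmoothFun fun z => Ψ z + c * Real.log (r z) :=
  hΨ.add ((hr.log fun z => (hr0 z).ne').smul_const c)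

lemma IsSliceFrame.sliceEq_of_weyl (h : IsSliceFrame g Ω κ) (hr : SmoothFun r)
    (hr0 : ∀ x, 0 < r x) (hΨ : SmoothFun Ψ) {x : M}
    (hS : SliceEq (Spacetime.weyl r g) Ω κ γ Ψ x) :
    SliceEq g Ω κ γ (fun z => Ψ z + -2 * Real.log (r z)) x := by
  refine (h.sliceEq_weyl hr hr0 (hΨ.add_log hr hr0 (-2)) x).1 ?_
  refine (congrArg (fun f => SliceEq (Spacetime.weyl r g) Ω κ γ f x) (funext fun z => ?_)).mp hS
  ring

/-- An exact Killing tensor of the rescaled metric gives a conformal Killing tensor. -/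
lemma exists_conformal_of_weyl (h : IsSliceFrame g Ω κ)
    (hk : ∀ a x v, nablaC g (flat g (κ a)) x v = 0) (hr : SmoothFun r) (hr0 : ∀ x, 0 < r x)
    (hK : IsSliceReducibleKT (weyl r g) Ω κ α γ Ψ) :
    IsSliceReducibleConformalKT g Ω κ (fun _ => 0) γ (fun z => Ψ z + -2 * Real.log (r z)) :=
  isSliceReducibleConformalKT_of_sliceEq h hk (SmoothFun.const 0) hK.smooth_γ
    (hK.smooth_Ψ.add_log hr hr0 (-2)) hK.symm_γ hK.const_γ fun x =>
      -- No invariance of `r` under the `κ_a` is needed: for the rescaled metric they are conformal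
      -- Killing, and the conformal factors do not enter the slice equation.
      h.sliceEq_of_weyl hr hr0 hK.smooth_Ψ (hK.sliceEq_and (h.weyl hr hr0)
        (fun a x v => nablaC_weyl_killing h hr hr0 a (hk a) x v) x).1

lemma exp_add_two_log (hr0 : ∀ x, 0 < r x) (x : M) :
    Real.exp (Ψ x + 2 * Real.log (r x)) = Real.exp (Ψ x) * r x ^ 2 := by
  rw [Real.exp_add, two_mul, Real.exp_add, Real.exp_log (hr0 x), sq]

/-- Two slice-reducible tensors have proportional normal coefficients. -/
lemma SliceConstant.prime_of_dd_eq (h : IsSliceFrame g Ω κ) {Ψ₁ : M → ℝ} (hΨ : SmoothFun Ψ)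
    (hΨ₁ : SmoothFun Ψ₁) (hd : ∀ x, dd Ψ x = dd Ψ₁ x)
    (hc : SliceConstant Ω (Spacetime.prime g Ω fun z => Real.exp (Ψ z))) :
    SliceConstant Ω (Spacetime.prime g Ω fun z => Real.exp (Ψ₁ z)) := by
  have hsub : SmoothFun fun z => Real.exp (Ψ₁ z + -1 * Ψ z) := (hΨ₁.add (hΨ.smul_const (-1))).exp
  -- The ratio `e^{Ψ₁ - Ψ}` has zero differential, so it passes through the derivative as a constant
  -- factor.
  have e : (Spacetime.prime g Ω fun z => Real.exp (Ψ₁ z))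
      = fun x => Real.exp (Ψ₁ x + -1 * Ψ x) * Spacetime.prime g Ω (fun z => Real.exp (Ψ z)) x := by
    funext x
    rw [prime_eq_dd, prime_eq_dd, dd_exp hΨ, dd_exp hΨ₁, hd, Real.exp_add, neg_one_mul,
      Real.exp_neg]
    have := (Real.exp_pos (Ψ x)).ne'
    field_simp
  rw [e]
  refine SliceConstant.mul hsub (hΨ.exp.prime h.metric h.foliation) ?_ hc
  intro x (v : E4) _
  refine (dd_exp (hΨ₁.add (hΨ.smul_const (-1))) x v).trans ?_
  rw [dd_add hΨ₁ (hΨ.smul_const (-1)), dd_const_mul hΨ, hd]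
  ring

/-- Any exact tensor of the rescaled metric has the same `dΨ` as the shifted conformal one, so slice
constancy of its `(e^Ψ)' = -α'` transfers. Conversely, integrating `-(e^Ψ)'` in the foliation
parameter produces the required `α`, with `γ` unchanged. -/
lemma exists_weyl_iff (h : IsSliceFrame g Ω κ)
    (hk : ∀ a x v, nablaC g (flat g (κ a)) x v = 0) (hr : SmoothFun r) (hr0 : ∀ x, 0 < r x)
    (hkt : ∀ a x v, nablaC (weyl r g) (flat (weyl r g) (κ a)) x v = 0)
    (hK : IsSliceReducibleConformalKT g Ω κ α γ Ψ) :
    (∃ αt γt Ψt, IsSliceReducibleKT (weyl r g) Ω κ αt γt Ψt) ↔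
      SliceConstant Ω (prime g Ω (fun x => Real.exp (Ψ x) * r x ^ 2)) := by
  have ht := h.weyl hr hr0
  have hS := hK.sliceEq (c := fun _ _ => 0) h (fun a x v => by rw [hk, zero_mul])
  have hΨt := hK.smooth_Ψ.add_log hr hr0 2
  have e1 : (fun x => Real.exp (Ψ x) * r x ^ 2)
      = fun x => Real.exp (Ψ x + 2 * Real.log (r x)) :=
    funext fun x => (exp_add_two_log hr0 x).symm
  have e2 : ∀ f, prime g Ω f = prime (weyl r g) Ω f := fun f =>
    funext fun x => (prime_weyl h.metric hr hr0 Ω f x).symm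
  have hSt : ∀ x, SliceEq (weyl r g) Ω κ γ (fun z => Ψ z + 2 * Real.log (r z)) x := fun x =>
    (h.sliceEq_weyl hr hr0 hK.smooth_Ψ x).2 (hS x)
  rw [e1, e2]
  constructor
  · rintro ⟨αt, γt, Ψt, hKt⟩
    refine SliceConstant.prime_of_dd_eq ht hKt.smooth_Ψ hΨt (fun x => ht.dd_unique
      ((hKt.sliceEq_and (c := fun _ _ => 0) ht (fun a x v => by rw [hkt, zero_mul]) x).1)
      (hSt x)) ?_
    have e3 : (prime (weyl r g) Ω fun z => Real.exp (Ψt z))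
        = fun x => -1 * prime (weyl r g) Ω αt x := funext fun x => by
      rw [hKt.prime_eq ht hkt]
      ring
    rw [e3]
    exact (hKt.const_α.prime ht.metric ht.foliation hKt.smooth_α).const_mul
      (hKt.smooth_α.prime ht.metric ht.foliation) (-1)
  · intro hc
    have hs := hΨt.exp.prime ht.metric ht.foliation
    obtain ⟨A, hA, hAc, hAp⟩ := SliceConstant.exists_prime_eq ht.metric ht.foliation
      (hs.smul_const (-1)) (hc.const_mul hs (-1))
    refine ⟨A, γ, _, isSliceReducibleKT_of_sliceEq ht hkt hA hK.smooth_γ hΨt hK.symm_γ hAc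
      hK.const_γ hSt fun x => ?_⟩
    rw [hAp]
    ring

end weyl

/-! ### The factor `χ_τ` -/

/-- Orthogonally to the Killing vectors the slice equation reduces to its metric term. A vector of
nonzero norm in these directions makes the factor unique. -/
lemma IsSliceFrame.isChiTau_iff (h : IsSliceFrame g Ω κ) (hS : ∀ x, SliceEq g Ω κ γ Ψ x)
    (χ : M → ℝ) : IsChiTau g Ω κ χ ↔ ∀ x, χ x = 1 / 2 * dd Ψ x (nv g Ω x) := by
  have h1 : ∀ (x : M) (σ : E4), dd Ω x σ = 0 → (∀ a, kf g κ a x σ = 0) →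
      secondForm g Ω x σ σ = 1 / 2 * dd Ψ x (nv g Ω x) * at₂ g x σ σ := fun x σ h2 h3 =>
    h.Qn_orthogonal (hS x) (nf_of_tangent h.metric h2) h3
  constructor
  · intro h2 x
    obtain ⟨σ, h3, h4, h5⟩ := h.exists_orthogonal x
    have h6 : secondForm g Ω x σ σ = χ x * at₂ g x σ σ := h2 x σ h3 h4
    rw [h1 x σ h3 h4] at h6
    exact (mul_right_cancel₀ h5.ne' h6).symm
  · intro h2 x σ h3 h4
    rw [h2]
    exact h1 x σ h3 h4

/-- With `χ_τ = ½ dΨ(n)` the expression equals `½ φ² e^{-Ψ} (e^Ψ m²)'`, and the positive factor `φ²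
e^{-Ψ}` is constant on the slices by `IsSliceFrame.dd_of_sliceEq`. -/
lemma IsSliceFrame.sliceConstant_iff_chiTau (h : IsSliceFrame g Ω κ)
    (hS : ∀ x, SliceEq g Ω κ γ Ψ x) (hΨ : SmoothFun Ψ) {m : M → ℝ} (hm : SmoothFun m)
    {χ : M → ℝ} (hχ : IsChiTau g Ω κ χ) :
    SliceConstant Ω (prime g Ω (fun x => Real.exp (Ψ x) * (m x) ^ 2)) ↔
      SliceConstant Ω (fun x => (m x) ^ 2 * (lapse g Ω x) ^ 3 * χ x
        + 1 / 2 * (lapse g Ω x) ^ 2 * prime g Ω (fun y => (m y) ^ 2) x) := by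
  have hχ' := (h.isChiTau_iff hS χ).1 hχ
  have hφ := smooth_lapse h.metric h.foliation
  have hφ0 := lapse_pos h.metric h.foliation
  have hm2 := hm.pow 2
  have hE := hΨ.exp.mul hm2
  have hP := hE.prime h.metric h.foliation
  have hln := hφ.log fun x => (hφ0 x).ne'
  have hu : SmoothFun fun x => 2 * Real.log (lapse g Ω x) + -1 * Ψ x :=
    (hln.smul_const 2).add (hΨ.smul_const (-1))
  have hu0 : SliceConstant Ω fun x => 2 * Real.log (lapse g Ω x) + -1 * Ψ x := by
    intro x (w : E4) (hw : dd Ω x w = 0)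
    refine (dd_add (hln.smul_const 2) (hΨ.smul_const (-1)) x w).trans ?_
    rw [dd_const_mul hln, dd_const_mul hΨ, dd_log hφ (hφ0 x).ne', h.dd_of_sliceEq (hS x) hw]
    ring
  have hexp : ∀ (f : M → ℝ), SmoothFun f → SliceConstant Ω f →
      SliceConstant Ω fun x => Real.exp (f x) := by
    intro f hf hc x w hw
    refine (dd_exp hf x w).trans ?_
    have : dd f x w = 0 := hc x w hw
    rw [this, mul_zero]
  have e : (fun x => (m x) ^ 2 * (lapse g Ω x) ^ 3 * χ x
        + 1 / 2 * (lapse g Ω x) ^ 2 * prime g Ω (fun y => (m y) ^ 2) x)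
      = fun x => 1 / 2 * (Real.exp (2 * Real.log (lapse g Ω x) + -1 * Ψ x)
        * prime g Ω (fun x => Real.exp (Ψ x) * (m x) ^ 2) x) := by
    funext x
    rw [hχ', prime_eq_dd, prime_eq_dd, dd_mul hΨ.exp hm2, dd_exp hΨ, Real.exp_add, two_mul,
      Real.exp_add, Real.exp_log (hφ0 x), neg_one_mul, Real.exp_neg]
    have := (Real.exp_pos (Ψ x)).ne'
    field_simp
    ring
  rw [e]
  constructor
  · intro h1
    exact (SliceConstant.mul hu.exp hP (hexp _ hu hu0) h1).const_mul (hu.exp.mul hP) (1 / 2)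
  · intro h1
    have hu' := hu.smul_const (-1)
    have h2 := SliceConstant.mul hu'.exp ((hu.exp.mul hP).smul_const (1 / 2))
      (hexp _ hu' (hu0.const_mul hu (-1))) h1
    have h3 := h2.const_mul (hu'.exp.mul ((hu.exp.mul hP).smul_const (1 / 2))) 2
    refine (congrArg (SliceConstant Ω) (funext fun x => ?_)).mp h3
    rw [neg_one_mul, Real.exp_neg]
    have := (Real.exp_pos (2 * Real.log (lapse g Ω x) + -1 * Ψ x)).ne'
    field_simp

end

section

variable [IsManifold (𝓡 4) ∞ M] {g : Tensor2 M} {Ω : M → ℝ} {κ : Fin 2 → VField M}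

/-! ### Curves in the charts -/

/-- The velocity of a curve, as an element of `E4`. -/
def vel (γ : ℝ → M) (s : ℝ) : E4 := velocity γ s

/-- The covariant acceleration of a curve, as an element of `E4`. -/
def acc (g : Tensor2 M) (γ : ℝ → M) (s : ℝ) : E4 := acceleration g γ s

lemma acc_eq (g : Tensor2 M) (γ : ℝ → M) (s : ℝ) :
    acc g γ s = deriv (deriv (inChartAt γ s)) s
      + Gam g (γ s) (deriv (inChartAt γ s) s) (deriv (inChartAt γ s) s) := by
  conv_rhs => rw [← sum_smul_single (deriv (deriv (inChartAt γ s)) s)]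
  rw [Gam, ← Finset.sum_add_distrib]
  simp only [← add_smul]
  rfl

lemma vel_eq {γ : ℝ → M} {s : ℝ} (h : MDifferentiableAt 𝓘(ℝ, ℝ) (𝓡 4) γ s) :
    vel γ s = deriv (inChartAt γ s) s := by
  have h1 := h.mfderiv
  rw [ModelWithCorners.range_eq_univ, fderivWithin_univ] at h1
  have h2 : vel γ s = (mfderiv 𝓘(ℝ, ℝ) (𝓡 4) γ s : ℝ →L[ℝ] E4) 1 := rfl
  rw [h2, ← fderiv_apply_one_eq_deriv]
  exact congrArg (fun L : ℝ →L[ℝ] E4 => L 1) h1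

lemma IsC2On.contMDiffAt {γ : ℝ → M} {J : Set ℝ} (h : IsC2On γ J) (hJ : IsOpen J) {s : ℝ}
    (hs : s ∈ J) : ContMDiffAt 𝓘(ℝ, ℝ) (𝓡 4) 2 γ s := ContMDiffOn.contMDiffAt h (hJ.mem_nhds hs)

lemma contDiffAt_inChartAt {γ : ℝ → M} {s : ℝ} (h : ContMDiffAt 𝓘(ℝ, ℝ) (𝓡 4) 2 γ s) :
    ContDiffAt ℝ 2 (inChartAt γ s) s :=
  contMDiffAt_iff_contDiffAt.1 (contMDiffAt_iff_target.1 h).2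

lemma inChartAt_self (γ : ℝ → M) (s : ℝ) : inChartAt γ s s = extChartAt (𝓡 4) (γ s) (γ s) := rfl

lemma hasDerivAt_inChartAt {γ : ℝ → M} {s : ℝ} (h : ContMDiffAt 𝓘(ℝ, ℝ) (𝓡 4) 2 γ s) :
    HasDerivAt (inChartAt γ s) (vel γ s) s := by
  rw [vel_eq (h.mdifferentiableAt (by simp))]
  exact ((contDiffAt_inChartAt h).differentiableAt (by simp)).hasDerivAt

/-- The chain rule for functions along curves. -/
lemma SmoothFun.hasDerivAt_comp {f : M → ℝ} (hf : SmoothFun f) {γ : ℝ → M} {s : ℝ}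
    (h : ContMDiffAt 𝓘(ℝ, ℝ) (𝓡 4) 2 γ s) :
    HasDerivAt (fun t => f (γ t)) (dd f (γ s) (vel γ s)) s := by
  have h1 := (hasFDerivAt_locF hf (γ s)).comp_hasDerivAt_of_eq s (hasDerivAt_inChartAt h)
    (inChartAt_self γ s)
  refine h1.congr_of_eventuallyEq ?_
  filter_upwards [h.continuousAt.preimage_mem_nhds (extChartAt_source_mem_nhds (I := 𝓡 4) (γ s))]
    with t ht
  change f (γ t) = f ((extChartAt (𝓡 4) (γ s)).symm (extChartAt (𝓡 4) (γ s) (γ t)))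
  rw [(extChartAt (𝓡 4) (γ s)).left_inv ht]

/-! ### Inverses of increasing functions on intervals -/

lemma strictMonoOn_of_hasDerivAt {τ R : ℝ → ℝ} {J : Set ℝ} (hJ : IsOpenInterval J)
    (hτ : ∀ s ∈ J, HasDerivAt τ (R s) s) (hR : ∀ s ∈ J, 0 < R s) : StrictMonoOn τ J :=
  strictMonoOn_of_deriv_pos hJ.2.convex (fun s hs => (hτ s hs).continuousAt.continuousWithinAt)
    fun s hs => by
      rw [(hτ s (interior_subset hs)).deriv]
      exact hR s (interior_subset hs)

/-- Strict monotonicity gives a global inverse on the image; near each point it coincides with the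
local inverse of the inverse function theorem and inherits its regularity. -/
lemma exists_inverse_on {τ R : ℝ → ℝ} {J : Set ℝ} (hJ : IsOpenInterval J)
    (hτ : ∀ s ∈ J, HasDerivAt τ (R s) s) (hR : ∀ s ∈ J, 0 < R s) {n : WithTop ℕ∞} (hn : n ≠ 0)
    (hc : ContDiffOn ℝ n τ J) : ∃ σ : ℝ → ℝ, IsOpenInterval (τ '' J) ∧ (∀ s ∈ J, σ (τ s) = s) ∧
      ContDiffOn ℝ n σ (τ '' J) ∧ ∀ s ∈ J, HasDerivAt σ (R s)⁻¹ (τ s) := by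
  have hinj := (strictMonoOn_of_hasDerivAt hJ hτ hR).injOn
  have hσ : ∀ s ∈ J, Function.invFunOn τ J (τ s) = s := fun s hs => hinj.leftInvOn_invFunOn hs
  have key : ∀ s ∈ J, ∃ L : ℝ → ℝ, ContDiffAt ℝ n L (τ s) ∧
      ∀ᶠ t in 𝓝 (τ s), L t ∈ J ∧ τ (L t) = t := by
    intro s hs
    have h1 := hc.contDiffAt (hJ.1.mem_nhds hs)
    have h2 : HasFDerivAt τ ((ContinuousLinearEquiv.unitsEquivAut ℝ (Units.mk0 (R s)
        (hR s hs).ne') : ℝ ≃L[ℝ] ℝ) : ℝ →L[ℝ] ℝ) s := by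
      refine (hτ s hs).hasFDerivAt.congr_fderiv ?_
      ext
      simp
    have h3 := h1.to_localInverse h2 hn
    refine ⟨_, h3, ?_⟩
    have h4 : h1.localInverse h2 hn (τ s) = s := h1.localInverse_apply_image h2 hn
    have h5 : ∀ᶠ t in 𝓝 (τ s), h1.localInverse h2 hn t ∈ J :=
      h3.continuousAt.eventually_mem (by rw [h4]; exact hJ.1.mem_nhds hs)
    have h6 : ∀ᶠ t in 𝓝 (τ s), τ (h1.localInverse h2 hn t) = t :=
      (h1.hasStrictFDerivAt' h2 hn).eventually_right_inverse
    exact h5.and h6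
  have hev : ∀ s ∈ J, ContDiffAt ℝ n (Function.invFunOn τ J) (τ s) := by
    intro s hs
    obtain ⟨L, h1, h2⟩ := key s hs
    refine h1.congr_of_eventuallyEq (h2.mono fun t ht => ?_)
    conv_lhs => rw [← ht.2]
    exact hσ _ ht.1
  refine ⟨Function.invFunOn τ J, ⟨?_, ?_⟩, hσ, ?_, ?_⟩
  · rw [isOpen_iff_mem_nhds]
    rintro _ ⟨s, hs, rfl⟩
    obtain ⟨L, -, h2⟩ := key s hs
    exact h2.mono fun t ht => ⟨L t, ht.1, ht.2⟩
  · exact (hJ.2.isPreconnected.image τ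
      fun s hs => (hτ s hs).continuousAt.continuousWithinAt).ordConnected
  · rintro _ ⟨s, hs, rfl⟩
    exact (hev s hs).contDiffWithinAt
  · intro s hs
    have h1 := ((hev s hs).differentiableAt hn).hasDerivAt
    have h2 : HasDerivAt (fun t => Function.invFunOn τ J (τ t))
        (deriv (Function.invFunOn τ J) (τ s) * R s) s := h1.comp s (hτ s hs)
    have h3 : HasDerivAt (fun t => Function.invFunOn τ J (τ t)) 1 s :=
      (hasDerivAt_id s).congr_of_eventuallyEq
        (Filter.Eventually.mono (hJ.1.mem_nhds hs) fun t ht => hσ t ht)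
    have h4 := h2.unique h3
    rw [eq_inv_of_mul_eq_one_left h4] at h1
    exact h1

lemma contDiffOn_one_of_hasDerivAt {τ R : ℝ → ℝ} {J : Set ℝ} (hJ : IsOpen J)
    (hτ : ∀ s ∈ J, HasDerivAt τ (R s) s) {n : ℕ} (hR : ContDiffOn ℝ n R J) :
    ContDiffOn ℝ (n + 1) τ J := by
  rw [contDiffOn_succ_iff_deriv_of_isOpen hJ]
  exact ⟨fun s hs => (hτ s hs).differentiableAt.differentiableWithinAt, by simp,
    hR.congr fun s hs => (hτ s hs).deriv⟩

lemma exists_primitive_on {R : ℝ → ℝ} {J : Set ℝ} (hJ : IsOpenInterval J)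
    (hR : ContinuousOn R J) : ∃ τ : ℝ → ℝ, ∀ s ∈ J, HasDerivAt τ (R s) s := by
  rcases J.eq_empty_or_nonempty with rfl | ⟨a, ha⟩
  · exact ⟨0, by simp⟩
  · refine ⟨fun s => ∫ t in a..s, R t, fun s hs => ?_⟩
    exact intervalIntegral.integral_hasDerivAt_right
      ((hR.mono (hJ.2.uIcc_subset ha hs)).intervalIntegrable)
      (hR.stronglyMeasurableAtFilter hJ.1 s hs) (hR.continuousAt (hJ.1.mem_nhds hs))

/-! ### Reparametrization -/

lemma SmoothFun.continuous {f : M → ℝ} (hf : SmoothFun f) : Continuous f :=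
  ContMDiff.continuous hf

lemma exists_reparam {m : M → ℝ} {mt : ℝ} (hm : SmoothFun m) (h0 : ∀ x, 0 < m x / mt)
    {J : Set ℝ} {γ : ℝ → M} (hJ : IsOpenInterval J) (hγ : ContinuousOn γ J) :
    ∃ τ γt, IsReparam m mt J γ τ γt := by
  have hR : ContinuousOn (fun s => (m (γ s) / mt) ^ 2) J :=
    ((hm.continuous.comp_continuousOn hγ).div_const mt).pow 2
  obtain ⟨τ, hτ⟩ := exists_primitive_on hJ hR
  obtain ⟨σ, -, hσ, -⟩ := exists_inverse_on (n := 1) hJ hτ (fun s _ => pow_pos (h0 _) 2) (by simp)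
    (contDiffOn_one_of_hasDerivAt (n := 0) hJ.1 hτ (contDiffOn_zero.2 hR))
  exact ⟨τ, fun t => γ (σ t), hτ, fun s hs => congrArg γ (hσ s hs)⟩

lemma exists_reparam_inverse {m : M → ℝ} {mt : ℝ} (hm : SmoothFun m) (h0 : ∀ x, 0 < m x / mt)
    {Jt : Set ℝ} {γt : ℝ → M} (hJ : IsOpenInterval Jt) (hγ : ContinuousOn γt Jt) :
    ∃ J γ τ, IsOpenInterval J ∧ τ '' J = Jt ∧ IsReparam m mt J γ τ γt := by
  have hR : ContinuousOn (fun s => ((m (γt s) / mt) ^ 2)⁻¹) Jt :=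
    (((hm.continuous.comp_continuousOn hγ).div_const mt).pow 2).inv₀
      fun s _ => (pow_pos (h0 _) 2).ne'
  obtain ⟨σ, hσ⟩ := exists_primitive_on hJ hR
  obtain ⟨τ, h1, h2, -, h3⟩ := exists_inverse_on (n := 1) hJ hσ
    (fun s _ => inv_pos.2 (pow_pos (h0 _) 2)) (by simp)
    (contDiffOn_one_of_hasDerivAt (n := 0) hJ.1 hσ (contDiffOn_zero.2 hR))
  refine ⟨σ '' Jt, fun s => γt (τ s), τ, h1, ?_, ?_, fun s _ => rfl⟩
  · rw [Set.image_image]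
    exact (Set.image_congr h2).trans (Set.image_id _)
  · rintro _ ⟨t, ht, rfl⟩
    have := h3 t ht
    rw [inv_inv] at this
    simp only [h2 t ht]
    exact this

section reparam
variable {m : M → ℝ} {mt : ℝ} {J : Set ℝ} {γ γt : ℝ → M} {τ : ℝ → ℝ}

lemma contDiffOn_comp_curve {f : M → ℝ} (hf : SmoothFun f) {n : ℕ}
    (hγ : ContMDiffOn 𝓘(ℝ, ℝ) (𝓡 4) n γ J) : ContDiffOn ℝ n (fun s => f (γ s)) J :=
  contMDiffOn_iff_contDiffOn.1
    ((ContMDiff.of_le hf (by exact_mod_cast le_top)).comp_contMDiffOn hγ)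

lemma smooth_ratio (hm : SmoothFun m) (mt : ℝ) : SmoothFun fun x => m x / mt := by
  refine (congrArg SmoothFun (funext fun x => ?_)).mp (hm.smul_const mt⁻¹)
  rw [div_eq_inv_mul]

lemma IsReparam.contDiffOn (hm : SmoothFun m) (hJ : IsOpen J) (h : IsReparam m mt J γ τ γt)
    {n : ℕ} (hγ : ContMDiffOn 𝓘(ℝ, ℝ) (𝓡 4) n γ J) : ContDiffOn ℝ (n + 1) τ J :=
  contDiffOn_one_of_hasDerivAt hJ h.1 (contDiffOn_comp_curve ((smooth_ratio hm mt).pow 2) hγ)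

lemma IsReparam.isC2On_right (hm : SmoothFun m) (h0 : ∀ x, 0 < m x / mt) (hJ : IsOpenInterval J)
    (h : IsReparam m mt J γ τ γt) (hγ : IsC2On γ J) :
    IsOpenInterval (τ '' J) ∧ ContDiffOn ℝ 2 τ J ∧ IsC2On γt (τ '' J) := by
  have hτ : ContDiffOn ℝ 2 τ J := (h.contDiffOn (n := 2) hm hJ.1 hγ).of_le (by norm_num)
  obtain ⟨σ, h1, h2, h3, -⟩ := exists_inverse_on hJ h.1 (fun s _ => pow_pos (h0 _) 2) (by simp) hτ
  refine ⟨h1, hτ, ?_⟩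
  have h4 : ContMDiffOn 𝓘(ℝ, ℝ) (𝓡 4) 2 (γ ∘ σ) (τ '' J) :=
    ContMDiffOn.comp hγ (contMDiffOn_iff_contDiffOn.2 h3) (by
      rintro _ ⟨s, hs, rfl⟩
      change σ (τ s) ∈ J
      rw [h2 s hs]
      exact hs)
  refine h4.congr ?_
  rintro _ ⟨s, hs, rfl⟩
  change γt (τ s) = γ (σ (τ s))
  rw [h.2 s hs, h2 s hs]

/-- A bootstrap. The derivative of `τ` is a smooth function along `γ`, and `γ` is the `C²` curve
`γt` composed with `τ`, so each degree of regularity of `γ` yields one more for `τ`, which returns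
to `γ`. -/
lemma IsReparam.isC2On_left (hm : SmoothFun m) (hJ : IsOpenInterval J)
    (h : IsReparam m mt J γ τ γt) (hγ : IsC2On γt (τ '' J)) : IsC2On γ J := by
  have step : ∀ n : ℕ, n ≤ 2 → ContDiffOn ℝ n τ J → ContMDiffOn 𝓘(ℝ, ℝ) (𝓡 4) n γ J := by
    intro n hn hτ
    have h1 : ContMDiffOn 𝓘(ℝ, ℝ) (𝓡 4) n (γt ∘ τ) J :=
      ContMDiffOn.comp (ContMDiffOn.of_le hγ (by exact_mod_cast hn))
        (contMDiffOn_iff_contDiffOn.2 hτ) fun s hs => ⟨s, hs, rfl⟩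
    exact h1.congr fun s hs => (h.2 s hs).symm
  have h0 := step 0 (by norm_num) (contDiffOn_zero.2
    fun s hs => (h.1 s hs).continuousAt.continuousWithinAt)
  have h1 := step 1 (by norm_num) (by simpa using h.contDiffOn hm hJ.1 h0)
  exact step 2 le_rfl ((h.contDiffOn hm hJ.1 h1).of_le (by norm_num))

lemma IsReparam.eventuallyEq (hJ : IsOpenInterval J) (h : IsReparam m mt J γ τ γt) {s : ℝ}
    (hs : s ∈ J) : inChartAt γ s =ᶠ[𝓝 s] fun t => inChartAt γt (τ s) (τ t) := by
  filter_upwards [hJ.1.mem_nhds hs] with t ht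
  rw [inChartAt, inChartAt, h.2 s hs, h.2 t ht]

lemma IsReparam.vel_eq (hJ : IsOpenInterval J) (h : IsReparam m mt J γ τ γt) {s : ℝ}
    (hs : s ∈ J) (h1 : ContMDiffAt 𝓘(ℝ, ℝ) (𝓡 4) 2 γ s)
    (h2 : ContMDiffAt 𝓘(ℝ, ℝ) (𝓡 4) 2 γt (τ s)) :
    vel γ s = (m (γ s) / mt) ^ 2 • vel γt (τ s) :=
  (hasDerivAt_inChartAt h1).unique
    (((hasDerivAt_inChartAt h2).scomp s (h.1 s hs)).congr_of_eventuallyEq (h.eventuallyEq hJ hs))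

lemma IsReparam.deriv_deriv (hm : SmoothFun m) (hJ : IsOpenInterval J)
    (h : IsReparam m mt J γ τ γt) {s : ℝ} (hs : s ∈ J) (h1 : ContMDiffAt 𝓘(ℝ, ℝ) (𝓡 4) 2 γ s)
    (h2 : ContMDiffAt 𝓘(ℝ, ℝ) (𝓡 4) 2 γt (τ s)) :
    deriv (deriv (inChartAt γ s)) s
      = (2 * (m (γ s) / mt) * dd (fun x => m x / mt) (γ s) (vel γ s)) • vel γt (τ s)
        + (m (γ s) / mt) ^ 4 • deriv (deriv (inChartAt γt (τ s))) (τ s) := by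
  have hr := smooth_ratio hm mt
  have hz := contDiffAt_inChartAt h2
  have hz1 : ∀ᶠ t in 𝓝 (τ s), DifferentiableAt ℝ (inChartAt γt (τ s)) t :=
    ((hz.of_le (m := 1) (by norm_num)).eventually (by simp)).mono
      fun t ht => ht.differentiableAt (by simp)
  have hz2 : DifferentiableAt ℝ (deriv (inChartAt γt (τ s))) (τ s) := by
    have h3 : ContDiffAt ℝ 1 (fderiv ℝ (inChartAt γt (τ s))) (τ s) :=
      hz.fderiv_right (by norm_num)
    exact ((h3.differentiableAt (by simp)).clm_apply (differentiableAt_const (1 : ℝ)))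
  have h3 : deriv (inChartAt γ s) =ᶠ[𝓝 s]
      fun t => (m (γ t) / mt) ^ 2 • deriv (inChartAt γt (τ s)) (τ t) := by
    filter_upwards [(h.eventuallyEq hJ hs).eventuallyEq_nhds, hJ.1.mem_nhds hs,
      (h.1 s hs).continuousAt.eventually hz1] with t ht hJt hzt
    rw [ht.deriv_eq]
    exact (hzt.hasDerivAt.scomp t (h.1 t hJt)).deriv
  have h4 : HasDerivAt (fun t => (m (γ t) / mt) ^ 2)
      (2 * (m (γ s) / mt) * dd (fun x => m x / mt) (γ s) (vel γ s)) s := by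
    have := (hr.pow 2).hasDerivAt_comp h1
    rwa [dd_pow_two hr] at this
  have h5 := (h4.smul (hz2.hasDerivAt.scomp s (h.1 s hs))).congr_of_eventuallyEq h3
  rw [h5.deriv, Spacetime.vel_eq (γ := γt) (h2.mdifferentiableAt (by simp)), smul_smul, add_comm]
  congr 2
  · ring

/-- The accelerations of a curve and of its reparametrization. -/
lemma IsReparam.acc_eq (hg : IsLorentzMetric g) (hm : SmoothFun m) (h0 : ∀ x, 0 < m x / mt)
    (hJ : IsOpenInterval J) (h : IsReparam m mt J γ τ γt) {s : ℝ} (hs : s ∈ J)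
    (h1 : ContMDiffAt 𝓘(ℝ, ℝ) (𝓡 4) 2 γ s) (h2 : ContMDiffAt 𝓘(ℝ, ℝ) (𝓡 4) 2 γt (τ s)) (w : E4) :
    (m (γ s) / mt) ^ 4 * at₂ g (γ s) (acc (weyl (fun x => m x / mt) g) γt (τ s)) w
      = at₂ g (γ s) (acc g γ s) w
        - (m (γ s) / mt)⁻¹ * dd (fun x => m x / mt) (γ s) w
          * at₂ g (γ s) (vel γ s) (vel γ s) := by
  set r : M → ℝ := fun x => m x / mt with hr'
  have hr : SmoothFun r := smooth_ratio hm mt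
  have e0 : m (γ s) / mt = r (γ s) := rfl
  have hr0 := (h0 (γ s)).ne'
  rw [e0] at hr0
  have hv := h.vel_eq hJ hs h1 h2
  have hd := h.deriv_deriv hm hJ hs h1 h2
  -- The term of the Weyl formula along the velocity cancels the term from the second derivative of
  -- the parameter; only the gradient of `r` times the norm survives.
  have hG := Gam_weyl hg hr h0 (γ s) (vel γ s) w
  rw [Spacetime.acc_eq, Spacetime.acc_eq, ← Spacetime.vel_eq (h1.mdifferentiableAt (by simp)),
    ← Spacetime.vel_eq (h2.mdifferentiableAt (by simp)), h.2 s hs, hd]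
  have hG2 : Gam (weyl r g) (γ s) (vel γ s) (vel γ s)
      = r (γ s) ^ 4 • Gam (weyl r g) (γ s) (vel γt (τ s)) (vel γt (τ s)) := by
    rw [hv, Gam_smul_left, Gam_smul_right, smul_smul]
    congr 1
    rw [e0]
    ring
  rw [hG2] at hG
  have hv2 : vel γt (τ s) = (r (γ s) ^ 2)⁻¹ • vel γ s := by
    rw [hv, smul_smul, inv_mul_cancel₀ (pow_ne_zero 2 hr0), one_smul]
  rw [e0] at *
  generalize Gam (weyl r g) (γ s) (vel γt (τ s)) (vel γt (τ s)) = A at *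
  rw [hv2]
  simp only [map_add, map_smul, add_apply, smul_apply, smul_eq_mul] at hG ⊢
  field_simp at hG ⊢
  linear_combination hG

/-- Worldlines of variable mass are reparametrized geodesics of the rescaled metric. -/
lemma IsReparam.isWorldline_iff (hg : IsLorentzMetric g) (hm : SmoothFun m)
    (h0 : ∀ x, 0 < m x / mt) (hJ : IsOpenInterval J) (h : IsReparam m mt J γ τ γt) :
    IsWorldline g m J γ ↔ IsMassiveGeodesic (weyl (fun x => m x / mt) g) mt (τ '' J) γt := by
  have key : IsC2On γ J → IsC2On γt (τ '' J) → IsOpenInterval (τ '' J) →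
      (IsWorldline g m J γ ↔ IsMassiveGeodesic (weyl (fun x => m x / mt) g) mt (τ '' J) γt) := by
    intro c1 c2 hJt
    have hmt : ∀ x, mt ≠ 0 ∧ m x ≠ 0 := fun x => ⟨fun e => by simpa [e] using h0 x,
      fun e => by simpa [e] using h0 x⟩
    have hnorm : ∀ s ∈ J, (at₂ g (γ s) (vel γ s) (vel γ s) = -(m (γ s)) ^ 2 ↔
        at₂ (weyl (fun x => m x / mt) g) (γt (τ s)) (vel γt (τ s)) (vel γt (τ s))
          = -mt ^ 2) := by
      intro s hs
      rw [h.vel_eq hJ hs (c1.contMDiffAt hJ.1 hs) (c2.contMDiffAt hJt.1 ⟨s, hs, rfl⟩), h.2 s hs,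
        at₂_weyl]
      simp only [map_smul, smul_apply, smul_eq_mul]
      have h3 := (hmt (γ s)).1
      have h4 := (hmt (γ s)).2
      generalize at₂ g (γ s) (vel γt (τ s)) (vel γt (τ s)) = A
      have h5 : m (γ s) ^ 2 ≠ 0 := pow_ne_zero 2 h4
      have e1 : (m (γ s) / mt) ^ 2 * ((m (γ s) / mt) ^ 2 * A) - -m (γ s) ^ 2
          = m (γ s) ^ 2 / mt ^ 2 * ((m (γ s) / mt) ^ 2 * A - -mt ^ 2) := by
        field_simp
      rw [← sub_eq_zero, e1, mul_eq_zero, or_iff_right (div_ne_zero h5 (pow_ne_zero 2 h3)),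
        sub_eq_zero]
    -- When the norm is `-m²`, the surviving gradient term becomes exactly the force `m dm`.
    have hacc : ∀ s ∈ J, at₂ g (γ s) (vel γ s) (vel γ s) = -(m (γ s)) ^ 2 →
        ((∀ w, at₂ g (γ s) (acc g γ s) w = -(m (γ s) * dd m (γ s) w)) ↔
          acc (weyl (fun x => m x / mt) g) γt (τ s) = 0) := by
      intro s hs hn
      have h3 := (hmt (γ s)).1
      have h4 := (hmt (γ s)).2
      have h5 := h.acc_eq hg hm h0 hJ hs (c1.contMDiffAt hJ.1 hs)
        (c2.contMDiffAt hJt.1 ⟨s, hs, rfl⟩)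
      have h6 : ∀ w, dd (fun x => m x / mt) (γ s) w = mt⁻¹ * dd m (γ s) w := by
        intro w
        rw [← dd_const_mul hm]
        exact congrArg (fun f => dd f (γ s) w) (funext fun x => div_eq_inv_mul _ _)
      have h7 : ∀ w, (m (γ s) / mt) ^ 4 * at₂ g (γ s) (acc (weyl (fun x => m x / mt) g) γt (τ s)) w
          = at₂ g (γ s) (acc g γ s) w - -(m (γ s) * dd m (γ s) w) := by
        intro w
        rw [h5, hn, h6]
        field_simp
      have h8 : (m (γ s) / mt) ^ 4 ≠ 0 := pow_ne_zero 4 (h0 _).ne'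
      constructor
      · intro h9
        refine (hg.form (γ s)).nondegenerate fun w => ?_
        have := h7 w
        rw [h9, sub_self] at this
        exact (mul_eq_zero.1 this).resolve_left h8
      · intro h9 w
        have := h7 w
        rw [h9, map_zero, zero_apply, mul_zero] at this
        linarith
    constructor
    · intro H
      refine ⟨c2, ?_, ?_⟩
      · rintro _ ⟨s, hs, rfl⟩
        exact (hnorm s hs).1 (H.norm s hs)
      · rintro _ ⟨s, hs, rfl⟩
        exact (hacc s hs (H.norm s hs)).1 (H.motion s hs)
    · intro H
      have hn : ∀ s ∈ J, at₂ g (γ s) (vel γ s) (vel γ s) = -(m (γ s)) ^ 2 := fun s hs =>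
        (hnorm s hs).2 (H.norm _ ⟨s, hs, rfl⟩)
      exact ⟨c1, hn, fun s hs => (hacc s hs (hn s hs)).2 (H.geodesic _ ⟨s, hs, rfl⟩)⟩
  constructor
  · intro H
    obtain ⟨h1, -, h2⟩ := h.isC2On_right hm h0 hJ H.c2
    exact (key H.c2 h2 h1).1 H
  · intro H
    have c1 := h.isC2On_left hm hJ H.c2
    exact (key c1 H.c2 (h.isC2On_right hm h0 hJ c1).1).2 H

/-- The factor `r²` of the metric cancels the factor `r⁻²` of the reparametrized velocity. -/
lemma IsReparam.charge_eq (hm : SmoothFun m) (h0 : ∀ x, 0 < m x / mt) (hJ : IsOpenInterval J)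
    (h : IsReparam m mt J γ τ γt) (hγ : IsC2On γ J) {s : ℝ} (hs : s ∈ J) (a : Fin 2) :
    charge (weyl (fun x => m x / mt) g) κ (γt (τ s)) (velocity γt (τ s)) a
      = charge g κ (γ s) (velocity γ s) a := by
  obtain ⟨h1, -, h2⟩ := h.isC2On_right hm h0 hJ hγ
  have h3 := h.vel_eq hJ hs (hγ.contMDiffAt hJ.1 hs) (h2.contMDiffAt h1.1 ⟨s, hs, rfl⟩)
  have e : ∀ (B : Tensor2 M) (c : ℝ → M) (t : ℝ), charge B κ (c t) (velocity c t) a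
      = at₂ B (c t) (kv κ a (c t)) (vel c t) := fun B c t => rfl
  rw [e, e, h3, h.2 s hs, at₂_weyl]
  simp only [map_smul, smul_apply, smul_eq_mul]

end reparam

end

section

variable [IsManifold (𝓡 4) ∞ M] {g : Tensor2 M} {Ω : M → ℝ} {κ : Fin 2 → VField M}

/-! ### Covariant derivatives along curves -/

lemma contMDiffAt_curve_eventually {c : ℝ → M} {s : ℝ}
    (h : ContMDiffAt 𝓘(ℝ, ℝ) (𝓡 4) 2 c s) : ∀ᶠ t in 𝓝 s, ContMDiffAt 𝓘(ℝ, ℝ) (𝓡 4) 2 c t :=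
  (contMDiffAt_iff_contMDiffAt_nhds (by simp)).1 h

/-- The velocity in the preferred chart at `x`. -/
lemma vel_eq_coordMap {c : ℝ → M} {t : ℝ} (h : ContMDiffAt 𝓘(ℝ, ℝ) (𝓡 4) 2 c t) (x : M)
    (hx : c t ∈ (extChartAt (𝓡 4) x).source) :
    HasDerivAt (fun u => extChartAt (𝓡 4) x (c u))
      (chartMap x (extChartAt (𝓡 4) x (c t)) (vel c t)) t
    ∧ vel c t = coordMap x (extChartAt (𝓡 4) x (c t))
      (deriv (fun u => extChartAt (𝓡 4) x (c u)) t) := by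
  have h1 : MDifferentiableAt 𝓘(ℝ, ℝ) (𝓡 4) c t := h.mdifferentiableAt (by simp)
  have h2 : MDifferentiableAt (𝓡 4) 𝓘(ℝ, E4) (extChartAt (𝓡 4) x) (c t) :=
    mdifferentiableAt_extChartAt (by rwa [extChartAt_source] at hx)
  have h3 := mfderiv_comp t h2 h1
  have h4 : MDifferentiableAt 𝓘(ℝ, ℝ) 𝓘(ℝ, E4) (extChartAt (𝓡 4) x ∘ c) t := h2.comp t h1
  have h5 : HasDerivAt (fun u => extChartAt (𝓡 4) x (c u))
      (fderiv ℝ (extChartAt (𝓡 4) x ∘ c) t 1) t := by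
    rw [mdifferentiableAt_iff_differentiableAt] at h4
    exact h4.hasFDerivAt.hasDerivAt
  have h6 : fderiv ℝ (extChartAt (𝓡 4) x ∘ c) t 1
      = chartMap x (extChartAt (𝓡 4) x (c t)) (vel c t) := by
    rw [← mfderiv_eq_fderiv, h3, chartMap, (extChartAt (𝓡 4) x).left_inv hx]
    rfl
  rw [h6] at h5
  refine ⟨h5, ?_⟩
  rw [h5.deriv, coordMap_chartMap x ((extChartAt (𝓡 4) x).map_source hx)]

lemma curve_eventually_source {c : ℝ → M} {s : ℝ} (h : ContinuousAt c s) {x : M}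
    (hx : c s ∈ (extChartAt (𝓡 4) x).source) :
    ∀ᶠ t in 𝓝 s, c t ∈ (extChartAt (𝓡 4) x).source :=
  h.eventually_mem ((isOpen_extChartAt_source x).mem_nhds hx)

lemma differentiableAt_deriv_inChartAt {c : ℝ → M} {s : ℝ}
    (h : ContMDiffAt 𝓘(ℝ, ℝ) (𝓡 4) 2 c s) :
    HasDerivAt (deriv (inChartAt c s)) (deriv (deriv (inChartAt c s)) s) s := by
  have h3 : ContDiffAt ℝ 1 (fderiv ℝ (inChartAt c s)) s :=
    (contDiffAt_inChartAt h).fderiv_right (by norm_num)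
  have h4 : DifferentiableAt ℝ (deriv (inChartAt c s)) s :=
    ((h3.differentiableAt (by simp)).clm_apply (differentiableAt_const (1 : ℝ)))
  exact h4.hasDerivAt

/-- The product rule `d/ds θ(ċ) = (∇_ċ θ)(ċ) + θ(∇_ċ ċ)`, computed in the chart frozen at `c s`; the
velocities at neighbouring parameters are carried into that chart. -/
lemma hasDerivAt_covector (g : Tensor2 M) {θ : CoField M} (hθ : DiffC θ) {c : ℝ → M} {s : ℝ}
    (h : ContMDiffAt 𝓘(ℝ, ℝ) (𝓡 4) 2 c s) :
    HasDerivAt (fun t => at₁ θ (c t) (vel c t))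
      (nablaC g θ (c s) (vel c s) + at₁ θ (c s) (acc g c s)) s := by
  have hs := mem_extChartAt_source (I := 𝓡 4) (c s)
  have hv := vel_eq (h.mdifferentiableAt (by simp))
  have h1 := ((hθ (c s)).hasFDerivAt.comp_hasDerivAt_of_eq s (hasDerivAt_inChartAt h)
    (inChartAt_self c s)).clm_apply (differentiableAt_deriv_inChartAt h)
  have h2 : (fun t => at₁ θ (c t) (vel c t)) =ᶠ[𝓝 s]
      fun t => loc₁ θ (c s) (inChartAt c s t) (deriv (inChartAt c s) t) := by
    filter_upwards [contMDiffAt_curve_eventually h, curve_eventually_source h.continuousAt hs]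
      with t ht hts
    rw [(vel_eq_coordMap ht (c s) hts).2]
    change _ = at₁ θ ((extChartAt (𝓡 4) (c s)).symm (extChartAt (𝓡 4) (c s) (c t))) _
    rw [(extChartAt (𝓡 4) (c s)).left_inv hts]
    rfl
  have h3 := h1.congr_of_eventuallyEq h2
  refine h3.congr_deriv ?_
  rw [nablaC_eq (hθ (c s)), nablaC₂, acc_eq, map_add, hv]
  have h4 : (loc₁ θ (c s) ∘ inChartAt c s) s = at₁ θ (c s) := loc₁_self' θ (c s)
  rw [h4]
  ring

lemma hasDerivAt_bilin_curve {E : Type*} [NormedAddCommGroup E] [NormedSpace ℝ E]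
    {G : E → E →L[ℝ] E →L[ℝ] ℝ} {y v w : ℝ → E} {s : ℝ} {y' v' w' : E}
    (h : DifferentiableAt ℝ G (y s)) (hy : HasDerivAt y y' s) (hv : HasDerivAt v v' s)
    (hw : HasDerivAt w w' s) :
    HasDerivAt (fun t => G (y t) (v t) (w t)) (fderiv ℝ G (y s) y' (v s) (w s)
      + G (y s) v' (w s) + G (y s) (v s) w') s := by
  have h0 : HasDerivAt (fun t => G (y t)) (fderiv ℝ G (y s) y') s :=
    HasFDerivAt.comp_hasDerivAt (E := E →L[ℝ] E →L[ℝ] ℝ) s h.hasFDerivAt hy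
  refine ((h0.clm_apply hv).clm_apply hw).congr_deriv ?_
  simp only [add_apply]

lemma hasDerivAt_loc₂_curve (hg : IsLorentzMetric g) (x : M) {y v w : ℝ → E4} {s : ℝ}
    {y' v' w' : E4} (hy : HasDerivAt y y' s) (hv : HasDerivAt v v' s) (hw : HasDerivAt w w' s)
    (hs : y s = extChartAt (𝓡 4) x x) :
    HasDerivAt (fun t => loc₂ g x (y t) (v t) (w t)) (dG g x y' (v s) (w s)
      + at₂ g x v' (w s) + at₂ g x (v s) w') s := by
  have h : DifferentiableAt ℝ (loc₂ g x) (y s) := by rw [hs]; exact hg.smoothT.diffT x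
  refine (hasDerivAt_bilin_curve h hy hv hw).congr_deriv ?_
  rw [hs, loc₂_self']
  rfl

lemma hasDerivAt_norm (hg : IsLorentzMetric g) {c : ℝ → M} {s : ℝ}
    (h : ContMDiffAt 𝓘(ℝ, ℝ) (𝓡 4) 2 c s) :
    HasDerivAt (fun t => at₂ g (c t) (vel c t) (vel c t))
      (2 * at₂ g (c s) (acc g c s) (vel c s)) s := by
  have hs := mem_extChartAt_source (I := 𝓡 4) (c s)
  have hv := vel_eq (h.mdifferentiableAt (by simp))
  have hd := differentiableAt_deriv_inChartAt h
  have h1 := hasDerivAt_loc₂_curve hg (c s) (hasDerivAt_inChartAt h) hd hd (inChartAt_self c s)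
  have h2 : (fun t => at₂ g (c t) (vel c t) (vel c t)) =ᶠ[𝓝 s]
      fun t => loc₂ g (c s) (inChartAt c s t) (deriv (inChartAt c s) t)
        (deriv (inChartAt c s) t) := by
    filter_upwards [contMDiffAt_curve_eventually h, curve_eventually_source h.continuousAt hs]
      with t ht hts
    rw [(vel_eq_coordMap ht (c s) hts).2]
    change _ = at₂ g ((extChartAt (𝓡 4) (c s)).symm (extChartAt (𝓡 4) (c s) (c t))) _ _
    rw [(extChartAt (𝓡 4) (c s)).left_inv hts]
    rfl
  refine (h1.congr_of_eventuallyEq h2).congr_deriv ?_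
  have h5 := hg.isSymmT (c s) (vel c s) (deriv (deriv (inChartAt c s)) s)
  rw [← hv, h5, acc_eq, ← hv, map_add, add_apply, apply_Gam_self hg]
  ring

/-! ### A linear system of differential equations -/

/-- Grönwall on the compact interval, where the continuous coefficients are bounded; in the maximum
norm on pairs the sum of the three bounds serves both components. -/
lemma linear_system_zero_forward {J : Set ℝ} (hJ : IsOpenInterval J) {u h a b c : ℝ → ℝ}
    (ha : ContinuousOn a J) (hb : ContinuousOn b J) (hc : ContinuousOn c J)
    (hu : ∀ s ∈ J, HasDerivAt u (a s * u s + b s * h s) s)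
    (hh : ∀ s ∈ J, HasDerivAt h (c s * u s) s) {s₀ s : ℝ} (hs₀ : s₀ ∈ J) (hs : s ∈ J)
    (hle : s₀ ≤ s) (h0 : u s₀ = 0) (h1 : h s₀ = 0) : u s = 0 ∧ h s = 0 := by
  have hsub : Set.Icc s₀ s ⊆ J := hJ.2.out hs₀ hs
  obtain ⟨A, hA⟩ := isCompact_Icc.exists_bound_of_continuousOn (ha.mono hsub)
  obtain ⟨B, hB⟩ := isCompact_Icc.exists_bound_of_continuousOn (hb.mono hsub)
  obtain ⟨C, hC⟩ := isCompact_Icc.exists_bound_of_continuousOn (hc.mono hsub)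
  have hd : ∀ t ∈ J, HasDerivAt (fun t => (u t, h t)) (a t * u t + b t * h t, c t * u t) t :=
    fun t ht => (hu t ht).prodMk (hh t ht)
  have key := norm_le_gronwallBound_of_norm_deriv_right_le (f := fun t => (u t, h t))
    (f' := fun t => (a t * u t + b t * h t, c t * u t)) (δ := 0) (K := A + B + C) (ε := 0)
    (a := s₀) (b := s) (fun t ht => (hd t (hsub ht)).continuousAt.continuousWithinAt)
    (fun t ht => (hd t (hsub (Set.Ico_subset_Icc_self ht))).hasDerivWithinAt)
    (by simp [h0, h1]) (by
      intro t ht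
      have ht' := Set.Ico_subset_Icc_self ht
      have e1 := hA t ht'
      have e2 := hB t ht'
      have e3 := hC t ht'
      have e4 : ‖u t‖ ≤ ‖(u t, h t)‖ := norm_fst_le (u t, h t)
      have e5 : ‖h t‖ ≤ ‖(u t, h t)‖ := norm_snd_le (u t, h t)
      have p1 := norm_nonneg (a t)
      have p2 := norm_nonneg (b t)
      have p3 := norm_nonneg (c t)
      have p4 := norm_nonneg (u t)
      have p5 := norm_nonneg (h t)
      set n := ‖(u t, h t)‖
      have pn : 0 ≤ n := norm_nonneg _
      rw [add_zero]
      refine norm_prod_le_iff.2 ⟨?_, ?_⟩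
      · have q1 : ‖a t * u t‖ ≤ A * n := by
          rw [norm_mul]; exact mul_le_mul e1 e4 p4 (p1.trans e1)
        have q2 : ‖b t * h t‖ ≤ B * n := by
          rw [norm_mul]; exact mul_le_mul e2 e5 p5 (p2.trans e2)
        have q3 := mul_nonneg (p3.trans e3) pn
        refine (norm_add_le _ _).trans ?_
        linarith
      · have q1 : ‖c t * u t‖ ≤ C * n := by
          rw [norm_mul]; exact mul_le_mul e3 e4 p4 (p3.trans e3)
        have q2 := mul_nonneg (p1.trans e1) pn
        have q3 := mul_nonneg (p2.trans e2) pn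
        refine q1.trans ?_
        linarith)
    s ⟨hle, le_rfl⟩
  rw [gronwallBound_ε0_δ0] at key
  have h2 : ((u s, h s) : ℝ × ℝ) = 0 := norm_le_zero_iff.1 key
  exact Prod.mk_eq_zero.1 h2

lemma linear_system_zero {J : Set ℝ} (hJ : IsOpenInterval J) {u h a b c : ℝ → ℝ}
    (ha : ContinuousOn a J) (hb : ContinuousOn b J) (hc : ContinuousOn c J)
    (hu : ∀ s ∈ J, HasDerivAt u (a s * u s + b s * h s) s)
    (hh : ∀ s ∈ J, HasDerivAt h (c s * u s) s) {s₀ : ℝ} (hs₀ : s₀ ∈ J)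
    (h0 : u s₀ = 0) (h1 : h s₀ = 0) {s : ℝ} (hs : s ∈ J) : u s = 0 ∧ h s = 0 := by
  rcases le_total s₀ s with hle | hle
  · exact linear_system_zero_forward hJ ha hb hc hu hh hs₀ hs hle h0 h1
  -- Backward uniqueness follows by reflecting the parameter, which changes the sign of the
  -- coefficients.
  · have hJ' : IsOpenInterval (Neg.neg ⁻¹' J) := by
      refine ⟨hJ.1.preimage continuous_neg, ⟨fun x hx y hy z hz => ?_⟩⟩
      exact hJ.2.out hy hx ⟨neg_le_neg hz.2, neg_le_neg hz.1⟩
    have hmaps : Set.MapsTo Neg.neg (Neg.neg ⁻¹' J) J := fun x hx => hx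
    have hn := continuousOn_neg (s := Neg.neg ⁻¹' J)
    have := linear_system_zero_forward (s₀ := -s₀) (s := -s) (J := Neg.neg ⁻¹' J)
      (u := fun t => u (-t)) (h := fun t => h (-t)) (a := fun t => -a (-t))
      (b := fun t => -b (-t)) (c := fun t => -c (-t)) hJ' (ha.comp hn hmaps).neg
      (hb.comp hn hmaps).neg (hc.comp hn hmaps).neg
      (fun t ht => ((hu (-t) ht).scomp t (hasDerivAt_neg t)).congr_deriv (by simp; ring))
      (fun t ht => ((hh (-t) ht).scomp t (hasDerivAt_neg t)).congr_deriv (by simp))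
      (by simpa using hs₀) (by simpa using hs) (neg_le_neg hle) (by simpa using h0)
      (by simpa using h1)
    simpa using this

/-! ### Constants of motion -/

section worldline
variable {m : M → ℝ} {J : Set ℝ} {c : ℝ → M}

lemma IsWorldline.hasDerivAt_covector (h : IsWorldline g m J c) (hJ : IsOpenInterval J)
    {θ : CoField M} (hθ : DiffC θ) {s : ℝ} (hs : s ∈ J) {Z : E4}
    (hg : IsLorentzMetric g) (hZ : at₁ θ (c s) = at₂ g (c s) Z) :
    HasDerivAt (fun t => at₁ θ (c t) (vel c t))
      (nablaC g θ (c s) (vel c s) - m (c s) * dd m (c s) Z) s := by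
  refine (Spacetime.hasDerivAt_covector g hθ (h.c2.contMDiffAt hJ.1 hs)).congr_deriv ?_
  have h1 : at₂ g (c s) (acc g c s) Z = -(m (c s) * dd m (c s) Z) := h.motion s hs Z
  rw [hZ, hg.isSymmT, h1, sub_eq_add_neg]

lemma IsWorldline.norm_vel (h : IsWorldline g m J c) {s : ℝ} (hs : s ∈ J) :
    at₂ g (c s) (vel c s) (vel c s) = -(m (c s)) ^ 2 := h.norm s hs

lemma const_of_hasDerivAt_zero {J : Set ℝ} (hJ : IsOpenInterval J) {f : ℝ → ℝ}
    (hf : ∀ s ∈ J, HasDerivAt f 0 s) {s t : ℝ} (hs : s ∈ J) (ht : t ∈ J) : f s = f t :=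
  hJ.1.is_const_of_deriv_eq_zero hJ.2.isPreconnected
    (fun s hs => (hf s hs).differentiableAt.differentiableWithinAt)
    (fun s hs => (hf s hs).deriv) hs ht

lemma IsWorldline.charge_const (h : IsWorldline g m J c) (hJ : IsOpenInterval J)
    (hf : IsSliceFrame g Ω κ) (hk : ∀ a x v, nablaC g (flat g (κ a)) x v = 0)
    (hmκ : ∀ a x, dd m x (kv κ a x) = 0) {s t : ℝ} (hs : s ∈ J) (ht : t ∈ J) (a : Fin 2) :
    kf g κ a (c s) (vel c s) = kf g κ a (c t) (vel c t) := by
  refine const_of_hasDerivAt_zero hJ (f := fun s => kf g κ a (c s) (vel c s)) (fun s hs => ?_)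
    hs ht
  have h1 := h.hasDerivAt_covector hJ (hf.diffC a) hs (Z := kv κ a (c s)) hf.metric rfl
  rw [hk, hmκ] at h1
  exact h1.congr_deriv (by ring)

/-- The evolution of the normal component of the velocity. -/
lemma IsWorldline.hasDerivAt_nf (h : IsWorldline g m J c) (hJ : IsOpenInterval J)
    (hf : IsSliceFrame g Ω κ) {γ : M → Matrix (Fin 2) (Fin 2) ℝ} {Ψ : M → ℝ}
    (hS : ∀ x, SliceEq g Ω κ γ Ψ x) {s : ℝ} (hs : s ∈ J) :
    HasDerivAt (fun t => nf g Ω (c t) (vel c t))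
      (-(1 / 2 * dd Ψ (c s) (nv g Ω (c s)) * m (c s) ^ 2)
        - 1 / 2 * Real.exp (-Ψ (c s)) * gq g Ω κ γ (c s) (vel c s)
        - 1 / 2 * nf g Ω (c s) (vel c s) * dd Ψ (c s) (vel c s)
        - m (c s) * dd m (c s) (nv g Ω (c s))) s := by
  have h1 := h.hasDerivAt_covector hJ (smoothC_normal hf.metric hf.foliation).diffC hs
    (Z := nv g Ω (c s)) hf.metric rfl
  have h2 := hS (c s) (vel c s)
  rw [h.norm_vel hs] at h2
  refine h1.congr_deriv ?_
  change Qn g Ω (c s) (vel c s) - _ = _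
  rw [h2]
  ring

end worldline

end

section

/-! ### The lowered acceleration -/

section calculus
variable {E : Type*} [NormedAddCommGroup E] [NormedSpace ℝ E]

/-- The acceleration, with lowered index, of a curve through `p` with derivatives `v` and `a`. -/
def lowAcc (G : E → E →L[ℝ] E →L[ℝ] ℝ) (p v a b : E) : ℝ :=
  G p a b + fderiv ℝ G p v v b - 1 / 2 * fderiv ℝ G p b v v

/-- The derivative of a pulled back tensor. -/
lemma fderiv_pullback {G G' : E → E →L[ℝ] E →L[ℝ] ℝ} {T : E → E} {p : E}
    (hT : ContDiffAt ℝ 2 T p) (hG : DifferentiableAt ℝ G (T p)) (hG' : DifferentiableAt ℝ G' p)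
    (h : ∀ᶠ q in 𝓝 p, ∀ a b, G' q a b = G (T q) (fderiv ℝ T q a) (fderiv ℝ T q b)) (u a b : E) :
    fderiv ℝ G' p u a b = fderiv ℝ G (T p) (fderiv ℝ T p u) (fderiv ℝ T p a) (fderiv ℝ T p b)
      + G (T p) (fderiv ℝ (fderiv ℝ T) p u a) (fderiv ℝ T p b)
      + G (T p) (fderiv ℝ T p a) (fderiv ℝ (fderiv ℝ T) p u b) := by
  have hl : HasDerivAt (fun t : ℝ => p + t • u) u 0 := by
    simpa using ((hasDerivAt_id (0 : ℝ)).smul_const u).const_add p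
  have hl0 : p + (0 : ℝ) • u = p := by simp
  have hT1 : HasDerivAt (fun t : ℝ => T (p + t • u)) (fderiv ℝ T p u) 0 :=
    (hT.differentiableAt (by simp)).hasFDerivAt.comp_hasDerivAt_of_eq 0 hl hl0.symm
  have hT2 : DifferentiableAt ℝ (fderiv ℝ T) p :=
    (hT.fderiv_right (m := 1) (by norm_num)).differentiableAt (by simp)
  have hT3 : HasDerivAt (fun t : ℝ => fderiv ℝ T (p + t • u)) (fderiv ℝ (fderiv ℝ T) p u) 0 :=
    HasFDerivAt.comp_hasDerivAt_of_eq (E := E →L[ℝ] E) 0 hT2.hasFDerivAt hl hl0.symm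
  have hT4 : ∀ w, HasDerivAt (fun t : ℝ => fderiv ℝ T (p + t • u) w)
      (fderiv ℝ (fderiv ℝ T) p u w) 0 := fun w =>
    (hT3.clm_apply (hasDerivAt_const 0 w)).congr_deriv (by simp)
  have h1 := hasDerivAt_bilin_curve (G := G) (y := fun t : ℝ => T (p + t • u)) (s := 0)
    (by simpa only [hl0] using hG) hT1 (hT4 a) (hT4 b)
  have h2 := hasDerivAt_bilin_curve (G := G') (y := fun t : ℝ => p + t • u) (s := 0)
    (by simpa only [hl0] using hG') hl (hasDerivAt_const 0 a) (hasDerivAt_const 0 b)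
  have h3 : Filter.Tendsto (fun t : ℝ => p + t • u) (𝓝 0) (𝓝 p) := by
    have := hl.continuousAt
    rwa [ContinuousAt, hl0] at this
  have h4 := h2.unique (h1.congr_of_eventuallyEq ((h3.eventually h).mono fun t ht => ht a b))
  simp only [hl0, map_zero, zero_apply, add_zero] at h4
  exact h4

/-- The lowered acceleration transforms as a covector. -/
lemma lowAcc_pullback {G G' : E → E →L[ℝ] E →L[ℝ] ℝ} {T : E → E} {p : E}
    (hT : ContDiffAt ℝ 2 T p) (hG : DifferentiableAt ℝ G (T p)) (hG' : DifferentiableAt ℝ G' p)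
    (hs : ∀ a b, G (T p) a b = G (T p) b a)
    (h : ∀ᶠ q in 𝓝 p, ∀ a b, G' q a b = G (T q) (fderiv ℝ T q a) (fderiv ℝ T q b)) (v a b : E) :
    lowAcc G' p v a b = lowAcc G (T p) (fderiv ℝ T p v)
      (fderiv ℝ T p a + fderiv ℝ (fderiv ℝ T) p v v) (fderiv ℝ T p b) := by
  have hsym : fderiv ℝ (fderiv ℝ T) p b v = fderiv ℝ (fderiv ℝ T) p v b :=
    (hT.isSymmSndFDerivAt (by simp)).eq b v
  have h1 := h.self_of_nhds a b
  rw [lowAcc, lowAcc, fderiv_pullback hT hG hG' h, fderiv_pullback hT hG hG' h, h1, hsym,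
    hs (fderiv ℝ (fderiv ℝ T) p v b), map_add, add_apply]
  ring

lemma contDiffOn_fderiv_apply {D F : Type*} [NormedAddCommGroup D] [NormedSpace ℝ D]
    [NormedAddCommGroup F] [NormedSpace ℝ F] {G : E → F} {U : Set E} (hU : IsOpen U)
    (hG : ContDiffOn ℝ ∞ G U) {P Q : D → E} {V : Set D} (hP : ContDiffOn ℝ ∞ P V)
    (hm : Set.MapsTo P V U) (hQ : ContDiffOn ℝ ∞ Q V) :
    ContDiffOn ℝ ∞ (fun q => fderiv ℝ G (P q) (Q q)) V :=
  ((hG.fderiv_of_isOpen (m := ∞) hU (by simp)).comp hP hm).clm_apply hQ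

/-- Local existence for second order equations with prescribed lowered acceleration. -/
lemma exists_lowAcc_eq [FiniteDimensional ℝ E] [CompleteSpace E] {G : E → E →L[ℝ] E →L[ℝ] ℝ}
    {f : E → E →L[ℝ] ℝ} {U : Set E} (hU : IsOpen U) (hG : ContDiffOn ℝ ∞ G U)
    (hf : ContDiffOn ℝ ∞ f U) {p v : E} (hp : p ∈ U) (e : E ≃L[ℝ] (E →L[ℝ] ℝ))
    (he : (e : E →L[ℝ] E →L[ℝ] ℝ) = G p) :
    ∃ ε > 0, ∃ y w a : ℝ → E, y 0 = p ∧ w 0 = v ∧ ContinuousOn a (Set.Ioo (-ε) ε) ∧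
      ∀ t ∈ Set.Ioo (-ε) ε, y t ∈ U ∧ HasDerivAt y (w t) t ∧ HasDerivAt w (a t) t ∧
        ∀ b, lowAcc G (y t) (w t) (a t) b = f (y t) b := by
  -- The prescribed equation reads `G(y) a = θ(y, w)`; solving it for `a` makes the problem a first
  -- order system for `(y, w)`.
  let θ₀ : E × E → E →ₗ[ℝ] ℝ := fun q =>
    { toFun := fun b => 1 / 2 * fderiv ℝ G q.1 b q.2 q.2 - fderiv ℝ G q.1 q.2 q.2 b + f q.1 b
      map_add' := fun b b' => by simp only [map_add, add_apply]; ring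
      map_smul' := fun k b => by
        simp only [map_smul, smul_apply, smul_eq_mul, RingHom.id_apply]; ring }
  set θ : E × E → E →L[ℝ] ℝ := fun q => LinearMap.toContinuousLinearMap (θ₀ q)
  have hθ : ∀ q b, θ q b = 1 / 2 * fderiv ℝ G q.1 b q.2 q.2 - fderiv ℝ G q.1 q.2 q.2 b + f q.1 b :=
    fun q b => rfl
  have hV : IsOpen (U ×ˢ (Set.univ : Set E)) := hU.prod isOpen_univ
  have hpV : (p, v) ∈ U ×ˢ (Set.univ : Set E) := ⟨hp, trivial⟩
  have c1 : ContDiffOn ℝ ∞ (fun q : E × E => q.1) (U ×ˢ (Set.univ : Set E)) :=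
    contDiff_fst.contDiffOn
  have c2 : ContDiffOn ℝ ∞ (fun q : E × E => q.2) (U ×ˢ (Set.univ : Set E)) :=
    contDiff_snd.contDiffOn
  have hm : Set.MapsTo (fun q : E × E => q.1) (U ×ˢ (Set.univ : Set E)) U := fun q hq => hq.1
  have c4 : ContDiffOn ℝ ∞ (fun q : E × E => G q.1) (U ×ˢ (Set.univ : Set E)) :=
    hG.comp c1 hm
  have c5 : ContDiffOn ℝ ∞ θ (U ×ˢ (Set.univ : Set E)) := by
    rw [contDiffOn_clm_apply]
    intro b
    have c3 := contDiffOn_fderiv_apply (F := E →L[ℝ] E →L[ℝ] ℝ) hU hG c1 hm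
      (contDiffOn_const (c := b))
    have c3' := contDiffOn_fderiv_apply (F := E →L[ℝ] E →L[ℝ] ℝ) hU hG c1 hm c2
    have d1 := (c3.clm_apply c2).clm_apply c2
    have d2 := (c3'.clm_apply c2).clm_apply (contDiffOn_const (c := b))
    have d3 := (hf.comp c1 hm).clm_apply (contDiffOn_const (c := b))
    exact (((contDiffOn_const (c := (1 / 2 : ℝ))).mul d1).sub d2).add d3
  have hinv : ContDiffAt ℝ ∞ (ContinuousLinearMap.inverse : (E →L[ℝ] E →L[ℝ] ℝ) → _) (G p) := by
    rw [← he]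
    exact contDiffAt_map_inverse e
  have hGp : ContDiffAt ℝ ∞ (fun q : E × E => G q.1) (p, v) :=
    c4.contDiffAt (hV.mem_nhds hpV)
  -- `G` is known to be invertible at `p` only. Elsewhere the inverse may be the default value, so
  -- the equation holds just near the initial point.
  set F : E × E → E := fun q => (G q.1).inverse (θ q) with hF
  have hFc : ContDiffAt ℝ ∞ F (p, v) :=
    (ContDiffAt.comp (p, v) (g := ContinuousLinearMap.inverse) (f := fun q : E × E => G q.1) hinv
      hGp).clm_apply (c5.contDiffAt (hV.mem_nhds hpV))
  have hFc1 : ContDiffAt ℝ 1 F (p, v) := hFc.of_le (by exact_mod_cast le_top)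
  have hX : ContDiffAt ℝ 1 (fun q : E × E => (q.2, F q)) (p, v) := contDiffAt_snd.prodMk hFc1
  obtain ⟨α, h0, ε, hε, hα⟩ :=
    hX.exists_forall_mem_closedBall_exists_eq_forall_mem_Ioo_hasDerivAt₀ 0
  rw [zero_sub, zero_add] at hα
  -- shrink the interval
  have ev : ∀ᶠ q in 𝓝 (p, v), q.1 ∈ U ∧ ContinuousAt F q ∧ ∀ b, G q.1 (F q) b = θ q b := by
    have e1 : ∀ᶠ q in 𝓝 (p, v), q ∈ U ×ˢ (Set.univ : Set E) := hV.mem_nhds hpV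
    have e2 : ∀ᶠ q in 𝓝 (p, v), ContinuousAt F q :=
      (hFc1.eventually (by simp)).mono fun q hq => hq.continuousAt
    have e3 := hGp.continuousAt.eventually (he ▸ ContinuousLinearEquiv.nhds e)
    filter_upwards [e1, e2, e3] with q h1 h2 h3
    obtain ⟨e', he'⟩ := h3
    refine ⟨h1.1, h2, fun b => ?_⟩
    simp only [hF]
    rw [← he', ContinuousLinearMap.inverse_equiv]
    simp
  have hαc : ContinuousAt α 0 := (hα 0 ⟨by linarith, hε⟩).continuousAt
  rw [← h0] at ev
  obtain ⟨δ, hδ, hδ'⟩ := Metric.eventually_nhds_iff.1 (hαc.eventually ev)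
  have hsub : ∀ t ∈ Set.Ioo (-min ε δ) (min ε δ), t ∈ Set.Ioo (-ε) ε ∧ dist t 0 < δ := by
    intro t ht
    have h1 := min_le_left ε δ
    have h2 := min_le_right ε δ
    refine ⟨⟨by linarith [ht.1], by linarith [ht.2]⟩, ?_⟩
    rw [Real.dist_0_eq_abs, abs_lt]
    exact ⟨by linarith [ht.1], by linarith [ht.2]⟩
  refine ⟨min ε δ, lt_min hε hδ, fun t => (α t).1, fun t => (α t).2, fun t => F (α t),
    congrArg Prod.fst h0, congrArg Prod.snd h0, fun t ht => ?_, fun t ht => ?_⟩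
  · obtain ⟨h1, h2⟩ := hsub t ht
    exact (ContinuousAt.comp (hδ' h2).2.1 (hα t h1).continuousAt).continuousWithinAt
  · obtain ⟨h1, h2⟩ := hsub t ht
    obtain ⟨k1, -, k3⟩ := hδ' h2
    refine ⟨k1, (hα t h1).fst, (hα t h1).snd, fun b => ?_⟩
    rw [lowAcc, k3 b]
    rw [hθ]
    ring

end calculus

/-! ### Accelerations under a change of the preferred chart -/

variable [IsManifold (𝓡 4) ∞ M] {g : Tensor2 M} {Ω : M → ℝ} {κ : Fin 2 → VField M}

lemma contDiffAt_transition (x z : M) {p : E4} (hp : p ∈ (extChartAt (𝓡 4) x).target)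
    (hz : (extChartAt (𝓡 4) x).symm p ∈ (extChartAt (𝓡 4) z).source) :
    ContDiffAt ℝ ∞ (fun q => extChartAt (𝓡 4) z ((extChartAt (𝓡 4) x).symm q)) p := by
  rw [← contMDiffAt_iff_contDiffAt]
  rw [extChartAt_source] at hz
  exact (contMDiffAt_extChartAt' hz).comp p
    ((contMDiffOn_extChartAt_symm x).contMDiffAt (target_mem_nhds x hp))

lemma transition_eventually (x z : M) {p : E4} (hp : p ∈ (extChartAt (𝓡 4) x).target)
    (hz : (extChartAt (𝓡 4) x).symm p ∈ (extChartAt (𝓡 4) z).source) :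
    ∀ᶠ q in 𝓝 p, q ∈ (extChartAt (𝓡 4) x).target ∧
      (extChartAt (𝓡 4) x).symm q ∈ (extChartAt (𝓡 4) z).source := by
  refine Filter.Eventually.and (target_mem_nhds x hp) ?_
  exact ((contMDiffOn_extChartAt_symm (I := 𝓡 4) (n := ∞) x).contMDiffAt
    (target_mem_nhds x hp)).continuousAt.eventually_mem ((isOpen_extChartAt_source z).mem_nhds hz)

lemma coordMap_transition (x z : M) {p : E4} (hp : p ∈ (extChartAt (𝓡 4) x).target)
    (hz : (extChartAt (𝓡 4) x).symm p ∈ (extChartAt (𝓡 4) z).source) (b : E4) :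
    coordMap x p b = coordMap z (extChartAt (𝓡 4) z ((extChartAt (𝓡 4) x).symm p))
      (fderiv ℝ (fun q => extChartAt (𝓡 4) z ((extChartAt (𝓡 4) x).symm q)) p b) := by
  have h1 : (extChartAt (𝓡 4) x).symm =ᶠ[𝓝 p] (extChartAt (𝓡 4) z).symm ∘
      fun q => extChartAt (𝓡 4) z ((extChartAt (𝓡 4) x).symm q) :=
    (transition_eventually x z hp hz).mono fun q hq =>
      ((extChartAt (𝓡 4) z).left_inv hq.2).symm
  have h2 : MDifferentiableAt 𝓘(ℝ, E4) 𝓘(ℝ, E4)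
      (fun q => extChartAt (𝓡 4) z ((extChartAt (𝓡 4) x).symm q)) p :=
    ((contDiffAt_transition x z hp hz).differentiableAt (by simp)).mdifferentiableAt
  have h3 := mfderiv_comp p (mdifferentiableAt_symm z ((extChartAt (𝓡 4) z).map_source hz)) h2
  have h4 : (coordMap x p : E4 →L[ℝ] E4) = mfderiv 𝓘(ℝ, E4) (𝓡 4) ((extChartAt (𝓡 4) z).symm ∘
      fun q => extChartAt (𝓡 4) z ((extChartAt (𝓡 4) x).symm q)) p := h1.mfderiv_eq
  rw [h4, h3, mfderiv_eq_fderiv]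
  rfl

lemma loc₂_transition (B : Tensor2 M) (x z : M) {p : E4}
    (hp : p ∈ (extChartAt (𝓡 4) x).target)
    (hz : (extChartAt (𝓡 4) x).symm p ∈ (extChartAt (𝓡 4) z).source) (a b : E4) :
    loc₂ B x p a b = loc₂ B z (extChartAt (𝓡 4) z ((extChartAt (𝓡 4) x).symm p))
      (fderiv ℝ (fun q => extChartAt (𝓡 4) z ((extChartAt (𝓡 4) x).symm q)) p a)
      (fderiv ℝ (fun q => extChartAt (𝓡 4) z ((extChartAt (𝓡 4) x).symm q)) p b) := by
  have h1 : at₂ B ((extChartAt (𝓡 4) x).symm p) = at₂ B ((extChartAt (𝓡 4) z).symm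
      (extChartAt (𝓡 4) z ((extChartAt (𝓡 4) x).symm p))) := by
    rw [(extChartAt (𝓡 4) z).left_inv hz]
  change at₂ B _ (coordMap x p a) (coordMap x p b) = at₂ B _ (coordMap z _ _) (coordMap z _ _)
  rw [← coordMap_transition x z hp hz, ← coordMap_transition x z hp hz, h1]

/-- The acceleration of a curve computed in another chart. -/
lemma apply_acc (hg : IsLorentzMetric g) {c : ℝ → M} {t : ℝ} (x : M)
    (hx : c t ∈ (extChartAt (𝓡 4) x).source) {y w : ℝ → E4} {a : E4}
    (hy : ∀ᶠ u in 𝓝 t, c u = (extChartAt (𝓡 4) x).symm (y u))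
    (hyt : y t = extChartAt (𝓡 4) x (c t))
    (hw : ∀ᶠ u in 𝓝 t, HasDerivAt y (w u) u) (ha : HasDerivAt w a t) (b : E4) :
    at₂ g (c t) (acc g c t) (coordMap x (y t) b) = lowAcc (loc₂ g x) (y t) (w t) a b := by
  -- `acc` is computed in the chart centred at the moving point, whereas the equation of motion is
  -- solved in one fixed chart; `T` is the transition between the two.
  set T : E4 → E4 := fun q => extChartAt (𝓡 4) (c t) ((extChartAt (𝓡 4) x).symm q) with hT
  have hp : y t ∈ (extChartAt (𝓡 4) x).target := by
    rw [hyt]; exact (extChartAt (𝓡 4) x).map_source hx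
  have hsym : (extChartAt (𝓡 4) x).symm (y t) = c t := by
    rw [hyt, (extChartAt (𝓡 4) x).left_inv hx]
  have hz : (extChartAt (𝓡 4) x).symm (y t) ∈ (extChartAt (𝓡 4) (c t)).source := by
    rw [hsym]; exact mem_extChartAt_source (c t)
  have hTp : T (y t) = extChartAt (𝓡 4) (c t) (c t) := by rw [hT]; simp only [hsym]
  have hTc : ContDiffAt ℝ 2 T (y t) :=
    (contDiffAt_transition x (c t) hp hz).of_le ENat.LEInfty.out
  have hb : coordMap x (y t) b = fderiv ℝ T (y t) b := by
    rw [coordMap_transition x (c t) hp hz]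
    have : extChartAt (𝓡 4) (c t) ((extChartAt (𝓡 4) x).symm (y t))
      = extChartAt (𝓡 4) (c t) (c t) := hTp
    rw [this, coordMap_self]
  -- the curve in the chart at `c t`
  have hyc : ContinuousAt y t := hw.self_of_nhds.continuousAt
  have hdT : ∀ᶠ u in 𝓝 t, DifferentiableAt ℝ T (y u) :=
    hyc.eventually (((hTc.of_le (m := 1) (by norm_num)).eventually (by simp)).mono
      fun q hq => hq.differentiableAt (by simp))
  have e1 : inChartAt c t =ᶠ[𝓝 t] fun u => T (y u) := hy.mono fun u hu => by
    rw [inChartAt, hu]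
  have e2 : deriv (inChartAt c t) =ᶠ[𝓝 t] fun u => fderiv ℝ T (y u) (w u) := by
    filter_upwards [e1.eventuallyEq_nhds, hw, hdT] with u h1 h2 h3
    rw [h1.deriv_eq]
    exact (h3.hasFDerivAt.comp_hasDerivAt u h2).deriv
  have hT2 : DifferentiableAt ℝ (fderiv ℝ T) (y t) :=
    (hTc.fderiv_right (m := 1) (by norm_num)).differentiableAt (by simp)
  have e3 : HasDerivAt (fun u => fderiv ℝ T (y u)) (fderiv ℝ (fderiv ℝ T) (y t) (w t)) t :=
    HasFDerivAt.comp_hasDerivAt (E := E4 →L[ℝ] E4) t hT2.hasFDerivAt hw.self_of_nhds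
  have e4 : deriv (deriv (inChartAt c t)) t
      = fderiv ℝ T (y t) a + fderiv ℝ (fderiv ℝ T) (y t) (w t) (w t) := by
    rw [((e3.clm_apply ha).congr_of_eventuallyEq e2).deriv, add_comm]
  have h1 := lowAcc_pullback (G := loc₂ g (c t)) (G' := loc₂ g x) hTc
    (by rw [hTp]; exact hg.smoothT.diffT (c t))
    (((hg.smoothT x).contDiffAt (target_mem_nhds x hp)).differentiableAt (by simp))
    (loc₂_symm hg.isSymmT (c t) _)
    ((transition_eventually x (c t) hp hz).mono fun q hq a b =>
      loc₂_transition g x (c t) hq.1 hq.2 a b) (w t) a b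
  rw [h1, hTp, ← e4, hb, acc_eq, map_add, add_apply, apply_Gam_self hg, lowAcc, loc₂_self',
    e2.self_of_nhds]
  change _ = _ + dG g (c t) _ _ _ - 1 / 2 * dG g (c t) _ _ _
  ring

end

section

variable [IsManifold (𝓡 4) ∞ M] {g : Tensor2 M} {Ω : M → ℝ} {κ : Fin 2 → VField M} {m : M → ℝ}

/-! ### Existence of worldlines -/

lemma contDiffOn_two_of_hasDerivAt {F : Type*} [NormedAddCommGroup F] [NormedSpace ℝ F]
    {y w a : ℝ → F} {J : Set ℝ} (hJ : IsOpen J) (hy : ∀ t ∈ J, HasDerivAt y (w t) t)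
    (hw : ∀ t ∈ J, HasDerivAt w (a t) t) (ha : ContinuousOn a J) : ContDiffOn ℝ 2 y J := by
  have h1 : ContDiffOn ℝ 1 w J := by
    rw [show (1 : WithTop ℕ∞) = 0 + 1 by simp, contDiffOn_succ_iff_deriv_of_isOpen hJ]
    refine ⟨fun t ht => (hw t ht).differentiableAt.differentiableWithinAt, by simp, ?_⟩
    rw [contDiffOn_zero]
    exact ha.congr fun t ht => (hw t ht).deriv
  rw [show (2 : WithTop ℕ∞) = 1 + 1 by norm_num, contDiffOn_succ_iff_deriv_of_isOpen hJ]
  exact ⟨fun t ht => (hy t ht).differentiableAt.differentiableWithinAt, by simp,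
    h1.congr fun t ht => (hy t ht).deriv⟩

/-- Solve the equation with force `-m dm` in the chart at `x`. The normalization need only hold
initially, since the equation makes `g(ċ,ċ) + m²` constant. -/
lemma exists_worldline (hg : IsLorentzMetric g) (hm : SmoothFun m) (x : M) {w : E4}
    (hw : at₂ g x w w = -(m x) ^ 2) : ∃ (J : Set ℝ) (c : ℝ → M), IsOpenInterval J ∧ (0 : ℝ) ∈ J ∧
      IsWorldline g m J c ∧ c 0 = x ∧ vel c 0 = w := by
  obtain ⟨e, he⟩ := (hg.form x).exists_equiv
  have hU := isOpen_extChartAt_target (I := 𝓡 4) x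
  have hmU := contDiffOn_locF hm x
  have hf : ContDiffOn ℝ ∞ (fun p => (-locF m x p) • fderiv ℝ (locF m x) p)
      (extChartAt (𝓡 4) x).target := hmU.neg.smul (hmU.fderiv_of_isOpen (m := ∞) hU (by simp))
  obtain ⟨ε, hε, y, u, a, hy0, hu0, hac, hy⟩ := exists_lowAcc_eq hU (contDiffOn_loc₂ hg x) hf
    (v := w) (mem_extChartAt_target x) e (he.trans (loc₂_self' g x).symm)
  set J : Set ℝ := Set.Ioo (-ε) ε with hJ
  have hJo : IsOpen J := isOpen_Ioo
  have h0 : (0 : ℝ) ∈ J := ⟨by linarith, hε⟩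
  have hJi : IsOpenInterval J := ⟨hJo, Set.ordConnected_Ioo⟩
  set c : ℝ → M := fun t => (extChartAt (𝓡 4) x).symm (y t) with hc
  have hcs : ∀ t ∈ J, c t ∈ (extChartAt (𝓡 4) x).source :=
    fun t ht => (extChartAt (𝓡 4) x).map_target (hy t ht).1
  have hyc : ∀ t ∈ J, y t = extChartAt (𝓡 4) x (c t) :=
    fun t ht => ((extChartAt (𝓡 4) x).right_inv (hy t ht).1).symm
  have hy2 : ContDiffOn ℝ 2 y J := contDiffOn_two_of_hasDerivAt hJo (fun t ht => (hy t ht).2.1)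
    (fun t ht => (hy t ht).2.2.1) hac
  have hc2 : IsC2On c J :=
    ((contMDiffOn_extChartAt_symm (I := 𝓡 4) (n := ∞) x).of_le ENat.LEInfty.out).comp
      (contMDiffOn_iff_contDiffOn.2 hy2) fun t ht => (hy t ht).1
  have hvel : ∀ t ∈ J, vel c t = coordMap x (y t) (u t) := by
    intro t ht
    have h1 := (vel_eq_coordMap (hc2.contMDiffAt hJo ht) x (hcs t ht)).2
    have h2 : (fun s => extChartAt (𝓡 4) x (c s)) =ᶠ[𝓝 t] y :=
      Filter.eventuallyEq_of_mem (hJo.mem_nhds ht) fun s hs => (hyc s hs).symm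
    rw [← hyc t ht, h2.deriv_eq, (hy t ht).2.1.deriv] at h1
    exact h1
  have hmot : ∀ t ∈ J, ∀ b : E4, at₂ g (c t) (acc g c t) b = -(m (c t) * dd m (c t) b) := by
    intro t ht b
    have h1 := apply_acc hg x (hcs t ht) (y := y) (Filter.Eventually.of_forall fun _ => rfl)
      (hyc t ht) (Filter.eventually_of_mem (hJo.mem_nhds ht) fun s hs => (hy s hs).2.1)
      (hy t ht).2.2.1 (chartMap x (y t) b)
    rw [(hy t ht).2.2.2, coordMap_chartMap x (hy t ht).1] at h1
    have h2 := dirDeriv_coordMap hm x (hy t ht).1 (chartMap x (y t) b)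
    rw [coordMap_chartMap x (hy t ht).1] at h2
    have h3 : dd m (c t) b = fderiv ℝ (locF m x) (y t) (chartMap x (y t) b) := h2
    rw [h1, h3, smul_apply, smul_eq_mul, neg_mul]
    rfl
  have hc0 : c 0 = x := by rw [hc]; simp only; rw [hy0, extChartAt_to_inv]
  have hv0 : vel c 0 = w := by rw [hvel 0 h0, hy0, coordMap_self, hu0]
  refine ⟨J, c, hJi, h0, ⟨hc2, fun s hs => ?_, hmot⟩, hc0, hv0⟩
  have hd : ∀ t ∈ J, HasDerivAt (fun t => at₂ g (c t) (vel c t) (vel c t) + (m (c t)) ^ 2) 0 t := by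
    intro t ht
    have h1 := hasDerivAt_norm hg (hc2.contMDiffAt hJo ht)
    have h2 := (hm.hasDerivAt_comp (hc2.contMDiffAt hJo ht)).pow 2
    refine (h1.add h2).congr_deriv ?_
    rw [hmot t ht]
    push_cast
    ring
  have h1 := const_of_hasDerivAt_zero hJi hd hs h0
  rw [hv0, hc0, hw] at h1
  change at₂ g (c s) (vel c s) (vel c s) = _
  linarith

end

section

variable [IsManifold (𝓡 4) ∞ M] {g : Tensor2 M} {Ω : M → ℝ} {κ : Fin 2 → VField M} {m : M → ℝ}
  {γ : M → Matrix (Fin 2) (Fin 2) ℝ} {α Ψ : M → ℝ} {q : Fin 2 → ℝ}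

/-! ### Massive particle surfaces -/

/-- The function which vanishes on a slice precisely when the slice is a massive particle surface
for the constants of motion `q`. -/
def surfaceFun (g : Tensor2 M) (Ω : M → ℝ) (γ : M → Matrix (Fin 2) (Fin 2) ℝ) (Ψ m : M → ℝ)
    (q : Fin 2 → ℝ) (x : M) : ℝ :=
  ∑ a, ∑ b, q a * q b * prime g Ω (fun z => γ z a b) x
    + prime g Ω (fun z => Real.exp (Ψ z) * m z ^ 2) x

lemma surfaceFun_eq (hm : SmoothFun m) (hΨ : SmoothFun Ψ) {x : M} {w : E4}
    (hw : ∀ a, kf g κ a x w = q a) : surfaceFun g Ω γ Ψ m q x = lapse g Ω x *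
      (gq g Ω κ γ x w + Real.exp (Ψ x) * (m x ^ 2 * dd Ψ x (nv g Ω x)
        + 2 * m x * dd m x (nv g Ω x))) := by
  have h1 : dd (fun z => Real.exp (Ψ z) * m z ^ 2) x (nv g Ω x)
      = Real.exp (Ψ x) * (m x ^ 2 * dd Ψ x (nv g Ω x) + 2 * m x * dd m x (nv g Ω x)) := by
    rw [dd_mul hΨ.exp (hm.pow 2), dd_pow_two hm, dd_exp hΨ]
    ring
  simp only [surfaceFun, prime_eq_dd, h1, gq, hw, Fin.sum_univ_two]
  ring

lemma smooth_surfaceFun (hf : IsSliceFrame g Ω κ) (hm : SmoothFun m) (hΨ : SmoothFun Ψ)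
    (hγ : ∀ a b, SmoothFun fun x => γ x a b) : SmoothFun (surfaceFun g Ω γ Ψ m q) := by
  have h1 := fun a b => (((hγ a b).prime hf.metric hf.foliation).smul_const (q a * q b))
  have h2 := (hΨ.exp.mul (hm.pow 2)).prime hf.metric hf.foliation
  refine (congrArg SmoothFun (funext fun x => ?_)).mp
    ((((h1 0 0).add (h1 0 1)).add ((h1 1 0).add (h1 1 1))).add h2)
  simp only [surfaceFun, Fin.sum_univ_two]

lemma sliceConstant_surfaceFun (hf : IsSliceFrame g Ω κ) (hm : SmoothFun m) (hΨ : SmoothFun Ψ)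
    (hγ : ∀ a b, SmoothFun fun x => γ x a b) (hc : ∀ a b, SliceConstant Ω fun x => γ x a b)
    (hms : SliceConstant Ω (prime g Ω fun x => Real.exp (Ψ x) * m x ^ 2)) :
    SliceConstant Ω (surfaceFun g Ω γ Ψ m q) := by
  have s1 := fun a b => (((hγ a b).prime hf.metric hf.foliation).smul_const (q a * q b))
  have s2 := (hΨ.exp.mul (hm.pow 2)).prime hf.metric hf.foliation
  have h1 := fun a b => ((hc a b).prime hf.metric hf.foliation (hγ a b)).const_mul
    ((hγ a b).prime hf.metric hf.foliation) (q a * q b)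
  refine (congrArg (SliceConstant Ω) (funext fun x => ?_)).mp
    (SliceConstant.add (((s1 0 0).add (s1 0 1)).add ((s1 1 0).add (s1 1 1))) s2
      (SliceConstant.add ((s1 0 0).add (s1 0 1)) ((s1 1 0).add (s1 1 1))
      (SliceConstant.add (s1 0 0) (s1 0 1) (h1 0 0) (h1 0 1))
      (SliceConstant.add (s1 1 0) (s1 1 1) (h1 1 0) (h1 1 1))) hms)
  simp only [surfaceFun, Fin.sum_univ_two]

/-- Once the charges are inserted, the `γ` term and all terms with the mass combine into
`surfaceFun`, which is the only source in a linear equation for the normal velocity. -/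
lemma IsWorldline.hasDerivAt_nf_surfaceFun {J : Set ℝ} {c : ℝ → M} (h : IsWorldline g m J c)
    (hJ : IsOpenInterval J) (hf : IsSliceFrame g Ω κ) (hm : SmoothFun m) (hΨ : SmoothFun Ψ)
    (hS : ∀ x, SliceEq g Ω κ γ Ψ x) {s : ℝ} (hs : s ∈ J)
    (hq : ∀ a, kf g κ a (c s) (vel c s) = q a) :
    HasDerivAt (fun t => nf g Ω (c t) (vel c t))
      (-(1 / 2) * dd Ψ (c s) (vel c s) * nf g Ω (c s) (vel c s)
        + -(1 / 2) * Real.exp (-Ψ (c s)) * (lapse g Ω (c s))⁻¹ * surfaceFun g Ω γ Ψ m q (c s))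
      s := by
  refine (h.hasDerivAt_nf hJ hf hS hs).congr_deriv ?_
  rw [surfaceFun_eq hm hΨ hq]
  have h0 := (lapse_pos hf.metric hf.foliation (c s)).ne'
  have h8 : Real.exp (-Ψ (c s)) * Real.exp (Ψ (c s)) = 1 := by rw [← Real.exp_add]; simp
  field_simp
  linear_combination (m (c s) ^ 2 * dd Ψ (c s) (nv g Ω (c s))
    + 2 * m (c s) * dd m (c s) (nv g Ω (c s))) * h8

/-- Because `surfaceFun` is constant on the slices, its derivative along a worldline is a multiple
of the normal velocity. The pair thus solves a homogeneous linear system, with zero data at the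
point of contact, so the normal velocity vanishes and `Ω` stays constant. -/
lemma isMassiveParticleSurface_of_surfaceFun (hf : IsSliceFrame g Ω κ) (hm : SmoothFun m)
    (hΨ : SmoothFun Ψ) (hγ : ∀ a b, SmoothFun fun x => γ x a b)
    (hc : ∀ a b, SliceConstant Ω fun x => γ x a b)
    (hms : SliceConstant Ω (prime g Ω fun x => Real.exp (Ψ x) * m x ^ 2))
    (hS : ∀ x, SliceEq g Ω κ γ Ψ x) {p : M} (hp : surfaceFun g Ω γ Ψ m q p = 0) :
    IsMassiveParticleSurface g Ω κ m (Ω p) q := by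
  rintro J c hJ hw hq ⟨s₀, hs₀, hs₁, hs₂⟩ s hs
  have hsm : SmoothFun (surfaceFun g Ω γ Ψ m q) := smooth_surfaceFun hf hm hΨ hγ
  have hsc : SliceConstant Ω (surfaceFun g Ω γ Ψ m q) :=
    sliceConstant_surfaceFun hf hm hΨ hγ hc hms
  have hC : ∀ t ∈ J, ContMDiffAt 𝓘(ℝ, ℝ) (𝓡 4) 2 c t := fun t ht => hw.c2.contMDiffAt hJ.1 ht
  have hcc : ContinuousOn c J := fun t ht => (hC t ht).continuousAt.continuousWithinAt
  have hl0 : ∀ x, lapse g Ω x ≠ 0 := fun x => (lapse_pos hf.metric hf.foliation x).ne'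
  have hl := smooth_lapse hf.metric hf.foliation
  have key := fun t (ht : t ∈ J) => linear_system_zero hJ
    (u := fun t => nf g Ω (c t) (vel c t)) (h := fun t => surfaceFun g Ω γ Ψ m q (c t))
    (a := fun t => -(1 / 2) * dd Ψ (c t) (vel c t))
    (b := fun t => -(1 / 2) * Real.exp (-Ψ (c t)) * (lapse g Ω (c t))⁻¹)
    (c := fun t => (lapse g Ω (c t))⁻¹ * prime g Ω (surfaceFun g Ω γ Ψ m q) (c t))
    (fun t ht => by
      have h1 := hasDerivAt_covector g (smoothC_dF hΨ).diffC (hC t ht)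
      exact (h1.continuousAt.const_mul (-(1 / 2))).continuousWithinAt)
    (((continuous_const.mul (Real.continuous_exp.comp hΨ.continuous.neg)).mul
      (hl.inv hl0).continuous).comp_continuousOn hcc)
    (((hl.inv hl0).mul (hsm.prime hf.metric hf.foliation)).continuous.comp_continuousOn hcc)
    (fun t ht => hw.hasDerivAt_nf_surfaceFun hJ hf hm hΨ hS ht (hq t ht))
    (fun t ht => by
      refine (hsm.hasDerivAt_comp (hC t ht)).congr_deriv ?_
      rw [hsc.dd_eq hf.metric hf.foliation, prime_eq_dd]
      field_simp [hl0 (c t)])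
    hs₀ (nf_of_tangent hf.metric hs₂)
    ((hsc.eq_of_eq hf.metric hf.foliation hsm hs₁).trans hp) ht
  have h1 := const_of_hasDerivAt_zero hJ (f := fun t => Ω (c t)) (fun t ht =>
    (hf.foliation.smooth.hasDerivAt_comp (hC t ht)).congr_deriv
      (dd_of_nf hf.metric hf.foliation (key t ht).1)) hs hs₀
  exact h1.trans hs₁

/-- A worldline starting with velocity `w` exists, keeps the charges and is trapped in the slice, so
its normal velocity vanishes identically and so must the source. Without an admissible `w` the
surface property could hold vacuously. -/
lemma IsMassiveParticleSurface.surfaceFun_eq_zero (hf : IsSliceFrame g Ω κ) (hm : SmoothFun m)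
    (hΨ : SmoothFun Ψ) (hk : ∀ a x v, nablaC g (flat g (κ a)) x v = 0)
    (hmκ : ∀ a x, dd m x (kv κ a x) = 0)
    (hS : ∀ x, SliceEq g Ω κ γ Ψ x) {x : M} (h : IsMassiveParticleSurface g Ω κ m (Ω x) q)
    {w : E4} (hw : dd Ω x w = 0) (hn : at₂ g x w w = -(m x) ^ 2)
    (hq : ∀ a, kf g κ a x w = q a) : surfaceFun g Ω γ Ψ m q x = 0 := by
  obtain ⟨J, c, hJ, h0, hc, hc0, hv0⟩ := exists_worldline hf.metric hm x hn
  have hq' : ∀ s ∈ J, ∀ a, kf g κ a (c s) (vel c s) = q a := by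
    intro s hs a
    rw [hc.charge_const hJ hf hk hmκ hs h0 a, hv0, hc0, hq]
  have ht : TangentToSlice Ω (c 0) (velocity c 0) := by
    change dd Ω (c 0) (vel c 0) = 0
    rw [hv0, hc0, hw]
  have h1 : ∀ s ∈ J, Ω (c s) = Ω x := h J c hJ hc hq' ⟨0, h0, congrArg Ω hc0, ht⟩
  have h2 : ∀ s ∈ J, nf g Ω (c s) (vel c s) = 0 := by
    intro s hs
    refine nf_of_tangent hf.metric ?_
    have h3 := hf.foliation.smooth.hasDerivAt_comp (hc.c2.contMDiffAt hJ.1 hs)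
    have h4 : (fun t => Ω (c t)) =ᶠ[𝓝 s] fun _ => Ω x :=
      Filter.eventuallyEq_of_mem (hJ.1.mem_nhds hs) h1
    exact h3.unique ((hasDerivAt_const s (Ω x)).congr_of_eventuallyEq h4)
  have h5 := hc.hasDerivAt_nf_surfaceFun hJ hf hm hΨ hS h0 (hq' 0 h0)
  have h6 : (fun t => nf g Ω (c t) (vel c t)) =ᶠ[𝓝 0] fun _ => 0 :=
    Filter.eventuallyEq_of_mem (hJ.1.mem_nhds h0) h2
  have h7 := h5.unique ((hasDerivAt_const (0 : ℝ) (0 : ℝ)).congr_of_eventuallyEq h6)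
  rw [h2 0 h0, hc0, mul_zero, zero_add] at h7
  refine (mul_eq_zero.1 h7).resolve_left ?_
  have := (lapse_pos hf.metric hf.foliation x)
  have := Real.exp_pos (-Ψ x)
  have : -(1 / 2) * Real.exp (-Ψ x) * (lapse g Ω x)⁻¹ < 0 := by
    rw [mul_assoc]
    exact mul_neg_of_neg_of_pos (by norm_num) (by positivity)
  exact this.ne

end

section

variable [IsManifold (𝓡 4) ∞ M] {g : Tensor2 M} {Ω : M → ℝ} {κ : Fin 2 → VField M} {m : M → ℝ}
  {mt : ℝ} {γ : M → Matrix (Fin 2) (Fin 2) ℝ} {α Ψ : M → ℝ} {q : Fin 2 → ℝ}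

/-! ### The Carter constant -/

/-- The function `Ψ` of the conformal Killing tensor of `g` associated with an exact Killing tensor
of `(m / mt)² g`. -/
def hatPsi (m : M → ℝ) (mt : ℝ) (Ψ : M → ℝ) (x : M) : ℝ := Ψ x + -2 * Real.log (m x / mt)

lemma smooth_hatPsi (hm : SmoothFun m) (h0 : ∀ x, 0 < m x / mt) (hΨ : SmoothFun Ψ) :
    SmoothFun (hatPsi m mt Ψ) := hΨ.add_log (smooth_ratio hm mt) h0 (-2)

lemma ne_zero_of_ratio_pos {a b : ℝ} (h : 0 < a / b) : a ≠ 0 ∧ b ≠ 0 := by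
  constructor <;> rintro rfl <;> simp at h

lemma exp_hatPsi (h0 : ∀ x, 0 < m x / mt) (x : M) :
    Real.exp (hatPsi m mt Ψ x) * (m x / mt) ^ 2 = Real.exp (Ψ x) := by
  rw [hatPsi, Real.exp_add, show -2 * Real.log (m x / mt) = -(2 * Real.log (m x / mt)) by ring,
    Real.exp_neg, mul_comm 2, Real.exp_mul, Real.exp_log (h0 x)]
  have := (h0 x).ne'
  rw [Real.rpow_two, mul_assoc, inv_mul_cancel₀ (pow_ne_zero 2 this), mul_one]

lemma exp_hatPsi_mul (h0 : ∀ x, 0 < m x / mt) (x : M) :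
    Real.exp (hatPsi m mt Ψ x) * m x ^ 2 = mt ^ 2 * Real.exp (Ψ x) := by
  rw [← exp_hatPsi (Ψ := Ψ) h0 x]
  have := (ne_zero_of_ratio_pos (h0 x)).2
  field_simp

/-- The value of the Carter constant on particle velocities. -/
lemma carter_eq (hg : IsLorentzMetric g) (hm : SmoothFun m) (h0 : ∀ x, 0 < m x / mt) {x : M}
    {u : E4} (hu : at₂ g x u u = -(m x) ^ 2) :
    carter (sliceTensor (weyl (fun x => m x / mt) g) Ω κ α γ Ψ) m mt x u
      = -(α x * mt ^ 2) + ∑ a, ∑ b, γ x a b * (kf g κ a x u * kf g κ b x u)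
        + Real.exp (hatPsi m mt Ψ x) * nf g Ω x u ^ 2 := by
  have h1 : ∀ w : E4, (sliceTensor (weyl (fun x => m x / mt) g) Ω κ α γ Ψ) x w w
      = α x * ((m x / mt) ^ 2 * at₂ g x w w) + ∑ a, ∑ b, γ x a b *
        (((m x / mt) ^ 2 * kf g κ a x w) * ((m x / mt) ^ 2 * kf g κ b x w))
        + Real.exp (Ψ x) * (nf (weyl (fun x => m x / mt) g) Ω x w
          * nf (weyl (fun x => m x / mt) g) Ω x w) := by
    intro w
    simp only [Fin.sum_univ_two, sliceTensor]
    rfl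
  have h2 : carter (sliceTensor (weyl (fun x => m x / mt) g) Ω κ α γ Ψ) m mt x u
    = (sliceTensor (weyl (fun x => m x / mt) g) Ω κ α γ Ψ) x ((mt / m x) ^ 2 • u)
      ((mt / m x) ^ 2 • u) := rfl
  rw [h2, h1, nf_weyl hg (smooth_ratio hm mt) h0, ← exp_hatPsi h0 x]
  obtain ⟨n1, n2⟩ := ne_zero_of_ratio_pos (h0 x)
  simp only [map_smul, smul_apply, smul_eq_mul, Fin.sum_univ_two, hu]
  field_simp

/-- `e^{hatPsi} m²` is `mt²` times the normal coefficient of the exact tensor, whose normal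
derivative is opposite to that of `α`. This balances the term `-α mt²` of the Carter constant. -/
lemma IsSliceReducibleKT.dd_eq (hf : IsSliceFrame g Ω κ) (hm : SmoothFun m)
    (h0 : ∀ x, 0 < m x / mt)
    (hkt : ∀ a x v, nablaC (weyl (fun x => m x / mt) g) (flat (weyl (fun x => m x / mt) g) (κ a))
      x v = 0)
    (hK : IsSliceReducibleKT (weyl (fun x => m x / mt) g) Ω κ α γ Ψ) (x : M) :
    dd (fun z => Real.exp (hatPsi m mt Ψ z) * m z ^ 2) x (nv g Ω x)
      = -(mt ^ 2 * dd α x (nv g Ω x)) := by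
  have hr := smooth_ratio hm mt
  have h1 := hK.prime_eq (hf.weyl hr h0) hkt x
  rw [prime_weyl hf.metric hr h0, prime_weyl hf.metric hr h0, prime_eq_dd, prime_eq_dd,
    ← mul_neg] at h1
  have h2 := mul_left_cancel₀ (lapse_pos hf.metric hf.foliation x).ne' h1
  rw [dd_smooth_eq (funext fun z => exp_hatPsi_mul h0 z), dd_const_mul hK.smooth_Ψ.exp, h2]
  ring

lemma IsSliceReducibleKT.sliceEq_hatPsi (hf : IsSliceFrame g Ω κ) (hm : SmoothFun m)
    (h0 : ∀ x, 0 < m x / mt) (hk : ∀ a x v, nablaC g (flat g (κ a)) x v = 0)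
    (hK : IsSliceReducibleKT (weyl (fun x => m x / mt) g) Ω κ α γ Ψ) (x : M) :
    SliceEq g Ω κ γ (hatPsi m mt Ψ) x :=
  hf.sliceEq_of_weyl (smooth_ratio hm mt) h0 hK.smooth_Ψ
    (hK.sliceEq_and (hf.weyl (smooth_ratio hm mt) h0)
      (fun a x v => nablaC_weyl_killing hf (smooth_ratio hm mt) h0 a (hk a) x v) x).1

/-- The slice-constant coefficients change along the curve at a rate proportional to the normal
velocity `ν`. In `e^{hatPsi} ν²`, the equation for `ν` cancels the term with `dhatPsi(ċ)` and
reproduces these rates with the opposite sign. -/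
lemma IsWorldline.carter_const (hf : IsSliceFrame g Ω κ) (hm : SmoothFun m)
    (h0 : ∀ x, 0 < m x / mt) (hk : ∀ a x v, nablaC g (flat g (κ a)) x v = 0)
    (hkt : ∀ a x v, nablaC (weyl (fun x => m x / mt) g) (flat (weyl (fun x => m x / mt) g) (κ a))
      x v = 0) (hmκ : ∀ a x, dd m x (kv κ a x) = 0)
    (hK : IsSliceReducibleKT (weyl (fun x => m x / mt) g) Ω κ α γ Ψ) {J : Set ℝ} {c : ℝ → M}
    (hJ : IsOpenInterval J) (h : IsWorldline g m J c) {s t : ℝ} (hs : s ∈ J) (ht : t ∈ J) :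
    carter (sliceTensor (weyl (fun x => m x / mt) g) Ω κ α γ Ψ) m mt (c s) (velocity c s)
      = carter (sliceTensor (weyl (fun x => m x / mt) g) Ω κ α γ Ψ) m mt (c t) (velocity c t) := by
  have hΨ := smooth_hatPsi hm h0 hK.smooth_Ψ
  have hq : ∀ u ∈ J, ∀ a, kf g κ a (c u) (vel c u) = kf g κ a (c s) (vel c s) :=
    fun u hu a => h.charge_const hJ hf hk hmκ hu hs a
  set q : Fin 2 → ℝ := fun a => kf g κ a (c s) (vel c s) with hqdef
  have h1 : ∀ u ∈ J, carter (sliceTensor (weyl (fun x => m x / mt) g) Ω κ α γ Ψ) m mt (c u)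
      (velocity c u) = -(α (c u) * mt ^ 2) + (γ (c u) 0 0 * (q 0 * q 0)
        + γ (c u) 0 1 * (q 0 * q 1) + (γ (c u) 1 0 * (q 1 * q 0) + γ (c u) 1 1 * (q 1 * q 1)))
        + Real.exp (hatPsi m mt Ψ (c u)) * nf g Ω (c u) (vel c u) ^ 2 := by
    intro u hu
    have e1 := carter_eq (α := α) (γ := γ) (Ψ := Ψ) (Ω := Ω) (κ := κ) hf.metric hm h0
      (h.norm_vel hu)
    simp only [hq u hu, Fin.sum_univ_two] at e1
    exact e1
  rw [h1 s hs, h1 t ht]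
  refine const_of_hasDerivAt_zero hJ (f := fun u => -(α (c u) * mt ^ 2)
    + (γ (c u) 0 0 * (q 0 * q 0) + γ (c u) 0 1 * (q 0 * q 1)
      + (γ (c u) 1 0 * (q 1 * q 0) + γ (c u) 1 1 * (q 1 * q 1)))
    + Real.exp (hatPsi m mt Ψ (c u)) * nf g Ω (c u) (vel c u) ^ 2) (fun u hu => ?_) hs ht
  have hC := h.c2.contMDiffAt hJ.1 hu
  have d1 := hK.smooth_α.hasDerivAt_comp hC
  have d2 := fun a b => (hK.smooth_γ a b).hasDerivAt_comp hC
  have d3 := hΨ.exp.hasDerivAt_comp hC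
  have d4 := h.hasDerivAt_nf hJ hf (fun x => hK.sliceEq_hatPsi hf hm h0 hk x) hu
  have d5 := (((d1.mul_const (mt ^ 2)).neg.add ((((d2 0 0).mul_const (q 0 * q 0)).add
    ((d2 0 1).mul_const (q 0 * q 1))).add (((d2 1 0).mul_const (q 1 * q 0)).add
    ((d2 1 1).mul_const (q 1 * q 1))))).add (d3.mul (d4.pow 2)))
  refine d5.congr_deriv ?_
  have e1 := hK.const_α.dd_eq hf.metric hf.foliation (c u) (vel c u)
  have e2 := fun a b => (hK.const_γ a b).dd_eq hf.metric hf.foliation (c u) (vel c u)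
  have e3 := hK.dd_eq hf hm h0 hkt (c u)
  have h8 : Real.exp (-hatPsi m mt Ψ (c u)) * Real.exp (hatPsi m mt Ψ (c u)) = 1 := by
    rw [← Real.exp_add]; simp
  rw [dd_mul hΨ.exp (hm.pow 2), dd_pow_two hm, dd_exp hΨ] at e3
  rw [dd_exp hΨ, e1]
  simp only [e2, gq, Fin.sum_univ_two, hq u hu]
  simp only [Pi.pow_apply]
  set ν := nf g Ω (c u) (vel c u) with hν
  linear_combination (-ν) * e3 - (ν * (dd (fun x => γ x 0 0) (c u) (nv g Ω (c u)) * (q 0 * q 0)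
    + dd (fun x => γ x 0 1) (c u) (nv g Ω (c u)) * (q 0 * q 1)
    + dd (fun x => γ x 1 0) (c u) (nv g Ω (c u)) * (q 1 * q 0)
    + dd (fun x => γ x 1 1) (c u) (nv g Ω (c u)) * (q 1 * q 1))) * h8

/-! ### Transport along the normal curves -/

/-- The parameter set need not be open, so the mean value inequality is applied with derivatives
within it. -/
lemma eq_of_onNormalCurve {f : M → ℝ} (hf : SmoothFun f)
    (h : ∀ x, dd f x (nv g Ω x) = 0) {O p : M} (hO : OnNormalCurve g Ω O p) : f O = f p := by
  obtain ⟨c, J, hJ, hc, ⟨s, hs, rfl⟩, t, ht, rfl⟩ := hO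
  have h1 : ∀ u ∈ J, HasDerivWithinAt (fun u => f (c u)) 0 J u := by
    intro u hu
    have h2 : HasMFDerivAt (𝓡 4) 𝓘(ℝ, ℝ) f (c u) (mfderiv (𝓡 4) 𝓘(ℝ, ℝ) f (c u)) :=
      ((hf (c u)).mdifferentiableAt (by simp)).hasMFDerivAt
    have h3 := h2.comp_hasMFDerivWithinAt u (hc u hu)
    have h4 : HasFDerivWithinAt (fun u => f (c u))
        ((dd f (c u)).comp ((1 : ℝ →L[ℝ] ℝ).smulRight (nv g Ω (c u)))) J u := h3.hasFDerivWithinAt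
    refine h4.hasDerivWithinAt.congr_deriv ?_
    simp [h]
  have h2 := hJ.convex.norm_image_sub_le_of_norm_hasDerivWithin_le (C := 0) h1 (by simp) hs ht
  rw [zero_mul] at h2
  exact (sub_eq_zero.1 (norm_le_zero_iff.1 h2)).symm

end

section

variable [IsManifold (𝓡 4) ∞ M] {g : Tensor2 M} {Ω : M → ℝ} {κ : Fin 2 → VField M} {m : M → ℝ}
  {mt : ℝ} {γ : M → Matrix (Fin 2) (Fin 2) ℝ} {Ψ : M → ℝ} {O : M} {v q : Fin 2 → ℝ} {E : ℝ}

/-! ### The shadow matrix -/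

lemma obsNorm_pos (h : v ⬝ᵥ gram g κ O *ᵥ v < 0) : 0 < obsNorm g κ O v :=
  Real.sqrt_pos.2 (neg_pos.2 h)

lemma obsNorm_sq (h : v ⬝ᵥ gram g κ O *ᵥ v < 0) :
    obsNorm g κ O v ^ 2 = -(v ⬝ᵥ gram g κ O *ᵥ v) := Real.sq_sqrt (neg_pos.2 h).le

lemma shadowMatrix_apply (h : v ⬝ᵥ gram g κ O *ᵥ v < 0) (x : M) (a b : Fin 2) :
    shadowMatrix g κ Ψ m O v E x a b = Real.exp (Ψ x) * (gram g κ x)⁻¹ a b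
      + v a * v b / E ^ 2 * (Real.exp (Ψ x) * m x ^ 2) := by
  have h1 := (obsNorm_pos h).ne'
  have h2 : effMassSq g κ m O v E x / obsNorm g κ O v ^ 2 = m x ^ 2 / E ^ 2 := by
    rw [effMassSq]
    field_simp
  rw [shadowMatrix, h2]
  simp only [Matrix.smul_apply, Matrix.add_apply, Matrix.vecMulVec_apply, smul_eq_mul]
  ring

lemma shadowMatrix'_apply (hf : IsSliceFrame g Ω κ) (hk : ∀ a x v, nablaC g (flat g (κ a)) x v = 0)
    (hm : SmoothFun m) (hΨ : SmoothFun Ψ) (hs : ∀ x, (γ x).IsSymm)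
    (hS : ∀ x, SliceEq g Ω κ γ Ψ x) (h : v ⬝ᵥ gram g κ O *ᵥ v < 0) (x : M) (a b : Fin 2) :
    shadowMatrix' g Ω κ Ψ m O v E x a b = prime g Ω (fun z => γ z a b) x
      + v a * v b / E ^ 2 * prime g Ω (fun z => Real.exp (Ψ z) * m z ^ 2) x := by
  have h1 : (fun y => shadowMatrix g κ Ψ m O v E y a b) = fun y =>
      Real.exp (Ψ y) * (gram g κ y)⁻¹ a b + v a * v b / E ^ 2 * (Real.exp (Ψ y) * m y ^ 2) :=
    funext fun y => shadowMatrix_apply h y a b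
  change prime g Ω (fun y => shadowMatrix g κ Ψ m O v E y a b) x = _
  have h2 := hΨ.exp.mul (hm.pow 2)
  rw [h1, prime_eq_dd, dd_add (hΨ.exp.mul (hf.smooth_gram_inv a b)) (h2.smul_const _),
    dd_const_mul h2, hf.dd_exp_gram_inv hs hΨ (fun a v => hk a x v) (hS x), prime_eq_dd,
    prime_eq_dd]
  ring

lemma sliceConstant_shadowMatrix' (hf : IsSliceFrame g Ω κ)
    (hk : ∀ a x v, nablaC g (flat g (κ a)) x v = 0)
    (hm : SmoothFun m) (hΨ : SmoothFun Ψ) (hs : ∀ x, (γ x).IsSymm)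
    (hγ : ∀ a b, SmoothFun fun x => γ x a b) (hc : ∀ a b, SliceConstant Ω fun x => γ x a b)
    (hS : ∀ x, SliceEq g Ω κ γ Ψ x)
    (hms : SliceConstant Ω (prime g Ω fun x => Real.exp (Ψ x) * m x ^ 2))
    (h : v ⬝ᵥ gram g κ O *ᵥ v < 0) (a b : Fin 2) :
    SliceConstant Ω fun x => shadowMatrix' g Ω κ Ψ m O v E x a b := by
  have h1 := (hΨ.exp.mul (hm.pow 2)).prime hf.metric hf.foliation
  exact (congrArg (SliceConstant Ω) (funext fun x =>
    shadowMatrix'_apply hf hk hm hΨ hs hS h x a b)).mpr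
    (SliceConstant.add ((hγ a b).prime hf.metric hf.foliation) (h1.smul_const _)
      ((hc a b).prime hf.metric hf.foliation (hγ a b)) (hms.const_mul h1 _))

/-- Under `v · q = -E` the rank-one part contributes `(v · q)²/E² = 1` times the mass term. The
shadow condition is therefore the massive particle surface condition. -/
lemma quad_shadowMatrix' (hf : IsSliceFrame g Ω κ) (hk : ∀ a x v, nablaC g (flat g (κ a)) x v = 0)
    (hm : SmoothFun m) (hΨ : SmoothFun Ψ) (hs : ∀ x, (γ x).IsSymm)
    (hS : ∀ x, SliceEq g Ω κ γ Ψ x) (h : v ⬝ᵥ gram g κ O *ᵥ v < 0) (hE : 0 < E)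
    (hq : v ⬝ᵥ q = -E) (x : M) :
    quad (shadowMatrix' g Ω κ Ψ m O v E x) q = surfaceFun g Ω γ Ψ m q x := by
  simp only [quad, Matrix.mulVec, dotProduct, Fin.sum_univ_two, surfaceFun,
    shadowMatrix'_apply hf hk hm hΨ hs hS h x] at hq ⊢
  have h1 : (v 0 * q 0 + v 1 * q 1) ^ 2 / E ^ 2 = 1 := by
    rw [hq, neg_sq, div_self (by positivity)]
  linear_combination (prime g Ω (fun z => Real.exp (Ψ z) * m z ^ 2) x) * h1

lemma quad_shadowMatrix (h : v ⬝ᵥ gram g κ O *ᵥ v < 0) (hE : 0 < E) (hq : v ⬝ᵥ q = -E) (x : M) :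
    quad (shadowMatrix g κ Ψ m O v E x) q
      = Real.exp (Ψ x) * (quad (gram g κ x)⁻¹ q + m x ^ 2) := by
  simp only [quad, Matrix.mulVec, dotProduct, Fin.sum_univ_two, shadowMatrix_apply h x] at hq ⊢
  have h1 : (v 0 * q 0 + v 1 * q 1) ^ 2 / E ^ 2 = 1 := by
    rw [hq, neg_sq, div_self (by positivity)]
  linear_combination (Real.exp (Ψ x) * m x ^ 2) * h1

/-! ### Conformal invariance of the shadow -/

section weyl
variable {r : M → ℝ}

lemma gram_weyl (r : M → ℝ) (g : Tensor2 M) (κ : Fin 2 → VField M) (x : M) :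
    gram (weyl r g) κ x = (r x) ^ 2 • gram g κ x := by
  ext a b
  rfl

lemma gram_weyl_inv (hr0 : ∀ x, 0 < r x) (x : M) (a b : Fin 2) :
    (gram (weyl r g) κ x)⁻¹ a b = ((r x) ^ 2)⁻¹ * (gram g κ x)⁻¹ a b := by
  have h1 := (hr0 x).ne'
  have : (gram (weyl r g) κ x).det = (r x) ^ 4 * (gram g κ x).det := by
    rw [gram_weyl, Matrix.det_smul, Fintype.card_fin]
    ring
  rw [gram_inv, gram_inv, this, gram_weyl, mul_inv]
  fin_cases a <;> fin_cases b <;> simp <;> field_simp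

lemma timelike_weyl (hr0 : ∀ x, 0 < r x) (h : v ⬝ᵥ gram g κ O *ᵥ v < 0) :
    v ⬝ᵥ gram (weyl r g) κ O *ᵥ v < 0 := by
  have h1 := hr0 O
  rw [gram_weyl, Matrix.smul_mulVec, dotProduct_smul, smul_eq_mul]
  exact mul_neg_of_pos_of_neg (by positivity) h

lemma obsNorm_weyl (hr0 : ∀ x, 0 < r x) :
    obsNorm (weyl r g) κ O v = r O * obsNorm g κ O v := by
  rw [obsNorm, obsNorm, gram_weyl, Matrix.smul_mulVec, dotProduct_smul, smul_eq_mul, ← mul_neg,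
    Real.sqrt_mul (by positivity), Real.sqrt_sq (hr0 O).le]

/-- The inverse Gram matrix scales by `r⁻²` and the root of the determinant by `r²`. -/
lemma obsTau_weyl (hr0 : ∀ x, 0 < r x) : obsTau (weyl r g) κ O v = obsTau g κ O v := by
  have h1 := (hr0 O).ne'
  have h2 : Real.sqrt (-(gram (weyl r g) κ O).det)
      = (r O) ^ 2 * Real.sqrt (-(gram g κ O).det) := by
    rw [gram_weyl, Matrix.det_smul, Fintype.card_fin, ← mul_neg, Real.sqrt_mul (by positivity),
      Real.sqrt_sq (by positivity)]
  ext a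
  rw [obsTau, obsTau, h2]
  simp only [Matrix.mulVec, dotProduct, Fin.sum_univ_two, gram_weyl_inv hr0 O, Pi.smul_apply,
    smul_eq_mul]
  field_simp

/-- The shift of `Ψ` contributes `(m/mt)²`, which cancels the scaling of the inverse Gram matrix and
turns `mt²` into `m²`. -/
lemma shadowMatrix_weyl (h0 : ∀ x, 0 < m x / mt) (h : v ⬝ᵥ gram g κ O *ᵥ v < 0) :
    shadowMatrix (weyl (fun x => m x / mt) g) κ (fun x => Ψ x + 2 * Real.log (m x / mt))
      (fun _ => mt) O v E = shadowMatrix g κ Ψ m O v E := by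
  ext x a b
  rw [shadowMatrix_apply (timelike_weyl h0 h), shadowMatrix_apply h, gram_weyl_inv h0,
    exp_add_two_log h0]
  obtain ⟨n1, n2⟩ := ne_zero_of_ratio_pos (h0 x)
  field_simp

lemma effMassSq_weyl (h0 : ∀ x, 0 < m x / mt) :
    effMassSq (weyl (fun x => m x / mt) g) κ (fun _ => mt) O v E O = effMassSq g κ m O v E O := by
  rw [effMassSq, effMassSq, obsNorm_weyl h0]
  have n2 := (ne_zero_of_ratio_pos (h0 O)).2
  field_simp

lemma obsNorm_mul_exp_weyl (hr0 : ∀ x, 0 < r x) :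
    obsNorm (weyl r g) κ O v * Real.exp (-(Ψ O + 2 * Real.log (r O)) / 2)
      = obsNorm g κ O v * Real.exp (-(Ψ O) / 2) := by
  rw [obsNorm_weyl hr0, show -(Ψ O + 2 * Real.log (r O)) / 2 = -(Ψ O) / 2 + -Real.log (r O) by ring,
    Real.exp_add, Real.exp_neg, Real.exp_log (hr0 O)]
  have := (hr0 O).ne'
  field_simp

lemma shadowFormula_weyl (hf : IsSliceFrame g Ω κ) (hm : SmoothFun m) (h0 : ∀ x, 0 < m x / mt)
    (h : v ⬝ᵥ gram g κ O *ᵥ v < 0) (p : M) :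
    shadowFormula (weyl (fun x => m x / mt) g) Ω κ (fun x => Ψ x + 2 * Real.log (m x / mt))
      (fun _ => mt) O v E p = shadowFormula g Ω κ Ψ m O v E p := by
  have h1 := shadowMatrix_weyl (κ := κ) (Ψ := Ψ) (E := E) h0 h
  have h2 : shadowMatrix' (weyl (fun x => m x / mt) g) Ω κ
      (fun x => Ψ x + 2 * Real.log (m x / mt)) (fun _ => mt) O v E p
      = shadowMatrix' g Ω κ Ψ m O v E p := by
    ext a b
    change prime _ Ω (fun y => shadowMatrix _ κ _ _ O v E y a b) p = prime g Ω _ p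
    rw [h1, prime_weyl hf.metric (smooth_ratio hm mt) h0]
  have h3 : obsNorm (weyl (fun x => m x / mt) g) κ O v
      * Real.exp (-(Ψ O + 2 * Real.log (m O / mt)) / 2)
      = obsNorm g κ O v * Real.exp (-(Ψ O) / 2) := obsNorm_mul_exp_weyl h0
  simp only [shadowFormula, shadowDenom, h1, h2, h3, obsTau_weyl h0, effMassSq_weyl h0]

end weyl

end

section

/-! ### Stereographic projection -/

lemma exists_angle {a b s : ℝ} (h : a ^ 2 + b ^ 2 = s ^ 2) :
    ∃ Φ ∈ Set.Icc 0 (2 * Real.pi), Real.sin Φ * s = a ∧ Real.cos Φ * s = b := by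
  rcases eq_or_ne s 0 with rfl | hs
  · refine ⟨0, ⟨le_rfl, by positivity⟩, ?_⟩
    have ha : a = 0 := by nlinarith [sq_nonneg a, sq_nonneg b]
    have hb : b = 0 := by nlinarith [sq_nonneg a, sq_nonneg b]
    simp [ha, hb]
  · have h1 : (b / s) ^ 2 + (a / s) ^ 2 = 1 := by
      field_simp
      linarith
    -- The angle is the argument of a unit complex number, moved into `[0, 2π]` by a full turn if
    -- negative.
    set z : ℂ := ⟨b / s, a / s⟩ with hz
    have hn : ‖z‖ = 1 := by
      rw [Complex.norm_def, Complex.normSq_mk, ← sq, ← sq, h1, Real.sqrt_one]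
    have hc : Real.cos z.arg = b / s := by
      rw [Complex.cos_arg (by rw [← norm_ne_zero_iff, hn]; norm_num), hn, div_one]
    have hsn : Real.sin z.arg = a / s := by rw [Complex.sin_arg, hn, div_one]
    have hp := Complex.neg_pi_lt_arg z
    have hp' := Complex.arg_le_pi z
    have := Real.pi_pos
    rcases le_or_gt 0 z.arg with h0 | h0
    · refine ⟨z.arg, ⟨h0, by linarith⟩, ?_, ?_⟩
      · rw [hsn]; field_simp
      · rw [hc]; field_simp
    · refine ⟨z.arg + 2 * Real.pi, ⟨by linarith, by linarith⟩, ?_, ?_⟩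
      · rw [Real.sin_add_two_pi, hsn]; field_simp
      · rw [Real.cos_add_two_pi, hc]; field_simp

lemma cos_ne_neg_one {Θ : ℝ} (h : Θ ∈ Set.Ico 0 Real.pi) : -1 < Real.cos Θ := by
  rw [← Real.cos_pi]
  exact Real.cos_lt_cos_of_nonneg_of_le_pi h.1 le_rfl h.2

lemma tan_half {Θ : ℝ} (h : Θ ∈ Set.Ico 0 Real.pi) :
    Real.tan (Θ / 2) = Real.sin Θ / (1 + Real.cos Θ) := by
  have h1 : 0 < Real.cos (Θ / 2) :=
    Real.cos_pos_of_mem_Ioo ⟨by linarith [h.1, Real.pi_pos], by linarith [h.2]⟩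
  have h2 : Real.sin Θ = 2 * Real.sin (Θ / 2) * Real.cos (Θ / 2) := by
    rw [← Real.sin_two_mul]; congr 1; ring
  have h3 : Real.cos Θ = 2 * Real.cos (Θ / 2) ^ 2 - 1 := by
    rw [← Real.cos_two_mul]; congr 1; ring
  rw [Real.tan_eq_sin_div_cos, h2, h3]
  field_simp
  ring

/-- Directions in spherical coordinates as unit vectors. -/
lemma exists_direction_iff (R : ℝ → ℝ → ℝ → Prop) (P : ℝ × ℝ) :
    (∃ Φ ∈ Set.Icc 0 (2 * Real.pi), ∃ Θ ∈ Set.Ico 0 Real.pi,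
      R (Real.sin Φ * Real.sin Θ) (Real.cos Φ * Real.sin Θ) (Real.cos Θ) ∧
      P.1 = -2 * Real.tan (Θ / 2) * Real.sin Φ ∧ P.2 = -2 * Real.tan (Θ / 2) * Real.cos Φ) ↔
    ∃ a b c : ℝ, a ^ 2 + b ^ 2 + c ^ 2 = 1 ∧ c ≠ -1 ∧ R a b c ∧
      P.1 = -2 * a / (1 + c) ∧ P.2 = -2 * b / (1 + c) := by
  constructor
  · rintro ⟨Φ, -, Θ, hΘ, hR, h1, h2⟩
    refine ⟨_, _, _, ?_, (cos_ne_neg_one hΘ).ne', hR, ?_, ?_⟩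
    · linear_combination (Real.sin Θ ^ 2) * Real.sin_sq_add_cos_sq Φ + Real.sin_sq_add_cos_sq Θ
    · rw [h1, tan_half hΘ]; ring
    · rw [h2, tan_half hΘ]; ring
  · rintro ⟨a, b, c, h, hc, hR, h1, h2⟩
    have hc1 : -1 ≤ c := by nlinarith [sq_nonneg a, sq_nonneg b]
    have hc2 : c ≤ 1 := by nlinarith [sq_nonneg a, sq_nonneg b]
    have hcos : Real.cos (Real.arccos c) = c := Real.cos_arccos hc1 hc2
    have hΘ : Real.arccos c ∈ Set.Ico 0 Real.pi := by
      refine ⟨Real.arccos_nonneg c, lt_of_le_of_ne (Real.arccos_le_pi c) fun h => hc ?_⟩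
      rw [← hcos, h, Real.cos_pi]
    have hs : a ^ 2 + b ^ 2 = Real.sin (Real.arccos c) ^ 2 := by
      have := Real.sin_sq_add_cos_sq (Real.arccos c)
      rw [hcos] at this
      linarith
    obtain ⟨Φ, hΦ, ha, hb⟩ := exists_angle hs
    refine ⟨Φ, hΦ, Real.arccos c, hΘ, ?_, ?_, ?_⟩
    · rw [ha, hb, hcos]; exact hR
    · rw [h1, tan_half hΘ, hcos, ← ha]; ring
    · rw [h2, tan_half hΘ, hcos, ← hb]; ring

lemma exists_sign (x : ℝ) : ∃ ε : ℝ, (ε = 1 ∨ ε = -1) ∧ ε * |x| = x := by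
  rcases le_total 0 x with h | h
  · exact ⟨1, Or.inl rfl, by rw [abs_of_nonneg h, one_mul]⟩
  · exact ⟨-1, Or.inr rfl, by rw [abs_of_nonpos h]; ring⟩

lemma quad_smul (A : Matrix (Fin 2) (Fin 2) ℝ) (c : ℝ) (ρ : Fin 2 → ℝ) :
    quad A (c • ρ) = c ^ 2 * quad A ρ := by
  simp only [quad, Matrix.mulVec_smul, dotProduct_smul, smul_dotProduct, smul_eq_mul]
  ring

lemma quad_sub (A B : Matrix (Fin 2) (Fin 2) ℝ) (ρ : Fin 2 → ℝ) :
    quad (A - B) ρ = quad A ρ - quad B ρ := by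
  simp only [quad, Matrix.sub_mulVec, dotProduct_sub]

lemma sqrt_of_eq_sq_mul {x e : ℝ} (y : ℝ) (he : 0 < e) (h : x = (e * y) ^ 2) :
    Real.sqrt x = e * |y| := by
  rw [h, Real.sqrt_sq_eq_abs, abs_mul, abs_of_pos he]

/-- The algebraic core of the shadow formula: impact parameters normalized by `v^a q_a = -E` versus
impact parameters up to scale. -/
lemma shadow_algebra {v τ : Fin 2 → ℝ} {S' S S₀ : Matrix (Fin 2) (Fin 2) ℝ} {E vb k e s F : ℝ}
    (hE : 0 < E) (hvb : 0 < vb) (hk : 0 < k) (he : 0 < e) (hs : s * E = k * vb) (hF : F = s ^ 2)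
    (hinj : ∀ ρ : Fin 2 → ℝ, v ⬝ᵥ ρ = 0 → τ ⬝ᵥ ρ = 0 → ρ = 0)
    (hS₀ : ∀ ρ : Fin 2 → ℝ, v ⬝ᵥ ρ = -E → quad S₀ ρ = e ^ 2 * ((τ ⬝ᵥ ρ / vb) ^ 2 - k ^ 2))
    {q : ℝ → Fin 2 → ℝ} (hqv : ∀ a, v ⬝ᵥ q a = -E) (hqτ : ∀ a, τ ⬝ᵥ q a = k * vb * a)
    (P : ℝ × ℝ) :
    (∃ a b c : ℝ, a ^ 2 + b ^ 2 + c ^ 2 = 1 ∧ c ≠ -1 ∧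
      (quad S' (q a) = 0 ∧ quad (S - S₀) (q a) = (e * (k * c)) ^ 2) ∧
      P.1 = -2 * a / (1 + c) ∧ P.2 = -2 * b / (1 + c)) ↔
    ∃ (ρ : Fin 2 → ℝ) (ε ε' : ℝ), ρ ≠ 0 ∧ (ε = 1 ∨ ε = -1) ∧ (ε' = 1 ∨ ε' = -1) ∧
      quad S' ρ = 0 ∧ (τ ⬝ᵥ ρ) ^ 2 ≤ F * (v ⬝ᵥ ρ) ^ 2 ∧ quad S ρ ≤ 0 ∧ 0 ≤ quad (S - S₀) ρ ∧
      s * (v ⬝ᵥ ρ) - ε * (vb * e⁻¹ * Real.sqrt (quad (S - S₀) ρ)) ≠ 0 ∧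
      P.1 = 2 * (τ ⬝ᵥ ρ) / (s * (v ⬝ᵥ ρ) - ε * (vb * e⁻¹ * Real.sqrt (quad (S - S₀) ρ))) ∧
      P.2 = ε' * (2 * (vb * e⁻¹ * Real.sqrt (-quad S ρ))
        / (s * (v ⬝ᵥ ρ) - ε * (vb * e⁻¹ * Real.sqrt (quad (S - S₀) ρ)))) := by
  constructor
  · rintro ⟨a, b, c, h1, hc, ⟨hS', hSS⟩, hX, hY⟩
    -- The impact parameter is the charge vector itself. The signs of `c` and `b` are those lost
    -- when the formula takes square roots.
    obtain ⟨ε, hε, hεc⟩ := exists_sign c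
    obtain ⟨ε', hε', hεb⟩ := exists_sign b
    have h2 := hS₀ (q a) (hqv a)
    rw [hqτ] at h2
    -- On `v · ρ = -E` the form `S₀` is `e² k² (a² - 1)`; adding `e² k² c²` leaves `-e² k² b²` by
    -- the sphere equation.
    have hSq : quad S (q a) = -(e * (k * b)) ^ 2 := by
      rw [quad_sub, h2] at hSS
      have h3 : k * vb * a / vb = k * a := by field_simp
      rw [h3] at hSS
      linear_combination hSS + e ^ 2 * k ^ 2 * h1
    have hD : s * (v ⬝ᵥ q a) - ε * (vb * e⁻¹ * Real.sqrt (quad (S - S₀) (q a)))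
        = -(k * vb) * (1 + c) := by
      rw [sqrt_of_eq_sq_mul _ he hSS, hqv, abs_mul, abs_of_pos hk]
      have : vb * e⁻¹ * (e * (k * |c|)) = vb * (k * |c|) := by field_simp
      rw [this]
      linear_combination -hs - vb * k * hεc
    have hc' : 1 + c ≠ 0 := fun h => hc (by linarith)
    refine ⟨q a, ε, ε', ?_, hε, hε', hS', ?_, ?_, ?_, ?_, ?_, ?_⟩
    · intro h
      have := hqv a
      rw [h, dotProduct_zero] at this
      linarith
    · rw [hqv, hqτ, hF]
      have : s ^ 2 * (-E) ^ 2 = (k * vb) ^ 2 := by rw [← hs]; ring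
      rw [this, mul_pow]
      have ha : a ^ 2 ≤ 1 := by nlinarith [sq_nonneg b, sq_nonneg c]
      exact mul_le_of_le_one_right (by positivity) ha
    · rw [hSq]
      exact neg_nonpos.2 (sq_nonneg _)
    · rw [hSS]
      exact sq_nonneg _
    · rw [hD]
      exact mul_ne_zero (by have := mul_pos hk hvb; linarith) hc'
    · rw [hD, hX, hqτ]
      field_simp
    · rw [hD, hY, sqrt_of_eq_sq_mul (k * b) he (by rw [hSq]; ring), abs_mul, abs_of_pos hk]
      conv_lhs => rw [← hεb]
      field_simp
  · rintro ⟨ρ, ε, ε', hρ, hε, hε', hS', hτ, hSρ, hSS, hD, hX, hY⟩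
    -- The inequality between `τ · ρ` and `v · ρ` excludes `v · ρ = 0`, since both pairings would
    -- then vanish.
    have hvρ : v ⬝ᵥ ρ ≠ 0 := by
      intro h
      rw [h] at hτ
      have : τ ⬝ᵥ ρ = 0 := by nlinarith [sq_nonneg (τ ⬝ᵥ ρ)]
      exact hρ (hinj ρ h this)
    -- The formula is homogeneous of degree zero in `ρ` once `ε` and `ε'` run over both signs. The
    -- scale is fixed by the charge normalization, and `a` is then read off from `τ`.
    set l : ℝ := -E / (v ⬝ᵥ ρ) with hl
    have hl0 : l ≠ 0 := div_ne_zero (by linarith) hvρ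
    have hlv : l * (v ⬝ᵥ ρ) = -E := by rw [hl]; field_simp
    set a : ℝ := l * (τ ⬝ᵥ ρ) / (k * vb) with ha
    have haτ : l * (τ ⬝ᵥ ρ) = k * vb * a := by rw [ha]; field_simp
    have hq : q a = l • ρ := by
      rw [← sub_eq_zero]
      apply hinj
      · rw [dotProduct_sub, dotProduct_smul, hqv, smul_eq_mul, hlv, sub_self]
      · rw [dotProduct_sub, dotProduct_smul, hqτ, smul_eq_mul, haτ, sub_self]
    -- `A` and `C` are the other two direction components up to the signs `ε'` and `ε`; the value of
    -- `S₀` on normalized vectors is what puts the triple on the unit sphere.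
    set A : ℝ := l * Real.sqrt (-quad S ρ) / (e * k) with hA
    set C : ℝ := l * Real.sqrt (quad (S - S₀) ρ) / (e * k) with hC
    have hA2 : (e * (k * A)) ^ 2 = -quad S (l • ρ) := by
      have : e * (k * A) = l * Real.sqrt (-quad S ρ) := by rw [hA]; field_simp
      rw [this, mul_pow, Real.sq_sqrt (by linarith), quad_smul]
      ring
    have hC2 : (e * (k * C)) ^ 2 = quad (S - S₀) (l • ρ) := by
      have : e * (k * C) = l * Real.sqrt (quad (S - S₀) ρ) := by rw [hC]; field_simp
      rw [this, mul_pow, Real.sq_sqrt hSS, quad_smul]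
    have h0 := hS₀ (l • ρ) (by rw [dotProduct_smul, smul_eq_mul, hlv])
    rw [dotProduct_smul, smul_eq_mul, haτ] at h0
    have hsum : a ^ 2 + A ^ 2 + C ^ 2 = 1 := by
      rw [quad_sub] at hC2
      have h3 : k * vb * a / vb = k * a := by field_simp
      rw [h3] at h0
      have h4 : (e * k) ^ 2 * (a ^ 2 + A ^ 2 + C ^ 2 - 1) = 0 := by
        linear_combination hA2 + hC2 - h0
      have := (mul_eq_zero.1 h4).resolve_left (by positivity)
      linarith
    have hε2 : ε ^ 2 = 1 := by rcases hε with rfl | rfl <;> norm_num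
    have hε2' : ε' ^ 2 = 1 := by rcases hε' with rfl | rfl <;> norm_num
    set D : ℝ := s * (v ⬝ᵥ ρ) - ε * (vb * e⁻¹ * Real.sqrt (quad (S - S₀) ρ)) with hDdef
    have hlD : l * D = -(k * vb) * (1 + ε * C) := by
      have h5 : l * (vb * e⁻¹ * Real.sqrt (quad (S - S₀) ρ)) = vb * k * C := by
        rw [hC]; field_simp
      rw [hDdef]
      linear_combination s * hlv - ε * h5 - hs
    have hc' : 1 + ε * C ≠ 0 := by
      intro h
      rw [h, mul_zero] at hlD
      exact mul_ne_zero hl0 hD hlD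
    refine ⟨a, ε' * A, ε * C, ?_, fun h => hc' (by rw [h]; norm_num), ⟨?_, ?_⟩, ?_, ?_⟩
    · rw [mul_pow, mul_pow, hε2, hε2', one_mul, one_mul, hsum]
    · rw [hq, quad_smul, hS', mul_zero]
    · rw [hq, ← hC2]
      linear_combination (-(e * k * C) ^ 2) * hε2
    · rw [hX, div_eq_div_iff hD hc']
      apply mul_left_cancel₀ hl0
      have h6 : (k * vb) ≠ 0 := by positivity
      linear_combination (2 * (1 + ε * C)) * haτ + (2 * a) * hlD
    · rw [hY, ← mul_div_assoc, div_eq_div_iff hD hc']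
      apply mul_left_cancel₀ hl0
      have h5 : l * (vb * e⁻¹ * Real.sqrt (-quad S ρ)) = vb * k * A := by
        rw [hA]; field_simp
      linear_combination (2 * ε' * (1 + ε * C)) * h5 + (2 * ε' * A) * hlD

end

section

variable [IsManifold (𝓡 4) ∞ M] {g : Tensor2 M} {Ω : M → ℝ} {κ : Fin 2 → VField M} {m : M → ℝ}
  {mt : ℝ} {γ γt : M → Matrix (Fin 2) (Fin 2) ℝ} {α αt Ψ Ψt : M → ℝ} {O : M} {v q : Fin 2 → ℝ}
  {E : ℝ}

/-! ### The observer's frame -/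

lemma at₂_sum_kv (x : M) (c d : Fin 2 → ℝ) :
    at₂ g x (∑ a, c a • kv κ a x) (∑ a, d a • kv κ a x) = c ⬝ᵥ gram g κ x *ᵥ d := by
  have h1 : ∀ a b, gram g κ x a b = at₂ g x (kv κ a x) (kv κ b x) := fun a b => rfl
  simp only [Fin.sum_univ_two, map_add, map_smul, add_apply, smul_apply, smul_eq_mul,
    dotProduct, Matrix.mulVec, h1]
  ring

lemma kf_sum_kv (x : M) (a : Fin 2) (d : Fin 2 → ℝ) :
    kf g κ a x (∑ b, d b • kv κ b x) = (gram g κ x *ᵥ d) a := by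
  have h1 : ∀ a b, gram g κ x a b = at₂ g x (kv κ a x) (kv κ b x) := fun a b => rfl
  simp only [Fin.sum_univ_two, map_add, map_smul, smul_eq_mul, dotProduct, Matrix.mulVec, h1, kf]
  ring

lemma gram_mulVec_obsTau (hf : IsSliceFrame g Ω κ) (O : M) (v : Fin 2 → ℝ) :
    gram g κ O *ᵥ obsTau g κ O v
      = Real.sqrt (-(gram g κ O).det) • (!![0, 1; -1, 0] *ᵥ v) := by
  rw [obsTau, Matrix.mulVec_mulVec, Matrix.mul_nonsing_inv _ (isUnit_iff_ne_zero.2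
    (hf.signature O).ne), Matrix.one_mulVec]

lemma dot_gram_obsTau (hf : IsSliceFrame g Ω κ) (O : M) (v : Fin 2 → ℝ) :
    v ⬝ᵥ gram g κ O *ᵥ obsTau g κ O v = 0 := by
  rw [gram_mulVec_obsTau hf]
  simp [dotProduct, Fin.sum_univ_two]
  ring

lemma dot_gram_comm (hg : IsLorentzMetric g) (O : M) (v w : Fin 2 → ℝ) :
    v ⬝ᵥ gram g κ O *ᵥ w = w ⬝ᵥ gram g κ O *ᵥ v := by
  have := gram_symm hg κ O
  simp only [Matrix.mulVec, dotProduct, Fin.sum_univ_two, this]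
  ring

lemma det_smul_obsTau (hf : IsSliceFrame g Ω κ) (O : M) (v ρ : Fin 2 → ℝ) :
    (gram g κ O).det * (obsTau g κ O v ⬝ᵥ ρ) = Real.sqrt (-(gram g κ O).det)
      * ((gram g κ O 1 1 * v 1 + gram g κ O 0 1 * v 0) * ρ 0
        - (gram g κ O 0 1 * v 1 + gram g κ O 0 0 * v 0) * ρ 1) := by
  have h0 := (hf.signature O).ne
  have h1 := gram_symm hf.metric κ O
  rw [obsTau, gram_inv]
  simp [Matrix.mulVec, dotProduct, Fin.sum_univ_two, h1]
  field_simp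
  ring

/-- The vectors `v/v̄` and `τ/v̄` form an orthonormal frame of the Killing plane, the first
timelike, so the inverse Gram matrix is `(τ τ - v v)/v̄²`. -/
lemma obsNorm_sq_mul_quad (hf : IsSliceFrame g Ω κ) (h : v ⬝ᵥ gram g κ O *ᵥ v < 0)
    (ρ : Fin 2 → ℝ) : obsNorm g κ O v ^ 2 * quad (gram g κ O)⁻¹ ρ
      = (obsTau g κ O v ⬝ᵥ ρ) ^ 2 - (v ⬝ᵥ ρ) ^ 2 := by
  have h0 := (hf.signature O).ne
  have h1 := gram_symm hf.metric κ O
  have h2 := det_smul_obsTau hf O v ρ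
  have h3 : Real.sqrt (-(gram g κ O).det) ^ 2 = -(gram g κ O).det :=
    Real.sq_sqrt (neg_pos.2 (hf.signature O)).le
  have h5 : (gram g κ O).det * quad (gram g κ O)⁻¹ ρ = gram g κ O 1 1 * ρ 0 ^ 2
      - 2 * gram g κ O 0 1 * ρ 0 * ρ 1 + gram g κ O 0 0 * ρ 1 ^ 2 := by
    rw [gram_inv]
    simp [quad, Matrix.mulVec, dotProduct, Fin.sum_univ_two, h1]
    field_simp
    ring
  have h6 : (gram g κ O).det = gram g κ O 0 0 * gram g κ O 1 1 - gram g κ O 0 1 ^ 2 := by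
    rw [Matrix.det_fin_two, h1]
    ring
  rw [obsNorm_sq h]
  refine mul_left_cancel₀ (pow_ne_zero 2 h0) ?_
  have h7 : ((gram g κ O).det * (obsTau g κ O v ⬝ᵥ ρ)) ^ 2 = -(gram g κ O).det
      * ((gram g κ O 1 1 * v 1 + gram g κ O 0 1 * v 0) * ρ 0
        - (gram g κ O 0 1 * v 1 + gram g κ O 0 0 * v 0) * ρ 1) ^ 2 := by
    rw [h2, mul_pow, h3]
  have h8 : v ⬝ᵥ gram g κ O *ᵥ v = gram g κ O 0 0 * v 0 ^ 2 + 2 * gram g κ O 0 1 * v 0 * v 1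
      + gram g κ O 1 1 * v 1 ^ 2 := by
    simp only [Matrix.mulVec, dotProduct, Fin.sum_univ_two, h1]
    ring
  have h9 : v ⬝ᵥ ρ = v 0 * ρ 0 + v 1 * ρ 1 := by simp only [dotProduct, Fin.sum_univ_two]
  rw [h8, h9]
  set D := (gram g κ O).det
  linear_combination (-D * (gram g κ O 0 0 * v 0 ^ 2 + 2 * gram g κ O 0 1 * v 0 * v 1
      + gram g κ O 1 1 * v 1 ^ 2)) * h5 - h7 + D * (v 0 * ρ 0 + v 1 * ρ 1) ^ 2 * h6

lemma obsTau_gram_obsTau (hf : IsSliceFrame g Ω κ) (h : v ⬝ᵥ gram g κ O *ᵥ v < 0) :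
    obsTau g κ O v ⬝ᵥ gram g κ O *ᵥ obsTau g κ O v = obsNorm g κ O v ^ 2 := by
  have h2 := det_smul_obsTau hf O v (gram g κ O *ᵥ obsTau g κ O v)
  have h3 : Real.sqrt (-(gram g κ O).det) ^ 2 = -(gram g κ O).det :=
    Real.sq_sqrt (neg_pos.2 (hf.signature O)).le
  have h4 : (gram g κ O *ᵥ obsTau g κ O v) 0 = Real.sqrt (-(gram g κ O).det) * v 1 := by
    rw [gram_mulVec_obsTau hf]; simp [dotProduct, Fin.sum_univ_two]
  have h5 : (gram g κ O *ᵥ obsTau g κ O v) 1 = -(Real.sqrt (-(gram g κ O).det) * v 0) := by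
    rw [gram_mulVec_obsTau hf]; simp [dotProduct, Fin.sum_univ_two]
  have h8 : v ⬝ᵥ gram g κ O *ᵥ v = gram g κ O 0 0 * v 0 ^ 2 + 2 * gram g κ O 0 1 * v 0 * v 1
      + gram g κ O 1 1 * v 1 ^ 2 := by
    simp only [Matrix.mulVec, dotProduct, Fin.sum_univ_two, gram_symm hf.metric κ O]
    ring
  rw [h4, h5] at h2
  refine mul_left_cancel₀ (hf.signature O).ne ?_
  rw [obsNorm_sq h, h2, h8]
  linear_combination (gram g κ O 0 0 * v 0 ^ 2 + 2 * gram g κ O 0 1 * v 0 * v 1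
      + gram g κ O 1 1 * v 1 ^ 2) * h3

lemma eq_zero_of_dot (hf : IsSliceFrame g Ω κ) (h : v ⬝ᵥ gram g κ O *ᵥ v < 0)
    (ρ : Fin 2 → ℝ) (h1 : v ⬝ᵥ ρ = 0) (h2 : obsTau g κ O v ⬝ᵥ ρ = 0) : ρ = 0 := by
  have h3 := det_smul_obsTau hf O v ρ
  have h8 : v ⬝ᵥ gram g κ O *ᵥ v = gram g κ O 0 0 * v 0 ^ 2 + 2 * gram g κ O 0 1 * v 0 * v 1
      + gram g κ O 1 1 * v 1 ^ 2 := by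
    simp only [Matrix.mulVec, dotProduct, Fin.sum_univ_two, gram_symm hf.metric κ O]
    ring
  rw [h2, mul_zero] at h3
  have h4 := (mul_eq_zero.1 h3.symm).resolve_left
    (Real.sqrt_pos.2 (neg_pos.2 (hf.signature O))).ne'
  have h9 : v 0 * ρ 0 + v 1 * ρ 1 = 0 := by
    rw [← h1]; simp only [dotProduct, Fin.sum_univ_two]
  ext a
  refine (mul_eq_zero.1 (?_ : (v ⬝ᵥ gram g κ O *ᵥ v) * ρ a = 0)).resolve_left h.ne
  rw [h8]
  fin_cases a
  · simp only [Fin.zero_eta]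
    linear_combination (v 1) * h4 + (gram g κ O 0 1 * v 1 + gram g κ O 0 0 * v 0) * h9
  · simp only [Fin.mk_one]
    linear_combination (-v 0) * h4 + (gram g κ O 0 1 * v 0 + gram g κ O 1 1 * v 1) * h9

/-! ### Tangent vectors with prescribed constants of motion -/

/-- The charges fix the component `𝒢⁻¹ q` in the Killing plane. A multiple of the spacelike tangent
vector orthogonal to it adjusts the norm, and the hypothesis makes the required square nonnegative.
-/
lemma exists_tangent (hf : IsSliceFrame g Ω κ) (x : M) {μ : ℝ}
    (h : quad (gram g κ x)⁻¹ q + μ ≤ 0) :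
    ∃ w : E4, dd Ω x w = 0 ∧ at₂ g x w w = -μ ∧ ∀ a, kf g κ a x w = q a := by
  obtain ⟨σ, hσ, hσκ, hσ0⟩ := hf.exists_orthogonal x
  set d : Fin 2 → ℝ := (gram g κ x)⁻¹ *ᵥ q with hd
  have hGd : gram g κ x *ᵥ d = q := by
    rw [hd, Matrix.mulVec_mulVec, Matrix.mul_nonsing_inv _ (isUnit_iff_ne_zero.2
      (hf.signature x).ne), Matrix.one_mulVec]
  set t : ℝ := Real.sqrt ((-μ - quad (gram g κ x)⁻¹ q) / at₂ g x σ σ) with ht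
  have ht2 : t ^ 2 * at₂ g x σ σ = -μ - quad (gram g κ x)⁻¹ q := by
    rw [ht, Real.sq_sqrt (div_nonneg (by linarith) hσ0.le), div_mul_cancel₀ _ hσ0.ne']
  set u : E4 := ∑ a, d a • kv κ a x with hu
  have hu1 : at₂ g x u σ = 0 := by
    have h1 : ∀ a, at₂ g x (kv κ a x) σ = 0 := hσκ
    simp [hu, h1]
  have hu2 : at₂ g x σ u = 0 := by rw [hf.metric.isSymmT, hu1]
  have hu3 : at₂ g x u u = quad (gram g κ x)⁻¹ q := by
    rw [hu, at₂_sum_kv, hGd, dotProduct_comm]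
    rfl
  refine ⟨u + t • σ, ?_, ?_, fun a => ?_⟩
  · rw [map_add, map_smul, hσ, hu]
    simp [hf.dd_kv]
  · simp only [map_add, map_smul, add_apply, smul_apply, smul_eq_mul, hu1, hu2, hu3]
    linear_combination ht2
  · rw [map_add, map_smul, hσκ, hu, kf_sum_kv, hGd, smul_zero, add_zero]

/-! ### Matching the velocity at the observer with a slice -/

/-- The part of the Carter constant which is constant on the slices. -/
def carterBase (mt : ℝ) (α : M → ℝ) (γ : M → Matrix (Fin 2) (Fin 2) ℝ) (q : Fin 2 → ℝ)
    (x : M) : ℝ := -(α x * mt ^ 2) + ∑ a, ∑ b, γ x a b * (q a * q b)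

lemma smooth_carterBase (hα : SmoothFun α) (hγ : ∀ a b, SmoothFun fun x => γ x a b) :
    SmoothFun (carterBase mt α γ q) := by
  refine (congrArg SmoothFun (funext fun x => ?_)).mp ((hα.smul_const (-mt ^ 2)).add
    ((((hγ 0 0).smul_const (q 0 * q 0)).add ((hγ 0 1).smul_const (q 0 * q 1))).add
    (((hγ 1 0).smul_const (q 1 * q 0)).add ((hγ 1 1).smul_const (q 1 * q 1)))))
  simp only [carterBase, Fin.sum_univ_two]
  ring

lemma dd_carterBase (hα : SmoothFun α) (hγ : ∀ a b, SmoothFun fun x => γ x a b) (x : M) (w : E4) :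
    dd (carterBase mt α γ q) x w
      = -(dd α x w * mt ^ 2) + ∑ a, ∑ b, dd (fun z => γ z a b) x w * (q a * q b) := by
  have h1 : carterBase mt α γ q = fun x => -mt ^ 2 * α x + ((q 0 * q 0 * γ x 0 0
      + q 0 * q 1 * γ x 0 1) + (q 1 * q 0 * γ x 1 0 + q 1 * q 1 * γ x 1 1)) := by
    funext x
    simp only [carterBase, Fin.sum_univ_two]
    ring
  have s := fun a b => (hγ a b).smul_const (q a * q b)
  rw [h1, dd_add (hα.smul_const _) (((s 0 0).add (s 0 1)).add ((s 1 0).add (s 1 1))),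
    dd_add ((s 0 0).add (s 0 1)) ((s 1 0).add (s 1 1)), dd_add (s 0 0) (s 0 1),
    dd_add (s 1 0) (s 1 1), dd_const_mul hα, dd_const_mul (hγ 0 0), dd_const_mul (hγ 0 1),
    dd_const_mul (hγ 1 0), dd_const_mul (hγ 1 1)]
  simp only [Fin.sum_univ_two]
  ring

lemma sliceConstant_carterBase (hf : IsSliceFrame g Ω κ) (hα : SmoothFun α)
    (hγ : ∀ a b, SmoothFun fun x => γ x a b) (hcα : SliceConstant Ω α)
    (hc : ∀ a b, SliceConstant Ω fun x => γ x a b) :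
    SliceConstant Ω (carterBase mt α γ q) := by
  intro x (w : E4) (hw : dd Ω x w = 0)
  change dd (carterBase mt α γ q) x w = 0
  have h1 := nf_of_tangent hf.metric hw
  rw [dd_carterBase hα hγ, hcα.dd_eq hf.metric hf.foliation, h1]
  simp only [fun a b => (hc a b).dd_eq hf.metric hf.foliation x w, h1]
  simp

/-- Transport of the Carter constant along the normal curves. -/
lemma IsSliceReducibleKT.carterBase_sub (hf : IsSliceFrame g Ω κ) (hm : SmoothFun m)
    (h0 : ∀ x, 0 < m x / mt) (hk : ∀ a x v, nablaC g (flat g (κ a)) x v = 0)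
    (hkt : ∀ a x v, nablaC (weyl (fun x => m x / mt) g) (flat (weyl (fun x => m x / mt) g) (κ a))
      x v = 0)
    (hΨ : SmoothFun Ψ) (hS : ∀ x, SliceEq g Ω κ γ Ψ x)
    (hK : IsSliceReducibleKT (weyl (fun x => m x / mt) g) Ω κ αt γt Ψt)
    (h : v ⬝ᵥ gram g κ O *ᵥ v < 0) (hE : 0 < E) (hq : v ⬝ᵥ q = -E) {p : M}
    (hp : OnNormalCurve g Ω O p) :
    carterBase mt αt γt q p - carterBase mt αt γt q O
      = Real.exp (hatPsi m mt Ψt O - Ψ O) * (quad (shadowMatrix g κ Ψ m O v E p) q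
        - quad (shadowMatrix g κ Ψ m O v E O) q) := by
  have hΨh := smooth_hatPsi hm h0 hK.smooth_Ψ
  have hSh := fun x => hK.sliceEq_hatPsi hf hm h0 hk x
  -- The given conformal tensor and the one induced by the exact tensor may differ, but their
  -- functions `Ψ` have equal differentials, hence a constant difference along the normal curve.
  have e1 : Real.exp (hatPsi m mt Ψt O - Ψ O) = Real.exp (hatPsi m mt Ψt p - Ψ p) := by
    have h1 := eq_of_onNormalCurve (f := fun x => hatPsi m mt Ψt x + -1 * Ψ x)
      (hΨh.add (hΨ.smul_const (-1))) (fun x => by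
        rw [dd_add hΨh (hΨ.smul_const (-1)), dd_const_mul hΨ, hf.dd_unique (hSh x) (hS x)]
        ring) hp
    congr 1
    linarith
  have s1 := hf.smooth_gram_inv
  have s2 := fun a b => (hΨh.exp.mul (s1 a b)).smul_const (-(q a * q b))
  have s3 := (hΨh.exp.mul (hm.pow 2)).smul_const (-1)
  have s4 := (((s2 0 0).add (s2 0 1)).add ((s2 1 0).add (s2 1 1)))
  have sB := smooth_carterBase (mt := mt) (q := q) hK.smooth_α hK.smooth_γ
  -- The conserved combination is `carterBase - e^{hatPsi} (𝒢^{ab} q_a q_b + m²)`: the normal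
  -- derivatives of `γ` and `α` in the first part are those of the two subtracted terms.
  have e2 := eq_of_onNormalCurve (sB.add (s4.add s3)) (fun x => by
    rw [dd_add sB (s4.add s3), dd_add s4 s3, dd_add ((s2 0 0).add (s2 0 1))
      ((s2 1 0).add (s2 1 1)), dd_add (s2 0 0) (s2 0 1), dd_add (s2 1 0) (s2 1 1),
      dd_const_mul (hΨh.exp.mul (hm.pow 2)), hK.dd_eq hf hm h0 hkt,
      dd_carterBase hK.smooth_α hK.smooth_γ]
    have d1 : ∀ a b, dd (fun z => -(q a * q b) * (Real.exp (hatPsi m mt Ψt z)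
        * (gram g κ z)⁻¹ a b)) x (nv g Ω x)
        = -(q a * q b) * dd (fun z => γt z a b) x (nv g Ω x) := by
      intro a b
      rw [dd_const_mul (hΨh.exp.mul (s1 a b)),
        hf.dd_exp_gram_inv hK.symm_γ hΨh (fun a v => hk a x v) (hSh x)]
    simp only [d1, Fin.sum_univ_two]
    ring) hp
  have e3 : ∀ x, Real.exp (hatPsi m mt Ψt x - Ψ x) * quad (shadowMatrix g κ Ψ m O v E x) q
      = Real.exp (hatPsi m mt Ψt x) * (quad (gram g κ x)⁻¹ q + m x ^ 2) := by
    intro x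
    rw [quad_shadowMatrix h hE hq, ← mul_assoc, ← Real.exp_add]
    congr 2
    ring
  have e4 := e3 O
  have e5 := e3 p
  rw [mul_sub, e4, e1, e5]
  simp only [quad, Matrix.mulVec, dotProduct, Fin.sum_univ_two] at e2 ⊢
  linear_combination -e2

/-- The first condition expresses the surface property, the second the equality of Carter constants.
The bound `hle` says that the component of `u` along `e₂` has nonnegative square; with the second
condition it gives `𝒮^{ab} q_a q_b ≤ 0` at `p`, so that a tangent velocity exists there. -/
lemma isShadowVelocity_iff (hf : IsSliceFrame g Ω κ) (hm : SmoothFun m)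
    (h0 : ∀ x, 0 < m x / mt) (hk : ∀ a x v, nablaC g (flat g (κ a)) x v = 0)
    (hkt : ∀ a x v, nablaC (weyl (fun x => m x / mt) g) (flat (weyl (fun x => m x / mt) g) (κ a))
      x v = 0) (hmκ : ∀ a x, dd m x (kv κ a x) = 0)
    (hK₀ : IsSliceReducibleConformalKT g Ω κ α γ Ψ) (hS : ∀ x, SliceEq g Ω κ γ Ψ x)
    (hms : SliceConstant Ω (prime g Ω fun x => Real.exp (Ψ x) * m x ^ 2))
    (hK : IsSliceReducibleKT (weyl (fun x => m x / mt) g) Ω κ αt γt Ψt)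
    (h : v ⬝ᵥ gram g κ O *ᵥ v < 0) (hE : 0 < E) (hq : v ⬝ᵥ q = -E) {p : M}
    (hp : OnNormalCurve g Ω O p) {u : E4} (hu : at₂ g O u u = -(m O) ^ 2)
    (huq : ∀ a, kf g κ a O u = q a)
    (hle : quad (shadowMatrix g κ Ψ m O v E O) q + Real.exp (Ψ O) * nf g Ω O u ^ 2 ≤ 0) :
    IsShadowVelocity g Ω κ (sliceTensor (weyl (fun x => m x / mt) g) Ω κ αt γt Ψt) m mt O u p ↔
      quad (shadowMatrix' g Ω κ Ψ m O v E p) q = 0 ∧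
        quad (shadowMatrix g κ Ψ m O v E p - shadowMatrix g κ Ψ m O v E O) q
          = Real.exp (Ψ O) * nf g Ω O u ^ 2 := by
  have hcq : charge g κ O u = q := funext huq
  have hCO : carter (sliceTensor (weyl (fun x => m x / mt) g) Ω κ αt γt Ψt) m mt O u
      = carterBase mt αt γt q O + Real.exp (hatPsi m mt Ψt O) * nf g Ω O u ^ 2 := by
    rw [carter_eq hf.metric hm h0 hu]
    simp only [huq, carterBase]
  have hCw : ∀ x, ∀ w : E4, dd Ω x w = 0 → at₂ g x w w = -(m x) ^ 2 →
      (∀ a, kf g κ a x w = q a) → Ω x = Ω p →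
      carter (sliceTensor (weyl (fun x => m x / mt) g) Ω κ αt γt Ψt) m mt x w
        = carterBase mt αt γt q p := by
    intro x w hw hn hwq hx
    rw [carter_eq hf.metric hm h0 hn, nf_of_tangent hf.metric hw]
    simp only [hwq]
    rw [← (sliceConstant_carterBase hf hK.smooth_α hK.smooth_γ hK.const_α hK.const_γ).eq_of_eq
      hf.metric hf.foliation (smooth_carterBase hK.smooth_α hK.smooth_γ) hx, carterBase]
    ring
  have hkey : carterBase mt αt γt q p = carterBase mt αt γt q O
      + Real.exp (hatPsi m mt Ψt O) * nf g Ω O u ^ 2 ↔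
      quad (shadowMatrix g κ Ψ m O v E p - shadowMatrix g κ Ψ m O v E O) q
          = Real.exp (Ψ O) * nf g Ω O u ^ 2 := by
    have h1 := hK.carterBase_sub hf hm h0 hk hkt hK₀.smooth_Ψ hS h hE hq hp
    have h2 : Real.exp (hatPsi m mt Ψt O) = Real.exp (hatPsi m mt Ψt O - Ψ O)
        * Real.exp (Ψ O) := by rw [← Real.exp_add]; congr 1; ring
    have h3 := Real.exp_pos (hatPsi m mt Ψt O - Ψ O)
    rw [quad_sub, ← sub_eq_iff_eq_add', h1, h2, mul_assoc, mul_right_inj' h3.ne']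
  have hquad := quad_shadowMatrix' hf hk hm hK₀.smooth_Ψ hK₀.symm_γ hS h hE hq p
  constructor
  · rintro ⟨h1, x, hx, w, hw, hn, hwq, hC⟩
    rw [hcq] at h1 hwq
    have hx' : Ω x = Ω p := hx
    have hwq' : ∀ a, kf g κ a x w = q a := fun a => congrFun hwq a
    refine ⟨?_, hkey.1 ?_⟩
    · rw [hquad, ← (sliceConstant_surfaceFun hf hm hK₀.smooth_Ψ hK₀.smooth_γ hK₀.const_γ
        hms).eq_of_eq hf.metric hf.foliation (smooth_surfaceFun hf hm hK₀.smooth_Ψ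
        hK₀.smooth_γ) hx']
      rw [← hx'] at h1
      exact h1.surfaceFun_eq_zero hf hm hK₀.smooth_Ψ hk hmκ hS hw hn hwq'
    · rw [← hCO, ← hC]
      exact (hCw x w hw hn hwq' hx').symm
  · rintro ⟨h1, h2⟩
    rw [hquad] at h1
    have h3 : quad (shadowMatrix g κ Ψ m O v E p) q ≤ 0 := by
      rw [quad_sub] at h2
      linarith
    rw [quad_shadowMatrix h hE hq] at h3
    have h4 : quad (gram g κ p)⁻¹ q + m p ^ 2 ≤ 0 := by
      by_contra! h5
      have := mul_pos (Real.exp_pos (Ψ p)) h5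
      linarith
    obtain ⟨w, hw, hn, hwq⟩ := exists_tangent hf p h4
    refine ⟨?_, p, rfl, w, hw, hn, (funext hwq).trans hcq.symm, ?_⟩
    · rw [hcq]
      exact isMassiveParticleSurface_of_surfaceFun hf hm hK₀.smooth_Ψ hK₀.smooth_γ hK₀.const_γ
        hms hS h1
    · rw [hCO, ← hkey.2 h2]
      exact hCw p w hw hn hwq rfl

end

section

variable [IsManifold (𝓡 4) ∞ M] {g : Tensor2 M} {Ω : M → ℝ} {κ : Fin 2 → VField M} {m : M → ℝ}
  {mt : ℝ} {γ γt : M → Matrix (Fin 2) (Fin 2) ℝ} {α αt Ψ Ψt : M → ℝ} {O : M} {v : Fin 2 → ℝ}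
  {E : ℝ}

/-! ### The shadow boundary -/

/-- The constants of motion of the particle with direction component `a` along `e₁`. -/
def particleCharge (g : Tensor2 M) (κ : Fin 2 → VField M) (m : M → ℝ) (O : M) (v : Fin 2 → ℝ)
    (E a : ℝ) : Fin 2 → ℝ :=
  gram g κ O *ᵥ ((E / obsNorm g κ O v ^ 2) • v
    + (Real.sqrt ((E / obsNorm g κ O v) ^ 2 - m O ^ 2) * a / obsNorm g κ O v) • obsTau g κ O v)

lemma dot_particleCharge (hf : IsSliceFrame g Ω κ) (h : v ⬝ᵥ gram g κ O *ᵥ v < 0) (a : ℝ) :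
    v ⬝ᵥ particleCharge g κ m O v E a = -E := by
  have h1 := obsNorm_sq h
  have h2 := (obsNorm_pos h).ne'
  rw [particleCharge, Matrix.mulVec_add, Matrix.mulVec_smul, Matrix.mulVec_smul, dotProduct_add,
    dotProduct_smul, dotProduct_smul, dot_gram_obsTau hf, ← neg_eq_iff_eq_neg.2 h1]
  simp only [smul_eq_mul]
  field_simp
  ring

lemma tau_particleCharge (hf : IsSliceFrame g Ω κ) (h : v ⬝ᵥ gram g κ O *ᵥ v < 0) (a : ℝ) :
    obsTau g κ O v ⬝ᵥ particleCharge g κ m O v E a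
      = Real.sqrt ((E / obsNorm g κ O v) ^ 2 - m O ^ 2) * obsNorm g κ O v * a := by
  have h2 := (obsNorm_pos h).ne'
  rw [particleCharge, Matrix.mulVec_add, Matrix.mulVec_smul, Matrix.mulVec_smul, dotProduct_add,
    dotProduct_smul, dotProduct_smul, dot_gram_comm hf.metric, dot_gram_obsTau hf,
    obsTau_gram_obsTau hf h]
  simp only [smul_eq_mul]
  field_simp
  ring

/-- The velocity of a received particle, in terms of the vectors at the observer. -/
lemma particleVelocity_eq (e₂ : E4) (Φ Θ : ℝ) :
    (particleVelocity g Ω κ m O v E e₂ Φ Θ : E4)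
      = ∑ b, ((E / obsNorm g κ O v ^ 2) • v
        + (Real.sqrt ((E / obsNorm g κ O v) ^ 2 - m O ^ 2) * (Real.sin Φ * Real.sin Θ)
          / obsNorm g κ O v) • obsTau g κ O v) b • kv κ b O
        + ((Real.sqrt ((E / obsNorm g κ O v) ^ 2 - m O ^ 2) * (Real.cos Φ * Real.sin Θ)) • e₂
        + (-(Real.sqrt ((E / obsNorm g κ O v) ^ 2 - m O ^ 2) * Real.cos Θ)) • nv g Ω O) := by
  set k := Real.sqrt ((E / obsNorm g κ O v) ^ 2 - m O ^ 2)
  have h1 : ∀ (w₀ w₁ e n : E4) (x y a b c v₀ v₁ t₀ t₁ : ℝ),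
      (x / y) • ((1 / y) • (v₀ • w₀ + v₁ • w₁))
        + k • (a • ((1 / y) • (t₀ • w₀ + t₁ • w₁)) + b • e + c • (-n))
      = (x / y ^ 2 * v₀ + k * a / y * t₀) • w₀ + (x / y ^ 2 * v₁ + k * a / y * t₁) • w₁
        + ((k * b) • e + (-(k * c)) • n) := by
    intros
    module
  simp only [particleVelocity, Fin.sum_univ_two]
  exact h1 _ _ _ _ _ _ _ _ _ _ _ _ _

lemma kf_particleVelocity (hf : IsSliceFrame g Ω κ) {e₂ : E4} (he : IsObserver g Ω κ m O v E e₂)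
    (Φ Θ : ℝ) (a : Fin 2) : kf g κ a O (particleVelocity g Ω κ m O v E e₂ Φ Θ)
      = particleCharge g κ m O v E (Real.sin Φ * Real.sin Θ) a := by
  have h1 : kf g κ a O e₂ = 0 := he.orth_killing a
  rw [particleVelocity_eq, map_add, kf_sum_kv, map_add, map_smul, map_smul, hf.kf_nv, h1]
  simp [particleCharge]

lemma nf_particleVelocity (hf : IsSliceFrame g Ω κ) {e₂ : E4} (he : IsObserver g Ω κ m O v E e₂)
    (Φ Θ : ℝ) : nf g Ω O (particleVelocity g Ω κ m O v E e₂ Φ Θ)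
      = -(Real.sqrt ((E / obsNorm g κ O v) ^ 2 - m O ^ 2) * Real.cos Θ) := by
  have h1 : nf g Ω O e₂ = 0 := he.orth_normal
  have h2 : ∀ a, nf g Ω O (kv κ a O) = 0 := fun a => nf_of_tangent hf.metric (hf.dd_kv a O)
  rw [particleVelocity_eq]
  simp [h1, h2, nf_nv hf.metric hf.foliation]

lemma IsObserver.lt (he : IsObserver g Ω κ m O v E e₂) :
    0 < (E / obsNorm g κ O v) ^ 2 - m O ^ 2 := by
  have h1 := obsNorm_pos he.timelike
  have h2 := he.energy_pos
  have h3 := he.energy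
  rw [effMassSq, div_lt_one (by positivity)] at h3
  rw [div_pow, sub_pos, lt_div_iff₀ (by positivity)]
  linarith

lemma metric_particleVelocity (hf : IsSliceFrame g Ω κ) {e₂ : E4}
    (he : IsObserver g Ω κ m O v E e₂) (Φ Θ : ℝ) :
    at₂ g O (particleVelocity g Ω κ m O v E e₂ Φ Θ) (particleVelocity g Ω κ m O v E e₂ Φ Θ)
      = -(m O) ^ 2 := by
  have h0 := (obsNorm_pos he.timelike).ne'
  have hk := Real.sq_sqrt he.lt.le
  rw [particleVelocity_eq]
  set k := Real.sqrt ((E / obsNorm g κ O v) ^ 2 - m O ^ 2)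
  set d : Fin 2 → ℝ := (E / obsNorm g κ O v ^ 2) • v
        + (k * (Real.sin Φ * Real.sin Θ) / obsNorm g κ O v) • obsTau g κ O v with hd
  set u : E4 := ∑ b, d b • kv κ b O with hu
  have e1 : at₂ g O e₂ e₂ = 1 := he.unit
  have e2 : at₂ g O (nv g Ω O) e₂ = 0 := he.orth_normal
  have e3 : at₂ g O e₂ (nv g Ω O) = 0 := by rw [hf.metric.isSymmT, e2]
  have e4 : at₂ g O (nv g Ω O) (nv g Ω O) = 1 := normal_normal hf.metric hf.foliation O
  have e5 : at₂ g O u e₂ = 0 := by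
    have h1 : ∀ a, at₂ g O (kv κ a O) e₂ = 0 := he.orth_killing
    simp [hu, h1]
  have e6 : at₂ g O u (nv g Ω O) = 0 := by
    have h1 : ∀ a, at₂ g O (kv κ a O) (nv g Ω O) = 0 := fun a => hf.kf_nv a O
    simp [hu, h1]
  have e7 : at₂ g O e₂ u = 0 := by rw [hf.metric.isSymmT, e5]
  have e8 : at₂ g O (nv g Ω O) u = 0 := by rw [hf.metric.isSymmT, e6]
  have e9 : at₂ g O u u = -(E / obsNorm g κ O v) ^ 2 + k ^ 2 * (Real.sin Φ * Real.sin Θ) ^ 2 := by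
    rw [hu, at₂_sum_kv, hd, Matrix.mulVec_add, Matrix.mulVec_smul, Matrix.mulVec_smul]
    simp only [dotProduct_add, add_dotProduct, dotProduct_smul, smul_dotProduct, smul_eq_mul,
      dot_gram_obsTau hf, dot_gram_comm hf.metric O (obsTau g κ O v) v,
      obsTau_gram_obsTau hf he.timelike, ← neg_eq_iff_eq_neg.2 (obsNorm_sq he.timelike)]
    field_simp
    ring
  simp only [map_add, map_smul, add_apply, smul_apply, smul_eq_mul, e1, e2, e3, e4, e5, e6, e7,
    e8, e9]
  linear_combination hk + k ^ 2 * ((Real.sin Θ ^ 2) * Real.sin_sq_add_cos_sq Φ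
    + Real.sin_sq_add_cos_sq Θ)

/-- A direction enters the matching conditions only through its `e₁` component, which fixes the
charges, and its normal component, which fixes `ν²` at `O`. The sphere equation determines the `e₂`
component up to sign, which is the sign `ε'` of the formula. -/
lemma shadowBoundary_eq (hf : IsSliceFrame g Ω κ) (hm : SmoothFun m)
    (h0 : ∀ x, 0 < m x / mt) (hk : ∀ a x v, nablaC g (flat g (κ a)) x v = 0)
    (hkt : ∀ a x v, nablaC (weyl (fun x => m x / mt) g) (flat (weyl (fun x => m x / mt) g) (κ a))
      x v = 0) (hmκ : ∀ a x, dd m x (kv κ a x) = 0)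
    (hK₀ : IsSliceReducibleConformalKT g Ω κ α γ Ψ) (hS : ∀ x, SliceEq g Ω κ γ Ψ x)
    (hms : SliceConstant Ω (prime g Ω fun x => Real.exp (Ψ x) * m x ^ 2))
    (hK : IsSliceReducibleKT (weyl (fun x => m x / mt) g) Ω κ αt γt Ψt) {e₂ : E4}
    (he : IsObserver g Ω κ m O v E e₂) {p : M} (hp : OnNormalCurve g Ω O p) :
    shadowBoundary g Ω κ (sliceTensor (weyl (fun x => m x / mt) g) Ω κ αt γt Ψt)
      m mt O v E e₂ p = shadowFormula g Ω κ Ψ m O v E p := by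
  have hE := he.energy_pos
  have ht := he.timelike
  have hvb := obsNorm_pos ht
  have hk2 := Real.sq_sqrt he.lt.le
  have hkp := Real.sqrt_pos.2 he.lt
  have hs2 := Real.sq_sqrt (sub_pos.2 he.energy).le
  have hsp := Real.sqrt_pos.2 (sub_pos.2 he.energy)
  have hquad : ∀ ρ : Fin 2 → ℝ, v ⬝ᵥ ρ = -E → quad (shadowMatrix g κ Ψ m O v E O) ρ
      = Real.exp (Ψ O / 2) ^ 2 * ((obsTau g κ O v ⬝ᵥ ρ / obsNorm g κ O v) ^ 2
        - Real.sqrt ((E / obsNorm g κ O v) ^ 2 - m O ^ 2) ^ 2) := by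
    intro ρ hρ
    have h1 := obsNorm_sq_mul_quad hf ht ρ
    have h2 : quad (gram g κ O)⁻¹ ρ = ((obsTau g κ O v ⬝ᵥ ρ) ^ 2 - E ^ 2)
        / obsNorm g κ O v ^ 2 := by
      rw [eq_div_iff (by positivity), mul_comm, h1, hρ, neg_sq]
    rw [quad_shadowMatrix ht hE hρ, h2, hk2, ← Real.exp_nat_mul]
    have : ((2 : ℕ) : ℝ) * (Ψ O / 2) = Ψ O := by push_cast; ring
    rw [this]
    field_simp
    ring
  have hexp : Real.exp (Ψ O) = Real.exp (Ψ O / 2) ^ 2 := by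
    rw [← Real.exp_nat_mul]
    congr 1
    push_cast
    ring
  have hexp' : Real.exp (-(Ψ O) / 2) = (Real.exp (Ψ O / 2))⁻¹ := by
    rw [← Real.exp_neg, neg_div]
  -- Relates the dimensionless factor of the formula to the spatial momentum `k` seen by the
  -- observer.
  have hsE : Real.sqrt (1 - effMassSq g κ m O v E O) * E
      = Real.sqrt ((E / obsNorm g κ O v) ^ 2 - m O ^ 2) * obsNorm g κ O v := by
    rw [← sq_eq_sq₀ (by positivity) (by positivity), mul_pow, mul_pow, hs2, hk2, effMassSq]
    field_simp
  set k := Real.sqrt ((E / obsNorm g κ O v) ^ 2 - m O ^ 2) with hkdef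
  set S' := shadowMatrix' g Ω κ Ψ m O v E p
  set S := shadowMatrix g κ Ψ m O v E p
  set S₀ := shadowMatrix g κ Ψ m O v E O
  have hiff : ∀ Φ Θ, IsShadowVelocity g Ω κ
      (sliceTensor (weyl (fun x => m x / mt) g) Ω κ αt γt Ψt) m mt O
      (particleVelocity g Ω κ m O v E e₂ Φ Θ) p ↔
      (fun a _ c : ℝ => quad S' (particleCharge g κ m O v E a) = 0 ∧
        quad (S - S₀) (particleCharge g κ m O v E a) = (Real.exp (Ψ O / 2) * (k * c)) ^ 2)
        (Real.sin Φ * Real.sin Θ) (Real.cos Φ * Real.sin Θ) (Real.cos Θ) := by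
    intro Φ Θ
    have hν := nf_particleVelocity hf he Φ Θ
    have hν2 : Real.exp (Ψ O) * nf g Ω O (particleVelocity g Ω κ m O v E e₂ Φ Θ) ^ 2
        = (Real.exp (Ψ O / 2) * (k * Real.cos Θ)) ^ 2 := by
      rw [hν, hexp]
      ring
    have hq := dot_particleCharge (m := m) (E := E) hf ht (Real.sin Φ * Real.sin Θ)
    rw [isShadowVelocity_iff hf hm h0 hk hkt hmκ hK₀ hS hms hK ht hE hq hp
      (metric_particleVelocity hf he Φ Θ) (fun a => kf_particleVelocity hf he Φ Θ a) (by
        rw [hν2, hquad _ hq, tau_particleCharge hf ht]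
        have h1 : k * obsNorm g κ O v * (Real.sin Φ * Real.sin Θ) / obsNorm g κ O v
          = k * (Real.sin Φ * Real.sin Θ) := by field_simp
        rw [← hkdef, h1]
        -- By the sphere equation the left side is minus the square of the weighted `e₂` component.
        have h2 : Real.exp (Ψ O / 2) ^ 2 * ((k * (Real.sin Φ * Real.sin Θ)) ^ 2 - k ^ 2)
            + (Real.exp (Ψ O / 2) * (k * Real.cos Θ)) ^ 2
            = -(Real.exp (Ψ O / 2) * k * (Real.cos Φ * Real.sin Θ)) ^ 2 := by
          linear_combination (Real.exp (Ψ O / 2) ^ 2 * k ^ 2) * ((Real.sin Θ ^ 2)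
            * Real.sin_sq_add_cos_sq Φ + Real.sin_sq_add_cos_sq Θ)
        rw [h2]
        exact neg_nonpos.2 (sq_nonneg _)), hν2]
  ext P
  have h1 := exists_direction_iff (fun a _ c : ℝ => quad S' (particleCharge g κ m O v E a) = 0 ∧
    quad (S - S₀) (particleCharge g κ m O v E a) = (Real.exp (Ψ O / 2) * (k * c)) ^ 2) P
  have h2 := shadow_algebra (S' := S') (S := S) (F := 1 - effMassSq g κ m O v E O) hE hvb hkp
    (Real.exp_pos (Ψ O / 2)) hsE hs2.symm (eq_zero_of_dot hf ht) hquad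
    (q := particleCharge g κ m O v E) (fun a => dot_particleCharge hf ht a)
    (fun a => tau_particleCharge hf ht a) P
  simp only [shadowBoundary, shadowFormula, shadowDenom, Set.mem_ofPred_eq, hexp']
  rw [← h2, ← h1]
  simp only [hiff]

end

/-! ### From the conformal factor `m / mt` to the mass -/

section

variable [IsManifold (𝓡 4) ∞ M] {g : Tensor2 M} {Ω : M → ℝ} {κ : Fin 2 → VField M} {m : M → ℝ}
  {mt : ℝ} {Ψ : M → ℝ}

lemma dd_ratio (hm : SmoothFun m) (mt : ℝ) (x : M) (w : E4) :
    dd (fun x => m x / mt) x w = mt⁻¹ * dd m x w := by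
  rw [dd_smooth_eq (funext fun z => div_eq_inv_mul (m z) mt), dd_const_mul hm]

/-- The Killing vectors are preserved exactly when the mass is invariant under them. -/
lemma isKillingVector_weyl_ratio_iff (hf : IsSliceFrame g Ω κ) (hm : SmoothFun m)
    (h0 : ∀ x, 0 < m x / mt) (a : Fin 2) (hk : ∀ x v, nablaC g (flat g (κ a)) x v = 0) :
    IsKillingVector (weyl (fun x => m x / mt) g) (κ a) ↔ ∀ x, dirDeriv m x (κ a x) = 0 := by
  rw [isKillingVector_weyl_iff hf (smooth_ratio hm mt) h0 a hk]
  refine forall_congr' fun x => ?_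
  rw [dd_ratio hm, mul_eq_zero, or_iff_right (inv_ne_zero (ne_zero_of_ratio_pos (h0 x)).2)]
  rfl

lemma sliceConstant_prime_ratio_iff (hf : IsSliceFrame g Ω κ) (hm : SmoothFun m)
    (h0 : ∀ x, 0 < m x / mt) (hΨ : SmoothFun Ψ) :
    SliceConstant Ω (prime g Ω (fun x => Real.exp (Ψ x) * (m x / mt) ^ 2)) ↔
      SliceConstant Ω (prime g Ω (fun x => Real.exp (Ψ x) * (m x) ^ 2)) := by
  have hr := smooth_ratio hm mt
  have s1 := hΨ.exp.mul (hm.pow 2)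
  have s2 := hΨ.exp.mul (hr.pow 2)
  have h1 : ∀ x, prime g Ω (fun x => Real.exp (Ψ x) * (m x / mt) ^ 2) x
      = (mt ^ 2)⁻¹ * prime g Ω (fun x => Real.exp (Ψ x) * (m x) ^ 2) x := by
    intro x
    have e : (fun x => Real.exp (Ψ x) * (m x / mt) ^ 2)
        = fun x => (mt ^ 2)⁻¹ * (Real.exp (Ψ x) * (m x) ^ 2) := by
      funext z
      rw [div_pow, div_eq_inv_mul]
      ring
    rw [prime_eq_dd, dd_smooth_eq e, dd_const_mul s1, prime_eq_dd]
    ring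
  have h2 : ∀ x, prime g Ω (fun x => Real.exp (Ψ x) * (m x) ^ 2) x
      = mt ^ 2 * prime g Ω (fun x => Real.exp (Ψ x) * (m x / mt) ^ 2) x := by
    intro x
    have := (ne_zero_of_ratio_pos (h0 x)).2
    rw [h1]
    field_simp
  constructor
  · intro h
    exact (congrArg (SliceConstant Ω) (funext h2)).mpr
      (h.const_mul (s2.prime hf.metric hf.foliation) _)
  · intro h
    exact (congrArg (SliceConstant Ω) (funext h1)).mpr
      (h.const_mul (s1.prime hf.metric hf.foliation) _)

end

end Spacetime

end

/-! ### The main theorem -/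

open Spacetime in
theorem mainTheorem2
    {M : Type*} [TopologicalSpace M] [T2Space M] [ChartedSpace E4 M] [IsManifold (𝓡 4) ∞ M]
    (g : Tensor2 M) (Ω : M → ℝ) (κ : Fin 2 → VField M) (m : M → ℝ) (mt : ℝ)
    (hg : IsLorentzMetric g) (hΩ : IsTimelikeFoliation g Ω) (hκ : IsAxistationary g Ω κ)
    (hm : SmoothFun m) (hmt : ∀ x, 0 < m x / mt) :
    -- Reduction of the motion to geodesics of the rescaled metric.
    ((∀ (J : Set ℝ) (γ : ℝ → M) (τ : ℝ → ℝ) (γt : ℝ → M), IsOpenInterval J →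
        IsReparam m mt J γ τ γt →
        (IsWorldline g m J γ ↔ IsMassiveGeodesic (weyl (fun x => m x / mt) g) mt (τ '' J) γt) ∧
        (IsC2On γ J → ∀ s ∈ J, ∀ a,
          charge (weyl (fun x => m x / mt) g) κ (γt (τ s)) (velocity γt (τ s)) a
            = charge g κ (γ s) (velocity γ s) a)) ∧
      (∀ (J : Set ℝ) (γ : ℝ → M), IsOpenInterval J → ContinuousOn γ J →
        ∃ τ γt, IsReparam m mt J γ τ γt) ∧
      (∀ (Jt : Set ℝ) (γt : ℝ → M), IsOpenInterval Jt → ContinuousOn γt Jt →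
        ∃ J γ τ, IsOpenInterval J ∧ τ '' J = Jt ∧ IsReparam m mt J γ τ γt)) ∧
    -- The Killing vectors are preserved exactly when the mass is axi-stationary.
    (∀ a, IsKillingVector (weyl (fun x => m x / mt) g) (κ a) ↔
      ∀ x, dirDeriv m x (κ a x) = 0) ∧
    -- An exact slice-reducible Killing tensor of the rescaled metric requires a slice-reducible
    -- conformal Killing tensor of the original one.
    ((∃ αt γt Ψt, IsSliceReducibleKT (weyl (fun x => m x / mt) g) Ω κ αt γt Ψt) →
      ∃ α γ Ψ, IsSliceReducibleConformalKT g Ω κ α γ Ψ) ∧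
    -- From now on the original metric has a slice-reducible conformal Killing tensor.
    ∀ (α : M → ℝ) (γ : M → Matrix (Fin 2) (Fin 2) ℝ) (Ψ : M → ℝ),
      IsSliceReducibleConformalKT g Ω κ α γ Ψ →
      -- The condition for an exact slice-reducible Killing tensor of the rescaled metric.
      (((∀ a, IsKillingVector (weyl (fun x => m x / mt) g) (κ a)) ∧
          ∃ αt γt Ψt, IsSliceReducibleKT (weyl (fun x => m x / mt) g) Ω κ αt γt Ψt) ↔
        ((∀ a x, dirDeriv m x (κ a x) = 0) ∧
          SliceConstant Ω (prime g Ω (fun x => Real.exp (Ψ x) * (m x) ^ 2)))) ∧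
      -- The equivalent form of the condition.
      ((∃ χτ, IsChiTau g Ω κ χτ) ∧ ∀ χτ, IsChiTau g Ω κ χτ →
        (SliceConstant Ω (prime g Ω (fun x => Real.exp (Ψ x) * (m x) ^ 2)) ↔
          SliceConstant Ω (fun x => (m x) ^ 2 * (lapse g Ω x) ^ 3 * χτ x
            + 1 / 2 * (lapse g Ω x) ^ 2 * prime g Ω (fun y => (m y) ^ 2) x))) ∧
      -- The shadow formula with variable mass.
      ((∀ a x, dirDeriv m x (κ a x) = 0) →
        SliceConstant Ω (prime g Ω (fun x => Real.exp (Ψ x) * (m x) ^ 2)) →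
        ∀ (αt : M → ℝ) (γt : M → Matrix (Fin 2) (Fin 2) ℝ) (Ψt : M → ℝ),
        IsSliceReducibleKT (weyl (fun x => m x / mt) g) Ω κ αt γt Ψt →
          -- The charges and the Carter constant are constants of motion.
          (∀ (J : Set ℝ) (c : ℝ → M), IsOpenInterval J → IsWorldline g m J c →
            ∀ s ∈ J, ∀ t ∈ J,
              charge g κ (c s) (velocity c s) = charge g κ (c t) (velocity c t) ∧
              carter (sliceTensor (weyl (fun x => m x / mt) g) Ω κ αt γt Ψt) m mt (c s)
                  (velocity c s)
                = carter (sliceTensor (weyl (fun x => m x / mt) g) Ω κ αt γt Ψt) m mt (c t)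
                  (velocity c t)) ∧
          ∀ (O : M) (v : Fin 2 → ℝ) (E : ℝ) (e₂ : TangentSpace (𝓡 4) O),
            IsObserver g Ω κ m O v E e₂ →
            (∀ a b, SliceConstant Ω fun x => shadowMatrix' g Ω κ Ψ m O v E x a b) ∧
            shadowMatrix (weyl (fun x => m x / mt) g) κ
                (fun x => Ψ x + 2 * Real.log (m x / mt)) (fun _ => mt) O v E
              = shadowMatrix g κ Ψ m O v E ∧
            ∀ p, OnNormalCurve g Ω O p →
              shadowFormula (weyl (fun x => m x / mt) g) Ω κ
                  (fun x => Ψ x + 2 * Real.log (m x / mt)) (fun _ => mt) O v E p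
                = shadowFormula g Ω κ Ψ m O v E p ∧
              shadowBoundary g Ω κ (sliceTensor (weyl (fun x => m x / mt) g) Ω κ αt γt Ψt)
                  m mt O v E e₂ p
                = shadowFormula g Ω κ Ψ m O v E p) := by
  have hf := hκ.isSliceFrame hg hΩ
  have hr := smooth_ratio hm mt
  have hk : ∀ a x v, nablaC g (flat g (κ a)) x v = 0 :=
    fun a => (hf.isKillingVector_iff a).1 (hκ.killing a)
  have hkill := fun a => isKillingVector_weyl_ratio_iff (mt := mt) hf hm hmt a (hk a)
  refine ⟨⟨fun J γ τ γt hJ h => ⟨h.isWorldline_iff hg hm hmt hJ,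
      fun hγ s hs a => h.charge_eq hm hmt hJ hγ hs a⟩,
    fun J γ hJ hγ => exists_reparam hm hmt hJ hγ,
    fun Jt γt hJ hγ => exists_reparam_inverse hm hmt hJ hγ⟩, hkill, ?_, ?_⟩
  · rintro ⟨αt, γt, Ψt, hK⟩
    exact ⟨_, _, _, exists_conformal_of_weyl hf hk hr hmt hK⟩
  intro α γ Ψ hK₀
  have hS : ∀ x, SliceEq g Ω κ γ Ψ x := fun x =>
    hK₀.sliceEq (c := fun _ _ => 0) hf (fun a x v => by rw [hk, zero_mul]) x
  have hkt : (∀ a x, dirDeriv m x (κ a x) = 0) → ∀ a x v,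
      nablaC (weyl (fun x => m x / mt) g) (flat (weyl (fun x => m x / mt) g) (κ a)) x v = 0 :=
    fun h a => ((hf.weyl hr hmt).isKillingVector_iff a).1 ((hkill a).2 (h a))
  -- The witness for `χ_τ` is `½ dΨ(n)`, filled in by unification.
  refine ⟨?_, ⟨⟨_, (hf.isChiTau_iff hS _).2 fun x => rfl⟩,
    fun χ hχ => hf.sliceConstant_iff_chiTau hS hK₀.smooth_Ψ hm hχ⟩, ?_⟩
  · rw [forall_congr' hkill]
    refine and_congr_right fun h => ?_
    rw [exists_weyl_iff hf hk hr hmt (hkt h) hK₀,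
      sliceConstant_prime_ratio_iff hf hm hmt hK₀.smooth_Ψ]
  · intro hmκ hms αt γt Ψt hK
    refine ⟨fun J c hJ hc s hs t ht => ⟨funext fun a => hc.charge_const hJ hf hk hmκ hs ht a,
      hc.carter_const hf hm hmt hk (hkt hmκ) hmκ hK hJ hs ht⟩, fun O v E e₂ he => ?_⟩
    exact ⟨sliceConstant_shadowMatrix' hf hk hm hK₀.smooth_Ψ hK₀.symm_γ hK₀.smooth_γ hK₀.const_γ
      hS hms he.timelike, shadowMatrix_weyl hmt he.timelike, fun p hp =>
      ⟨shadowFormula_weyl hf hm hmt he.timelike p,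
        shadowBoundary_eq hf hm hmt hk (hkt hmκ) hmκ hK₀ hS hms hK he hp⟩⟩
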